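/- **Theorem (Density of counterexamples).** Let $m\ge 1$ be an integer, $s\in(0,1]$, $p\in[1,+\infty)$, and let $\mathcal N$ be a connected (smooth, boundaryless, second countable) Riemannian manifold with geodesic distance $d_{\mathcal N}$. Write $\mathbb B^m_r=\{x\in\mathbb R^m:|x|<r\}$ and $\mathbb B^m=\mathbb B^m_1$. Maps are defined everywhere on their domain (not up to null sets), and measurable means Lebesgue measurable. For an open set $A\subset\mathbb R^m$ and a measurable map $u:A\to\mathcal N$ put $$\mathcal E_{s,p}(u,A)=\int_A\int_A\frac{d_{\mathcal N}(u(x),u(y))^p}{|x-y|^{m+sp}}\,dx\,dy\quad(0<s<1),\qquad \mathcal E_{1,p}(u,A)=\int_A|Du|^p ,$$ where $Du(x):\mathbb R^m\to T_{u(x)}\mathcal N$ is the weak derivative of $u$, i.e. for every Lipschitz $f\in C^1(\mathcal N,\mathbb R)$ the function $f\circ u$ is locally integrable and weakly differentiable on $A$ with weak derivative $df_{u(x)}\circ Du(x)$, where $|\cdot|$ is the Hilbert--Schmidt norm, and where $\mathcal E_{1,p}(u,A)=+\infty$ if there is no such $Du$. Let $\mathcal G$ be an energy over $\mathbb R^m$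 with state space $\mathcal N$: it assigns to every open $A\subset\mathbb R^m$ and every measurable $u:A\to\mathcal N$ a value $\mathcal G(u,A)\in[0,+\infty]$ such that $\mathcal G(u|_A,A)\le\mathcal G(u,B)$ whenever $A\subseteq B$ are open and $u:B\to\mathcal N$ is measurable. Assume that for every measurable $u:\mathbb R^m\to\mathcal N$: 1. (superadditivity) $\mathcal G(u,A\cup B)\ge\mathcal G(u,A)+\mathcal G(u,B)$ for all open $A,B\subset\mathbb R^m$ with disjoint closures; 2. (scaling) $\mathcal G(u,h+\lambda A)=\lambda^{m-sp}\,\mathcal G(u(h+\lambda\,\cdot),A)$ for all $\lambda>0$, $h\in\mathbb R^m$ and all open $A\subset\mathbb R^m$. Assume furthermore that $sp\le m$, that $s<m$, and that there is a sequence of measurable maps $u_k:\mathbb B^m\to\mathcal N$ with $\mathcal E_{s,p}(u_k,\mathbb B^m)>0$ and $\mathcal G(u_k,\mathbb B^m)<+\infty$ for every $k$, $$\lim_{k\to\infty}\frac{\mathcal G(u_k,\mathbb B^m)}{\mathcal E_{s,p}(u_k,\mathbb B^m)}=+\infty,\qquad\text{and, if } sp=m,\qquad \lim_{k\to\infty}\mathcal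 E_{s,p}(u_k,\mathbb B^m)=0 .$$ Let $v:\mathbb B^m\to\mathcal N$ be measurable with $\mathcal E_{s,p}(v,\mathbb B^m)<+\infty$. Then for every $\varepsilon>0$ there is a measurable map $w:\mathbb B^m\to\mathcal N$ such that - (i) $w=v$ on $\mathbb B^m\setminus\mathbb B^m_\varepsilon$; - (ii) $\mathcal E_{s,p}(w,\mathbb B^m)\le\mathcal E_{s,p}(v,\mathbb B^m)+\varepsilon$; - (iii) $\mathcal G(w,\mathbb B^m)=+\infty$. Moreover maps of infinite $\mathcal G$-energy are dense: there are measurable maps $w_k:\mathbb B^m\to\mathcal N$, $k\in\mathbb N$, with $w_k=v$ on $\mathbb B^m\setminus\mathbb B^m_{1/(k+1)}$, $\mathcal E_{s,p}(w_k,\mathbb B^m)<+\infty$, $\mathcal G(w_k,\mathbb B^m)=+\infty$ and $\mathcal E_{s,p}(w_k,\mathbb B^m)\to\mathcal E_{s,p}(v,\mathbb B^m)$, which converge strongly to $v$ in $W^{s,p}(\mathbb B^m,\mathcal N)$, in the sense that for every $\nu\in\mathbb N$ and every Lipschitz map $\iota:\mathcal N\to\mathbb R^\nu$ of class $C^1$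 (in particular for every $C^1$ isometric or bi-Lipschitz embedding), $$\int_{\mathbb B^m}|\iota\circ w_k-\iota\circ v|^p\to0\qquad\text{and}\qquad\mathcal E_{s,p}(\iota\circ w_k-\iota\circ v,\mathbb B^m)\to0 .$$ -/

import Mathlib

open MeasureTheory Set Filter Metric Bundle
open scoped ENNReal Topology Manifold ContDiff

noncomputable section

namespace SobolevMaps

/-- Lebesgue measurability on `A` of a map that is defined at every point: `u` coincides almost
everywhere on `A` with a Borel map. For maps into a second countable space this says exactly that
preimages of Borel sets are Lebesgue measurable in `A`. -/
def MeasurableMapOn {m : ℕ} {N : Type*} [MeasurableSpace N]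
    (u : EuclideanSpace ℝ (Fin m) → N) (A : Set (EuclideanSpace ℝ (Fin m))) : Prop :=
  AEMeasurable u (volume.restrict A)

/-- The Gagliardo energy `∫_A ∫_A d(u(x), u(y))^p / |x - y|^(m + s p) dx dy`. -/
def gagliardoEnergy {m : ℕ} {N : Type*} [EMetricSpace N] (s p : ℝ)
    (u : EuclideanSpace ℝ (Fin m) → N) (A : Set (EuclideanSpace ℝ (Fin m))) : ℝ≥0∞ :=
  ∫⁻ x in A, ∫⁻ y in A, edist (u x) (u y) ^ p / edist x y ^ ((m : ℝ) + s * p)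

/-- The real function `g` is weakly differentiable on the open set `A`, with weak derivative
`g'`: both are locally integrable on `A` and they satisfy the integration by parts formula
against smooth functions with compact support in `A`. -/
def HasWeakFDerivOn {m : ℕ} (g : EuclideanSpace ℝ (Fin m) → ℝ)
    (g' : EuclideanSpace ℝ (Fin m) → (EuclideanSpace ℝ (Fin m) →L[ℝ] ℝ))
    (A : Set (EuclideanSpace ℝ (Fin m))) : Prop :=
  LocallyIntegrableOn g A volume ∧ LocallyIntegrableOn g' A volume ∧
    ∀ φ : EuclideanSpace ℝ (Fin m) → ℝ, ContDiff ℝ ∞ φ → HasCompactSupport φ → tsupport φ ⊆ A →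
      ∀ h : EuclideanSpace ℝ (Fin m),
        ∫ x in A, g x * fderiv ℝ φ x h = - ∫ x in A, φ x * g' x h

/-- `D` is a weak derivative on `A` of the map `u` with values in the manifold `N`: the value `D x`
is a linear map from `ℝ^m` to the tangent space of `N` at `u x`, and for every Lipschitz function
`f : N → ℝ` of class `C^1`, the function `f ∘ u` is weakly differentiable with weak derivative
`df (u x) ∘ D x`. -/
def IsWeakDerivOn {m n : ℕ} {N : Type*} [EMetricSpace N]
    [ChartedSpace (EuclideanSpace ℝ (Fin n)) N]
    (u : EuclideanSpace ℝ (Fin m) → N)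
    (D : (x : EuclideanSpace ℝ (Fin m)) →
      (EuclideanSpace ℝ (Fin m) →L[ℝ] TangentSpace (𝓡 n) (u x)))
    (A : Set (EuclideanSpace ℝ (Fin m))) : Prop :=
  ∀ f : N → ℝ, ContMDiff (𝓡 n) 𝓘(ℝ, ℝ) 1 f → (∃ K, LipschitzWith K f) →
    HasWeakFDerivOn (fun x => f (u x))
      (fun x => (mfderiv (𝓡 n) 𝓘(ℝ, ℝ) f (u x)).comp (D x)) A

/-- The Dirichlet type energy `∫_A |Du|^p`, where `|Du|` is the Euclidean (Hilbert-Schmidt) norm of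
the weak derivative, computed in the Riemannian metric of `N`. The weak derivative is unique almost
everywhere on `A` when it exists, and the energy is infinite when it does not exist. -/
def dirichletEnergy {m : ℕ} (n : ℕ) {N : Type*} [EMetricSpace N]
    [ChartedSpace (EuclideanSpace ℝ (Fin n)) N]
    [RiemannianBundle (fun x : N => TangentSpace (𝓡 n) x)] (p : ℝ)
    (u : EuclideanSpace ℝ (Fin m) → N) (A : Set (EuclideanSpace ℝ (Fin m))) : ℝ≥0∞ :=
  ⨅ (D : (x : EuclideanSpace ℝ (Fin m)) →
      (EuclideanSpace ℝ (Fin m) →L[ℝ] TangentSpace (𝓡 n) (u x)))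
    (_ : IsWeakDerivOn u D A),
    ∫⁻ x in A, (∑ i : Fin m, ‖D x (EuclideanSpace.single i 1)‖ₑ ^ 2) ^ (p / 2)

/-- The Sobolev energy `E_{s,p}(u, A)` for `0 < s ≤ 1`. -/
def sobolevEnergy {m : ℕ} (n : ℕ) {N : Type*} [EMetricSpace N]
    [ChartedSpace (EuclideanSpace ℝ (Fin n)) N]
    [RiemannianBundle (fun x : N => TangentSpace (𝓡 n) x)] (s p : ℝ)
    (u : EuclideanSpace ℝ (Fin m) → N) (A : Set (EuclideanSpace ℝ (Fin m))) : ℝ≥0∞ :=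
  open scoped Classical in
  if s = 1 then dirichletEnergy n p u A else gagliardoEnergy s p u A

/-- Strong convergence in `W^{s,p}(A, N)`: for every Lipschitz map `ι` of class `C^1` from `N` to a
Euclidean space (in particular for every isometric or bi-Lipschitz embedding of class `C^1`), the
maps `ι ∘ w k` converge to `ι ∘ v` in the linear Sobolev space `W^{s,p}(A, ℝ^ν)`. -/
def SobolevTendsto {m : ℕ} (n : ℕ) {N : Type*} [EMetricSpace N]
    [ChartedSpace (EuclideanSpace ℝ (Fin n)) N] (s p : ℝ)
    (w : ℕ → EuclideanSpace ℝ (Fin m) → N) (v : EuclideanSpace ℝ (Fin m) → N)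
    (A : Set (EuclideanSpace ℝ (Fin m))) : Prop :=
  ∀ (ν : ℕ) (ι : N → EuclideanSpace ℝ (Fin ν)),
    ContMDiff (𝓡 n) (𝓡 ν) 1 ι → (∃ K, LipschitzWith K ι) →
      Tendsto (fun k => ∫⁻ x in A, ‖ι (w k x) - ι (v x)‖ₑ ^ p) atTop (𝓝 0) ∧
      Tendsto (fun k => sobolevEnergy ν s p (fun x => ι (w k x) - ι (v x)) A) atTop (𝓝 0)

/-- An energy over `ℝ^m` with state space `N`. A measurable map `A → N` is represented by a map on
`ℝ^m` that is measurable on `A`; the values on other sets or maps are irrelevant. The axiom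
`restrict_le` says that `G(u|_A, A) ≤ G(u, B)` when `A ⊆ B`, where `w` is any extension of `u|_A`;
with `A = B` it says that `G(u, A)` depends only on `u|_A`. -/
structure Energy (m : ℕ) (N : Type*) [MeasurableSpace N] where
  toFun : (EuclideanSpace ℝ (Fin m) → N) → Set (EuclideanSpace ℝ (Fin m)) → ℝ≥0∞
  restrict_le : ∀ (A B : Set (EuclideanSpace ℝ (Fin m))) (u w : EuclideanSpace ℝ (Fin m) → N),
    IsOpen A → IsOpen B → A ⊆ B → MeasurableMapOn u B → EqOn w u A → toFun w A ≤ toFun u B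

/-- Superadditivity on open sets with disjoint closures. -/
def Energy.IsSuperadditive {m : ℕ} {N : Type*} [MeasurableSpace N] (G : Energy m N) : Prop :=
  ∀ u : EuclideanSpace ℝ (Fin m) → N, MeasurableMapOn u univ →
    ∀ A B : Set (EuclideanSpace ℝ (Fin m)), IsOpen A → IsOpen B →
      Disjoint (closure A) (closure B) → G.toFun u A + G.toFun u B ≤ G.toFun u (A ∪ B)

/-- Scaling: `G(u, h + l A) = l^(m - s p) G(u(h + l ·), A)`. -/
def Energy.HasScaling {m : ℕ} {N : Type*} [MeasurableSpace N] (G : Energy m N) (s p : ℝ) : Prop :=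
  ∀ u : EuclideanSpace ℝ (Fin m) → N, MeasurableMapOn u univ →
    ∀ (l : ℝ) (h : EuclideanSpace ℝ (Fin m)) (A : Set (EuclideanSpace ℝ (Fin m))),
      0 < l → IsOpen A →
        G.toFun u ((fun x => h + l • x) '' A) =
          ENNReal.ofReal (l ^ ((m : ℝ) - s * p)) * G.toFun (fun x => u (h + l • x)) A

end SobolevMaps

end

open MeasureTheory Set Filter Metric Bundle
open scoped ENNReal Topology Manifold ContDiff

namespace SobolevMaps

open ENNReal (ofReal rpow_ne_top_of_nonneg ofReal_ne_top ofReal_le_ofReal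
  mul_rpow_of_nonneg ofReal_mul ofReal_one)

set_option linter.unusedSectionVars false

variable {m n : ℕ}

/-! The maps `u k` violate every estimate of `G` by a multiple of the Sobolev energy. The proof
turns this into one bad map: infinitely many bubbles with large ratio of the two energies are
concentrated near the origin, with small total Sobolev energy and infinite `G`.

Scaling makes this possible. A copy of a map shrunk by a factor l has both energies multiplied by
l^(m - sp). Hence K^m disjoint copies at a scale proportional to 1/K multiply both by K^(sp), up to
constants: the ratio survives and the level of energy can be tuned. `G` is bounded below on such a
cluster by superadditivity, and the Sobolev energy is bounded above by gluing
(`IsGluingEnergy.place`, `IsGluingEnergy.cluster`). To hit a prescribed small level one must start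
below it. This is achieved by shrinking when sp < m, and it is the hypothesis that the energies of
`u k` tend to 0 when sp = m, where shrinking changes nothing. The result is a cell with Sobolev
energy at most δ and `G` at least M, for arbitrary δ and M (`IsGluingEnergy.exists_cell`). Cells in
balls accumulating at a point, with summable Sobolev energies and contributions to `G` at least 1
each, give `IsGluingEnergy.exists_infinite`.

Gluing needs matching constants on the boundaries of balls, and three constructions provide them.
Extension: a map of the unit ball is continued by inversion in the sphere and made constant far away
(`HasExtension`). Connection: a constant is changed into another one inside a small ball at
arbitrarily small cost, by composing a path in the connected manifold with a cut-off function. This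
works because points have zero capacity when sp ≤ m and s < m. The capacity vanishes because the
infimum I of the energies of cut-offs satisfies I ≤ c I with some c < 1 (`exists_isCutoff_le`): for
sp < m one rescales, and for sp = m, where p > 1, one averages a cut-off with a much more
concentrated copy of itself. Insertion: the given map is opened, that is composed with a map that
collapses a small ball to its centre a and is the identity away from it (`openMap`). An average over
a bounds the energy of the result for some generic a, and a bubble with boundary value v(a) then
fits in the collapsed ball. Only a small ball around the origin is modified, so absolute continuity
of the integral makes every change of energy small (`HasInsertion`).

For s < 1 all this rests on triangle inequalities averaged over intermediate points, which reduce a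
double integral along a Lipschitz map to a single integral of the energy density
(`exists_lintegral_comp_le_gker`). For s = 1 it rests on chain rules for weak derivatives. Since
opening destroys a ball, the chain rule is proved first for nondegenerate maps contracting by t > 0,
and t tends to 0 at Lebesgue points. Weak derivatives are tested against bounded functions during
the constructions, because a bounded function of any measurable map is locally integrable. Unbounded
Lipschitz tests are recovered at the end by truncation and the Poincaré inequality
(`IsBddWeakDeriv.isLipWeakDeriv_of_eq`). -/

abbrev Euc (m : ℕ) := EuclideanSpace ℝ (Fin m)

/-! ### Weak derivatives: elementary properties and stability under limits. -/

theorem exists_smooth_cutoff {K A : Set (Euc m)} (hK : IsCompact K) (hA : IsOpen A)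
    (hKA : K ⊆ A) : ∃ χ : Euc m → ℝ, ContDiff ℝ ∞ χ ∧ HasCompactSupport χ ∧ tsupport χ ⊆ A ∧
      (∀ x, χ x ∈ Icc (0 : ℝ) 1) ∧ ∃ U, IsOpen U ∧ K ⊆ U ∧ U ⊆ A ∧ ∀ x ∈ U, χ x = 1 := by
  obtain ⟨K1, hK1, hKK1, hK1A⟩ := exists_compact_between hK hA hKA
  obtain ⟨K2, hK2, hK12, hK2A⟩ := exists_compact_between hK1 hA hK1A
  obtain ⟨f, hf, hr, hs, h1⟩ := exists_contMDiff_support_eq_eq_one_iff 𝓘(ℝ, Euc m)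
    (n := (⊤ : ℕ∞)) (isOpen_interior (s := K2)) hK1.isClosed hK12
  have hts : tsupport f ⊆ K2 := by
    rw [tsupport, hs]
    exact closure_minimal interior_subset hK2.isClosed
  refine ⟨f, hf.contDiff, HasCompactSupport.of_support_subset_isCompact hK2 (hs ▸ interior_subset),
    hts.trans hK2A, fun x => hr (mem_range_self x), interior K1, isOpen_interior, hKK1,
    interior_subset.trans hK1A, fun x hx => (h1 x).1 (interior_subset hx)⟩

theorem fderiv_eq_zero_of_notMem {φ : Euc m → ℝ} {A : Set (Euc m)} (h : tsupport φ ⊆ A)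
    {x : Euc m} (hx : x ∉ A) : fderiv ℝ φ x = 0 :=
  fderiv_of_notMem_tsupport ℝ (fun hx' => hx (h hx'))

theorem eq_zero_of_notMem {φ : Euc m → ℝ} {A : Set (Euc m)} (h : tsupport φ ⊆ A)
    {x : Euc m} (hx : x ∉ A) : φ x = 0 :=
  image_eq_zero_of_notMem_tsupport (fun hx' => hx (h hx'))

theorem tendsto_zero_of_le {ι : Type*} {l : Filter ι} {f g : ι → ℝ≥0∞} (hg : Tendsto g l (𝓝 0))
    (h : ∀ i, f i ≤ g i) : Tendsto f l (𝓝 0) :=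
  tendsto_of_tendsto_of_tendsto_of_le_of_le tendsto_const_nhds hg (fun _ => zero_le) h

theorem setIntegral_mul_fderiv_test {g φ : Euc m → ℝ} {A : Set (Euc m)} (h : tsupport φ ⊆ A)
    (v : Euc m) : ∫ x in A, g x * fderiv ℝ φ x v = ∫ x, g x * fderiv ℝ φ x v :=
  setIntegral_eq_integral_of_forall_compl_eq_zero fun x hx => by
    simp [fderiv_eq_zero_of_notMem h hx]

theorem setIntegral_test_mul {g φ : Euc m → ℝ} {A : Set (Euc m)} (h : tsupport φ ⊆ A) :
    ∫ x in A, φ x * g x = ∫ x, φ x * g x :=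
  setIntegral_eq_integral_of_forall_compl_eq_zero fun x hx => by
    simp [eq_zero_of_notMem h hx]

theorem HasWeakFDerivOn.integral_eq {g : Euc m → ℝ} {G : Euc m → Euc m →L[ℝ] ℝ}
    {A : Set (Euc m)} (h : HasWeakFDerivOn g G A) {φ : Euc m → ℝ} (hφ : ContDiff ℝ ∞ φ)
    (hc : HasCompactSupport φ) (hA : tsupport φ ⊆ A) (v : Euc m) :
    ∫ x, g x * fderiv ℝ φ x v = - ∫ x, φ x * G x v := by
  have := h.2.2 φ hφ hc hA v
  rwa [setIntegral_mul_fderiv_test hA, setIntegral_test_mul hA] at this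

theorem HasWeakFDerivOn.of_integral {g : Euc m → ℝ} {G : Euc m → Euc m →L[ℝ] ℝ}
    {A : Set (Euc m)} (hg : LocallyIntegrableOn g A) (hG : LocallyIntegrableOn G A)
    (h : ∀ φ : Euc m → ℝ, ContDiff ℝ ∞ φ → HasCompactSupport φ → tsupport φ ⊆ A → ∀ v : Euc m,
      ∫ x, g x * fderiv ℝ φ x v = - ∫ x, φ x * G x v) : HasWeakFDerivOn g G A := by
  refine ⟨hg, hG, fun φ h1 h2 h3 v => ?_⟩
  rw [setIntegral_mul_fderiv_test h3, setIntegral_test_mul h3]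
  exact h φ h1 h2 h3 v

theorem HasWeakFDerivOn.mono {g : Euc m → ℝ} {G : Euc m → Euc m →L[ℝ] ℝ}
    {A A' : Set (Euc m)} (h : HasWeakFDerivOn g G A) (hA : A' ⊆ A) : HasWeakFDerivOn g G A' :=
  .of_integral (h.1.mono_set hA) (h.2.1.mono_set hA) fun _ h1 h2 h3 v =>
    h.integral_eq h1 h2 (h3.trans hA) v

theorem HasWeakFDerivOn.congr_ae {g g' : Euc m → ℝ} {G G' : Euc m → Euc m →L[ℝ] ℝ}
    {A : Set (Euc m)} (h : HasWeakFDerivOn g G A) (hg : g =ᵐ[volume.restrict A] g')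
    (hG : G =ᵐ[volume.restrict A] G') : HasWeakFDerivOn g' G' A := by
  refine ⟨h.1.congr hg, h.2.1.congr hG, fun φ h1 h2 h3 v => ?_⟩
  have e1 : ∫ x in A, g x * fderiv ℝ φ x v = ∫ x in A, g' x * fderiv ℝ φ x v :=
    integral_congr_ae (by filter_upwards [hg] with x hx; simp only [hx])
  have e2 : ∫ x in A, φ x * G x v = ∫ x in A, φ x * G' x v :=
    integral_congr_ae (by filter_upwards [hG] with x hx; simp only [hx])
  rw [← e1, ← e2]
  exact h.2.2 φ h1 h2 h3 v

theorem HasWeakFDerivOn.congr {g g' : Euc m → ℝ} {G G' : Euc m → Euc m →L[ℝ] ℝ}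
    {A : Set (Euc m)} (h : HasWeakFDerivOn g G A) (hA : MeasurableSet A) (hg : EqOn g g' A)
    (hG : EqOn G G' A) : HasWeakFDerivOn g' G' A :=
  h.congr_ae (ae_restrict_of_forall_mem hA hg) (ae_restrict_of_forall_mem hA hG)

theorem continuous_fderiv_apply_test {φ : Euc m → ℝ} (hφ : ContDiff ℝ ∞ φ) (v : Euc m) :
    Continuous fun x => fderiv ℝ φ x v :=
  (hφ.continuous_fderiv (by simp)).clm_apply continuous_const

theorem integrable_mul_of_tsupport {E : Type*} [NormedAddCommGroup E] [NormedSpace ℝ E]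
    {g : Euc m → E} {A K : Set (Euc m)}
    (hg : LocallyIntegrableOn g A) {θ : Euc m → ℝ} (hθ : Continuous θ) (hK : IsCompact K)
    (hKA : K ⊆ A) (h0 : ∀ x ∉ K, θ x = 0) : Integrable fun x => θ x • g x := by
  have h1 : IntegrableOn (fun x => θ x • g x) K :=
    (hg.integrableOn_compact_subset hKA hK).continuousOn_smul hθ.continuousOn hK
  rw [← integrable_indicator_iff hK.measurableSet] at h1
  refine h1.congr (.of_forall fun x => ?_)
  by_cases hx : x ∈ K <;> simp [hx, h0]

theorem HasWeakFDerivOn.integrable_left {g : Euc m → ℝ} {G : Euc m → Euc m →L[ℝ] ℝ}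
    {A : Set (Euc m)} (h : HasWeakFDerivOn g G A) {φ : Euc m → ℝ} (hφ : ContDiff ℝ ∞ φ)
    (hc : HasCompactSupport φ) (hA : tsupport φ ⊆ A) (v : Euc m) :
    Integrable fun x => g x * fderiv ℝ φ x v := by
  simpa [mul_comm] using integrable_mul_of_tsupport h.1 (continuous_fderiv_apply_test hφ v)
    hc.isCompact hA (fun x hx => by simp [fderiv_of_notMem_tsupport ℝ hx])

theorem HasWeakFDerivOn.integrable_right {g : Euc m → ℝ} {G : Euc m → Euc m →L[ℝ] ℝ}
    {A : Set (Euc m)} (h : HasWeakFDerivOn g G A) {φ : Euc m → ℝ} (hφ : ContDiff ℝ ∞ φ)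
    (hc : HasCompactSupport φ) (hA : tsupport φ ⊆ A) (v : Euc m) :
    Integrable fun x => φ x * G x v := by
  have := integrable_mul_of_tsupport h.2.1 hφ.continuous hc.isCompact hA
    (fun x hx => image_eq_zero_of_notMem_tsupport hx)
  simpa using this.apply_continuousLinearMap v

theorem HasWeakFDerivOn.add {g g' : Euc m → ℝ} {G G' : Euc m → Euc m →L[ℝ] ℝ}
    {A : Set (Euc m)} (h : HasWeakFDerivOn g G A) (h' : HasWeakFDerivOn g' G' A) :
    HasWeakFDerivOn (fun x => g x + g' x) (fun x => G x + G' x) A := by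
  refine HasWeakFDerivOn.of_integral (LocallyIntegrableOn.add h.1 h'.1 :)
    (by simpa [sub_eq_add_neg, Pi.add_def] using h.2.1.sub h'.2.1.neg) fun φ h1 h2 h3 v => ?_
  simp only [add_mul, mul_add, add_apply]
  rw [integral_add (h.integrable_left h1 h2 h3 v) (h'.integrable_left h1 h2 h3 v),
    integral_add (h.integrable_right h1 h2 h3 v) (h'.integrable_right h1 h2 h3 v),
    h.integral_eq h1 h2 h3, h'.integral_eq h1 h2 h3]
  ring

theorem HasWeakFDerivOn.const_mul {g : Euc m → ℝ} {G : Euc m → Euc m →L[ℝ] ℝ}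
    {A : Set (Euc m)} (h : HasWeakFDerivOn g G A) (c : ℝ) :
    HasWeakFDerivOn (fun x => c * g x) (fun x => c • G x) A := by
  refine .of_integral (h.1.smul c) (h.2.1.smul c) fun φ h1 h2 h3 v => ?_
  simp only [smul_apply, smul_eq_mul, mul_assoc, mul_left_comm _ c]
  rw [integral_const_mul, integral_const_mul, h.integral_eq h1 h2 h3]
  ring

theorem HasWeakFDerivOn.sub {g g' : Euc m → ℝ} {G G' : Euc m → Euc m →L[ℝ] ℝ}
    {A : Set (Euc m)} (h : HasWeakFDerivOn g G A) (h' : HasWeakFDerivOn g' G' A) :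
    HasWeakFDerivOn (fun x => g x - g' x) (fun x => G x - G' x) A := by
  convert h.add (h'.const_mul (-1)) using 2
  · simp [sub_eq_add_neg]
  · ext v
    simp [sub_eq_add_neg]

theorem test_lipschitz {φ : Euc m → ℝ} (hφ : ContDiff ℝ ∞ φ) (hc : HasCompactSupport φ) :
    ∃ C, LipschitzWith C φ :=
  ContDiff.lipschitzWith_of_hasCompactSupport hc hφ (by simp)

theorem LipschitzWith.norm_fderiv_le_coe {E : Type*} [NormedAddCommGroup E] [NormedSpace ℝ E]
    {g : Euc m → E} {C : NNReal} (hg : LipschitzWith C g)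
    (x : Euc m) : ‖fderiv ℝ g x‖ ≤ C := norm_fderiv_le_of_lipschitz ℝ hg

/-- A Lipschitz function is weakly differentiable. -/
theorem LipschitzWith.hasWeakFDerivOn {g : Euc m → ℝ} {C : NNReal} (hg : LipschitzWith C g)
    (A : Set (Euc m)) : HasWeakFDerivOn g (fderiv ℝ g) A := by
  refine .of_integral (hg.continuous.locallyIntegrable.locallyIntegrableOn A) ?_
    fun φ h1 h2 h3 v => ?_
  · refine LocallyIntegrable.locallyIntegrableOn ?_ A
    exact (memLp_top_of_bound (measurable_fderiv ℝ g).aestronglyMeasurable C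
      (.of_forall (LipschitzWith.norm_fderiv_le_coe hg))).locallyIntegrable le_top
  · obtain ⟨D, hD⟩ := test_lipschitz h1 h2
    -- Integration by parts holds for directional derivatives of Lipschitz functions, and by
    -- Rademacher's theorem these are given almost everywhere by `fderiv`.
    have := LipschitzWith.integral_lineDeriv_mul_eq (μ := volume) hg hD h2 v
    have e1 : ∫ x, lineDeriv ℝ g x v * φ x = ∫ x, φ x * fderiv ℝ g x v := by
      refine integral_congr_ae ?_
      filter_upwards [hg.ae_differentiableAt] with x hx
      rw [hx.lineDeriv_eq_fderiv, mul_comm]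
    have e2 : ∫ x, lineDeriv ℝ φ x (-v) * g x = - ∫ x, g x * fderiv ℝ φ x v := by
      rw [← integral_neg]
      refine integral_congr_ae (.of_forall fun x => ?_)
      simp only [((h1.differentiable (by simp)) x).lineDeriv_eq_fderiv, map_neg]
      ring
    rw [← e1, this, e2, neg_neg]

theorem HasWeakFDerivOn.const (c : ℝ) (A : Set (Euc m)) :
    HasWeakFDerivOn (fun _ : Euc m => c) (fun _ => 0) A := by
  have := LipschitzWith.hasWeakFDerivOn (LipschitzWith.const (α := Euc m) c) A
  convert this using 2
  simp

/-- Weak differentiability passes to limits in `L^1` on compact sets. -/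
theorem HasWeakFDerivOn.of_tendsto {ι : Type*} {l : Filter ι} [l.NeBot]
    {A : Set (Euc m)} {g : Euc m → ℝ} {G : Euc m → Euc m →L[ℝ] ℝ}
    (hg : LocallyIntegrableOn g A) (hG : LocallyIntegrableOn G A)
    (hi : ∀ φ : Euc m → ℝ, ContDiff ℝ ∞ φ → HasCompactSupport φ → tsupport φ ⊆ A →
      ∃ (gi : ι → Euc m → ℝ) (Gi : ι → Euc m → Euc m →L[ℝ] ℝ) (B : Set (Euc m)),
      tsupport φ ⊆ B ∧ (∀ᶠ i in l, HasWeakFDerivOn (gi i) (Gi i) B) ∧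
      Tendsto (fun i => ∫⁻ x in tsupport φ, ‖gi i x - g x‖ₑ) l (𝓝 0) ∧
      Tendsto (fun i => ∫⁻ x in tsupport φ, ‖Gi i x - G x‖ₑ) l (𝓝 0)) :
    HasWeakFDerivOn g G A := by
  refine .of_integral hg hG fun φ h1 h2 h3 v => ?_
  obtain ⟨gi, Gi, B, hB, hw, t1, t2⟩ := hi φ h1 h2 h3
  -- Both sides of the integration by parts formula are integrals of b(x, f(x)), with b Lipschitz in
  -- its second variable and zero off the support of φ. One continuity statement therefore serves
  -- for the function and for its derivative.
  have key : ∀ {F : Type} [NormedAddCommGroup F] [NormedSpace ℝ F] (f : Euc m → F)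
      (fi : ι → Euc m → F) (b : Euc m → F → ℝ) (C : NNReal)
      (_ : ∀ x y z, ‖b x y - b x z‖ₑ ≤ C * ‖y - z‖ₑ) (_ : ∀ x ∉ tsupport φ, ∀ y, b x y = 0)
      (_ : Integrable fun x => b x (f x)) (_ : ∀ᶠ i in l, Integrable fun x => b x (fi i x))
      (_ : Tendsto (fun i => ∫⁻ x in tsupport φ, ‖fi i x - f x‖ₑ) l (𝓝 0)),
      Tendsto (fun i => ∫ x, b x (fi i x)) l (𝓝 (∫ x, b x (f x))) := by
    intro F _ _ f fi b C hb h0 hf hfi ht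
    refine tendsto_integral_of_L1 _ hf.aestronglyMeasurable hfi ?_
    have ht' : Tendsto (fun i => (C : ℝ≥0∞) * ∫⁻ x in tsupport φ, ‖fi i x - f x‖ₑ) l (𝓝 0) := by
      simpa using ENNReal.Tendsto.const_mul ht (Or.inr ENNReal.coe_ne_top)
    refine tendsto_zero_of_le ht' fun i => ?_
    calc ∫⁻ x, ‖b x (fi i x) - b x (f x)‖ₑ
        = ∫⁻ x in tsupport φ, ‖b x (fi i x) - b x (f x)‖ₑ := by
          rw [← lintegral_indicator (isClosed_tsupport φ).measurableSet]
          congr 1 with x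
          by_cases hx : x ∈ tsupport φ <;> simp [hx, h0]
      _ ≤ ∫⁻ x in tsupport φ, C * ‖fi i x - f x‖ₑ := lintegral_mono fun x => hb _ _ _
      _ = _ := lintegral_const_mul' _ _ ENNReal.coe_ne_top
  obtain ⟨D, hD⟩ := test_lipschitz h1 h2
  obtain ⟨M, hM⟩ := h1.continuous.bounded_above_of_compact_support h2
  have T1 := key g gi (fun x y => y * fderiv ℝ φ x v) (D * ‖v‖₊) (fun x y z => by
      rw [← sub_mul, enorm_mul, mul_comm]
      gcongr
      rw [enorm_eq_nnnorm]
      norm_cast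
      exact (ContinuousLinearMap.le_opNNNorm _ _).trans
        (by gcongr; exact LipschitzWith.norm_fderiv_le_coe hD x))
    (fun x hx y => by simp [fderiv_of_notMem_tsupport ℝ hx])
    (by
      simpa [mul_comm] using integrable_mul_of_tsupport hg (continuous_fderiv_apply_test h1 v)
        h2.isCompact h3 (fun x hx => by simp [fderiv_of_notMem_tsupport ℝ hx]))
    (hw.mono fun i hi => hi.integrable_left h1 h2 hB v) t1
  have T2 := key G Gi (fun x y => φ x * y v) (M.toNNReal * ‖v‖₊) (fun x y z => by
      rw [← mul_sub, enorm_mul, ← sub_apply]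
      push_cast
      rw [mul_assoc]
      gcongr
      · rw [enorm_eq_nnnorm]
        norm_cast
        rw [← NNReal.coe_le_coe, coe_nnnorm]
        exact (hM x).trans (Real.le_coe_toNNReal M)
      · rw [mul_comm]
        simp only [enorm_eq_nnnorm]
        norm_cast
        exact ContinuousLinearMap.le_opNNNorm _ _)
    (fun x hx y => by simp [image_eq_zero_of_notMem_tsupport hx])
    (by
      have := integrable_mul_of_tsupport hG h1.continuous h2.isCompact h3
        (fun x hx => image_eq_zero_of_notMem_tsupport hx)
      simpa using this.apply_continuousLinearMap v)
    (hw.mono fun i hi => hi.integrable_right h1 h2 hB v) t2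
  refine tendsto_nhds_unique T1 (T2.neg.congr' ?_)
  filter_upwards [hw] with i hi
  exact (hi.integral_eq h1 h2 hB v).symm

/-- Weak differentiability passes to limits in `L^1` on compact sets. -/
theorem HasWeakFDerivOn.of_approx {A : Set (Euc m)} {g : Euc m → ℝ} {G : Euc m → Euc m →L[ℝ] ℝ}
    (hg : LocallyIntegrableOn g A) (hG : LocallyIntegrableOn G A)
    (hi : ∀ K ⊆ A, IsCompact K → ∀ ε : ℝ≥0∞, ε ≠ 0 →
      ∃ (g' : Euc m → ℝ) (G' : Euc m → Euc m →L[ℝ] ℝ), HasWeakFDerivOn g' G' K ∧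
        ∫⁻ x in K, ‖g' x - g x‖ₑ ≤ ε ∧ ∫⁻ x in K, ‖G' x - G x‖ₑ ≤ ε) :
    HasWeakFDerivOn g G A := by
  refine .of_tendsto (ι := ℕ) (l := atTop) hg hG fun φ h1 h2 h3 => ?_
  choose gi Gi hw t1 t2 using fun n : ℕ => hi (tsupport φ) h3 h2.isCompact ((n : ℝ≥0∞) + 1)⁻¹
    (by simp)
  have t0 : Tendsto (fun n : ℕ => ((n : ℝ≥0∞) + 1)⁻¹) atTop (𝓝 0) := by
    have := (tendsto_add_atTop_iff_nat 1).2 ENNReal.tendsto_inv_nat_nhds_zero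
    simpa using this
  exact ⟨gi, Gi, tsupport φ, le_rfl, .of_forall hw,
    tendsto_zero_of_le t0 t1,
    tendsto_zero_of_le t0 t2⟩

/-! ### Composition and mollification in L^1. -/

theorem lintegral_comp_le_of_map_le {X Y : Type*} [MeasurableSpace X] [MeasurableSpace Y]
    {μ : Measure X} {ν : Measure Y} {Φ : X → Y} {C : ℝ≥0∞} (hΦ : AEMeasurable Φ μ)
    (h : μ.map Φ ≤ C • ν) {f : Y → ℝ≥0∞} (hf : AEMeasurable f ν) :
    ∫⁻ x, f (Φ x) ∂μ ≤ C * ∫⁻ y, f y ∂ν := by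
  have h1 : AEMeasurable f (μ.map Φ) := (hf.smul_measure C).mono_measure h
  rw [← lintegral_map' h1 hΦ, ← smul_eq_mul, ← lintegral_smul_measure]
  exact lintegral_mono' h le_rfl

/-- The bound on the image measures makes composition continuous in L^1, uniformly in the index.
This reduces the claim to a continuous compactly supported function, for which dominated convergence
applies since μ is finite. -/
theorem tendsto_lintegral_comp_sub {X : Type*} [MeasurableSpace X] {μ : Measure X}
    [IsFiniteMeasure μ] {ι : Type*} {l : Filter ι} [l.IsCountablyGenerated]
    {E : Type*} [NormedAddCommGroup E] [NormedSpace ℝ E]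
    {Φi : ι → X → Euc m} {Φ : X → Euc m} {C : ℝ≥0∞} (hC : C ≠ ⊤)
    (hΦi : ∀ᶠ i in l, Measurable (Φi i)) (hΦ : Measurable Φ)
    (hi : ∀ᶠ i in l, μ.map (Φi i) ≤ C • volume) (hm : μ.map Φ ≤ C • volume)
    (hlim : ∀ᵐ x ∂μ, Tendsto (fun i => Φi i x) l (𝓝 (Φ x)))
    {F : Euc m → E} (hF : Integrable F) :
    Tendsto (fun i => ∫⁻ x, ‖F (Φi i x) - F (Φ x)‖ₑ ∂μ) l (𝓝 0) := by
  rw [ENNReal.tendsto_nhds_zero]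
  intro ε hε
  obtain ⟨δ, hδ, hδε⟩ : ∃ δ : ℝ≥0∞, δ ≠ 0 ∧ C * δ ≤ ε / 3 := by
    rcases eq_or_ne ε ⊤ with rfl | hεt
    · exact ⟨1, one_ne_zero, by simp [ENNReal.top_div_of_ne_top]⟩
    · refine ⟨ε / 3 / (C + 1), ?_, ?_⟩
      · refine ENNReal.div_ne_zero.2 ⟨ENNReal.div_ne_zero.2 ⟨hε.ne', by simp⟩, by finiteness⟩
      · rw [← mul_div_assoc]
        refine ENNReal.div_le_of_le_mul ?_
        rw [mul_comm]
        gcongr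
        exact le_self_add
  obtain ⟨c, hc1, hc2, hc3, hc4⟩ := hF.exists_hasCompactSupport_lintegral_sub_le hδ
  obtain ⟨M, hM⟩ := hc3.bounded_above_of_compact_support hc1
  have hlimc : Tendsto (fun i => ∫⁻ x, ‖c (Φi i x) - c (Φ x)‖ₑ ∂μ) l (𝓝 0) := by
    have := tendsto_lintegral_filter_of_dominated_convergence (μ := μ) (l := l)
      (F := fun i x => ‖c (Φi i x) - c (Φ x)‖ₑ) (f := fun _ => 0)
      (fun _ => ofReal (2 * M)) ?_ ?_ ?_ ?_
    · simpa using this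
    · filter_upwards [hΦi] with i hi'
      exact ((hc3.comp_stronglyMeasurable hi'.stronglyMeasurable).sub
        (hc3.comp_stronglyMeasurable hΦ.stronglyMeasurable)).enorm
    · refine .of_forall fun i => .of_forall fun x => ?_
      rw [← ofReal_norm]
      refine ofReal_le_ofReal ((norm_sub_le _ _).trans ?_)
      linarith [hM (Φi i x), hM (Φ x)]
    · simp [ENNReal.mul_eq_top]
    · filter_upwards [hlim] with x hx
      have h1 := ((hc3.tendsto (Φ x)).comp hx).sub_const (c (Φ x))
      simpa using h1.enorm
  have hmeas : AEMeasurable (fun x => ‖F x - c x‖ₑ) (volume : Measure (Euc m)) :=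
    (hF.1.sub hc4.1).enorm
  filter_upwards [ENNReal.tendsto_nhds_zero.1 hlimc (ε / 3) (by simp [hε.ne']), hi, hΦi]
    with i hi1 hi2 hi3
  have m1 : AEMeasurable (fun x => ‖F (Φi i x) - c (Φi i x)‖ₑ) μ := by
    exact ((hmeas.smul_measure C).mono_measure hi2).comp_measurable hi3
  have m3 : AEMeasurable (fun x => ‖F (Φ x) - c (Φ x)‖ₑ) μ := by
    exact ((hmeas.smul_measure C).mono_measure hm).comp_measurable hΦ
  calc ∫⁻ x, ‖F (Φi i x) - F (Φ x)‖ₑ ∂μ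
      ≤ ∫⁻ x, ‖F (Φi i x) - c (Φi i x)‖ₑ + (‖c (Φi i x) - c (Φ x)‖ₑ
          + ‖F (Φ x) - c (Φ x)‖ₑ) ∂μ := by
        refine lintegral_mono fun x => ?_
        have : F (Φi i x) - F (Φ x) = (F (Φi i x) - c (Φi i x)) + ((c (Φi i x) - c (Φ x))
          + -(F (Φ x) - c (Φ x))) := by abel
        rw [this]
        refine (enorm_add_le _ _).trans ?_
        gcongr
        refine (enorm_add_le _ _).trans ?_
        rw [enorm_neg]
    _ = (∫⁻ x, ‖F (Φi i x) - c (Φi i x)‖ₑ ∂μ) + ((∫⁻ x, ‖c (Φi i x) - c (Φ x)‖ₑ ∂μ)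
          + ∫⁻ x, ‖F (Φ x) - c (Φ x)‖ₑ ∂μ) := by
        rw [lintegral_add_left' m1, lintegral_add_right' _ m3]
    _ ≤ ε / 3 + (ε / 3 + ε / 3) := by
        gcongr
        · refine (lintegral_comp_le_of_map_le hi3.aemeasurable hi2 hmeas).trans (le_trans ?_ hδε)
          gcongr
        · refine (lintegral_comp_le_of_map_le hΦ.aemeasurable hm hmeas).trans (le_trans ?_ hδε)
          gcongr
    _ = ε := by rw [← add_assoc, ENNReal.add_thirds]

theorem tendsto_lintegral_translate {E : Type*} [NormedAddCommGroup E] [NormedSpace ℝ E]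
    {F : Euc m → E} (hF : Integrable F) {K : Set (Euc m)} (hK : IsCompact K) :
    Tendsto (fun t => ∫⁻ x in K, ‖F (x - t) - F x‖ₑ) (𝓝 0) (𝓝 0) := by
  have : IsFiniteMeasure (volume.restrict K) := ⟨by simpa using hK.measure_lt_top⟩
  have hm : ∀ t : Euc m, (volume.restrict K).map (fun x => x - t) ≤ (1 : ℝ≥0∞) • volume := by
    intro t
    rw [one_smul]
    refine (Measure.map_mono Measure.restrict_le_self (by fun_prop)).trans ?_
    rw [map_sub_right_eq_self]
  have := tendsto_lintegral_comp_sub (μ := volume.restrict K) (l := 𝓝 (0 : Euc m))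
    (Φi := fun t x => x - t) (Φ := fun x => x) ENNReal.one_ne_top
    (.of_forall fun t => by fun_prop) (by fun_prop) (.of_forall hm) (by simpa using hm 0)
    (.of_forall fun x => by
      simpa using (tendsto_const_nhds (x := x)).sub (tendsto_id (x := 𝓝 (0 : Euc m)))) hF
  exact this

/-- A mollification is an average of translates with weights of total mass 1, so Tonelli's theorem
bounds its distance to F by the largest distance of a translate. -/
theorem lintegral_conv_sub_le {E : Type*} [NormedAddCommGroup E] [NormedSpace ℝ E]
    [CompleteSpace E] {F : Euc m → E} (hF : Integrable F) (φ : ContDiffBump (0 : Euc m))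
    {K : Set (Euc m)} {ε : ℝ≥0∞}
    (h : ∀ t ∈ ball (0 : Euc m) φ.rOut, ∫⁻ x in K, ‖F (x - t) - F x‖ₑ ≤ ε) :
    ∫⁻ x in K, ‖(∫ t, φ.normed volume t • F (x - t)) - F x‖ₑ ≤ ε := by
  -- Tonelli's theorem needs joint measurability of F(x - t) in (x, t). Passing to a representative
  -- changes neither the hypothesis nor the convolution, because null sets are preserved by
  -- translations and reflections.
  wlog hsm : StronglyMeasurable F generalizing F
  · have hFm := hF.1.ae_eq_mk
    have tr : ∀ t : Euc m, ∀ᵐ x, F (x - t) = hF.1.mk F (x - t) := fun t =>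
      (measurePreserving_sub_right volume t).quasiMeasurePreserving.ae hFm
    have tr' : ∀ x : Euc m, ∀ᵐ t, F (x - t) = hF.1.mk F (x - t) := fun x =>
      (quasiMeasurePreserving_sub_left_of_right_invariant volume x).ae hFm
    have := this (F := hF.1.mk F) (hF.congr hFm) (fun t ht => by
      refine le_trans (le_of_eq (lintegral_congr_ae (ae_restrict_of_ae ?_))) (h t ht)
      filter_upwards [tr t, hFm] with x h1 h2
      rw [h1, h2]) hF.1.stronglyMeasurable_mk
    refine le_trans (le_of_eq (lintegral_congr_ae (ae_restrict_of_ae ?_))) this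
    filter_upwards [hFm] with x h2
    rw [← h2, integral_congr_ae (g := fun t => φ.normed volume t • hF.1.mk F (x - t))]
    filter_upwards [tr' x] with t ht
    rw [ht]
  obtain ⟨M, hM⟩ := φ.continuous_normed.bounded_above_of_compact_support
    (φ.hasCompactSupport_normed (μ := volume))
  have hcont : Continuous (φ.normed (volume : Measure (Euc m))) := φ.continuous_normed
  have e1 : ∀ x, (∫ t, φ.normed volume t • F (x - t)) - F x
      = ∫ t, φ.normed volume t • (F (x - t) - F x) := by
    intro x
    have i1 : Integrable fun t => φ.normed volume t • F (x - t) :=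
      (hF.comp_sub_left x).bdd_smul M hcont.aestronglyMeasurable (.of_forall hM)
    have i2 : Integrable fun t => φ.normed volume t • F x := φ.integrable_normed.smul_const _
    simp only [smul_sub]
    rw [integral_sub i1 i2, integral_smul_const, φ.integral_normed, one_smul]
  calc ∫⁻ x in K, ‖(∫ t, φ.normed volume t • F (x - t)) - F x‖ₑ
      ≤ ∫⁻ x in K, ∫⁻ t, ‖φ.normed volume t‖ₑ * ‖F (x - t) - F x‖ₑ := by
        refine lintegral_mono fun x => ?_
        rw [e1]
        refine (enorm_integral_le_lintegral_enorm _).trans (le_of_eq ?_)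
        simp [enorm_smul]
    _ = ∫⁻ t, ∫⁻ x in K, ‖φ.normed volume t‖ₑ * ‖F (x - t) - F x‖ₑ := by
        refine lintegral_lintegral_swap ?_
        refine Measurable.aemeasurable ?_
        refine (hcont.measurable.comp measurable_snd).enorm.mul ?_
        exact ((hsm.comp_measurable (measurable_fst.sub measurable_snd)).sub
          (hsm.comp_measurable measurable_fst)).enorm
    _ = ∫⁻ t, ‖φ.normed volume t‖ₑ * ∫⁻ x in K, ‖F (x - t) - F x‖ₑ := by
        congr 1 with t
        rw [lintegral_const_mul' _ _ enorm_ne_top]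
    _ ≤ ∫⁻ t, ‖φ.normed volume t‖ₑ * ε := by
        refine lintegral_mono fun t => ?_
        by_cases ht : t ∈ ball (0 : Euc m) φ.rOut
        · gcongr
          exact h t ht
        · have : φ.normed volume t = 0 := by
            rw [← Function.notMem_support, φ.support_normed_eq]; exact ht
          simp [this]
    _ ≤ ε := by
        rw [lintegral_mul_const'' _ hcont.enorm.measurable.aemeasurable]
        have : ∫⁻ t, ‖φ.normed volume t‖ₑ = 1 := by
          rw [← ofReal_integral_norm_eq_lintegral_enorm φ.integrable_normed]
          simp only [Real.norm_eq_abs, abs_of_nonneg (φ.nonneg_normed _), φ.integral_normed,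
            ofReal_one]
        rw [this, one_mul]

/-- The derivative of a convolution falls on the mollifier, and the weak formulation with the test
function t ↦ φ(x - t) transfers it to h. The gradient of the mollified function is thus the
mollified H, and both converge in L^1 on K. -/
theorem HasWeakFDerivOn.exists_smooth_approx_univ {h : Euc m → ℝ} {H : Euc m → Euc m →L[ℝ] ℝ}
    (hw : HasWeakFDerivOn h H univ) (hc : HasCompactSupport h) (hh : Integrable h)
    (hH : Integrable H) {K : Set (Euc m)} (hK : IsCompact K) {ε : ℝ≥0∞} (hε : ε ≠ 0) :
    ∃ f : Euc m → ℝ, ContDiff ℝ ∞ f ∧ HasCompactSupport f ∧ ∫⁻ x in K, ‖f x - h x‖ₑ ≤ ε ∧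
      ∫⁻ x in K, ‖fderiv ℝ f x - H x‖ₑ ≤ ε := by
  have t1 := ENNReal.tendsto_nhds_zero.1 (tendsto_lintegral_translate hh hK) ε hε.bot_lt
  have t2 := ENNReal.tendsto_nhds_zero.1 (tendsto_lintegral_translate hH hK) ε hε.bot_lt
  obtain ⟨r, hr, hb⟩ := Metric.eventually_nhds_iff_ball.1 (t1.and t2)
  let φ : ContDiffBump (0 : Euc m) := ⟨r / 2, r, by positivity, by linarith⟩
  have hφ : ContDiff ℝ ∞ (φ.normed (volume : Measure (Euc m))) := φ.contDiff_normed
  have hφc : HasCompactSupport (φ.normed (volume : Measure (Euc m))) := φ.hasCompactSupport_normed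
  have hl : LocallyIntegrable h := hh.locallyIntegrable
  let f := convolution (φ.normed volume) h (ContinuousLinearMap.lsmul ℝ ℝ) volume
  have hf : ∀ x, fderiv ℝ f x = ∫ t, φ.normed volume t • H (x - t) := by
    intro x
    have hd := hφc.hasFDerivAt_convolution_left (ContinuousLinearMap.lsmul ℝ ℝ)
      (hφ.of_le (by simp)) hl x
    rw [hd.fderiv]
    obtain ⟨M, hM⟩ := hφ.continuous.bounded_above_of_compact_support hφc
    have i1 : Integrable fun t => φ.normed volume t • H (x - t) :=
      (hH.comp_sub_left x).bdd_smul M hφ.continuous.aestronglyMeasurable (.of_forall hM)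
    ext v
    rw [ContinuousLinearMap.integral_apply i1]
    have hex := (hφc.fderiv ℝ).convolutionExists_left
      ((ContinuousLinearMap.lsmul ℝ ℝ : ℝ →L[ℝ] ℝ →L[ℝ] ℝ).precompL (Euc m)) (hφ.continuous_fderiv (by simp)) hl x
    rw [convolution_def, ContinuousLinearMap.integral_apply hex]
    have hψ : ContDiff ℝ ∞ (fun t => φ.normed volume (x - t)) := by fun_prop
    have hψc : HasCompactSupport (fun t => φ.normed (volume : Measure (Euc m)) (x - t)) :=
      hφc.comp_homeomorph (Homeomorph.subLeft x)
    have key := hw.integral_eq hψ hψc (subset_univ _) v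
    have hder : ∀ t, fderiv ℝ (fun t => φ.normed volume (x - t)) t v
        = - fderiv ℝ (φ.normed volume) (x - t) v := by
      intro t
      have h1 : HasFDerivAt (fun t : Euc m => x - t) (-ContinuousLinearMap.id ℝ (Euc m)) t :=
        (hasFDerivAt_id t).const_sub x
      have h2 := ((hφ.differentiable (by simp)) (x - t)).hasFDerivAt
      have h3 : HasFDerivAt (fun t => φ.normed volume (x - t)) _ t := h2.comp t h1
      rw [h3.fderiv]
      simp
    simp only [hder, mul_neg, integral_neg, neg_inj] at key
    rw [← integral_sub_left_eq_self _ volume x] at key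
    rw [← integral_sub_left_eq_self (fun t => φ.normed volume (x - t) * H t v) volume x] at key
    simpa [mul_comm] using key
  refine ⟨f, hφc.contDiff_convolution_left _ hφ hl, hφc.convolution _ hc, ?_, ?_⟩
  · exact lintegral_conv_sub_le hh φ fun t ht => (hb t ht).1
  · simp_rw [hf]
    exact lintegral_conv_sub_le hH φ fun t ht => (hb t ht).2

theorem integrable_fun_add {X E : Type*} [MeasurableSpace X] [NormedAddCommGroup E]
    {μ : Measure X} {f g : X → E} (hf : Integrable f μ) (hg : Integrable g μ) :
    Integrable (fun x => f x + g x) μ := hf.add hg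

theorem IntegrableOn.integrable_of_zero {X E : Type*} [MeasurableSpace X]
    [NormedAddCommGroup E] {μ : Measure X} {f : X → E} {K : Set X} (hf : IntegrableOn f K μ)
    (hK : MeasurableSet K) (h0 : ∀ x ∉ K, f x = 0) : Integrable f μ := by
  rw [← integrable_indicator_iff hK] at hf
  refine hf.congr (.of_forall fun x => ?_)
  by_cases hx : x ∈ K
  · simp [hx]
  · simp [hx, h0 x hx]

/-! ### Localization, patching and uniqueness of weak derivatives. -/

theorem HasWeakFDerivOn.cutoff {g : Euc m → ℝ} {G : Euc m → Euc m →L[ℝ] ℝ} {A : Set (Euc m)}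
    (h : HasWeakFDerivOn g G A) {χ : Euc m → ℝ} (hχ : ContDiff ℝ ∞ χ) (hχc : HasCompactSupport χ)
    (hχA : tsupport χ ⊆ A) :
    HasWeakFDerivOn (fun x => χ x * g x) (fun x => χ x • G x + g x • fderiv ℝ χ x) univ ∧
    Integrable (fun x => χ x * g x) ∧
    Integrable (fun x => χ x • G x + g x • fderiv ℝ χ x) := by
  have i1 : Integrable (fun x => χ x * g x) := by
    simpa using integrable_mul_of_tsupport h.1 hχ.continuous hχc.isCompact hχA
      (fun x hx => image_eq_zero_of_notMem_tsupport hx)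
  have i2 : Integrable (fun x => χ x • G x) :=
    integrable_mul_of_tsupport h.2.1 hχ.continuous hχc.isCompact hχA
      (fun x hx => image_eq_zero_of_notMem_tsupport hx)
  have i3 : Integrable (fun x => g x • fderiv ℝ χ x) := by
    have h1 : IntegrableOn (fun x => g x • fderiv ℝ χ x) (tsupport χ) :=
      (h.1.integrableOn_compact_subset hχA hχc.isCompact).smul_continuousOn
        (hχ.continuous_fderiv (by simp)).continuousOn hχc.isCompact
    exact IntegrableOn.integrable_of_zero h1 (isClosed_tsupport χ).measurableSet
      fun x hx => by rw [fderiv_of_notMem_tsupport ℝ hx, smul_zero]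
  have i23 := integrable_fun_add i2 i3
  refine ⟨.of_integral (i1.locallyIntegrable.locallyIntegrableOn _)
    (i23.locallyIntegrable.locallyIntegrableOn _) fun φ h1 h2 _ v => ?_, i1, i23⟩
  -- The product rule is moved onto the test function: χφ is admissible for g on A, although φ is
  -- not.
  have hm1 : ContDiff ℝ ∞ (fun x => χ x * φ x) := hχ.mul h1
  have hm2 : HasCompactSupport (fun x => χ x * φ x) := hχc.mul_right
  have hm3 : tsupport (fun x => χ x * φ x) ⊆ A := (tsupport_mul_subset_left).trans hχA
  have key := h.integral_eq hm1 hm2 hm3 v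
  have hd : ∀ x, fderiv ℝ (fun x => χ x * φ x) x v
      = χ x * fderiv ℝ φ x v + φ x * fderiv ℝ χ x v := by
    intro x
    rw [fderiv_fun_mul (hχ.differentiable (by simp) x) (h1.differentiable (by simp) x)]
    simp
  obtain ⟨M, hM⟩ := h1.continuous.bounded_above_of_compact_support h2
  obtain ⟨M', hM'⟩ := (continuous_fderiv_apply_test h1 v).bounded_above_of_compact_support
    ((h2.fderiv ℝ).comp_left (g := fun L : Euc m →L[ℝ] ℝ => L v) (by simp))
  have j1 : Integrable fun x => χ x * g x * fderiv ℝ φ x v :=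
    i1.mul_bdd (c := M') (continuous_fderiv_apply_test h1 v).aestronglyMeasurable (.of_forall hM')
  have j2 : Integrable fun x => φ x * (g x * fderiv ℝ χ x v) :=
    (i3.apply_continuousLinearMap v).bdd_mul (c := M) h1.continuous.aestronglyMeasurable (.of_forall hM)
  have j3 : Integrable fun x => φ x * (χ x * G x v) :=
    (i2.apply_continuousLinearMap v).bdd_mul (c := M) h1.continuous.aestronglyMeasurable (.of_forall hM)
  have e1 : ∫ x, g x * fderiv ℝ (fun x => χ x * φ x) x v
      = (∫ x, χ x * g x * fderiv ℝ φ x v) + ∫ x, φ x * (g x * fderiv ℝ χ x v) := by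
    rw [← integral_add j1 j2]
    congr 1 with x
    rw [hd]; ring
  have e2 : ∫ x, φ x * ((χ x • G x + g x • fderiv ℝ χ x) v)
      = (∫ x, φ x * (χ x * G x v)) + ∫ x, φ x * (g x * fderiv ℝ χ x v) := by
    rw [← integral_add j3 j2]
    congr 1 with x
    simp [mul_add]
  have e3 : ∫ x, χ x * φ x * G x v = ∫ x, φ x * (χ x * G x v) := by
    congr 1 with x; ring
  rw [e2]
  rw [e1, e3] at key
  linarith

theorem HasWeakFDerivOn.exists_smooth_approx {g : Euc m → ℝ} {G : Euc m → Euc m →L[ℝ] ℝ}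
    {A : Set (Euc m)} (h : HasWeakFDerivOn g G A) (hA : IsOpen A) {K : Set (Euc m)}
    (hK : IsCompact K) (hKA : K ⊆ A) {ε : ℝ≥0∞} (hε : ε ≠ 0) :
    ∃ f : Euc m → ℝ, ContDiff ℝ ∞ f ∧ HasCompactSupport f ∧ ∫⁻ x in K, ‖f x - g x‖ₑ ≤ ε ∧
      ∫⁻ x in K, ‖fderiv ℝ f x - G x‖ₑ ≤ ε := by
  obtain ⟨χ, c1, c2, c3, -, U, hU, hKU, -, hχ1⟩ := exists_smooth_cutoff hK hA hKA
  obtain ⟨w, i1, i2⟩ := h.cutoff c1 c2 c3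
  obtain ⟨f, f1, f2, f3, f4⟩ := w.exists_smooth_approx_univ c2.mul_right i1 i2 hK hε
  refine ⟨f, f1, f2, le_trans (le_of_eq ?_) f3, le_trans (le_of_eq ?_) f4⟩
  · refine setLIntegral_congr_fun hK.measurableSet fun x hx => ?_
    simp [hχ1 x (hKU hx)]
  · refine setLIntegral_congr_fun hK.measurableSet fun x hx => ?_
    have : fderiv ℝ χ x = 0 := by
      have : χ =ᶠ[𝓝 x] fun _ => 1 := by
        filter_upwards [hU.mem_nhds (hKU hx)] with y hy using hχ1 y hy
      rw [this.fderiv_eq]; simp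
    simp [hχ1 x (hKU hx), this]

/-- A partition of unity subordinate to the two sets: with χ = 1 near supp φ \ B and χ supported in
A, the functions χφ and (1 - χ)φ are test functions for A and for B. -/
theorem HasWeakFDerivOn.union {g : Euc m → ℝ} {G : Euc m → Euc m →L[ℝ] ℝ}
    {A B : Set (Euc m)} (hA : IsOpen A) (hB : IsOpen B)
    (h : HasWeakFDerivOn g G A) (h' : HasWeakFDerivOn g G B) : HasWeakFDerivOn g G (A ∪ B) := by
  have loc : ∀ {F : Type} [NormedAddCommGroup F] {f : Euc m → F}, LocallyIntegrableOn f A →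
      LocallyIntegrableOn f B → LocallyIntegrableOn f (A ∪ B) := by
    intro F _ f h1 h2 x hx
    rcases hx with hx | hx
    · have := h1 x hx
      rw [hA.nhdsWithin_eq hx] at this
      rwa [(hA.union hB).nhdsWithin_eq (Or.inl hx)]
    · have := h2 x hx
      rw [hB.nhdsWithin_eq hx] at this
      rwa [(hA.union hB).nhdsWithin_eq (Or.inr hx)]
  refine .of_integral (loc h.1 h'.1) (loc h.2.1 h'.2.1) fun φ h1 h2 h3 v => ?_
  have hK : IsCompact (tsupport φ \ B) := h2.isCompact.diff hB
  obtain ⟨χ, c1, c2, c3, -, U, hU, hKU, -, hχ1⟩ := exists_smooth_cutoff hK hA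
    (fun x hx => (h3 hx.1).resolve_right hx.2)
  have p1 : ContDiff ℝ ∞ (fun x => χ x * φ x) := c1.mul h1
  have p2 : HasCompactSupport (fun x => χ x * φ x) := h2.mul_left
  have p3 : tsupport (fun x => χ x * φ x) ⊆ A := (tsupport_mul_subset_left).trans c3
  have q1 : ContDiff ℝ ∞ (fun x => (1 - χ x) * φ x) := (contDiff_const.sub c1).mul h1
  have q2 : HasCompactSupport (fun x => (1 - χ x) * φ x) := h2.mul_left
  have q3 : tsupport (fun x => (1 - χ x) * φ x) ⊆ B := by
    have hs : Function.support (fun x => (1 - χ x) * φ x) ⊆ tsupport φ ∩ Uᶜ := by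
      intro x hx
      refine ⟨subset_tsupport _ fun h0 => hx (by simp [h0]), fun hxU => hx (by simp [hχ1 x hxU])⟩
    intro x hx
    have := closure_minimal hs ((isClosed_tsupport φ).inter hU.isClosed_compl) hx
    by_contra hxB
    exact this.2 (hKU ⟨this.1, hxB⟩)
  have k1 := h.integral_eq p1 p2 p3 v
  have k2 := h'.integral_eq q1 q2 q3 v
  have hd : ∀ x, fderiv ℝ φ x v = fderiv ℝ (fun x => χ x * φ x) x v
      + fderiv ℝ (fun x => (1 - χ x) * φ x) x v := by
    intro x
    rw [← add_apply, ← fderiv_fun_add (p1.differentiable (by simp) x)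
      (q1.differentiable (by simp) x)]
    congr 3
    ext y; ring
  have e1 : ∫ x, g x * fderiv ℝ φ x v = (∫ x, g x * fderiv ℝ (fun x => χ x * φ x) x v)
      + ∫ x, g x * fderiv ℝ (fun x => (1 - χ x) * φ x) x v := by
    rw [← integral_add (h.integrable_left p1 p2 p3 v) (h'.integrable_left q1 q2 q3 v)]
    congr 1 with x
    rw [hd]; ring
  have e2 : ∫ x, φ x * G x v = (∫ x, χ x * φ x * G x v) + ∫ x, (1 - χ x) * φ x * G x v := by
    rw [← integral_add (h.integrable_right p1 p2 p3 v) (h'.integrable_right q1 q2 q3 v)]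
    congr 1 with x
    ring
  rw [e1, e2, k1, k2]; ring

theorem HasWeakFDerivOn.ae_eq {g : Euc m → ℝ} {G G' : Euc m → Euc m →L[ℝ] ℝ}
    {A : Set (Euc m)} (hA : IsOpen A)
    (h : HasWeakFDerivOn g G A) (h' : HasWeakFDerivOn g G' A) : ∀ᵐ x, x ∈ A → G x = G' x := by
  have := hA.ae_eq_zero_of_integral_contDiff_smul_eq_zero (μ := volume)
    (f := fun x => G x - G' x) (h.2.1.sub h'.2.1) fun φ h1 h2 h3 => by
      have i1 := integrable_mul_of_tsupport h.2.1 h1.continuous h2.isCompact h3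
        (fun x hx => image_eq_zero_of_notMem_tsupport hx)
      have i2 := integrable_mul_of_tsupport h'.2.1 h1.continuous h2.isCompact h3
        (fun x hx => image_eq_zero_of_notMem_tsupport hx)
      simp only [smul_sub]
      rw [integral_sub i1 i2, sub_eq_zero]
      ext v
      rw [ContinuousLinearMap.integral_apply i1, ContinuousLinearMap.integral_apply i2]
      have a1 := h.integral_eq h1 h2 h3 v
      have a2 := h'.integral_eq h1 h2 h3 v
      simp only [smul_apply, smul_eq_mul]
      linarith
  filter_upwards [this] with x hx hxA
  exact sub_eq_zero.1 (hx hxA)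

/-- Multiplication by a cut-off equal to 1 near K changes neither g nor G: the additional term of
the product rule vanishes near K because χ is locally constant, and off K because g is zero. -/
theorem HasWeakFDerivOn.extend_zero {g : Euc m → ℝ} {G : Euc m → Euc m →L[ℝ] ℝ}
    {A : Set (Euc m)} (hA : IsOpen A) (h : HasWeakFDerivOn g G A) {K : Set (Euc m)}
    (hK : IsCompact K) (hKA : K ⊆ A) (h0 : ∀ x ∉ K, g x = 0) (h0' : ∀ x ∉ K, G x = 0) :
    HasWeakFDerivOn g G univ ∧ Integrable g ∧ Integrable G := by
  obtain ⟨χ, c1, c2, c3, -, U, hU, hKU, -, hχ1⟩ := exists_smooth_cutoff hK hA hKA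
  have key := h.cutoff c1 c2 c3
  have e1 : (fun x => χ x * g x) = g := by
    ext x
    by_cases hx : x ∈ K
    · simp [hχ1 x (hKU hx)]
    · simp [h0 x hx]
  have e2 : (fun x => χ x • G x + g x • fderiv ℝ χ x) = G := by
    funext x
    by_cases hx : x ∈ K
    · have : fderiv ℝ χ x = 0 := by
        have : χ =ᶠ[𝓝 x] fun _ => 1 := by
          filter_upwards [hU.mem_nhds (hKU hx)] with y hy using hχ1 y hy
        rw [this.fderiv_eq]; simp
      simp [hχ1 x (hKU hx), this]
    · simp [h0 x hx, h0' x hx]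
  rwa [e1, e2] at key

/-! ### The Poincaré inequality. -/

theorem lintegral_rpow_le_measure_mul {X : Type*} [MeasurableSpace X] {μ : Measure X}
    {f : X → ℝ≥0∞} (hf : AEMeasurable f μ) {p : ℝ} (hp : 1 ≤ p) :
    (∫⁻ x, f x ∂μ) ^ p ≤ μ univ ^ (p - 1) * ∫⁻ x, f x ^ p ∂μ := by
  rcases hp.eq_or_lt with rfl | hp
  · simp
  have hpq : p.HolderConjugate (p / (p - 1)) := Real.HolderConjugate.conjExponent hp
  have := ENNReal.lintegral_mul_le_Lp_mul_Lq μ hpq hf (aemeasurable_const (b := 1))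
  simp only [Pi.mul_apply, mul_one, ENNReal.one_rpow, lintegral_const, one_mul] at this
  calc (∫⁻ x, f x ∂μ) ^ p ≤ _ := ENNReal.rpow_le_rpow this (by linarith)
    _ = _ := by
      rw [mul_rpow_of_nonneg _ _ (by linarith), ← ENNReal.rpow_mul, ← ENNReal.rpow_mul,
        mul_comm]
      have h1 : p - 1 ≠ 0 := by linarith
      have h2 : p ≠ 0 := by linarith
      congr 2
      · field_simp
      · field_simp
        simp

theorem exists_ne_zero_mul_le {c ε : ℝ≥0∞} (hc : c ≠ ⊤) (hε : ε ≠ 0) : ∃ δ, δ ≠ 0 ∧ c * δ ≤ ε := by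
  rcases eq_or_ne ε ⊤ with rfl | hεt
  · exact ⟨1, one_ne_zero, le_top⟩
  · refine ⟨ε / (c + 1), ENNReal.div_ne_zero.2 ⟨hε, by finiteness⟩, ?_⟩
    rw [← mul_div_assoc]
    refine ENNReal.div_le_of_le_mul ?_
    rw [mul_comm]
    gcongr
    exact le_self_add

theorem eq_zero_of_forall_le_mul {V c : ℝ≥0∞} (hc : c ≠ ⊤) (h : ∀ ε : ℝ≥0∞, ε ≠ 0 → V ≤ c * ε) :
    V = 0 := by
  by_contra hV
  obtain ⟨t, ht0, htV⟩ := exists_between (pos_iff_ne_zero.2 hV)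
  obtain ⟨δ, hδ, hδt⟩ := exists_ne_zero_mul_le hc ht0.ne'
  exact absurd ((h δ hδ).trans hδt) (not_le.2 htV)

theorem setLIntegral_add_right_le {S K : Set (Euc m)} (hS : MeasurableSet S)
    (hK : MeasurableSet K) {a : Euc m}
    (h : ∀ x ∈ S, x + a ∈ K) (g : Euc m → ℝ≥0∞) : ∫⁻ x in S, g (x + a) ≤ ∫⁻ x in K, g x := by
  rw [← lintegral_indicator hS, ← lintegral_indicator hK,
    ← lintegral_add_right_eq_self (K.indicator g) a]
  refine lintegral_mono fun x => ?_
  by_cases hx : x ∈ S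
  · simp [hx, h x hx]
  · simp [hx]

theorem enorm_sub_le_lintegral_fderiv {f : Euc m → ℝ} (hf : ContDiff ℝ ∞ f) (x e : Euc m)
    (he : ‖e‖ = 1) {T : ℝ} (hT : 0 ≤ T) :
    ‖f (x + T • e) - f x‖ₑ ≤ ∫⁻ t in Ioc 0 T, ‖fderiv ℝ f (x + t • e)‖ₑ := by
  have hd : ∀ t : ℝ, HasDerivAt (fun t : ℝ => f (x + t • e)) (fderiv ℝ f (x + t • e) e) t := by
    intro t
    have h1 : HasDerivAt (fun t : ℝ => x + t • e) e t := by
      simpa using ((hasDerivAt_id t).smul_const e).const_add x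
    exact (hf.differentiable (by simp) (x + t • e)).hasFDerivAt.comp_hasDerivAt t h1
  have hc : Continuous fun t : ℝ => fderiv ℝ f (x + t • e) e :=
    ((hf.continuous_fderiv (by simp)).comp (by fun_prop)).clm_apply continuous_const
  have := intervalIntegral.integral_eq_sub_of_hasDerivAt (a := 0) (b := T)
    (fun t _ => hd t) (hc.intervalIntegrable _ _)
  simp only [zero_smul, add_zero] at this
  rw [← this, intervalIntegral.integral_of_le hT]
  refine (enorm_integral_le_lintegral_enorm _).trans (lintegral_mono fun t => ?_)
  rw [← ofReal_norm, ← ofReal_norm]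
  refine ofReal_le_ofReal ?_
  simpa [he] using (fderiv ℝ f (x + t • e)).le_opNorm e

set_option maxHeartbeats 400000 in
/-- Poincaré inequality for a weakly differentiable function vanishing outside a ball. -/
theorem HasWeakFDerivOn.poincare (hm : 1 ≤ m) {h : Euc m → ℝ} {H : Euc m → Euc m →L[ℝ] ℝ}
    (hw : HasWeakFDerivOn h H univ) (hh : Integrable h) (hH : Integrable H) {R : ℝ} (hR : 0 < R)
    (h0 : ∀ x ∉ ball (0 : Euc m) R, h x = 0) {p : ℝ} (hp : 1 ≤ p) :
    ∫⁻ x, ‖h x‖ₑ ^ p ≤ ofReal (2 * R) ^ p * ∫⁻ x, ‖H x‖ₑ ^ p := by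
  wlog hsm : StronglyMeasurable H generalizing H
  · have hae := hH.1.ae_eq_mk
    refine (this (H := hH.1.mk H) (hw.congr_ae .rfl (by simpa using hae)) (hH.congr hae)
      hH.1.stronglyMeasurable_mk).trans (le_of_eq ?_)
    congr 1
    refine lintegral_congr_ae ?_
    filter_upwards [hae] with x hx
    rw [hx]
  have hcs : HasCompactSupport h := HasCompactSupport.intro (isCompact_closedBall (0 : Euc m) R)
    fun x hx => h0 x fun hx' => hx (ball_subset_closedBall hx')
  let e : Euc m := EuclideanSpace.single ⟨0, hm⟩ 1
  have he : ‖e‖ = 1 := by simp [e]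
  -- A displacement by 2R in the direction e takes every point of the ball of radius R out of it, so
  -- h vanishes at the end of the segment.
  set T := 2 * R with hT
  have hT0 : 0 < T := by positivity
  -- Every segment used starts in the ball of radius R and has length at most 2R, so K contains it.
  let K := closedBall (0 : Euc m) (4 * R)
  have hK : IsCompact K := isCompact_closedBall _ _
  have hKB : ∀ t ∈ Icc 0 T, ∀ x ∈ ball (0 : Euc m) R, x + t • e ∈ K := by
    intro t ht x hx
    simp only [K, mem_closedBall_zero_iff, mem_ball_zero_iff] at hx ⊢
    refine (norm_add_le _ _).trans ?_
    rw [norm_smul, he, Real.norm_of_nonneg ht.1]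
    linarith [ht.2]
  let Ψ : Euc m → ℝ≥0∞ := fun x => ∫⁻ t in Ioc 0 T, ‖H (x + t • e)‖ₑ
  have hmeas : Measurable fun q : Euc m × ℝ => ‖H (q.1 + q.2 • e)‖ₑ :=
    (hsm.comp_measurable (by fun_prop)).enorm
  have hΨ : Measurable Ψ := Measurable.lintegral_prod_right' hmeas
  -- The fundamental theorem of calculus along segments, transferred from smooth approximations.
  -- Subtraction in `ℝ≥0∞` is truncated, so it suffices that the excess of |h| over Ψ has zero
  -- integral. The two endpoints and the line integral contribute errors ε, ε and Tε.
  have key : ∀ᵐ x ∂(volume.restrict (ball (0 : Euc m) R)), ‖h x‖ₑ ≤ Ψ x := by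
    have hz : ∫⁻ x in ball (0 : Euc m) R, (‖h x‖ₑ - Ψ x) = 0 := by
      refine eq_zero_of_forall_le_mul (c := 2 + ofReal T) (by finiteness) fun ε hε => ?_
      obtain ⟨f, f1, f2, f3, f4⟩ := hw.exists_smooth_approx_univ hcs hh hH hK hε
      have hDm : Measurable fun q : Euc m × ℝ =>
          ‖fderiv ℝ f (q.1 + q.2 • e) - H (q.1 + q.2 • e)‖ₑ := by
        refine StronglyMeasurable.enorm ?_
        exact (((f1.continuous_fderiv (by simp)).comp (by fun_prop)).stronglyMeasurable.sub
          (hsm.comp_measurable (by fun_prop)))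
      have hfm : AEMeasurable (fun x => ‖f x - h x‖ₑ) (volume : Measure (Euc m)) :=
        (f1.continuous.aestronglyMeasurable.sub hh.1).enorm
      calc ∫⁻ x in ball (0 : Euc m) R, (‖h x‖ₑ - Ψ x)
          ≤ ∫⁻ x in ball (0 : Euc m) R, (‖f x - h x‖ₑ + (‖f (x + T • e) - h (x + T • e)‖ₑ
            + ∫⁻ t in Ioc 0 T, ‖fderiv ℝ f (x + t • e) - H (x + t • e)‖ₑ)) := by
            refine setLIntegral_mono' measurableSet_ball fun x hx => ?_
            rw [tsub_le_iff_right]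
            have z : h (x + T • e) = 0 := by
              refine h0 _ fun hx' => ?_
              simp only [mem_ball_zero_iff] at hx hx'
              have : ‖T • e‖ ≤ ‖x + T • e‖ + ‖x‖ := by
                simpa using norm_sub_le (x + T • e) x
              rw [norm_smul, he, Real.norm_of_nonneg hT0.le] at this
              linarith
            have e1 : h x = -(f x - h x) + ((f (x + T • e) - h (x + T • e))
                + -(f (x + T • e) - f x)) := by rw [z]; ring
            have e2 : ‖f (x + T • e) - f x‖ₑ ≤
                (∫⁻ t in Ioc 0 T, ‖fderiv ℝ f (x + t • e) - H (x + t • e)‖ₑ) + Ψ x := by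
              refine (enorm_sub_le_lintegral_fderiv f1 x e he hT0.le).trans ?_
              have hm1 := hDm.comp (measurable_prodMk_left (x := x))
              simp only [Function.comp_def] at hm1
              rw [← lintegral_add_left hm1]
              refine lintegral_mono fun t => ?_
              have := enorm_add_le (fderiv ℝ f (x + t • e) - H (x + t • e)) (H (x + t • e))
              simpa using this
            calc ‖h x‖ₑ ≤ ‖f x - h x‖ₑ + (‖f (x + T • e) - h (x + T • e)‖ₑ
                  + ‖f (x + T • e) - f x‖ₑ) := by
                  conv_lhs => rw [e1]
                  refine (enorm_add_le _ _).trans ?_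
                  rw [enorm_neg]
                  gcongr
                  refine (enorm_add_le _ _).trans ?_
                  rw [enorm_neg]
              _ ≤ _ := by
                  rw [add_assoc, add_assoc]
                  gcongr
        _ = (∫⁻ x in ball (0 : Euc m) R, ‖f x - h x‖ₑ)
            + ((∫⁻ x in ball (0 : Euc m) R, ‖f (x + T • e) - h (x + T • e)‖ₑ)
            + ∫⁻ x in ball (0 : Euc m) R,
              ∫⁻ t in Ioc 0 T, ‖fderiv ℝ f (x + t • e) - H (x + t • e)‖ₑ) := by
            rw [lintegral_add_left' hfm.restrict,
              lintegral_add_right _ (Measurable.lintegral_prod_right' hDm)]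
        _ ≤ ε + (ε + ofReal T * ε) := by
            gcongr
            · refine (lintegral_mono_set ?_).trans f3
              exact fun x hx => by simpa using hKB 0 ⟨le_rfl, hT0.le⟩ x hx
            · exact (setLIntegral_add_right_le measurableSet_ball hK.measurableSet
                (hKB T ⟨hT0.le, le_rfl⟩) (fun x => ‖f x - h x‖ₑ)).trans f3
            · rw [lintegral_lintegral_swap (hDm.aemeasurable)]
              calc _ ≤ ∫⁻ t in Ioc 0 T, ε := by
                    refine setLIntegral_mono' measurableSet_Ioc fun t ht => ?_
                    exact (setLIntegral_add_right_le measurableSet_ball hK.measurableSet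
                      (hKB t ⟨ht.1.le, ht.2⟩) (fun x => ‖fderiv ℝ f x - H x‖ₑ)).trans f4
                _ = _ := by simp [mul_comm]
        _ = (2 + ofReal T) * ε := by ring
    have hm' : AEMeasurable (fun x => ‖h x‖ₑ - Ψ x) (volume.restrict (ball (0 : Euc m) R)) :=
      (hh.1.enorm.sub hΨ.aemeasurable).restrict
    rw [lintegral_eq_zero_iff' hm'] at hz
    filter_upwards [hz] with x hx
    exact tsub_eq_zero_iff_le.1 hx
  have hp0 : 0 < p := by linarith
  calc ∫⁻ x, ‖h x‖ₑ ^ p = ∫⁻ x in ball (0 : Euc m) R, ‖h x‖ₑ ^ p := by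
        rw [← lintegral_indicator measurableSet_ball]
        congr 1 with x
        by_cases hx : x ∈ ball (0 : Euc m) R
        · simp [hx]
        · simp [hx, h0 x hx, hp0]
    _ ≤ ∫⁻ x in ball (0 : Euc m) R, Ψ x ^ p := by
        refine lintegral_mono_ae ?_
        filter_upwards [key] with x hx
        gcongr
    _ ≤ ∫⁻ x in ball (0 : Euc m) R, ofReal T ^ (p - 1) *
          ∫⁻ t in Ioc 0 T, ‖H (x + t • e)‖ₑ ^ p := by
        refine lintegral_mono fun x => ?_
        have hm1 := hmeas.comp (measurable_prodMk_left (x := x))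
        simp only [Function.comp_def] at hm1
        have := lintegral_rpow_le_measure_mul (μ := volume.restrict (Ioc 0 T)) hm1.aemeasurable hp
        simpa using this
    _ = ofReal T ^ (p - 1) * ∫⁻ x in ball (0 : Euc m) R,
          ∫⁻ t in Ioc 0 T, ‖H (x + t • e)‖ₑ ^ p :=
        lintegral_const_mul' _ _ (by simp [hp])
    _ = ofReal T ^ (p - 1) * ∫⁻ t in Ioc 0 T, ∫⁻ x in ball (0 : Euc m) R,
          ‖H (x + t • e)‖ₑ ^ p := by
        rw [lintegral_lintegral_swap (hmeas.pow_const p).aemeasurable]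
    _ ≤ ofReal T ^ (p - 1) * ∫⁻ t in Ioc 0 T, ∫⁻ x, ‖H x‖ₑ ^ p := by
        refine mul_le_mul' le_rfl (lintegral_mono fun t => ?_)
        have := setLIntegral_add_right_le (K := univ) (a := t • e)
          (measurableSet_ball (x := (0 : Euc m)) (ε := R))
          .univ (fun _ _ => mem_univ _) (fun x => ‖H x‖ₑ ^ p)
        simpa using this
    _ = _ := by
        simp only [lintegral_const, MeasurableSet.univ, Measure.restrict_apply, univ_inter,
          Real.volume_Ioc, sub_zero]
        rw [mul_comm (∫⁻ x, ‖H x‖ₑ ^ p), ← mul_assoc]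
        congr 1
        conv_lhs => rw [← ENNReal.rpow_one (ofReal T), ← ENNReal.rpow_mul, one_mul]
        rw [← ENNReal.rpow_add _ _ (by simp [hT0]) (by simp)]
        congr 1; ring

/-! ### Chain rules for weak derivatives. -/

theorem map_restrict_le {Φ : Euc m → Euc m} (hΦ : Measurable Φ) {U S T : Set (Euc m)} {C : ℝ≥0∞}
    (h : (volume.restrict U).map Φ ≤ C • volume) (hSU : S ⊆ U) (hST : MapsTo Φ S T)
    (hT : MeasurableSet T) :
    (volume.restrict S).map Φ ≤ C • volume.restrict T := by
  refine Measure.le_iff.2 fun s hs => ?_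
  rw [Measure.map_apply hΦ hs, Measure.restrict_apply (hΦ hs)]
  have h1 := h (s ∩ T)
  rw [Measure.map_apply hΦ (hs.inter hT), Measure.restrict_apply (hΦ (hs.inter hT))] at h1
  simp only [Measure.smul_apply, smul_eq_mul] at h1 ⊢
  rw [Measure.restrict_apply hs]
  refine (measure_mono ?_).trans h1
  exact fun x hx => ⟨⟨hx.1, hST hx.2⟩, hSU hx.2⟩

theorem integrableOn_comp {E : Type*} [NormedAddCommGroup E] {Φ : Euc m → Euc m}
    (hΦ : Measurable Φ) {U S T : Set (Euc m)} {C : ℝ≥0∞} (hC : C ≠ ⊤)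
    (h : (volume.restrict U).map Φ ≤ C • volume) (hSU : S ⊆ U) (hST : MapsTo Φ S T)
    (hT : MeasurableSet T) {f : Euc m → E} (hf : IntegrableOn f T) :
    IntegrableOn (fun x => f (Φ x)) S := by
  have h1 := map_restrict_le hΦ h hSU hST hT
  exact ((Integrable.smul_measure hf hC).mono_measure h1).comp_measurable hΦ

theorem setLIntegral_comp_le {Φ : Euc m → Euc m}
    (hΦ : Measurable Φ) {U S T : Set (Euc m)} {C : ℝ≥0∞}
    (h : (volume.restrict U).map Φ ≤ C • volume) (hSU : S ⊆ U) (hST : MapsTo Φ S T)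
    (hT : MeasurableSet T) {f : Euc m → ℝ≥0∞}
    (hf : AEMeasurable f (volume.restrict T)) :
    ∫⁻ x in S, f (Φ x) ≤ C * ∫⁻ y in T, f y :=
  lintegral_comp_le_of_map_le hΦ.aemeasurable (map_restrict_le hΦ h hSU hST hT) hf

theorem integrableOn_comp_fderiv {G : Euc m → Euc m →L[ℝ] ℝ} {S : Set (Euc m)}
    (hG : IntegrableOn G S) {Φ : Euc m → Euc m} {L : NNReal} (hL : LipschitzWith L Φ) :
    IntegrableOn (fun x => (G x).comp (fderiv ℝ Φ x)) S := by
  refine Integrable.mono' (hG.norm.mul_const L) ?_ (.of_forall fun x => ?_)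
  · exact (ContinuousLinearMap.compL ℝ (Euc m) (Euc m) ℝ).aestronglyMeasurable_comp₂
      hG.1 (measurable_fderiv ℝ Φ).aestronglyMeasurable
  · refine (ContinuousLinearMap.opNorm_comp_le _ _).trans ?_
    gcongr
    exact norm_fderiv_le_of_lipschitz ℝ hL

theorem enorm_comp_le {E F G : Type*} [NormedAddCommGroup E] [NormedSpace ℝ E]
    [NormedAddCommGroup F] [NormedSpace ℝ F] [NormedAddCommGroup G] [NormedSpace ℝ G]
    (A : F →L[ℝ] G) (B : E →L[ℝ] F) : ‖A.comp B‖ₑ ≤ ‖A‖ₑ * ‖B‖ₑ := by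
  simp only [enorm_eq_nnnorm]
  norm_cast
  exact ContinuousLinearMap.opNorm_comp_le A B

theorem enorm_fderiv_le_of_lipschitz {E F : Type*} [NormedAddCommGroup E] [NormedSpace ℝ E]
    [NormedAddCommGroup F] [NormedSpace ℝ F] {Φ : E → F} {L : NNReal} (hL : LipschitzWith L Φ)
    (x : E) : ‖fderiv ℝ Φ x‖ₑ ≤ L := by
  rw [enorm_eq_nnnorm]
  norm_cast
  exact norm_fderiv_le_of_lipschitz ℝ hL

/-- Chain rule for the composition of a weakly differentiable function with a Lipschitz map that
does not compress Lebesgue measure. -/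
theorem HasWeakFDerivOn.comp_lipschitz {A U : Set (Euc m)} {g : Euc m → ℝ}
    {G : Euc m → Euc m →L[ℝ] ℝ} (h : HasWeakFDerivOn g G A) (hA : IsOpen A) (hU : IsOpen U)
    {Φ : Euc m → Euc m} {L : NNReal} (hL : LipschitzWith L Φ) (hUA : MapsTo Φ U A) {C : ℝ≥0∞}
    (hC : C ≠ ⊤) (hm : (volume.restrict U).map Φ ≤ C • volume) :
    HasWeakFDerivOn (fun x => g (Φ x)) (fun x => (G (Φ x)).comp (fderiv ℝ Φ x)) U := by
  have hΦ := hL.continuous.measurable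
  have hK : ∀ K ⊆ U, IsCompact K → IsCompact (Φ '' K) ∧ Φ '' K ⊆ A := fun K hKU hK =>
    ⟨hK.image hL.continuous, image_subset_iff.2 fun x hx => hUA (hKU hx)⟩
  have i1 : ∀ K ⊆ U, IsCompact K → IntegrableOn (fun x => g (Φ x)) K := fun K hKU hKc =>
    integrableOn_comp hΦ hC hm hKU (mapsTo_image Φ K)
      (hK K hKU hKc).1.measurableSet
      (h.1.integrableOn_compact_subset (hK K hKU hKc).2 (hK K hKU hKc).1)
  have i2 : ∀ K ⊆ U, IsCompact K → IntegrableOn (fun x => G (Φ x)) K := fun K hKU hKc =>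
    integrableOn_comp hΦ hC hm hKU (mapsTo_image Φ K)
      (hK K hKU hKc).1.measurableSet
      (h.2.1.integrableOn_compact_subset (hK K hKU hKc).2 (hK K hKU hKc).1)
  refine .of_approx ((locallyIntegrableOn_iff hU.isLocallyClosed).2 i1)
    ((locallyIntegrableOn_iff hU.isLocallyClosed).2 fun K hKU hKc =>
      integrableOn_comp_fderiv (i2 K hKU hKc) hL) fun K hKU hKc ε hε => ?_
  -- The L^1 errors grow by C for the functions and by CL for the derivatives; C(L + 1) covers both.
  obtain ⟨δ, hδ, hδε⟩ := exists_ne_zero_mul_le (c := C * (L + 1)) (by finiteness) hε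
  obtain ⟨f, f1, f2, f3, f4⟩ := h.exists_smooth_approx hA (hK K hKU hKc).1 (hK K hKU hKc).2 hδ
  obtain ⟨D, hD⟩ := test_lipschitz f1 f2
  refine ⟨fun x => f (Φ x), fun x => (fderiv ℝ f (Φ x)).comp (fderiv ℝ Φ x), ?_, ?_, ?_⟩
  -- For a smooth compactly supported f the composition is Lipschitz, and the classical chain rule
  -- holds wherever Φ is differentiable, hence almost everywhere.
  · refine (LipschitzWith.hasWeakFDerivOn (hD.comp hL) K).congr_ae .rfl (ae_restrict_of_ae ?_)
    filter_upwards [hL.ae_differentiableAt] with x hx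
    exact ((f1.differentiable (by simp) (Φ x)).hasFDerivAt.comp x hx.hasFDerivAt).fderiv
  · refine (setLIntegral_comp_le hΦ hm hKU (mapsTo_image Φ K)
      (hK K hKU hKc).1.measurableSet (f := fun y => ‖f y - g y‖ₑ) ?_).trans ?_
    · exact (f1.continuous.aestronglyMeasurable.sub
        (h.1.integrableOn_compact_subset (hK K hKU hKc).2 (hK K hKU hKc).1).1).enorm
    · refine le_trans ?_ hδε
      gcongr
      exact le_mul_of_one_le_right' le_add_self
  · calc ∫⁻ x in K, ‖(fderiv ℝ f (Φ x)).comp (fderiv ℝ Φ x) - (G (Φ x)).comp (fderiv ℝ Φ x)‖ₑ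
        ≤ ∫⁻ x in K, ‖fderiv ℝ f (Φ x) - G (Φ x)‖ₑ * L := by
          refine lintegral_mono fun x => ?_
          rw [← ContinuousLinearMap.sub_comp]
          refine (enorm_comp_le _ _).trans ?_
          gcongr
          exact enorm_fderiv_le_of_lipschitz hL x
      _ = (∫⁻ x in K, ‖fderiv ℝ f (Φ x) - G (Φ x)‖ₑ) * L :=
          lintegral_mul_const' _ _ ENNReal.coe_ne_top
      _ ≤ (C * δ) * L := by
          gcongr
          refine (setLIntegral_comp_le hΦ hm hKU (mapsTo_image Φ K)
            (hK K hKU hKc).1.measurableSet (f := fun y => ‖fderiv ℝ f y - G y‖ₑ) ?_).trans ?_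
          · exact ((f1.continuous_fderiv (by simp)).aestronglyMeasurable.sub
              (h.2.1.integrableOn_compact_subset (hK K hKU hKc).2 (hK K hKU hKc).1).1).enorm
          · gcongr
      _ ≤ C * (L + 1) * δ := by
          rw [mul_right_comm]
          gcongr
          exact le_self_add
      _ ≤ ε := hδε

theorem enorm_fun_add_le {E : Type*} [NormedAddCommGroup E] (a b : E) :
    ‖a + b‖ₑ ≤ ‖a‖ₑ + ‖b‖ₑ := enorm_add_le a b

theorem enorm_fun_sub_le {E : Type*} [NormedAddCommGroup E] (a b : E) :
    ‖a - b‖ₑ ≤ ‖a‖ₑ + ‖b‖ₑ := enorm_sub_le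

theorem tendsto_enorm_sub_zero {E ι : Type*} [NormedAddCommGroup E] {l : Filter ι} {f : ι → E}
    {a : E} (h : Tendsto f l (𝓝 a)) : Tendsto (fun i => ‖f i - a‖ₑ) l (𝓝 0) := by
  simpa using (h.sub_const a).enorm

theorem integrable_fun_sum {X E ι : Type*} [MeasurableSpace X] [NormedAddCommGroup E] [Fintype ι]
    {μ : Measure X} {f : ι → X → E} (hf : ∀ i, Integrable (f i) μ) :
    Integrable (fun x => ∑ i, f i x) μ := integrable_finsetSum _ fun i _ => hf i

theorem euc_eq_sum {ν : ℕ} (y : Euc ν) :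
    y = ∑ i, y i • EuclideanSpace.single i (1 : ℝ) := by
  ext j
  simp [Pi.single_apply]

theorem clm_eq_sum {ν : ℕ} (B : Euc m →L[ℝ] Euc ν) :
    B = ∑ i, (ContinuousLinearMap.toSpanSingleton ℝ (EuclideanSpace.single i (1 : ℝ))).comp
      ((EuclideanSpace.proj i : Euc ν →L[ℝ] ℝ).comp B) := by
  ext v j
  simp [Pi.single_apply, sum_apply]

theorem lintegral_enorm_le_sum {X E F : Type*} [MeasurableSpace X] {μ : Measure X}
    [NormedAddCommGroup E] [NormedSpace ℝ E] [NormedAddCommGroup F] [NormedSpace ℝ F] {ν : ℕ}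
    (L : Fin ν → E →L[ℝ] F) (hL : ∀ i, ‖L i‖ ≤ 1) {f : Fin ν → X → E}
    (hf : ∀ i, AEStronglyMeasurable (f i) μ) :
    ∫⁻ x, ‖∑ i, L i (f i x)‖ₑ ∂μ ≤ ∑ i, ∫⁻ x, ‖f i x‖ₑ ∂μ := by
  rw [← lintegral_finsetSum' _ fun i _ => (hf i).enorm]
  refine lintegral_mono fun x => (enorm_sum_le _ _).trans (Finset.sum_le_sum fun i _ => ?_)
  rw [← ofReal_norm, ← ofReal_norm]
  exact ofReal_le_ofReal ((L i).le_of_opNorm_le (hL i) _ |>.trans (by simp))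

set_option maxHeartbeats 800000 in
/-- Chain rule for the composition of a `C^1` Lipschitz function with a weakly differentiable
vector-valued map. -/
theorem HasWeakFDerivOn.comp_contDiff {ν : ℕ} {A : Set (Euc m)} (hA : IsOpen A)
    {h : Euc m → Euc ν} {H : Euc m → Euc m →L[ℝ] Euc ν}
    (hw : ∀ i, HasWeakFDerivOn (fun x => h x i)
      (fun x => (EuclideanSpace.proj i : Euc ν →L[ℝ] ℝ).comp (H x)) A)
    {f : Euc ν → ℝ} (hf : ContDiff ℝ 1 f) {L : NNReal} (hL : LipschitzWith L f) :
    HasWeakFDerivOn (fun x => f (h x)) (fun x => (fderiv ℝ f (h x)).comp (H x)) A := by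
  let e : Fin ν → Euc ν := fun i => EuclideanSpace.single i (1 : ℝ)
  let Le : Fin ν → ℝ →L[ℝ] Euc ν := fun i => ContinuousLinearMap.toSpanSingleton ℝ (e i)
  let Lc : Fin ν → (Euc m →L[ℝ] ℝ) →L[ℝ] (Euc m →L[ℝ] Euc ν) := fun i =>
    ContinuousLinearMap.compL ℝ (Euc m) ℝ (Euc ν) (Le i)
  have hLe : ∀ i, ‖Le i‖ ≤ 1 := fun i => by simp [Le, e]
  have hLc : ∀ i, ‖Lc i‖ ≤ 1 := fun i => by
    refine ContinuousLinearMap.opNorm_le_bound _ zero_le_one fun B => ?_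
    refine (ContinuousLinearMap.opNorm_comp_le _ _).trans ?_
    gcongr
    exact hLe i
  have hh : h = fun x => ∑ i, Le i (h x i) := by
    funext x; simpa [Le, e] using euc_eq_sum (h x)
  have hH : H = fun x => ∑ i, Lc i ((EuclideanSpace.proj i : Euc ν →L[ℝ] ℝ).comp (H x)) := by
    funext x; exact clm_eq_sum (H x)
  have ih : ∀ K ⊆ A, IsCompact K → IntegrableOn h K := fun K hKA hK => by
    rw [hh]
    exact integrable_fun_sum fun i =>
      (Le i).integrable_comp ((hw i).1.integrableOn_compact_subset hKA hK)
  have iH : ∀ K ⊆ A, IsCompact K → IntegrableOn H K := fun K hKA hK => by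
    rw [hH]
    exact integrable_fun_sum fun i =>
      (Lc i).integrable_comp ((hw i).2.1.integrableOn_compact_subset hKA hK)
  have cf : Continuous (fderiv ℝ f) := hf.continuous_fderiv (by simp)
  have am : ∀ K ⊆ A, IsCompact K → AEStronglyMeasurable (fun x => fderiv ℝ f (h x))
      (volume.restrict K) := fun K hKA hK => cf.comp_aestronglyMeasurable (ih K hKA hK).1
  have lf : LocallyIntegrableOn (fun x => f (h x)) A := by
    refine (locallyIntegrableOn_iff hA.isLocallyClosed).2 fun K hKA hK => ?_
    have i0 : IntegrableOn (fun x => L * ‖h x‖ + ‖f 0‖) K :=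
      ((ih K hKA hK).norm.const_mul _).add (integrableOn_const hK.measure_lt_top.ne)
    refine Integrable.mono' i0 (hL.continuous.comp_aestronglyMeasurable (ih K hKA hK).1)
      (.of_forall fun x => ?_)
    have h1 := hL.norm_sub_le (h x) 0
    have h2 := norm_sub_norm_le (f (h x)) (f 0)
    rw [sub_zero] at h1
    linarith
  have lF : LocallyIntegrableOn (fun x => (fderiv ℝ f (h x)).comp (H x)) A := by
    refine (locallyIntegrableOn_iff hA.isLocallyClosed).2 fun K hKA hK => ?_
    refine Integrable.mono' ((iH K hKA hK).norm.const_mul L) ?_ (.of_forall fun x => ?_)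
    · exact (ContinuousLinearMap.compL ℝ (Euc m) (Euc ν) ℝ).aestronglyMeasurable_comp₂
        (am K hKA hK) (iH K hKA hK).1
    · refine (ContinuousLinearMap.opNorm_comp_le _ _).trans ?_
      gcongr
      exact norm_fderiv_le_of_lipschitz ℝ hL
  refine .of_approx lf lF fun K hKA hK ε hε => ?_
  choose F F1 F2 F3 F4 using fun (n : ℕ) (i : Fin ν) =>
    (hw i).exists_smooth_approx hA hK hKA (ε := ((n : ℝ≥0∞) + 1)⁻¹) (by simp)
  have t0 : Tendsto (fun n : ℕ => ((n : ℝ≥0∞) + 1)⁻¹) atTop (𝓝 0) := by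
    have := (tendsto_add_atTop_iff_nat 1).2 ENNReal.tendsto_inv_nat_nhds_zero
    simpa using this
  have t1 : Tendsto (fun n : ℕ => ∑ i : Fin ν, ((n : ℝ≥0∞) + 1)⁻¹) atTop (𝓝 0) := by
    simpa using tendsto_finsetSum (Finset.univ : Finset (Fin ν)) fun i _ => t0
  let hn : ℕ → Euc m → Euc ν := fun n x => ∑ i, Le i (F n i x)
  let Hn : ℕ → Euc m → Euc m →L[ℝ] Euc ν := fun n x => ∑ i, Lc i (fderiv ℝ (F n i) x)
  have hnd : ∀ n x, HasFDerivAt (hn n) (Hn n x) x := fun n x =>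
    HasFDerivAt.fun_sum fun i _ =>
      (Le i).hasFDerivAt.comp x ((F1 n i).differentiable (by simp) x).hasFDerivAt
  have hns : ∀ n, ContDiff ℝ ∞ (hn n) := fun n =>
    ContDiff.sum fun i _ => (Le i).contDiff.comp (F1 n i)
  have hnl : ∀ n, ∃ D, LipschitzWith D (hn n) := fun n => by
    choose D hD using fun i => test_lipschitz (F1 n i) (F2 n i)
    refine ⟨∑ i, ‖Le i‖₊ * D i, ?_⟩
    have := fun s : Finset (Fin ν) => show LipschitzWith (∑ i ∈ s, ‖Le i‖₊ * D i)
        (fun x => ∑ i ∈ s, Le i (F n i x)) by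
      classical
      induction s using Finset.induction_on with
      | empty => simp
      | insert a s ha ih =>
        simp only [Finset.sum_insert ha]
        exact ((Le a).lipschitz.comp (hD a)).add ih
    exact this Finset.univ
  have e1 : Tendsto (fun n => ∫⁻ x in K, ‖hn n x - h x‖ₑ) atTop (𝓝 0) := by
    refine tendsto_zero_of_le t1 fun n => ?_
    have : ∀ x, hn n x - h x = ∑ i, Le i (F n i x - h x i) := fun x => by
      conv_lhs => rw [hh]
      simp only [hn, map_sub, Finset.sum_sub_distrib]
    simp only [this]
    refine (lintegral_enorm_le_sum Le hLe fun i => ?_).trans (Finset.sum_le_sum fun i _ => F3 n i)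
    exact (F1 n i).continuous.aestronglyMeasurable.sub
      ((hw i).1.integrableOn_compact_subset hKA hK).1
  have e2 : Tendsto (fun n => ∫⁻ x in K, ‖Hn n x - H x‖ₑ) atTop (𝓝 0) := by
    refine tendsto_zero_of_le t1 fun n => ?_
    have : ∀ x, Hn n x - H x = ∑ i, Lc i (fderiv ℝ (F n i) x
        - (EuclideanSpace.proj i : Euc ν →L[ℝ] ℝ).comp (H x)) := fun x => by
      conv_lhs => rw [hH]
      simp only [Hn, map_sub, Finset.sum_sub_distrib]
    simp only [this]
    refine (lintegral_enorm_le_sum Lc hLc fun i => ?_).trans (Finset.sum_le_sum fun i _ => F4 n i)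
    exact ((F1 n i).continuous_fderiv (by simp)).aestronglyMeasurable.sub
      ((hw i).2.1.integrableOn_compact_subset hKA hK).1
  -- The derivative of f is only continuous, so convergence of `fderiv ℝ f (hn k x)` needs
  -- convergence at almost every point. L^1 convergence gives it along a subsequence.
  have tm : TendstoInMeasure (volume.restrict K) hn atTop h := by
    refine tendstoInMeasure_of_tendsto_eLpNorm (p := 1) one_ne_zero
      (fun n => (hns n).continuous.aestronglyMeasurable) (ih K hKA hK).1 ?_
    simpa [eLpNorm_one_eq_lintegral_enorm] using e1
  obtain ⟨ns, hns', hae⟩ := tm.exists_seq_tendsto_ae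
  have e3 : Tendsto (fun k => ∫⁻ x in K, ‖fderiv ℝ f (hn (ns k) x) - fderiv ℝ f (h x)‖ₑ * ‖H x‖ₑ)
      atTop (𝓝 0) := by
    have := tendsto_lintegral_of_dominated_convergence' (μ := volume.restrict K)
      (F := fun k x => ‖fderiv ℝ f (hn (ns k) x) - fderiv ℝ f (h x)‖ₑ * ‖H x‖ₑ)
      (f := fun _ => 0) (fun x => (L + L) * ‖H x‖ₑ) ?_ ?_ ?_ ?_
    · simpa using this
    · exact fun k => ((cf.comp (hns _).continuous).aestronglyMeasurable.sub
        (am K hKA hK)).enorm.mul (iH K hKA hK).1.enorm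
    · refine fun k => .of_forall fun x => ?_
      refine mul_le_mul' ((enorm_fun_sub_le _ _).trans ?_) le_rfl
      gcongr <;> exact enorm_fderiv_le_of_lipschitz hL _
    · rw [lintegral_const_mul' _ _ (by finiteness)]
      exact ENNReal.mul_ne_top (by finiteness) (iH K hKA hK).2.ne
    · filter_upwards [hae] with x hx
      have h1 := tendsto_enorm_sub_zero ((cf.tendsto (h x)).comp hx)
      have h2 := ENNReal.Tendsto.mul_const (b := ‖H x‖ₑ) h1 (Or.inr enorm_ne_top)
      rwa [zero_mul] at h2
  have e1' := e1.comp hns'.tendsto_atTop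
  have e2' := e2.comp hns'.tendsto_atTop
  have e4 := ENNReal.Tendsto.const_mul (a := (L : ℝ≥0∞)) e1' (Or.inr ENNReal.coe_ne_top)
  have e5 := (ENNReal.Tendsto.const_mul (a := (L : ℝ≥0∞)) e2' (Or.inr ENNReal.coe_ne_top)).add e3
  simp only [mul_zero, add_zero] at e4 e5
  obtain ⟨k, k1, k2⟩ := ((ENNReal.tendsto_nhds_zero.1 e4 ε hε.bot_lt).and
    (ENNReal.tendsto_nhds_zero.1 e5 ε hε.bot_lt)).exists
  obtain ⟨D, hD⟩ := hnl (ns k)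
  refine ⟨fun x => f (hn (ns k) x), fun x => (fderiv ℝ f (hn (ns k) x)).comp (Hn (ns k) x),
    ?_, ?_, ?_⟩
  · refine (LipschitzWith.hasWeakFDerivOn (hL.comp hD) K).congr_ae .rfl (.of_forall fun x => ?_)
    exact ((hf.differentiable (by simp) _).hasFDerivAt.comp x (hnd _ x)).fderiv
  · refine le_trans ?_ k1
    simp only [Function.comp]
    rw [← lintegral_const_mul' _ _ ENNReal.coe_ne_top]
    refine lintegral_mono fun x => ?_
    have := hL (hn (ns k) x) (h x)
    rwa [edist_eq_enorm_sub, edist_eq_enorm_sub] at this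
  · refine le_trans ?_ k2
    simp only [Function.comp]
    rw [← lintegral_const_mul' _ _ ENNReal.coe_ne_top, ← lintegral_add_right']
    · refine lintegral_mono fun x => ?_
      have : (fderiv ℝ f (hn (ns k) x)).comp (Hn (ns k) x) - (fderiv ℝ f (h x)).comp (H x)
          = (fderiv ℝ f (hn (ns k) x)).comp (Hn (ns k) x - H x)
            + (fderiv ℝ f (hn (ns k) x) - fderiv ℝ f (h x)).comp (H x) := by
        rw [ContinuousLinearMap.comp_sub, ContinuousLinearMap.sub_comp]; abel
      rw [this]
      refine (enorm_fun_add_le _ _).trans ?_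
      refine add_le_add ((enorm_comp_le _ _).trans ?_) (enorm_comp_le _ _)
      gcongr
      exact enorm_fderiv_le_of_lipschitz hL _
    · exact ((cf.comp (hns _).continuous).aestronglyMeasurable.sub
        (am K hKA hK)).enorm.mul (iH K hKA hK).1.enorm

/-! ### Kernel estimates for the Gagliardo energy. -/

section Gagliardo

variable {N : Type*} [EMetricSpace N] [SecondCountableTopology N] [MeasurableSpace N] [BorelSpace N]

theorem lintegral_homothety (f : Euc m → ℝ≥0∞) {l : ℝ} (hl : 0 < l) (h : Euc m) :
    ∫⁻ x, f x = ofReal (l ^ m) * ∫⁻ x, f (h + l • x) := by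
  let e : Euc m ≃ᵐ Euc m :=
    ((Homeomorph.smulOfNeZero l hl.ne').trans (Homeomorph.addLeft h)).toMeasurableEquiv
  have hmap : Measure.map e (volume : Measure (Euc m)) =
      ofReal ((l ^ m)⁻¹) • volume := by
    have h1 : (e : Euc m → Euc m) = (fun x => h + x) ∘ (fun x => l • x) := rfl
    rw [h1, ← Measure.map_map (measurable_const_add h) (measurable_const_smul l),
      Measure.map_addHaar_smul _ hl.ne', Measure.map_smul, map_add_left_eq_self]
    simp only [finrank_euclideanSpace, Fintype.card_fin]
    rw [abs_of_pos (by positivity)]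
  have h2 := lintegral_map_equiv (μ := volume) f e
  rw [hmap, lintegral_smul_measure] at h2
  change _ = ofReal (l ^ m) * ∫⁻ x, f (e x)
  rw [← h2, smul_eq_mul, ← mul_assoc, ← ofReal_mul (by positivity),
    mul_inv_cancel₀ (by positivity)]
  simp

theorem ofReal_pow_mul_rpow {l : ℝ} (hl : 0 < l) (q : ℝ) :
    ofReal (l ^ m) * ofReal l ^ (-q) = ofReal l ^ ((m : ℝ) - q) := by
  have h0 : ofReal l ≠ 0 := by simpa using hl
  rw [ENNReal.ofReal_pow hl.le, ← ENNReal.rpow_natCast,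
    ← ENNReal.rpow_add _ _ h0 ofReal_ne_top]
  congr 1

theorem edist_homothety (x z : Euc m) {l : ℝ} (hl : 0 < l) :
    edist x (x + l • z) = ofReal l * ‖z‖ₑ := by
  rw [edist_comm, edist_eq_enorm_sub, add_sub_cancel_left, enorm_smul, Real.enorm_of_nonneg hl.le]

/-- By homogeneity the homothety of centre x and ratio ρ reduces the integral to ρ = 1, where the
kernel is at most 2^q (1 + |z|)^(-q), integrable because q > m. -/
theorem exists_tail_kernel {q : ℝ} (hq : (m : ℝ) < q) :
    ∃ C : ℝ≥0∞, C ≠ ⊤ ∧ C ≠ 0 ∧ ∀ (x : Euc m) (ρ : ℝ≥0∞),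
      ∫⁻ y in {y | ρ ≤ edist x y}, edist x y ^ (-q) ≤ C * ρ ^ ((m : ℝ) - q) := by
  have hq0 : 0 < q := lt_of_le_of_lt (Nat.cast_nonneg m) hq
  set C₀ : ℝ≥0∞ := ∫⁻ z : Euc m in {z | 1 ≤ ‖z‖ₑ}, ‖z‖ₑ ^ (-q) with hC₀
  have hfin : C₀ ≠ ⊤ := by
    have h1 := finite_integral_one_add_norm (E := Euc m) (μ := volume) (r := q) (by simpa using hq)
    have h2 : C₀ ≤ ofReal (2 ^ q) * ∫⁻ x : Euc m, ofReal ((1 + ‖x‖) ^ (-q)) := by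
      rw [← lintegral_const_mul' _ _ ofReal_ne_top]
      refine (setLIntegral_mono' (measurableSet_le measurable_const measurable_enorm)
        fun z hz => ?_).trans (setLIntegral_le_lintegral _ _)
      have hz1 : 1 ≤ ‖z‖ := by
        have : (1 : ℝ≥0∞) ≤ ‖z‖ₑ := hz
        rw [← ofReal_norm, ENNReal.one_le_ofReal] at this
        exact this
      rw [← ofReal_mul (by positivity), ← ofReal_norm,
        ENNReal.ofReal_rpow_of_pos (by linarith)]
      apply ofReal_le_ofReal
      rw [Real.rpow_neg (by positivity), Real.rpow_neg (by positivity), ← div_eq_mul_inv,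
        inv_eq_one_div, div_le_div_iff₀ (by positivity) (by positivity), one_mul,
        ← Real.mul_rpow (by norm_num) (by positivity)]
      exact Real.rpow_le_rpow (by positivity) (by linarith) hq0.le
    exact (h2.trans_lt (ENNReal.mul_lt_top ENNReal.ofReal_lt_top h1)).ne
  -- The summand 1 makes the constant nonzero, so that for ρ = 0 the right side is C · ∞ = ∞.
  refine ⟨C₀ + 1, by finiteness, by simp, fun x ρ => ?_⟩
  have hms : ∀ ρ : ℝ≥0∞, MeasurableSet {y : Euc m | ρ ≤ edist x y} := fun ρ =>
    measurableSet_le measurable_const (by fun_prop)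
  rcases eq_or_ne ρ 0 with rfl | h0
  · rw [ENNReal.zero_rpow_of_neg (by linarith), ENNReal.mul_top (by simp)]
    exact le_top
  rcases eq_or_ne ρ ⊤ with rfl | ht
  · simp
  obtain ⟨l, hl, rfl⟩ : ∃ l : ℝ, 0 < l ∧ ρ = ofReal l :=
    ⟨ρ.toReal, ENNReal.toReal_pos h0 ht, (ENNReal.ofReal_toReal ht).symm⟩
  rw [← lintegral_indicator (hms _), lintegral_homothety _ hl x]
  have h3 : ∀ z : Euc m, ({y : Euc m | ofReal l ≤ edist x y}).indicator
      (fun y => edist x y ^ (-q)) (x + l • z) =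
      ofReal l ^ (-q) * ({z : Euc m | 1 ≤ ‖z‖ₑ}).indicator (fun z => ‖z‖ₑ ^ (-q)) z := by
    intro z
    have h4 : (ofReal l ≤ ofReal l * ‖z‖ₑ) ↔ 1 ≤ ‖z‖ₑ := by
      conv_lhs => rw [← mul_one (ofReal l), mul_assoc, one_mul]
      exact ENNReal.mul_le_mul_iff_right h0 ofReal_ne_top
    simp only [indicator, mem_ofPred_eq, edist_homothety x z hl, h4]
    split_ifs with h5
    · rw [ENNReal.mul_rpow_of_ne_top ofReal_ne_top enorm_ne_top]
    · simp
  simp only [h3]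
  rw [lintegral_const_mul' _ _ (ENNReal.rpow_ne_top_of_ne_zero h0 ofReal_ne_top),
    lintegral_indicator (measurableSet_le measurable_const measurable_enorm), ← mul_assoc,
    ofReal_pow_mul_rpow hl, mul_comm]
  gcongr
  exact le_self_add

/-- In polar coordinates the density is r^(m - 1 - q), integrable at 0 because q < m. -/
theorem exists_near_kernel (hm : 1 ≤ m) {q : ℝ} (hq : q < m) :
    ∃ C : ℝ≥0∞, C ≠ ⊤ ∧ ∀ x : Euc m, ∫⁻ y in ball x 1, edist x y ^ (-q) ≤ C := by
  have hnt : Nontrivial (Euc m) := by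
    have : Nonempty (Fin m) := ⟨⟨0, hm⟩⟩
    infer_instance
  refine ⟨∫⁻ z in ball (0 : Euc m) 1, ‖z‖ₑ ^ (-q), ?_, fun x => ?_⟩
  · have h1 : IntegrableOn (fun z : Euc m => ‖z‖ ^ (-q)) (ball 0 1) := by
      rw [integrableOn_fun_norm_addHaar (μ := volume) (f := fun r : ℝ => r ^ (-q))]
      have h2 : IntegrableOn (fun y : ℝ => y ^ ((m : ℝ) - 1 - q)) (Ioo 0 1) :=
        (intervalIntegral.integrableOn_Ioo_rpow_iff zero_lt_one).2 (by linarith)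
      refine h2.congr_fun (fun y hy => ?_) measurableSet_Ioo
      simp only [finrank_euclideanSpace, Fintype.card_fin, smul_eq_mul]
      rw [← Real.rpow_natCast, ← Real.rpow_add hy.1]
      congr 1
      rw [Nat.cast_sub hm]
      simp
      ring
    have h2 := h1.2.ne
    refine ne_of_eq_of_ne ?_ h2
    refine setLIntegral_congr_fun_ae measurableSet_ball ?_
    have : ∀ᵐ z : Euc m, z ≠ 0 := by simp [ae_iff, measure_singleton]
    filter_upwards [this] with z hz _
    have hz0 : 0 < ‖z‖ := by simpa using hz
    rw [← ofReal_norm, ENNReal.ofReal_rpow_of_pos hz0, ← ofReal_norm, Real.norm_of_nonneg]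
    positivity
  · rw [← lintegral_indicator measurableSet_ball, ← lintegral_indicator measurableSet_ball,
      lintegral_homothety _ one_pos x]
    simp only [one_pow, ofReal_one, one_mul, one_smul]
    refine lintegral_mono fun z => le_of_eq ?_
    have : x + z ∈ ball x 1 ↔ z ∈ ball (0 : Euc m) 1 := by simp
    by_cases hz : z ∈ ball (0 : Euc m) 1
    · rw [indicator_of_mem (this.2 hz), indicator_of_mem hz]
      simp [edist_eq_enorm_sub]
    · rw [indicator_of_notMem (fun h => hz (this.1 h)), indicator_of_notMem hz]

/-- The density of the Gagliardo energy on `Z`. -/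
noncomputable def gker (p q : ℝ) (u : Euc m → N) (Z : Set (Euc m)) (z : Euc m) : ℝ≥0∞ :=
  ∫⁻ ξ in Z, edist (u z) (u ξ) ^ p / edist z ξ ^ q

theorem gagliardoEnergy_eq (s p : ℝ) (u : Euc m → N) (Z : Set (Euc m)) :
    gagliardoEnergy s p u Z = ∫⁻ z in Z, gker p ((m : ℝ) + s * p) u Z z := rfl

theorem edist_rpow_le_add {p : ℝ} (hp : 1 ≤ p) (a b c : N) :
    edist a c ^ p ≤ 2 ^ (p - 1) * (edist a b ^ p + edist b c ^ p) :=
  (ENNReal.rpow_le_rpow (edist_triangle a b c) (by linarith)).trans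
    (ENNReal.rpow_add_le_mul_rpow_add_rpow _ _ hp)

theorem measurable_edist_rpow {X : Type*} [MeasurableSpace X] {f g : X → N} (hf : Measurable f)
    (hg : Measurable g) (p : ℝ) : Measurable fun x => edist (f x) (g x) ^ p :=
  (hf.edist hg).pow_const p

theorem measurable_gker {p q : ℝ} {u : Euc m → N} (hu : Measurable u) (Z : Set (Euc m)) :
    Measurable (gker p q u Z) := by
  have h : Measurable (fun z : Euc m × Euc m => edist (u z.1) (u z.2) ^ p / edist z.1 z.2 ^ q) :=
    (measurable_edist_rpow (hu.comp measurable_fst) (hu.comp measurable_snd) p).div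
      ((measurable_fst.edist measurable_snd).pow_const q)
  exact h.lintegral_prod_right'

/-- The Gagliardo energy of a composition with a Lipschitz map is controlled by the integral of the
energy density along the map. -/
theorem exists_lintegral_comp_le_gker {p q : ℝ} (hp : 1 ≤ p) (hq : (m : ℝ) < q) (hq0 : 0 < q)
    (κ : ℝ≥0∞) (hκ : κ ≠ 0) (hκ' : κ ≠ ⊤) (L : NNReal) :
    ∃ C : ℝ≥0∞, C ≠ ⊤ ∧ ∀ (u : Euc m → N), Measurable u → ∀ (Z X : Set (Euc m)),
      MeasurableSet Z → MeasurableSet X → ∀ Φ : Euc m → Euc m, Measurable Φ → LipschitzOnWith L Φ X →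
      (∀ x ∈ X, ∀ y ∈ X, κ * edist x y ^ m ≤ volume (Z ∩ eball (Φ x) (edist x y))) →
      ∫⁻ x in X, ∫⁻ y in X, edist (u (Φ x)) (u (Φ y)) ^ p / edist x y ^ q ≤
        C * ∫⁻ x in X, gker p q u Z (Φ x) := by
  -- The exponent m + q collects |x - y|^(-q) from the energy and |x - y|^(-m) from averaging over a
  -- ball of radius |x - y|.
  obtain ⟨C₁, hC₁, hC₁0, htail⟩ := exists_tail_kernel (m := m) (q := m + q) (by linarith)
  -- A point within |x - y| of Φ(x) is within (L + 1)|x - y| of Φ(y), because Φ is L-Lipschitz on X.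
  set c : ℝ≥0∞ := ((L + 1 : NNReal) : ℝ≥0∞) with hc
  have hc0 : c ≠ 0 := by simp [hc]
  have hct : c ≠ ⊤ := ENNReal.coe_ne_top
  refine ⟨κ⁻¹ * 2 ^ (p - 1) * (2 * (C₁ * c ^ q)), ?_, ?_⟩
  · refine ENNReal.mul_ne_top (ENNReal.mul_ne_top (ENNReal.inv_ne_top.2 hκ) ?_)
      (ENNReal.mul_ne_top (by simp) (ENNReal.mul_ne_top hC₁ ?_))
    · exact rpow_ne_top_of_nonneg (by linarith) (by simp)
    · exact rpow_ne_top_of_nonneg hq0.le hct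
  intro u hu Z X hZ hX Φ hΦ hL hvol
  -- The contribution of the intermediate point ξ to the pair (x, y). It involves y only through |x
  -- - y|, which allows the integration in y to be carried out first.
  obtain ⟨t, ht⟩ : ∃ t : Euc m → Euc m → Euc m → ℝ≥0∞, ∀ x y ξ, t x y ξ =
    (if edist (Φ x) ξ ≤ c * edist x y then edist (u (Φ x)) (u ξ) ^ p else 0) *
      edist x y ^ (-((m : ℝ) + q)) := ⟨_, fun _ _ _ => rfl⟩
  have hpm : ∀ {Y : Type} [MeasurableSpace Y] {f g h : Y → Euc m}, Measurable f → Measurable g →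
      Measurable h → Measurable fun z => t (f z) (g z) (h z) := by
    intro Y _ f g h hf hg hh
    simp only [ht]
    refine Measurable.mul (Measurable.ite (measurableSet_le ((hΦ.comp hf).edist hh)
      ((hf.edist hg).const_mul c)) ?_ measurable_const) ((hf.edist hg).pow_const _)
    exact measurable_edist_rpow (hu.comp (hΦ.comp hf)) (hu.comp hh) p
  have ht1 : Measurable fun z : (Euc m × Euc m) × Euc m => t z.1.1 z.1.2 z.2 :=
    hpm (measurable_fst.comp measurable_fst) (measurable_snd.comp measurable_fst) measurable_snd
  have ht1' : Measurable fun z : (Euc m × Euc m) × Euc m => t z.1.2 z.1.1 z.2 :=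
    hpm (measurable_snd.comp measurable_fst) (measurable_fst.comp measurable_fst) measurable_snd
  have hTm : Measurable fun z : Euc m × Euc m => ∫⁻ ξ in Z, t z.1 z.2 ξ := by
    have := ht1.lintegral_prod_right' (ν := volume.restrict Z)
    exact this
  have hTm' : Measurable fun z : Euc m × Euc m => ∫⁻ ξ in Z, t z.2 z.1 ξ := by
    have := ht1'.lintegral_prod_right' (ν := volume.restrict Z)
    exact this
  have hTm1 : ∀ x, Measurable fun y => ∫⁻ ξ in Z, t x y ξ := fun x =>
    (hpm (Y := Euc m × Euc m) measurable_const measurable_fst measurable_snd).lintegral_prod_right'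
  have hTm2 : Measurable fun x => ∫⁻ y in X, ∫⁻ ξ in Z, t x y ξ := hTm.lintegral_prod_right'
  -- The triangle inequality through u(ξ), averaged over ξ in the part of Z within |x - y| of Φ(x).
  -- That set has measure at least κ|x - y|^m by assumption.
  have hpoint : ∀ x ∈ X, ∀ y ∈ X, x ≠ y → edist (u (Φ x)) (u (Φ y)) ^ p / edist x y ^ q ≤
      κ⁻¹ * 2 ^ (p - 1) * ((∫⁻ ξ in Z, t x y ξ) + ∫⁻ ξ in Z, t y x ξ) := by
    intro x hx y hy hxy
    set r := edist x y with hr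
    have hr0 : r ≠ 0 := by simpa [hr] using hxy
    have hrt : r ≠ ⊤ := edist_ne_top x y
    set Q := Z ∩ eball (Φ x) r with hQ
    have hQm : MeasurableSet Q := hZ.inter measurableSet_eball
    have h1 : κ * r ^ m * edist (u (Φ x)) (u (Φ y)) ^ p ≤ 2 ^ (p - 1) *
        ((∫⁻ ξ in Q, edist (u (Φ x)) (u ξ) ^ p) + ∫⁻ ξ in Q, edist (u (Φ y)) (u ξ) ^ p) := by
      refine (mul_le_mul_left (hvol x hx y hy) _).trans ?_
      rw [← lintegral_add_left (measurable_edist_rpow measurable_const hu p),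
        ← lintegral_const_mul' _ _ (rpow_ne_top_of_nonneg (by linarith) (by simp)),
        mul_comm, ← setLIntegral_const]
      refine lintegral_mono fun ξ => ?_
      have := edist_rpow_le_add hp (u (Φ x)) (u ξ) (u (Φ y))
      rwa [edist_comm (u ξ)] at this
    have hsub : ∀ x', (∀ ξ ∈ Q, edist (Φ x') ξ ≤ c * r) →
        ∫⁻ ξ in Q, edist (u (Φ x')) (u ξ) ^ p ≤ ∫⁻ ξ in Z,
          (if edist (Φ x') ξ ≤ c * r then edist (u (Φ x')) (u ξ) ^ p else 0) := by
      intro x' hx'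
      calc ∫⁻ ξ in Q, edist (u (Φ x')) (u ξ) ^ p = ∫⁻ ξ in Q,
          (if edist (Φ x') ξ ≤ c * r then edist (u (Φ x')) (u ξ) ^ p else 0) :=
            setLIntegral_congr_fun hQm fun ξ hξ => by rw [if_pos (hx' ξ hξ)]
        _ ≤ _ := lintegral_mono_set inter_subset_left
    have hx1 : ∀ ξ ∈ Q, edist (Φ x) ξ ≤ c * r := by
      intro ξ hξ
      have : edist ξ (Φ x) < r := hξ.2
      rw [edist_comm]
      refine this.le.trans (le_mul_of_one_le_left zero_le ?_)
      simp [hc]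
    have hx2 : ∀ ξ ∈ Q, edist (Φ y) ξ ≤ c * r := by
      intro ξ hξ
      have h2 : edist ξ (Φ x) < r := hξ.2
      refine (edist_triangle _ (Φ x) _).trans ?_
      have h3 := hL hy hx
      rw [edist_comm y x] at h3
      rw [hc]
      push_cast
      rw [add_mul, one_mul]
      exact add_le_add h3 (by rw [edist_comm]; exact h2.le)
    have h2 := h1.trans (mul_le_mul_right (add_le_add (hsub x hx1) (hsub y hx2)) _)
    have hrm0 : κ * r ^ m ≠ 0 := mul_ne_zero hκ (pow_ne_zero _ hr0)
    have hrmt : κ * r ^ m ≠ ⊤ := ENNReal.mul_ne_top hκ' (ENNReal.pow_ne_top hrt)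
    have hrq : r ^ (-((m : ℝ) + q)) ≠ ⊤ := ENNReal.rpow_ne_top_of_ne_zero hr0 hrt
    simp only [ht]
    rw [edist_comm y x, ← hr, lintegral_mul_const' _ _ hrq, lintegral_mul_const' _ _ hrq, ← add_mul]
    have h3 := mul_le_mul_left (mul_le_mul_right h2 κ⁻¹) (r ^ (-((m : ℝ) + q)))
    have h4 : κ⁻¹ * (κ * r ^ m * edist (u (Φ x)) (u (Φ y)) ^ p) * r ^ (-((m : ℝ) + q)) =
        edist (u (Φ x)) (u (Φ y)) ^ p / r ^ q := by
      have e1 : r ^ (-((m : ℝ) + q)) * r ^ m = (r ^ q)⁻¹ := by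
        rw [← ENNReal.rpow_natCast, ← ENNReal.rpow_add _ _ hr0 hrt, ← ENNReal.rpow_neg]
        congr 1
        ring
      calc _ = (κ⁻¹ * κ) * edist (u (Φ x)) (u (Φ y)) ^ p * (r ^ (-((m : ℝ) + q)) * r ^ m) := by ring
        _ = _ := by rw [e1, ENNReal.inv_mul_cancel hκ hκ', one_mul, div_eq_mul_inv]
    rw [h4] at h3
    refine h3.trans (le_of_eq ?_)
    ring
  -- For fixed x and ξ the constraint on y is |x - y| ≥ |Φ(x) - ξ|/c, so the tail estimate produces
  -- |Φ(x) - ξ|^(-q), which is the kernel of the energy density at Φ(x).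
  have hinner : ∀ x, ∫⁻ y in X, ∫⁻ ξ in Z, t x y ξ ≤ C₁ * c ^ q * gker p q u Z (Φ x) := by
    intro x
    rw [lintegral_lintegral_swap (hpm measurable_const measurable_fst measurable_snd).aemeasurable,
      gker, ← lintegral_const_mul' _ _ (ENNReal.mul_ne_top hC₁
        (rpow_ne_top_of_nonneg hq0.le hct))]
    refine lintegral_mono fun ξ => ?_
    have hms : MeasurableSet {y | edist (Φ x) ξ / c ≤ edist x y} :=
      measurableSet_le measurable_const (by fun_prop)
    calc ∫⁻ y in X, t x y ξ ≤ ∫⁻ y, t x y ξ := setLIntegral_le_lintegral _ _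
      _ = ∫⁻ y, edist (u (Φ x)) (u ξ) ^ p * ({y | edist (Φ x) ξ / c ≤ edist x y}).indicator
            (fun y => edist x y ^ (-((m : ℝ) + q))) y := by
          refine lintegral_congr fun y => ?_
          have e : (edist (Φ x) ξ ≤ c * edist x y) ↔ edist (Φ x) ξ / c ≤ edist x y := by
            rw [ENNReal.div_le_iff_le_mul (Or.inl hc0) (Or.inl hct), mul_comm]
          simp only [ht, indicator, mem_ofPred_eq, e]
          split_ifs <;> simp
      _ = edist (u (Φ x)) (u ξ) ^ p * ∫⁻ y in {y | edist (Φ x) ξ / c ≤ edist x y},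
            edist x y ^ (-((m : ℝ) + q)) := by
          rw [lintegral_const_mul _ (Measurable.indicator (by fun_prop) hms),
            lintegral_indicator hms]
      _ ≤ edist (u (Φ x)) (u ξ) ^ p * (C₁ * (edist (Φ x) ξ / c) ^ ((m : ℝ) - (m + q))) := by
          gcongr
          exact htail x _
      _ = C₁ * c ^ q * (edist (u (Φ x)) (u ξ) ^ p / edist (Φ x) ξ ^ q) := by
          have e1 : (edist (Φ x) ξ / c) ^ ((m : ℝ) - (m + q)) = c ^ q * (edist (Φ x) ξ ^ q)⁻¹ := by
            rw [show (m : ℝ) - (m + q) = -q by ring, ENNReal.rpow_neg,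
              ENNReal.div_rpow_of_nonneg _ _ hq0.le, ENNReal.inv_div, div_eq_mul_inv]
            · exact Or.inl (rpow_ne_top_of_nonneg hq0.le hct)
            · exact Or.inl (by simp [hc0, hct])
          rw [e1, div_eq_mul_inv]
          ring
  have hκ2 : κ⁻¹ * 2 ^ (p - 1) ≠ ⊤ := ENNReal.mul_ne_top (ENNReal.inv_ne_top.2 hκ)
    (rpow_ne_top_of_nonneg (by linarith) (by simp))
  have hA : ∫⁻ x in X, ∫⁻ y in X, ∫⁻ ξ in Z, t x y ξ ≤
      C₁ * c ^ q * ∫⁻ x in X, gker p q u Z (Φ x) := by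
    rw [← lintegral_const_mul' _ _ (ENNReal.mul_ne_top hC₁
        (rpow_ne_top_of_nonneg hq0.le hct))]
    exact lintegral_mono fun x => hinner x
  have hB : ∫⁻ x in X, ∫⁻ y in X, ∫⁻ ξ in Z, t y x ξ = ∫⁻ x in X, ∫⁻ y in X, ∫⁻ ξ in Z, t x y ξ :=
    lintegral_lintegral_swap hTm'.aemeasurable
  calc ∫⁻ x in X, ∫⁻ y in X, edist (u (Φ x)) (u (Φ y)) ^ p / edist x y ^ q
      ≤ ∫⁻ x in X, ∫⁻ y in X, κ⁻¹ * 2 ^ (p - 1) *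
        ((∫⁻ ξ in Z, t x y ξ) + ∫⁻ ξ in Z, t y x ξ) := by
        refine setLIntegral_mono' hX fun x hx => ?_
        refine setLIntegral_mono' hX fun y hy => ?_
        rcases eq_or_ne x y with rfl | hxy
        · simp [ENNReal.zero_rpow_of_pos (by linarith : 0 < p)]
        · exact hpoint x hx y hy hxy
    _ = κ⁻¹ * 2 ^ (p - 1) * ((∫⁻ x in X, ∫⁻ y in X, ∫⁻ ξ in Z, t x y ξ) +
        ∫⁻ x in X, ∫⁻ y in X, ∫⁻ ξ in Z, t y x ξ) := by
        rw [← lintegral_add_left hTm2, ← lintegral_const_mul' _ _ hκ2]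
        refine lintegral_congr fun x => ?_
        rw [← lintegral_add_left (hTm1 x), ← lintegral_const_mul' _ _ hκ2]
    _ ≤ κ⁻¹ * 2 ^ (p - 1) * (2 * (C₁ * c ^ q) * ∫⁻ x in X, gker p q u Z (Φ x)) := by
        rw [hB, ← two_mul, mul_assoc 2]
        gcongr
    _ = _ := by ring

/-! ### The opening map and the choice of its centre. -/

/-- The radial profile of the opening map. -/
noncomputable def openProfile (t r : ℝ) : ℝ := max t (min 1 (r - 1))

/-- The opening map: it contracts the ball of center `a` and radius `ρ` by the factor `t` and is the
identity outside the ball of radius `2 ρ`. -/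
noncomputable def openMap (t : ℝ) (a : Euc m) (ρ : ℝ) (x : Euc m) : Euc m :=
  a + openProfile t (‖x - a‖ / ρ) • (x - a)

theorem openProfile_mem {t : ℝ} (ht : t ∈ Icc (0 : ℝ) 1) (r : ℝ) : openProfile t r ∈ Icc t 1 :=
  ⟨le_max_left _ _, max_le ht.2 (min_le_left _ _)⟩

theorem openProfile_eq_of_le {t r : ℝ} (h : r ≤ 1 + t) : openProfile t r = t :=
  max_eq_left ((min_le_right _ _).trans (by linarith))

theorem openProfile_eq_of_ge {t r : ℝ} (ht : t ∈ Icc (0 : ℝ) 1) (h : 1 + t ≤ r) :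
    openProfile t r = openProfile 0 r := by
  rw [openProfile, openProfile, max_eq_right (le_min ht.2 (by linarith)),
    max_eq_right (le_min zero_le_one (by linarith [ht.1]))]

theorem openProfile_eq_one {t r : ℝ} (ht : t ∈ Icc (0 : ℝ) 1) (h : 2 ≤ r) : openProfile t r = 1 := by
  rw [openProfile, min_eq_left (by linarith), max_eq_right ht.2]

theorem openProfile_mono (t : ℝ) : Monotone (openProfile t) := by
  intro r r' h
  unfold openProfile
  gcongr

theorem abs_openProfile_sub_le (t r r' : ℝ) :
    |openProfile t r - openProfile t r'| ≤ |r - r'| := by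
  unfold openProfile
  have h1 := abs_max_sub_max_le_abs (min 1 (r - 1)) (min 1 (r' - 1)) t
  have h2 := abs_min_sub_min_le_max 1 (r - 1) 1 (r' - 1)
  rw [max_comm t, max_comm t]
  refine h1.trans (h2.trans ?_)
  simp

theorem continuous_openMap (t : ℝ) (a : Euc m) (ρ : ℝ) : Continuous (openMap t a ρ) := by
  unfold openMap openProfile
  fun_prop

theorem openMap_eq_self {t : ℝ} (ht : t ∈ Icc (0 : ℝ) 1) {a x : Euc m} {ρ : ℝ} (hρ : 0 < ρ)
    (h : 2 * ρ ≤ ‖x - a‖) : openMap t a ρ x = x := by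
  rw [openMap, openProfile_eq_one ht (by rwa [le_div_iff₀ hρ])]
  simp

theorem openMap_eq_of_le {t : ℝ} {a x : Euc m} {ρ : ℝ} (hρ : 0 < ρ)
    (h : ‖x - a‖ ≤ ρ * (1 + t)) : openMap t a ρ x = a + t • (x - a) := by
  rw [openMap, openProfile_eq_of_le (by rwa [div_le_iff₀' hρ])]

theorem openMap_eq_of_ge {t : ℝ} (ht : t ∈ Icc (0 : ℝ) 1) {a x : Euc m} {ρ : ℝ} (hρ : 0 < ρ)
    (h : ρ * (1 + t) ≤ ‖x - a‖) : openMap t a ρ x = openMap 0 a ρ x := by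
  rw [openMap, openMap, openProfile_eq_of_ge ht (by rwa [le_div_iff₀' hρ])]

theorem openMap_zero_eq {a x : Euc m} {ρ : ℝ} (hρ : 0 < ρ) (h : ‖x - a‖ ≤ ρ) :
    openMap 0 a ρ x = a := by
  rw [openMap_eq_of_le hρ (by simpa using h)]
  simp

theorem norm_openMap_sub_le {t : ℝ} (ht : t ∈ Icc (0 : ℝ) 1) (a x : Euc m) (ρ : ℝ) :
    ‖openMap t a ρ x - a‖ ≤ ‖x - a‖ := by
  have h := openProfile_mem ht (‖x - a‖ / ρ)
  rw [openMap, add_sub_cancel_left, norm_smul, Real.norm_of_nonneg (ht.1.trans h.1)]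
  exact mul_le_of_le_one_left (norm_nonneg _) h.2

/-- Write the difference as k(x - y) + (k - k')(y - a) with y the point closer to a. The first term
is at most |x - y|. In the second, the factors differ by at most |x - y|/ρ, and both are 1 unless |y
- a| < 2ρ, which gives 2|x - y|. -/
theorem openMap_lipschitz {t : ℝ} (ht : t ∈ Icc (0 : ℝ) 1) (a : Euc m) {ρ : ℝ} (hρ : 0 < ρ) :
    LipschitzWith 3 (openMap t a ρ) := by
  have key : ∀ x y : Euc m, ‖y - a‖ ≤ ‖x - a‖ →
      ‖openMap t a ρ x - openMap t a ρ y‖ ≤ 3 * ‖x - y‖ := by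
    intro x y hxy
    set k := openProfile t (‖x - a‖ / ρ)
    set k' := openProfile t (‖y - a‖ / ρ)
    have hk := openProfile_mem ht (‖x - a‖ / ρ)
    have e : openMap t a ρ x - openMap t a ρ y = k • (x - y) + (k - k') • (y - a) := by
      simp only [openMap, k, k']
      module
    have h2 : |k - k'| * ‖y - a‖ ≤ 2 * ‖x - y‖ := by
      rcases le_or_gt (2 * ρ) ‖y - a‖ with h | h
      · have e1 : k = 1 := openProfile_eq_one ht (by rw [le_div_iff₀ hρ]; linarith)
        have e2 : k' = 1 := openProfile_eq_one ht (by rwa [le_div_iff₀ hρ])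
        rw [e1, e2]
        simp
      · have h3 : |k - k'| ≤ ‖x - y‖ / ρ := by
          refine (abs_openProfile_sub_le _ _ _).trans ?_
          rw [← sub_div, abs_div, abs_of_pos hρ]
          gcongr
          have := abs_norm_sub_norm_le (x - a) (y - a)
          simpa using this
        calc |k - k'| * ‖y - a‖ ≤ ‖x - y‖ / ρ * (2 * ρ) := by gcongr
          _ = 2 * ‖x - y‖ := by field_simp
    rw [e]
    refine (norm_add_le _ _).trans ?_
    rw [norm_smul, norm_smul, Real.norm_eq_abs, Real.norm_eq_abs, abs_of_nonneg (ht.1.trans hk.1)]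
    have h4 : k * ‖x - y‖ ≤ 1 * ‖x - y‖ := by
      gcongr
      exact hk.2
    linarith
  refine LipschitzWith.of_dist_le_mul fun x y => ?_
  simp only [NNReal.coe_ofNat]
  rcases le_total ‖y - a‖ ‖x - a‖ with h | h
  · rw [dist_eq_norm, dist_eq_norm]
    exact key x y h
  · rw [dist_comm, dist_comm x, dist_eq_norm, dist_eq_norm]
    exact key y x h

/-- The function r ↦ (`openProfile t r` - t) r is nondecreasing, so `openMap` minus t times the
identity is a monotone map. The inner product of the difference of images with x - y is therefore at
least t|x - y|², and Cauchy–Schwarz concludes. -/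
theorem openMap_antilipschitz {t : ℝ} (ht : t ∈ Icc (0 : ℝ) 1) (a : Euc m) {ρ : ℝ} (hρ : 0 < ρ)
    (x y : Euc m) : t * ‖x - y‖ ≤ ‖openMap t a ρ x - openMap t a ρ y‖ := by
  rcases eq_or_ne x y with rfl | hxy
  · simp
  have hpos : 0 < ‖x - y‖ := norm_pos_iff.2 (sub_ne_zero.2 hxy)
  obtain ⟨z, hz⟩ : ∃ z, z = x - a := ⟨_, rfl⟩
  obtain ⟨w, hw⟩ : ∃ w, w = y - a := ⟨_, rfl⟩
  obtain ⟨k, hk⟩ : ∃ k, k = openProfile t (‖z‖ / ρ) := ⟨_, rfl⟩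
  obtain ⟨k', hk'⟩ : ∃ k', k' = openProfile t (‖w‖ / ρ) := ⟨_, rfl⟩
  have e : openMap t a ρ x - openMap t a ρ y = k • z - k' • w := by
    simp only [openMap, hk, hk', hz, hw]
    module
  have e2 : x - y = z - w := by simp [hz, hw]
  have h1 : t ≤ k := hk ▸ (openProfile_mem ht (‖z‖ / ρ)).1
  have h2 : t ≤ k' := hk' ▸ (openProfile_mem ht (‖w‖ / ρ)).1
  have hmono : 0 ≤ ((k - t) * ‖z‖ - (k' - t) * ‖w‖) * (‖z‖ - ‖w‖) := by
    rcases le_total ‖z‖ ‖w‖ with h | h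
    · have : k ≤ k' := by rw [hk, hk']; exact openProfile_mono t (by gcongr)
      apply mul_nonneg_of_nonpos_of_nonpos _ (by linarith)
      have : (k - t) * ‖z‖ ≤ (k' - t) * ‖w‖ := by
        gcongr
      linarith
    · have : k' ≤ k := by rw [hk, hk']; exact openProfile_mono t (by gcongr)
      apply mul_nonneg _ (by linarith)
      have : (k' - t) * ‖w‖ ≤ (k - t) * ‖z‖ := by
        gcongr
      linarith
  have hin : t * ‖z - w‖ ^ 2 ≤ inner ℝ (k • z - k' • w) (z - w) := by
    have hzw := real_inner_le_norm z w
    have e3 : inner ℝ (k • z - k' • w) (z - w) - t * ‖z - w‖ ^ 2 =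
        (k - t) * ‖z‖ ^ 2 + (k' - t) * ‖w‖ ^ 2 - ((k - t) + (k' - t)) * inner ℝ z w := by
      rw [norm_sub_sq_real, inner_sub_left, inner_sub_right, inner_sub_right, real_inner_smul_left,
        real_inner_smul_left, real_inner_smul_left, real_inner_smul_left,
        real_inner_self_eq_norm_sq, real_inner_self_eq_norm_sq, real_inner_comm z w]
      ring
    have h3 : ((k - t) + (k' - t)) * inner ℝ z w ≤ ((k - t) + (k' - t)) * (‖z‖ * ‖w‖) := by
      apply mul_le_mul_of_nonneg_left hzw
      linarith
    nlinarith
  have h5 := hin.trans (real_inner_le_norm _ _)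
  rw [e, e2]
  rw [e2] at hpos
  have h6 : (t * ‖z - w‖) * ‖z - w‖ ≤ ‖k • z - k' • w‖ * ‖z - w‖ := by
    rw [mul_assoc, ← sq]; exact h5
  exact le_of_mul_le_mul_right h6 hpos

theorem openMap_mem_ball {t : ℝ} (ht : t ∈ Icc (0 : ℝ) 1) {a x c : Euc m} {ρ r : ℝ} (hρ : 0 < ρ)
    (har : ball a (2 * ρ) ⊆ ball c r) (hx : x ∈ ball c r) : openMap t a ρ x ∈ ball c r := by
  rcases le_or_gt (2 * ρ) ‖x - a‖ with h | h
  · rwa [openMap_eq_self ht hρ h]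
  · apply har
    rw [mem_ball, dist_eq_norm]
    exact (norm_openMap_sub_le ht a x ρ).trans_lt h

/-- Averaging over the center of the opening. -/
theorem lintegral_openMap_le {F : Euc m → ℝ≥0∞} (hF : Measurable F) (c : Euc m) {ρ : ℝ} (hρ : 0 < ρ) :
    ∫⁻ a in ball c ρ, ∫⁻ x in ball c (3 * ρ), F (openMap 0 a ρ x) ≤
      volume (ball (0 : Euc m) (4 * ρ)) * ∫⁻ x in ball c (3 * ρ), F x := by
  have h0 : (0 : ℝ) ∈ Icc (0 : ℝ) 1 := by simp
  set F' : Euc m → ℝ≥0∞ := (ball c (3 * ρ)).indicator F with hF'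
  have hF'm : Measurable F' := hF.indicator measurableSet_ball
  let φ : Euc m → Euc m := fun z => openProfile 0 (‖z‖ / ρ) • z
  have hφ : Continuous φ := by
    simp only [φ, openProfile]
    fun_prop
  -- In the variable z = x - a the opened point is a + φ(z), with φ independent of a. Integrating
  -- first in a is then a mere translation. Since |a - c| < ρ and |x - c| < 3ρ, z stays in the ball
  -- of radius 4ρ.
  have hinner : ∀ a ∈ ball c ρ, ∫⁻ x in ball c (3 * ρ), F (openMap 0 a ρ x) ≤
      ∫⁻ z in ball (0 : Euc m) (4 * ρ), F' (a + φ z) := by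
    intro a ha
    rw [← lintegral_indicator measurableSet_ball, ← lintegral_indicator measurableSet_ball,
      ← lintegral_add_left_eq_self _ a]
    refine lintegral_mono fun z => ?_
    have ha' : ‖a - c‖ < ρ := by rwa [mem_ball, dist_eq_norm] at ha
    by_cases hz : a + z ∈ ball c (3 * ρ)
    · rw [indicator_of_mem hz]
      have hz' : z ∈ ball (0 : Euc m) (4 * ρ) := by
        rw [mem_ball, dist_eq_norm] at hz ⊢
        have e : z - 0 = (a + z - c) - (a - c) := by abel
        rw [e]
        exact (norm_sub_le _ _).trans_lt (by linarith)
      rw [indicator_of_mem hz']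
      have hmem : openMap 0 a ρ (a + z) ∈ ball c (3 * ρ) := by
        apply openMap_mem_ball h0 hρ _ hz
        apply ball_subset_ball'
        rw [dist_eq_norm]
        linarith
      have e : a + φ z = openMap 0 a ρ (a + z) := by simp [openMap, φ]
      rw [e, hF', indicator_of_mem hmem]
    · rw [indicator_of_notMem hz]
      exact zero_le
  have hjm : Measurable fun q : Euc m × Euc m => F' (q.1 + φ q.2) :=
    hF'm.comp (measurable_fst.add (hφ.measurable.comp measurable_snd))
  calc ∫⁻ a in ball c ρ, ∫⁻ x in ball c (3 * ρ), F (openMap 0 a ρ x)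
      ≤ ∫⁻ a in ball c ρ, ∫⁻ z in ball (0 : Euc m) (4 * ρ), F' (a + φ z) :=
        setLIntegral_mono' measurableSet_ball hinner
    _ ≤ ∫⁻ a, ∫⁻ z in ball (0 : Euc m) (4 * ρ), F' (a + φ z) := setLIntegral_le_lintegral _ _
    _ = ∫⁻ z in ball (0 : Euc m) (4 * ρ), ∫⁻ a, F' (a + φ z) :=
        lintegral_lintegral_swap hjm.aemeasurable
    _ = ∫⁻ z in ball (0 : Euc m) (4 * ρ), ∫⁻ a, F' a := by
        simp only [lintegral_add_right_eq_self]
    _ = _ := by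
        rw [setLIntegral_const, mul_comm, hF', lintegral_indicator measurableSet_ball]

theorem volume_ball_mul (c : Euc m) {k r : ℝ} (hk : 0 < k) (hr : 0 < r) :
    volume (ball c (k * r)) = ofReal k ^ m * volume (ball c r) := by
  rw [Measure.addHaar_ball_of_pos _ _ (by positivity), Measure.addHaar_ball_of_pos _ _ hr,
    ← mul_assoc, mul_pow, ofReal_mul (by positivity), ENNReal.ofReal_pow hk.le]
  simp

/-- A good center for the opening. -/
theorem exists_open_center {F : Euc m → ℝ≥0∞} (hF : Measurable F) (c : Euc m) {ρ : ℝ} (hρ : 0 < ρ)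
    {P : Euc m → Prop} (hP : ∀ᵐ a, a ∈ ball c ρ → P a) :
    ∃ a ∈ ball c (ρ / 2), P a ∧ ∫⁻ x in ball c (3 * ρ), F (openMap 0 a ρ x) ≤
      8 ^ m * ∫⁻ x in ball c (3 * ρ), F x := by
  have hb : volume (ball c (ρ / 2)) ≠ 0 := (measure_ball_pos _ _ (by positivity)).ne'
  have hjm : Measurable fun q : Euc m × Euc m => F (openMap 0 q.1 ρ q.2) := by
    refine hF.comp (Continuous.measurable ?_)
    unfold openMap openProfile
    fun_prop
  have hm : AEMeasurable (fun a => ∫⁻ x in ball c (3 * ρ), F (openMap 0 a ρ x))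
      (volume.restrict (ball c (ρ / 2))) := by
    have := hjm.lintegral_prod_right' (ν := volume.restrict (ball c (3 * ρ)))
    exact this.aemeasurable
  have hN : (volume.restrict (ball c (ρ / 2))) {a | ¬ (a ∈ ball c (ρ / 2) ∧ P a)} = 0 := by
    have : ∀ᵐ a ∂volume.restrict (ball c (ρ / 2)), a ∈ ball c (ρ / 2) ∧ P a := by
      filter_upwards [ae_restrict_mem measurableSet_ball, ae_restrict_of_ae hP] with a ha hPa
      exact ⟨ha, hPa (ball_subset_ball (by linarith) ha)⟩
    exact this
  have : IsFiniteMeasure (volume.restrict (ball c (ρ / 2))) :=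
    ⟨by simpa using measure_ball_lt_top⟩
  -- Centres are taken in the ball of radius ρ/2 rather than ρ: the closed ball of radius 2ρ around
  -- a is then well inside the ball of radius 3ρ around c.
  obtain ⟨a, haN, ha⟩ := exists_notMem_null_le_laverage
    (μ := volume.restrict (ball c (ρ / 2))) (by simpa [Measure.restrict_eq_zero] using hb) hm hN
  simp only [mem_ofPred_eq, not_not] at haN
  refine ⟨a, haN.1, haN.2, ha.trans ?_⟩
  rw [laverage_eq, Measure.restrict_apply_univ]
  have h1 := (lintegral_mono_set (μ := volume)
    (f := fun a => ∫⁻ x in ball c (3 * ρ), F (openMap 0 a ρ x))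
    (ball_subset_ball (x := c) (by linarith : ρ / 2 ≤ ρ))).trans (lintegral_openMap_le hF c hρ)
  refine ENNReal.div_le_of_le_mul (h1.trans (le_of_eq ?_))
  -- The factor 8^m is the ratio of the volumes of the balls of radii 4ρ and ρ/2.
  have h2 : volume (ball (0 : Euc m) (4 * ρ)) = 8 ^ m * volume (ball c (ρ / 2)) := by
    rw [show 4 * ρ = 8 * (ρ / 2) by ring, volume_ball_mul _ (by norm_num) (by positivity)]
    congr 1
    · norm_num
    · exact Measure.addHaar_ball_center _ _ _ |>.symm
  rw [h2]
  ring

/-! ### Scaling, gluing and localization of the Gagliardo energy. -/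

theorem gagliardoEnergy_congr_ae {s p : ℝ} {u w : Euc m → N} {A : Set (Euc m)}
    (h : u =ᵐ[volume.restrict A] w) : gagliardoEnergy s p u A = gagliardoEnergy s p w A := by
  refine lintegral_congr_ae ?_
  filter_upwards [h] with x hx
  refine lintegral_congr_ae ?_
  filter_upwards [h] with y hy
  rw [hx, hy]

theorem gker_const (p q : ℝ) (hp : 0 < p) (c : N) (Z : Set (Euc m)) (z : Euc m) :
    gker p q (fun _ => c) Z z = 0 := by
  simp [gker, ENNReal.zero_rpow_of_pos hp]

theorem gker_mono_set {p q : ℝ} {u : Euc m → N} {Z Z' : Set (Euc m)} (h : Z ⊆ Z') (z : Euc m) :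
    gker p q u Z z ≤ gker p q u Z' z := lintegral_mono_set h

theorem lintegral_gker_mono {p q : ℝ} {u : Euc m → N} {A A' Z Z' : Set (Euc m)} (hA : A ⊆ A')
    (h : Z ⊆ Z') : ∫⁻ x in A, gker p q u Z x ≤ ∫⁻ x in A', gker p q u Z' x :=
  (lintegral_mono_set hA).trans (lintegral_mono fun z => gker_mono_set h z)

theorem lintegral_gker_congr {p q : ℝ} {u w : Euc m → N} {A Z : Set (Euc m)} (hA : MeasurableSet A)
    (hZ : MeasurableSet Z) (h : EqOn u w A) (h' : EqOn u w Z) :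
    ∫⁻ x in A, gker p q u Z x = ∫⁻ x in A, gker p q w Z x := by
  refine setLIntegral_congr_fun hA fun x hx => setLIntegral_congr_fun hZ fun y hy => ?_
  simp only [h hx, h' hy]

theorem gagliardoEnergy_homothety {s p : ℝ} (W : Euc m → N) {l : ℝ} (hl : 0 < l)
    (h : Euc m) :
    gagliardoEnergy s p (fun x => W (l⁻¹ • (x - h))) univ =
      ofReal (l ^ ((m : ℝ) - s * p)) * gagliardoEnergy s p W univ := by
  have hl0 : ofReal l ≠ 0 := by simpa using hl
  simp only [gagliardoEnergy, Measure.restrict_univ]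
  rw [lintegral_homothety _ hl h, ← ENNReal.ofReal_rpow_of_pos hl]
  have e : ∀ x : Euc m, l⁻¹ • (h + l • x - h) = x := fun x => by
    rw [add_sub_cancel_left, smul_smul, inv_mul_cancel₀ hl.ne', one_smul]
  have key : ∀ x, ∫⁻ y, edist (W (l⁻¹ • (h + l • x - h))) (W (l⁻¹ • (y - h))) ^ p /
      edist (h + l • x) y ^ ((m : ℝ) + s * p) = ofReal l ^ (-(s * p)) *
        ∫⁻ y, edist (W x) (W y) ^ p / edist x y ^ ((m : ℝ) + s * p) := by
    intro x
    have hne : ofReal l ^ (-((m : ℝ) + s * p)) ≠ ⊤ :=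
      ENNReal.rpow_ne_top_of_ne_zero hl0 ofReal_ne_top
    rw [lintegral_homothety _ hl h]
    have : ofReal l ^ (-(s * p)) = ofReal (l ^ m) *
        ofReal l ^ (-((m : ℝ) + s * p)) := by
      rw [ofReal_pow_mul_rpow hl]
      congr 1
      ring
    rw [this, mul_assoc, ← lintegral_const_mul' _ _ hne]
    congr 1
    refine lintegral_congr fun y => ?_
    rw [e, e]
    have h2 : edist (h + l • x) (h + l • y) = ofReal l * edist x y := by
      rw [edist_eq_enorm_sub, edist_eq_enorm_sub, add_sub_add_left_eq_sub, ← smul_sub, enorm_smul,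
        Real.enorm_of_nonneg hl.le]
    rw [h2, div_eq_mul_inv, div_eq_mul_inv, ← ENNReal.rpow_neg, ← ENNReal.rpow_neg,
      ENNReal.mul_rpow_of_ne_top ofReal_ne_top (edist_ne_top _ _)]
    ring
  simp only [key]
  rw [lintegral_const_mul' _ _ (ENNReal.rpow_ne_top_of_ne_zero hl0 ofReal_ne_top),
    ← mul_assoc, ofReal_pow_mul_rpow hl]

theorem aemeasurable_gker_prod {p q : ℝ} {u : Euc m → N} {A : Set (Euc m)}
    (hu : AEMeasurable u (volume.restrict A)) :
    AEMeasurable (fun z : Euc m × Euc m => edist (u z.1) (u z.2) ^ p / edist z.1 z.2 ^ q)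
      ((volume.restrict A).prod (volume.restrict A)) :=
  ((hu.comp_fst.edist hu.comp_snd).pow_const p).div
    ((measurable_fst.edist measurable_snd).pow_const q).aemeasurable

/-- Points of different pieces are compared through c, which each piece takes at the other point.
Each half is a difference of values of a single W i, or of Γ, at the same pair of points. Only two
terms ever occur, so the constant 2^p does not depend on the number of pieces. -/
theorem gagliardoEnergy_glue_le {ι : Type*} [Countable ι] {s p : ℝ} (hp : 0 < p) {A : Set (Euc m)}
    {S : ι → Set (Euc m)} (hS : Pairwise fun i j => Disjoint (S i) (S j)) {W : ι → Euc m → N}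
    {Γ w : Euc m → N} {c : N} (hW : ∀ i, ∀ x ∉ S i, W i x = c) (hΓ : ∀ i, ∀ x ∈ S i, Γ x = c)
    (hwS : ∀ i, ∀ x ∈ S i, w x = W i x) (hw : ∀ x, (∀ i, x ∉ S i) → w x = Γ x)
    (hWm : ∀ i, AEMeasurable (W i) (volume.restrict A))
    (hΓm : AEMeasurable Γ (volume.restrict A)) :
    gagliardoEnergy s p w A ≤
      2 ^ p * (gagliardoEnergy s p Γ A + ∑' i, gagliardoEnergy s p (W i) A) := by
  have h2p : (2 : ℝ≥0∞) ^ p ≠ ⊤ := rpow_ne_top_of_nonneg hp.le (by simp)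
  have hpt : ∀ x y, edist (w x) (w y) ^ p ≤
      2 ^ p * (edist (Γ x) (Γ y) ^ p + ∑' i, edist (W i x) (W i y) ^ p) := by
    intro x y
    set T := edist (Γ x) (Γ y) ^ p + ∑' i, edist (W i x) (W i y) ^ p with hT
    have hΓT : edist (Γ x) (Γ y) ^ p ≤ T := le_self_add
    have hWT : ∀ i, edist (W i x) (W i y) ^ p ≤ T := fun i =>
      (ENNReal.le_tsum i).trans le_add_self
    have hone : ∀ d, d ^ p ≤ T → d ^ p ≤ 2 ^ p * T := fun d hd =>
      hd.trans (le_mul_of_one_le_left zero_le (ENNReal.one_le_rpow (by norm_num) hp))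
    have htwo : ∀ d a b : ℝ≥0∞, d ≤ a + b → a ^ p ≤ T → b ^ p ≤ T → d ^ p ≤ 2 ^ p * T := by
      intro d a b hd ha hb
      have h1 : d ≤ 2 * max a b := by
        rw [two_mul]
        exact hd.trans (add_le_add (le_max_left _ _) (le_max_right _ _))
      refine (ENNReal.rpow_le_rpow h1 hp.le).trans ?_
      rw [mul_rpow_of_nonneg _ _ hp.le]
      gcongr
      rcases max_choice a b with h | h <;> rw [h] <;> assumption
    by_cases hx : ∃ i, x ∈ S i
    · obtain ⟨i, hi⟩ := hx
      by_cases hy : ∃ j, y ∈ S j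
      · obtain ⟨j, hj⟩ := hy
        rcases eq_or_ne i j with rfl | hij
        · rw [hwS i x hi, hwS i y hj]
          exact hone _ (hWT i)
        · have hyi : y ∉ S i := fun h => (hS hij).le_bot ⟨h, hj⟩
          have hxj : x ∉ S j := fun h => (hS hij).le_bot ⟨hi, h⟩
          refine htwo _ _ _ ?_ (hWT i) (hWT j)
          rw [hwS i x hi, hwS j y hj, hW i y hyi, hW j x hxj]
          exact edist_triangle _ _ _
      · push Not at hy
        refine htwo _ _ _ ?_ (hWT i) hΓT
        rw [hwS i x hi, hw y hy, hW i y (hy i), hΓ i x hi]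
        exact edist_triangle _ _ _
    · push Not at hx
      by_cases hy : ∃ j, y ∈ S j
      · obtain ⟨j, hj⟩ := hy
        refine htwo _ _ _ ?_ hΓT (hWT j)
        rw [hw x hx, hwS j y hj, hΓ j y hj, hW j x (hx j)]
        exact edist_triangle _ _ _
      · push Not at hy
        rw [hw x hx, hw y hy]
        exact hone _ hΓT
  have hm1 : ∀ (V : Euc m → N), AEMeasurable V (volume.restrict A) → ∀ x, AEMeasurable
      (fun y => edist (V x) (V y) ^ p / edist x y ^ ((m : ℝ) + s * p)) (volume.restrict A) :=
    fun V hV x => ((aemeasurable_const.edist hV).pow_const p).div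
      ((measurable_const.edist measurable_id).pow_const _).aemeasurable
  have hm2 : ∀ (V : Euc m → N), AEMeasurable V (volume.restrict A) → AEMeasurable
      (fun x => ∫⁻ y in A, edist (V x) (V y) ^ p / edist x y ^ ((m : ℝ) + s * p))
      (volume.restrict A) := fun V hV => (aemeasurable_gker_prod hV).lintegral_prod_right'
  unfold gagliardoEnergy
  rw [← lintegral_tsum fun i => hm2 _ (hWm i), ← lintegral_add_left' (hm2 _ hΓm),
    ← lintegral_const_mul' _ _ h2p]
  refine lintegral_mono fun x => ?_
  rw [← lintegral_tsum fun i => hm1 _ (hWm i) x, ← lintegral_add_left' (hm1 _ hΓm x),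
    ← lintegral_const_mul' _ _ h2p]
  refine lintegral_mono fun y => ?_
  simp only [div_eq_mul_inv]
  rw [ENNReal.tsum_mul_right, ← add_mul, ← mul_assoc]
  gcongr
  exact hpt x y

theorem lintegral_gker_swap {p q : ℝ} {u : Euc m → N} (hu : Measurable u) (A B : Set (Euc m)) :
    ∫⁻ x in A, gker p q u B x = ∫⁻ x in B, gker p q u A x := by
  unfold gker
  rw [lintegral_lintegral_swap]
  · refine lintegral_congr fun x => lintegral_congr fun y => ?_
    rw [edist_comm, edist_comm x y]
  · exact Measurable.aemeasurable ((measurable_edist_rpow (hu.comp measurable_fst)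
      (hu.comp measurable_snd) p).div ((measurable_fst.edist measurable_snd).pow_const q))

/-- The square Z × Z is covered by (Z \ B)², B × Z and Z × B, and the last two have equal integrals
by symmetry. -/
theorem lintegral_gker_split_le {p q : ℝ} {u : Euc m → N} (hu : Measurable u) {Z B : Set (Euc m)}
    (hB : MeasurableSet B) (hBZ : B ⊆ Z) :
    ∫⁻ x in Z, gker p q u Z x ≤
      (∫⁻ x in Z \ B, gker p q u (Z \ B) x) + 2 * ∫⁻ x in B, gker p q u Z x := by
  have h1 : ∀ f : Euc m → ℝ≥0∞, ∫⁻ x in Z, f x = (∫⁻ x in B, f x) + ∫⁻ x in Z \ B, f x := by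
    intro f
    rw [← lintegral_inter_add_sdiff f Z hB, inter_eq_right.2 hBZ]
  have h2 : ∀ x, gker p q u Z x = gker p q u B x + gker p q u (Z \ B) x := fun x => h1 _
  calc ∫⁻ x in Z, gker p q u Z x
      = (∫⁻ x in B, gker p q u Z x) + ∫⁻ x in Z \ B, gker p q u Z x := h1 _
    _ = (∫⁻ x in B, gker p q u Z x) + ((∫⁻ x in Z \ B, gker p q u B x) +
        ∫⁻ x in Z \ B, gker p q u (Z \ B) x) := by
        rw [← lintegral_add_left (measurable_gker hu B)]
        simp only [← h2]
    _ = (∫⁻ x in B, gker p q u Z x) + ((∫⁻ x in B, gker p q u (Z \ B) x) +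
        ∫⁻ x in Z \ B, gker p q u (Z \ B) x) := by rw [lintegral_gker_swap hu (Z \ B) B]
    _ ≤ (∫⁻ x in B, gker p q u Z x) + ((∫⁻ x in B, gker p q u Z x) +
        ∫⁻ x in Z \ B, gker p q u (Z \ B) x) := by
        gcongr with x
        exact gker_mono_set sdiff_subset x
    _ = _ := by ring

theorem volume_ball_le_annulus (hm : 1 ≤ m) (c : Euc m) {r : ℝ} (hr : 0 < r) :
    volume (ball c r) ≤ volume (ball c (2 * r) \ ball c r) := by
  have h1 : volume (ball c (2 * r) \ ball c r) + volume (ball c r) = volume (ball c (2 * r)) := by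
    have := measure_sdiff_add_inter (μ := volume) (ball c (2 * r)) (measurableSet_ball (x := c) (ε := r))
    rwa [inter_eq_right.2 (ball_subset_ball (by linarith))] at this
  have h2 : volume (ball c r) + volume (ball c r) ≤ volume (ball c (2 * r)) := by
    rw [volume_ball_mul c two_pos hr, ← two_mul]
    gcongr
    rw [ENNReal.ofReal_ofNat]
    exact le_self_pow₀ (by norm_num) (by omega)
  rw [← h1] at h2
  exact ENNReal.le_of_add_le_add_right measure_ball_lt_top.ne h2

/-- Localized energy estimate for a map that agrees with another one outside a ball. -/
theorem exists_lintegral_gker_near_le (hm : 1 ≤ m) {p q : ℝ} (hp : 1 ≤ p) (hq : (m : ℝ) < q) :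
    ∃ C : ℝ≥0∞, C ≠ ⊤ ∧ ∀ w v : Euc m → N, Measurable w → Measurable v → ∀ Z : Set (Euc m),
      MeasurableSet Z → ∀ (c : Euc m) (r : ℝ), 0 < r → ball c (2 * r) ⊆ Z →
      (∀ x ∈ Z \ ball c r, w x = v x) →
      ∫⁻ x in ball c r, gker p q w Z x ≤
        C * ((∫⁻ x in ball c (2 * r), gker p q w (ball c (2 * r)) x) +
          ∫⁻ x in ball c (2 * r), gker p q v Z x) := by
  obtain ⟨C₁, hC₁, hC₁0, htail⟩ := exists_tail_kernel (m := m) hq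
  have hq0 : 0 < q := lt_of_le_of_lt (Nat.cast_nonneg m) hq
  set V₁ : ℝ≥0∞ := volume (ball (0 : Euc m) 1) with hV1
  have hV0 : V₁ ≠ 0 := (measure_ball_pos _ _ one_pos).ne'
  have hVt : V₁ ≠ ⊤ := measure_ball_lt_top.ne
  set c2 : ℝ≥0∞ := 2 ^ (p - 1) with hc2
  have hc2t : c2 ≠ ⊤ := rpow_ne_top_of_nonneg (by linarith) (by simp)
  set K : ℝ≥0∞ := c2 * (C₁ * 3 ^ q * V₁⁻¹ + 4 ^ q) with hK
  have h3q : (3 : ℝ≥0∞) ^ q ≠ ⊤ := rpow_ne_top_of_nonneg hq0.le (by simp)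
  have h4q : (4 : ℝ≥0∞) ^ q ≠ ⊤ := rpow_ne_top_of_nonneg hq0.le (by simp)
  have hKt : K ≠ ⊤ := ENNReal.mul_ne_top hc2t (ENNReal.add_ne_top.2
    ⟨ENNReal.mul_ne_top (ENNReal.mul_ne_top hC₁ h3q) (ENNReal.inv_ne_top.2 hV0), h4q⟩)
  refine ⟨1 + K, by finiteness, ?_⟩
  intro w v hw hv Z hZ c r hr hBZ hwv
  set B := ball c r with hB
  set B2 := ball c (2 * r) with hB2
  set A := B2 \ B with hA
  set Y := Z \ B2 with hY
  have hBm : MeasurableSet B := measurableSet_ball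
  have hB2m : MeasurableSet B2 := measurableSet_ball
  have hYm : MeasurableSet Y := hZ.diff hB2m
  have hBB2 : B ⊆ B2 := ball_subset_ball (by linarith)
  set ρ : ℝ≥0∞ := ofReal r with hρ
  have hρ0 : ρ ≠ 0 := by simpa [hρ] using hr
  have hρt : ρ ≠ ⊤ := ofReal_ne_top
  have hVB : volume B = ρ ^ m * V₁ := by
    rw [hB, Measure.addHaar_ball_of_pos _ _ hr, hρ, ENNReal.ofReal_pow hr.le]
    simp [hV1]
  have hVB0 : volume B ≠ 0 := (measure_ball_pos _ _ hr).ne'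
  have hVBt : volume B ≠ ⊤ := measure_ball_lt_top.ne
  set E := ∫⁻ x in B2, gker p q v Z x with hE
  have heq : ∀ x ∈ Z, x ∉ B → w x = v x := fun x hx hxB => hwv x ⟨hx, hxB⟩
  have hdxc : ∀ x ∈ B, edist x c < ρ := fun x hx => by
    rwa [hρ, edist_lt_ofReal]
  have hd2 : ∀ x ∈ B2, edist x c < 2 * ρ := fun x hx => by
    have : edist x c < ofReal (2 * r) := by rw [edist_lt_ofReal]; exact hx
    rwa [ofReal_mul (by norm_num), ENNReal.ofReal_ofNat] at this
  -- A point x of B and a far point y are compared through points η of the annulus A, whose volume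
  -- is at least that of B. Between x and η the energy of w on the doubled ball is used; between η
  -- and y both points are outside B, so w may be replaced by v.
  have hcross : ∀ x ∈ B, volume B * gker p q w Y x ≤
      c2 * (C₁ * 3 ^ q * ρ ^ m * gker p q w B2 x + 4 ^ q * E) := by
    intro x hx
    have hfar : ∀ y ∈ Y, ρ ≤ edist x y := by
      intro y hy
      by_contra hlt
      push Not at hlt
      apply hy.2
      have : edist y c < ofReal (2 * r) := by
        rw [ofReal_mul (by norm_num), ENNReal.ofReal_ofNat, two_mul]
        refine (edist_triangle y x c).trans_lt (ENNReal.add_lt_add ?_ (hdxc x hx))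
        rwa [edist_comm]
      rwa [edist_lt_ofReal] at this
    have hxη : ∀ η ∈ A, edist x η ≤ 3 * ρ := by
      intro η hη
      refine (edist_triangle x c η).trans ?_
      rw [edist_comm c]
      calc edist x c + edist η c ≤ ρ + 2 * ρ := add_le_add (hdxc x hx).le (hd2 η hη.1).le
        _ = 3 * ρ := by ring
    have hpt : ∀ y ∈ Y, volume B * (edist (w x) (w y) ^ p / edist x y ^ q) ≤
        c2 * ((∫⁻ η in A, edist (w x) (w η) ^ p) * edist x y ^ (-q) +
          4 ^ q * ∫⁻ η in A, edist (v η) (v y) ^ p / edist η y ^ q) := by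
      intro y hy
      have hyB : y ∉ B := fun h => hy.2 (hBB2 h)
      have h1 : volume B * edist (w x) (w y) ^ p ≤
          c2 * ((∫⁻ η in A, edist (w x) (w η) ^ p) + ∫⁻ η in A, edist (v η) (v y) ^ p) := by
        refine (mul_le_mul_left (volume_ball_le_annulus hm c hr) _).trans ?_
        rw [← lintegral_add_left (measurable_edist_rpow measurable_const hw p),
          ← lintegral_const_mul' _ _ hc2t, mul_comm, ← setLIntegral_const]
        refine setLIntegral_mono' (hB2m.diff hBm) fun η hη => ?_
        rw [← heq η (hBZ hη.1) hη.2, ← heq y hy.1 hyB]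
        exact edist_rpow_le_add hp _ _ _
      -- Seen from a far point, x and η are at comparable distances: |x - η| ≤ 3r and |x - y| ≥ r
      -- give |η - y| ≤ 4|x - y|.
      have h2 : (∫⁻ η in A, edist (v η) (v y) ^ p) * edist x y ^ (-q) ≤
          4 ^ q * ∫⁻ η in A, edist (v η) (v y) ^ p / edist η y ^ q := by
        have hr0 : edist x y ≠ 0 := fun h => hρ0 (le_zero_iff.1 (h ▸ hfar y hy))
        rw [← lintegral_mul_const' _ _ (ENNReal.rpow_ne_top_of_ne_zero hr0 (edist_ne_top _ _)),
          ← lintegral_const_mul' _ _ h4q]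
        refine setLIntegral_mono' (hB2m.diff hBm) fun η hη => ?_
        have h3 : edist η y ≤ 4 * edist x y := by
          refine (edist_triangle η x y).trans ?_
          rw [edist_comm η x]
          calc edist x η + edist x y ≤ 3 * edist x y + edist x y := by
                gcongr
                exact (hxη η hη).trans (mul_le_mul_right (hfar y hy) _)
            _ = 4 * edist x y := by ring
        have h5 : edist x y ^ (-q) ≤ 4 ^ q * (edist η y ^ q)⁻¹ := by
          have h6 := ENNReal.rpow_le_rpow h3 hq0.le
          rw [mul_rpow_of_nonneg _ _ hq0.le] at h6
          have h7 := ENNReal.inv_le_inv.2 h6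
          rw [ENNReal.mul_inv (Or.inr (rpow_ne_top_of_nonneg hq0.le (edist_ne_top _ _)))
            (Or.inl h4q)] at h7
          have h8 := mul_le_mul_right h7 ((4 : ℝ≥0∞) ^ q)
          rw [← mul_assoc, ENNReal.mul_inv_cancel (by simp) h4q, one_mul] at h8
          rwa [ENNReal.rpow_neg]
        refine (mul_le_mul_right h5 _).trans (le_of_eq ?_)
        rw [div_eq_mul_inv]
        ring
      have h9 := mul_le_mul_left h1 (edist x y ^ (-q))
      rw [div_eq_mul_inv, ← ENNReal.rpow_neg, ← mul_assoc]
      refine h9.trans ?_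
      rw [mul_assoc, add_mul]
      gcongr
    -- Inside the doubled ball the kernel is bounded below, since |x - η| ≤ 3r.
    have hI1 : (∫⁻ η in A, edist (w x) (w η) ^ p) ≤ 3 ^ q * ρ ^ q * gker p q w B2 x := by
      have hne : (3 : ℝ≥0∞) ^ q * ρ ^ q ≠ ⊤ :=
        ENNReal.mul_ne_top h3q (rpow_ne_top_of_nonneg hq0.le hρt)
      rw [gker, ← lintegral_const_mul' _ _ hne]
      refine (setLIntegral_mono' (hB2m.diff hBm) fun η hη => ?_).trans
        (lintegral_mono_set sdiff_subset)
      have hη0 : edist x η ≠ 0 := by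
        rw [Ne, edist_eq_zero]
        rintro rfl
        exact hη.2 hx
      have h1 := ENNReal.rpow_le_rpow (hxη η hη) hq0.le
      rw [mul_rpow_of_nonneg _ _ hq0.le] at h1
      have hne0 : edist x η ^ q ≠ 0 := by simp [hη0, edist_ne_top]
      have hnet : edist x η ^ q ≠ ⊤ := rpow_ne_top_of_nonneg hq0.le (edist_ne_top _ _)
      calc edist (w x) (w η) ^ p = edist x η ^ q * (edist (w x) (w η) ^ p / edist x η ^ q) :=
            (ENNReal.mul_div_cancel hne0 hnet).symm
        _ ≤ _ := by gcongr
    have hI2 : ∫⁻ y in Y, ∫⁻ η in A, edist (v η) (v y) ^ p / edist η y ^ q ≤ E := by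
      have : ∫⁻ y in Y, ∫⁻ η in A, edist (v η) (v y) ^ p / edist η y ^ q =
          ∫⁻ y in Y, gker p q v A y := by
        refine lintegral_congr fun y => lintegral_congr fun η => ?_
        rw [edist_comm, edist_comm η]
      rw [this, lintegral_gker_swap hv]
      exact lintegral_gker_mono sdiff_subset sdiff_subset
    have hI3 : ∫⁻ y in Y, edist x y ^ (-q) ≤ C₁ * ρ ^ ((m : ℝ) - q) :=
      (lintegral_mono_set hfar).trans (htail x ρ)
    calc volume B * gker p q w Y x
        = ∫⁻ y in Y, volume B * (edist (w x) (w y) ^ p / edist x y ^ q) := by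
          rw [gker, lintegral_const_mul' _ _ hVBt]
      _ ≤ ∫⁻ y in Y, c2 * ((∫⁻ η in A, edist (w x) (w η) ^ p) * edist x y ^ (-q) +
          4 ^ q * ∫⁻ η in A, edist (v η) (v y) ^ p / edist η y ^ q) :=
          setLIntegral_mono' hYm hpt
      _ = c2 * ((∫⁻ η in A, edist (w x) (w η) ^ p) * (∫⁻ y in Y, edist x y ^ (-q)) +
          4 ^ q * ∫⁻ y in Y, ∫⁻ η in A, edist (v η) (v y) ^ p / edist η y ^ q) := by
          have hme : Measurable fun y : Euc m => edist x y ^ (-q) := by fun_prop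
          rw [lintegral_const_mul' _ _ hc2t, lintegral_add_left (hme.const_mul _),
            lintegral_const_mul _ hme, lintegral_const_mul' _ _ h4q]
      _ ≤ c2 * ((3 ^ q * ρ ^ q * gker p q w B2 x) * (C₁ * ρ ^ ((m : ℝ) - q)) + 4 ^ q * E) := by
          gcongr
      _ = _ := by
          have e : ρ ^ q * ρ ^ ((m : ℝ) - q) = ρ ^ m := by
            rw [← ENNReal.rpow_add _ _ hρ0 hρt, ← ENNReal.rpow_natCast]
            congr 1
            ring
          rw [← e]
          ring
  have hsplit : ∀ x, gker p q w Z x = gker p q w B2 x + gker p q w Y x := by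
    intro x
    rw [gker, ← lintegral_inter_add_sdiff _ Z hB2m, inter_eq_right.2 hBZ]
    rfl
  have hYint : ∫⁻ x in B, gker p q w Y x ≤ K * ((∫⁻ x in B2, gker p q w B2 x) + E) := by
    have h1 : volume B * ∫⁻ x in B, gker p q w Y x ≤
        c2 * (C₁ * 3 ^ q * ρ ^ m * (∫⁻ x in B2, gker p q w B2 x) + volume B * (4 ^ q * E)) := by
      rw [← lintegral_const_mul' _ _ hVBt]
      refine (setLIntegral_mono' hBm hcross).trans ?_
      rw [lintegral_const_mul' _ _ hc2t, lintegral_add_right _ measurable_const,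
        lintegral_const_mul _ (measurable_gker hw _), setLIntegral_const, mul_comm (4 ^ q * E)]
      gcongr
    have h2 : C₁ * 3 ^ q * ρ ^ m * (∫⁻ x in B2, gker p q w B2 x) =
        volume B * (C₁ * 3 ^ q * V₁⁻¹ * ∫⁻ x in B2, gker p q w B2 x) := by
      rw [hVB]
      calc _ = (V₁ * V₁⁻¹) * (C₁ * 3 ^ q * ρ ^ m * (∫⁻ x in B2, gker p q w B2 x)) := by
            rw [ENNReal.mul_inv_cancel hV0 hVt, one_mul]
        _ = _ := by ring
    rw [h2, ← mul_add, mul_left_comm, ENNReal.mul_le_mul_iff_right hVB0 hVBt] at h1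
    refine h1.trans ?_
    rw [hK, mul_assoc c2]
    refine mul_le_mul_right ?_ c2
    rw [mul_add, add_mul, add_mul]
    exact add_le_add le_self_add le_add_self
  calc ∫⁻ x in B, gker p q w Z x
      = (∫⁻ x in B, gker p q w B2 x) + ∫⁻ x in B, gker p q w Y x := by
        simp only [hsplit]
        rw [lintegral_add_left (measurable_gker hw B2)]
    _ ≤ ((∫⁻ x in B2, gker p q w B2 x) + E) + K * ((∫⁻ x in B2, gker p q w B2 x) + E) := by
        refine add_le_add ((lintegral_mono_set hBB2).trans le_self_add) hYint
    _ = _ := by ring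

/-- The localized estimate with the constant b as comparison map, whose energy is zero. -/
theorem exists_gagliardoEnergy_far_le (hm : 1 ≤ m) {s p : ℝ} (hp : 1 ≤ p) (hsp : 0 < s * p) :
    ∃ C : ℝ≥0∞, C ≠ ⊤ ∧ ∀ w : Euc m → N, Measurable w → ∀ (b : N) (c : Euc m) (r : ℝ), 0 < r →
      (∀ x ∉ ball c r, w x = b) →
      gagliardoEnergy s p w univ ≤ C * gagliardoEnergy s p w (ball c (2 * r)) := by
  obtain ⟨C, hC, h⟩ := exists_lintegral_gker_near_le (N := N) hm hp
    (show (m : ℝ) < m + s * p by linarith)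
  refine ⟨2 * C, by finiteness, fun w hw b c r hr hwb => ?_⟩
  have h1 := h w (fun _ => b) hw measurable_const univ MeasurableSet.univ c r hr (subset_univ _)
    (fun x hx => hwb x hx.2)
  simp only [gker_const _ _ (by linarith : 0 < p), lintegral_zero, add_zero] at h1
  rw [gagliardoEnergy_eq, gagliardoEnergy_eq]
  refine (lintegral_gker_split_le hw measurableSet_ball (subset_univ (ball c r))).trans ?_
  have hm0 : MeasurableSet (univ \ ball c r) := MeasurableSet.univ.diff measurableSet_ball
  rw [lintegral_gker_congr (w := fun _ => b) hm0 hm0 (fun x hx => hwb x hx.2)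
    (fun x hx => hwb x hx.2)]
  simp only [gker_const _ _ (by linarith : 0 < p), lintegral_zero, zero_add, mul_assoc]
  gcongr

/-! ### Inversion in the sphere and extension for the Gagliardo energy. -/

/-- Lebesgue measure is a multiple of the m-dimensional Hausdorff measure, for which Lipschitz
images are controlled. -/
theorem volume_image_le_of_lipschitzOnWith {g : Euc m → Euc m} {T : Set (Euc m)} {K : NNReal}
    (hg : LipschitzOnWith K g T) : volume (g '' T) ≤ (K : ℝ≥0∞) ^ m * volume T := by
  have : (Measure.hausdorffMeasure (Module.finrank ℝ (Euc m)) : Measure (Euc m)).IsAddHaarMeasure :=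
    isAddHaarMeasure_hausdorffMeasure
  have h1 := Measure.isAddLeftInvariant_eq_smul (volume : Measure (Euc m))
    (Measure.hausdorffMeasure (Module.finrank ℝ (Euc m)))
  have h2 := hg.hausdorffMeasure_image_le (d := Module.finrank ℝ (Euc m)) (Nat.cast_nonneg _)
  rw [h1]
  simp only [Measure.smul_apply]
  rw [ENNReal.rpow_natCast] at h2
  have h3 : Module.finrank ℝ (Euc m) = m := by simp
  rw [ENNReal.smul_def, ENNReal.smul_def, smul_eq_mul, smul_eq_mul, mul_left_comm]
  refine mul_le_mul_right (h2.trans (le_of_eq ?_)) _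
  rw [h3]

/-- The assumption says that Φ is injective on U with K-Lipschitz inverse, so a preimage in U is a
Lipschitz image of a subset of s. -/
theorem map_restrict_le_of_antilipschitz {Φ : Euc m → Euc m} (hΦ : Measurable Φ) {U : Set (Euc m)}
    {K : NNReal} (h : ∀ x ∈ U, ∀ y ∈ U, edist x y ≤ K * edist (Φ x) (Φ y)) :
    (volume.restrict U).map Φ ≤ (K : ℝ≥0∞) ^ m • volume := by
  refine Measure.le_iff.2 fun s hs => ?_
  rw [Measure.map_apply hΦ hs, Measure.restrict_apply (hΦ hs), Measure.smul_apply, smul_eq_mul]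
  set V := Φ ⁻¹' s ∩ U with hV
  have hinj : InjOn Φ V := fun x hx y hy hxy => by
    have := h x hx.2 y hy.2
    rw [hxy, edist_self, mul_zero] at this
    exact edist_le_zero.1 this
  have hg : LipschitzOnWith K (Function.invFunOn Φ V) (Φ '' V) := by
    rintro _ ⟨x, hx, rfl⟩ _ ⟨y, hy, rfl⟩
    rw [hinj.leftInvOn_invFunOn hx, hinj.leftInvOn_invFunOn hy]
    exact h x hx.2 y hy.2
  have h1 := volume_image_le_of_lipschitzOnWith hg
  have h2 : Function.invFunOn Φ V '' (Φ '' V) = V := hinj.leftInvOn_invFunOn.image_image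
  rw [h2] at h1
  refine h1.trans ?_
  gcongr
  rintro _ ⟨x, hx, rfl⟩
  exact hx.1

/-- A segment from inside to outside crosses the unit sphere, where both estimates are available,
and the lengths of its two parts add up. -/
theorem lipschitzWith_of_closedBall {F : Type*} [PseudoEMetricSpace F] {f : Euc m → F} {K : NNReal}
    (h1 : LipschitzOnWith K f (closedBall 0 1)) (h2 : LipschitzOnWith K f {x | 1 ≤ ‖x‖}) :
    LipschitzWith K f := by
  have key : ∀ x y : Euc m, ‖x‖ ≤ 1 → 1 ≤ ‖y‖ → edist (f x) (f y) ≤ K * edist x y := by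
    intro x y hx hy
    have hc : ContinuousOn (fun t : ℝ => ‖AffineMap.lineMap (k := ℝ) x y t‖) (Icc 0 1) := by
      apply Continuous.continuousOn
      fun_prop
    obtain ⟨t, ht, hz⟩ := intermediate_value_Icc (zero_le_one (α := ℝ)) hc
      (show (1 : ℝ) ∈ Icc _ _ by simpa using ⟨hx, hy⟩)
    set z : Euc m := AffineMap.lineMap (k := ℝ) x y t with hzdef
    have hz1 : ‖z‖ = 1 := hz
    have hd : edist x z + edist z y = edist x y := by
      have h1 : dist x z + dist z y = dist x y := by
        rw [hzdef, dist_left_lineMap, dist_lineMap_right, Real.norm_of_nonneg ht.1,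
          Real.norm_of_nonneg (by linarith [ht.2])]
        ring
      rw [edist_dist, edist_dist, edist_dist, ← ENNReal.ofReal_add dist_nonneg dist_nonneg, h1]
    calc edist (f x) (f y) ≤ edist (f x) (f z) + edist (f z) (f y) := edist_triangle _ _ _
      _ ≤ K * edist x z + K * edist z y := add_le_add
          (h1 (by simpa using hx) (by simp [hz1])) (h2 (by simp [hz1]) hy)
      _ = K * edist x y := by rw [← mul_add, hd]
  intro x y
  rcases le_total ‖x‖ 1 with hx | hx <;> rcases le_total ‖y‖ 1 with hy | hy
  · exact h1 (by simpa using hx) (by simpa using hy)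
  · exact key x y hx hy
  · rw [edist_comm, edist_comm x]
    exact key y x hy hx
  · exact h2 hx hy

/-- The inversion with respect to the unit sphere. -/
noncomputable def sphereInv (x : Euc m) : Euc m := (‖x‖ ^ 2)⁻¹ • x

theorem norm_sphereInv (x : Euc m) : ‖sphereInv x‖ = ‖x‖⁻¹ := by
  rcases eq_or_ne x 0 with rfl | hx
  · simp [sphereInv]
  have : ‖x‖ ≠ 0 := norm_ne_zero_iff.2 hx
  rw [sphereInv, norm_smul, norm_inv, norm_pow, norm_norm]
  field_simp

theorem norm_sphereInv_sub {x y : Euc m} (hx : x ≠ 0) (hy : y ≠ 0) :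
    ‖sphereInv x - sphereInv y‖ = ‖x - y‖ / (‖x‖ * ‖y‖) := by
  have hx' : 0 < ‖x‖ := norm_pos_iff.2 hx
  have hy' : 0 < ‖y‖ := norm_pos_iff.2 hy
  have h : ‖sphereInv x - sphereInv y‖ ^ 2 = (‖x - y‖ / (‖x‖ * ‖y‖)) ^ 2 := by
    rw [div_pow, norm_sub_sq_real, norm_sub_sq_real, norm_sphereInv, norm_sphereInv, sphereInv,
      sphereInv, real_inner_smul_left, real_inner_smul_right]
    field_simp
    ring
  exact (sq_eq_sq₀ (norm_nonneg _) (by positivity)).1 h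

theorem measurable_sphereInv : Measurable (sphereInv : Euc m → Euc m) := by
  unfold sphereInv
  fun_prop

theorem sphereInv_lipschitzOnWith : LipschitzOnWith 1 sphereInv {x : Euc m | 1 ≤ ‖x‖} := by
  refine LipschitzOnWith.of_dist_le_mul fun x hx y hy => ?_
  have hx' : 1 ≤ ‖x‖ := hx
  have hy' : 1 ≤ ‖y‖ := hy
  rw [dist_eq_norm, dist_eq_norm, norm_sphereInv_sub (norm_pos_iff.1 (by linarith))
    (norm_pos_iff.1 (by linarith)), NNReal.coe_one, one_mul]
  exact div_le_self (norm_nonneg _) (one_le_mul_of_one_le_of_one_le hx' hy')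

/-- Inversion satisfies |x - y| = |x||y| |x' - y'| for the images x', y', so it compresses lengths
at most by R² for |x|, |y| < R. -/
theorem map_sphereInv_le {R : NNReal} :
    (volume.restrict {x : Euc m | 1 < ‖x‖ ∧ ‖x‖ < R}).map sphereInv ≤
      ((R * R : NNReal) : ℝ≥0∞) ^ m • volume := by
  refine map_restrict_le_of_antilipschitz measurable_sphereInv fun x hx y hy => ?_
  have hx0 : 0 < ‖x‖ := by linarith [hx.1]
  have hy0 : 0 < ‖y‖ := by linarith [hy.1]
  have h := norm_sphereInv_sub (norm_pos_iff.1 hx0) (norm_pos_iff.1 hy0)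
  have h2 : ‖x - y‖ ≤ (R * R) * ‖sphereInv x - sphereInv y‖ := by
    rw [eq_div_iff (by positivity)] at h
    rw [← h, mul_comm]
    gcongr
    · exact hx.2.le
    · exact hy.2.le
  rw [edist_eq_enorm_sub, edist_eq_enorm_sub, enorm_eq_nnnorm, enorm_eq_nnnorm]
  exact_mod_cast h2

/-- The map that is the identity on the unit ball and an opened inversion outside. -/
noncomputable def extMap (a : Euc m) (x : Euc m) : Euc m :=
  open scoped Classical in
  if ‖x‖ ≤ 1 then x else openMap 0 a (1 / 6) (sphereInv x)

theorem extMap_of_le {a x : Euc m} (h : ‖x‖ ≤ 1) : extMap a x = x := if_pos h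

theorem extMap_of_ge {a x : Euc m} (ha : a ∈ ball (0 : Euc m) (1 / 12)) (h : 1 ≤ ‖x‖) :
    extMap a x = openMap 0 a (1 / 6) (sphereInv x) := by
  rcases h.eq_or_lt with h | h
  · rw [extMap_of_le h.symm.le, sphereInv, ← h]
    simp only [one_pow, inv_one, one_smul]
    rw [openMap_eq_self (by simp) (by norm_num)]
    have h1 := norm_sub_norm_le x a
    have h2 : ‖a‖ < 1 / 12 := by simpa using ha
    linarith
  · exact if_neg (by linarith)

theorem extMap_lipschitz {a : Euc m} (ha : a ∈ ball (0 : Euc m) (1 / 12)) :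
    LipschitzWith 3 (extMap a) := by
  refine lipschitzWith_of_closedBall ?_ ?_
  · intro x hx y hy
    rw [extMap_of_le (by simpa using hx), extMap_of_le (by simpa using hy)]
    exact le_mul_of_one_le_left zero_le (by norm_num)
  · intro x hx y hy
    rw [extMap_of_ge ha hx, extMap_of_ge ha hy]
    refine (openMap_lipschitz (by simp) a (by norm_num) _ _).trans ?_
    have := sphereInv_lipschitzOnWith hx hy
    rw [ENNReal.coe_one, one_mul] at this
    gcongr

theorem norm_extMap_le {a : Euc m} (ha : a ∈ ball (0 : Euc m) (1 / 12)) (x : Euc m) :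
    ‖extMap a x‖ ≤ 1 := by
  rcases le_or_gt ‖x‖ 1 with h | h
  · rwa [extMap_of_le h]
  · rw [extMap_of_ge ha h.le]
    have ha' : ‖a‖ < 1 / 12 := by simpa using ha
    have hb : sphereInv x ∈ ball (0 : Euc m) 1 := by
      rw [mem_ball_zero_iff, norm_sphereInv]
      exact inv_lt_one_of_one_lt₀ h
    have := openMap_mem_ball (t := 0) (by simp) (ρ := 1 / 6) (by norm_num) (a := a) (c := 0) (r := 1)
      (ball_subset_ball' (by rw [dist_zero_right]; linarith)) hb
    rw [mem_ball_zero_iff] at this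
    exact this.le

theorem extMap_far {a : Euc m} (ha : a ∈ ball (0 : Euc m) (1 / 12)) {x : Euc m}
    (hx : x ∉ ball (0 : Euc m) 12) : extMap a x = a := by
  have hx' : 12 ≤ ‖x‖ := by simpa using hx
  have ha' : ‖a‖ < 1 / 12 := by simpa using ha
  rw [extMap_of_ge ha (by linarith), openMap_zero_eq (by norm_num)]
  have h1 : ‖sphereInv x‖ ≤ 1 / 12 := by
    rw [norm_sphereInv, one_div]
    exact inv_anti₀ (by norm_num) hx'
  exact (norm_sub_le _ _).trans (by linarith)

/-- Outside the unit ball `extMap` is an inversion followed by an opening. The inversion pushes the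
measure of the annulus forward to a measure bounded by a multiple of Lebesgue measure, and the
averaged choice of the centre controls the opening. -/
theorem exists_ext_center : ∃ C : ℝ≥0∞, C ≠ ⊤ ∧ ∀ F : Euc m → ℝ≥0∞, Measurable F →
    ∀ P : Euc m → Prop, (∀ᵐ a, a ∈ ball (0 : Euc m) 1 → P a) →
    ∃ a ∈ ball (0 : Euc m) (1 / 12), P a ∧
      ∫⁻ x in ball (0 : Euc m) (1 / 2), F (openMap 0 a (1 / 6) x) ≤
        8 ^ m * ∫⁻ x in ball (0 : Euc m) (1 / 2), F x ∧
      ∫⁻ x in ball (0 : Euc m) 24, F (extMap a x) ≤ C * ∫⁻ x in ball (0 : Euc m) 1, F x := by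
  -- The unit ball, where the map is the identity, accounts for 1. The annulus 1 < |x| < 24 accounts
  -- for the distortion 24² per dimension of the inversion times 8^m + 1: 8^m inside the ball of
  -- radius 1/2 affected by the opening, 1 outside it.
  refine ⟨1 + ((24 * 24 : NNReal) : ℝ≥0∞) ^ m * (8 ^ m + 1), by finiteness, fun F hF P hP => ?_⟩
  obtain ⟨a, ha, hPa, hI⟩ := exists_open_center hF (0 : Euc m) (ρ := 1 / 6) (by norm_num) (P := P)
    (by filter_upwards [hP] with a h1 h2 using h1 (ball_subset_ball (by norm_num) h2))
  norm_num at ha hI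
  have ha12 : a ∈ ball (0 : Euc m) (1 / 12) := by simpa using ha
  refine ⟨a, ha12, hPa, by simpa using hI, ?_⟩
  set I := ∫⁻ x in ball (0 : Euc m) 1, F x with hIdef
  have hop : ∫⁻ y in ball (0 : Euc m) 1, F (openMap 0 a (1 / 6) y) ≤ (8 ^ m + 1) * I := by
    rw [← lintegral_inter_add_sdiff _ _ (measurableSet_ball (x := (0 : Euc m)) (ε := 1 / 2)),
      inter_eq_right.2 (ball_subset_ball (by norm_num)), add_mul, one_mul]
    refine add_le_add ?_ ?_
    · refine (by simpa using hI : _ ≤ _).trans ?_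
      gcongr
      exact lintegral_mono_set (ball_subset_ball (by norm_num))
    · refine (setLIntegral_mono' (g := F) (measurableSet_ball.diff measurableSet_ball)
        fun y hy => ?_).trans (lintegral_mono_set sdiff_subset)
      rw [openMap_eq_self (by simp) (by norm_num)]
      have h1 : 1 / 2 ≤ ‖y‖ := by simpa using hy.2
      have h2 := norm_sub_norm_le y a
      have ha' : ‖a‖ < 1 / 12 := by simpa using ha12
      linarith
  set S : Set (Euc m) := {x | 1 < ‖x‖ ∧ ‖x‖ < (24 : NNReal)} with hS
  have hsub : ball (0 : Euc m) 24 ⊆ ball 0 1 ∪ (sphere 0 1 ∪ S) := by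
    intro x hx
    have hx' : ‖x‖ < 24 := by simpa using hx
    rcases lt_trichotomy ‖x‖ 1 with h | h | h
    · left; simpa using h
    · right; left; simpa using h
    · right; right; exact ⟨h, by simpa using hx'⟩
  have hSm : MeasurableSet S := (measurableSet_lt measurable_const measurable_norm).inter
    (measurableSet_lt measurable_norm measurable_const)
  refine (lintegral_mono_set hsub).trans ((lintegral_union_le _ _ _).trans ?_)
  rw [add_mul, one_mul]
  refine add_le_add (le_of_eq ?_) ((lintegral_union_le _ _ _).trans ?_)
  · refine setLIntegral_congr_fun measurableSet_ball fun x hx => ?_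
    rw [extMap_of_le (by simpa using (mem_ball_zero_iff.1 hx).le)]
  · have h0 : ∫⁻ x in sphere (0 : Euc m) 1, F (extMap a x) = 0 :=
      setLIntegral_measure_zero _ _ (Measure.addHaar_sphere_of_ne_zero _ _ one_ne_zero)
    rw [h0, zero_add, mul_assoc]
    calc ∫⁻ x in S, F (extMap a x) = ∫⁻ x in S, F (openMap 0 a (1 / 6) (sphereInv x)) :=
          setLIntegral_congr_fun hSm fun x hx => by rw [extMap_of_ge ha12 hx.1.le]
      _ ≤ ((24 * 24 : NNReal) : ℝ≥0∞) ^ m * ∫⁻ y in ball (0 : Euc m) 1, F (openMap 0 a (1 / 6) y) := by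
          refine setLIntegral_comp_le (f := fun y => F (openMap 0 a (1 / 6) y))
            measurable_sphereInv map_sphereInv_le subset_rfl (fun x hx => ?_) measurableSet_ball
            (hF.comp (continuous_openMap _ _ _).measurable).aemeasurable
          rw [mem_ball_zero_iff, norm_sphereInv]
          exact inv_lt_one_of_one_lt₀ hx.1
      _ ≤ _ := by gcongr

/-- With r = l and t = l/R, the point z is pulled towards the origin to (1 - t)z. The ball of radius
t around it stays in the unit ball, and in the ball of radius l around z because 2t ≤ l. -/
theorem volume_ball_inter_eball_ge (hm : 1 ≤ m) {z : Euc m} (hz : ‖z‖ ≤ 1) {R : ℝ} (hR : 2 ≤ R) {r : ℝ≥0∞}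
    (hr : r ≤ ofReal R) :
    volume (ball (0 : Euc m) 1) * (ofReal R)⁻¹ ^ m * r ^ m ≤
      volume (ball (0 : Euc m) 1 ∩ eball z r) := by
  have hrt : r ≠ ⊤ := ne_top_of_le_ne_top ofReal_ne_top hr
  obtain ⟨l, hl, rfl⟩ : ∃ l : ℝ, 0 ≤ l ∧ r = ofReal l :=
    ⟨r.toReal, ENNReal.toReal_nonneg, (ENNReal.ofReal_toReal hrt).symm⟩
  have hlR : l ≤ R := (ENNReal.ofReal_le_ofReal_iff (by linarith)).1 hr
  rcases hl.eq_or_lt with rfl | hl0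
  · simp [(show m ≠ 0 by omega)]
  set t := l / R with ht
  have ht0 : 0 < t := by positivity
  have ht1 : t ≤ 1 := (div_le_one (by linarith)).2 hlR
  have ht2 : 2 * t ≤ l := by
    rw [ht, mul_div_assoc', div_le_iff₀ (by linarith)]
    nlinarith
  have hsub : ball ((1 - t) • z) t ⊆ ball (0 : Euc m) 1 ∩ eball z (ofReal l) := by
    intro y hy
    rw [mem_ball, dist_eq_norm] at hy
    constructor
    · rw [mem_ball_zero_iff]
      have e : y = (y - (1 - t) • z) + (1 - t) • z := by abel
      rw [e]
      refine (norm_add_le _ _).trans_lt ?_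
      rw [norm_smul, Real.norm_of_nonneg (by linarith)]
      nlinarith
    · rw [Metric.eball_ofReal, mem_ball, dist_eq_norm]
      have e : y - z = (y - (1 - t) • z) - t • z := by module
      rw [e]
      refine (norm_sub_le _ _).trans_lt ?_
      rw [norm_smul, Real.norm_of_nonneg ht0.le]
      nlinarith
  refine le_trans (le_of_eq ?_) (measure_mono hsub)
  rw [Measure.addHaar_ball_of_pos _ _ ht0, ht, ENNReal.ofReal_pow (by positivity),
    ENNReal.ofReal_div_of_pos (by linarith), div_eq_mul_inv, mul_pow, finrank_euclideanSpace,
    Fintype.card_fin]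
  ring

theorem exists_gagliardoEnergy_extension (hm : 1 ≤ m) {s p : ℝ} (hp : 1 ≤ p) (hsp : 0 < s * p) :
    ∃ C : ℝ≥0∞, C ≠ ⊤ ∧ ∀ u : Euc m → N, AEMeasurable u (volume.restrict (ball 0 1)) →
      ∃ (w : Euc m → N) (b : N), AEMeasurable w ∧ EqOn w u (ball 0 1) ∧
        (∀ x ∉ ball (0 : Euc m) 12, w x = b) ∧
        gagliardoEnergy s p w univ ≤ C * gagliardoEnergy s p u (ball 0 1) := by
  classical
  set q := (m : ℝ) + s * p with hq
  have hqm : (m : ℝ) < q := by linarith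
  have hq0 : 0 < q := lt_of_le_of_lt (Nat.cast_nonneg m) hqm
  -- Distances between points of the ball of radius 24 are at most 48, which is the value of R in
  -- the density estimate.
  set κ : ℝ≥0∞ := volume (ball (0 : Euc m) 1) * (ofReal 48)⁻¹ ^ m with hκ
  have hκ0 : κ ≠ 0 := mul_ne_zero (measure_ball_pos _ _ one_pos).ne' (pow_ne_zero _ (by simp))
  have hκt : κ ≠ ⊤ := ENNReal.mul_ne_top measure_ball_lt_top.ne (ENNReal.pow_ne_top (by simp))
  obtain ⟨C₁, hC₁, h1⟩ := exists_lintegral_comp_le_gker (N := N) hp hqm hq0 κ hκ0 hκt 3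
  obtain ⟨C₂, hC₂, h2⟩ := exists_ext_center (m := m)
  obtain ⟨C₃, hC₃, h3⟩ := exists_gagliardoEnergy_far_le (N := N) hm hp hsp
  refine ⟨C₃ * (C₁ * C₂), by finiteness, fun u hu => ?_⟩
  obtain ⟨u', hu'm, huu'⟩ := hu
  obtain ⟨a, ha, -, -, hI⟩ := h2 (gker p q u' (ball 0 1)) (measurable_gker hu'm _) (fun _ => True)
    (by simp)
  have hΨ := (extMap_lipschitz ha).continuous.measurable
  have hball : (volume.restrict (ball (0 : Euc m) 1) : Measure (Euc m)) = volume.restrict (ball 0 1) := rfl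
  set w' : Euc m → N := fun x => u' (extMap a x) with hw'
  have hw'm : Measurable w' := hu'm.comp hΨ
  -- The extension has to equal u at every point of the unit ball, whereas w' only equals it almost
  -- everywhere there.
  set w : Euc m → N := (ball (0 : Euc m) 1).piecewise u w' with hw
  have hww' : w =ᵐ[volume] w' := by
    have := (ae_restrict_iff' measurableSet_ball).1 huu'
    filter_upwards [this] with x hx
    by_cases hxb : x ∈ ball (0 : Euc m) 1
    · rw [hw, piecewise_eq_of_mem _ _ _ hxb, hx hxb, hw']
      simp only
      rw [extMap_of_le (by simpa using (mem_ball_zero_iff.1 hxb).le)]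
    · rw [hw, piecewise_eq_of_notMem _ _ _ hxb]
  refine ⟨w, u' a, ⟨w', hw'm, hww'⟩, fun x hx => piecewise_eq_of_mem _ _ _ hx, fun x hx => ?_, ?_⟩
  · rw [hw, piecewise_eq_of_notMem _ _ _ (fun h => hx (ball_subset_ball (by norm_num) h)), hw']
    simp only
    rw [extMap_far ha hx]
  · rw [gagliardoEnergy_congr_ae (ae_restrict_of_ae hww'), gagliardoEnergy_congr_ae huu']
    -- The map is constant outside the ball of radius 12, so its energy on the whole space is
    -- controlled on the ball of radius 24.
    have h4 := h3 w' hw'm (u' a) 0 12 (by norm_num) (fun x hx => by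
      rw [hw']
      simp only
      rw [extMap_far ha hx])
    refine h4.trans ?_
    rw [mul_assoc, mul_assoc]
    refine mul_le_mul_right ?_ _
    have h5 := h1 u' hu'm (ball 0 1) (ball 0 24) measurableSet_ball measurableSet_ball (extMap a) hΨ
      ((extMap_lipschitz ha).lipschitzOnWith) (fun x hx y hy => by
        refine volume_ball_inter_eball_ge hm (norm_extMap_le ha x) (by norm_num) ?_
        refine (edist_triangle_right x y 0).trans ?_
        rw [show (48 : ℝ) = 24 + 24 by norm_num, ENNReal.ofReal_add (by norm_num) (by norm_num)]
        refine add_le_add ?_ ?_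
        · rw [edist_dist]; exact ofReal_le_ofReal (mem_ball.1 hx).le
        · rw [edist_dist]; exact ofReal_le_ofReal (mem_ball.1 hy).le)
    norm_num only at h5 ⊢
    refine h5.trans ?_
    gcongr
    exact hI

/-! ### Insertion for the Gagliardo energy. -/

theorem tendsto_setLIntegral_ball_zero (hm : 1 ≤ m) {F : Euc m → ℝ≥0∞} {A : Set (Euc m)}
    (hF : ∫⁻ x in A, F x ≠ ⊤) (hA : ball 0 1 ⊆ A) {τ : ℝ≥0∞} (hτ : τ ≠ 0) :
    ∃ r : ℝ, 0 < r ∧ r ≤ 1 ∧ ∫⁻ x in ball 0 r, F x ≤ τ := by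
  have hnt : Nontrivial (Euc m) := by
    have : Nonempty (Fin m) := ⟨⟨0, hm⟩⟩
    infer_instance
  obtain ⟨δ, hδ, h⟩ := exists_pos_setLIntegral_lt_of_measure_lt
    (μ := volume.restrict A) hF hτ
  have hlim : Tendsto (fun r : ℝ => ofReal (r ^ m) * volume (ball (0 : Euc m) 1)) (𝓝[>] 0)
      (𝓝 0) := by
    have h1 : Tendsto (fun r : ℝ => ofReal (r ^ m)) (𝓝[>] 0) (𝓝 0) := by
      have : Tendsto (fun r : ℝ => ofReal (r ^ m)) (𝓝 0) (𝓝 (ofReal (0 ^ m))) :=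
        ((ENNReal.continuous_ofReal.comp (continuous_pow m)).tendsto 0)
      rw [zero_pow (by omega), ENNReal.ofReal_zero] at this
      exact this.mono_left nhdsWithin_le_nhds
    simpa using ENNReal.Tendsto.mul_const h1 (Or.inr measure_ball_lt_top.ne)
  have hev := (hlim.eventually_lt_const hδ).and (Ioo_mem_nhdsGT (zero_lt_one (α := ℝ)))
  obtain ⟨r, hr, hr0, hr1⟩ := hev.exists
  refine ⟨r, hr0, hr1.le, ?_⟩
  have h2 := h (ball 0 r) (by
    rw [Measure.restrict_apply measurableSet_ball]
    refine (measure_mono inter_subset_left).trans_lt ?_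
    rw [Measure.addHaar_ball_of_pos _ _ hr0]
    simpa using hr)
  rw [Measure.restrict_restrict measurableSet_ball, inter_eq_left.2
    ((ball_subset_ball hr1.le).trans hA)] at h2
  exact h2.le

/-- Insertion of maps of small energy in a map of finite Gagliardo energy. -/
theorem exists_gagliardo_insertion (hm : 1 ≤ m) {s p : ℝ} (hp : 1 ≤ p) (hsp : 0 < s * p) :
    ∃ C : NNReal → ℝ≥0∞, (∀ K, C K ≠ ⊤) ∧ ∀ v : Euc m → N,
      AEMeasurable v (volume.restrict (ball 0 1)) → gagliardoEnergy s p v (ball 0 1) < ⊤ →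
      ∀ ε : ℝ, 0 < ε → ∀ τ : ℝ≥0∞, τ ≠ 0 → ∃ (a : Euc m) (ρ : ℝ) (b : N) (δ : ℝ≥0∞), 0 < ρ ∧ δ ≠ 0 ∧
        ball a ρ ⊆ ball 0 ε ∧ ball a ρ ⊆ ball 0 1 ∧
        ∀ W : Euc m → N, AEMeasurable W → (∀ x ∉ ball a ρ, W x = b) →
          gagliardoEnergy s p W univ ≤ δ → ∃ w : Euc m → N,
            AEMeasurable w (volume.restrict (ball 0 1)) ∧ EqOn w v (ball 0 1 \ ball 0 ε) ∧
            EqOn w W (ball a ρ) ∧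
            gagliardoEnergy s p w (ball 0 1) ≤ gagliardoEnergy s p v (ball 0 1) + τ ∧
            gagliardoEnergy s p v (ball 0 1) ≤ gagliardoEnergy s p w (ball 0 1) + τ ∧
            ∀ (ν : ℕ) (f : N → Euc ν) (K : NNReal), LipschitzWith K f →
              ∫⁻ x in ball 0 1, ‖f (w x) - f (v x)‖ₑ ^ p ≤ C K * τ ∧
              gagliardoEnergy s p (fun x => f (w x) - f (v x)) (ball 0 1) ≤ C K * τ := by
  classical
  set q := (m : ℝ) + s * p with hq
  have hqm : (m : ℝ) < q := by linarith
  have hq0 : 0 < q := lt_of_le_of_lt (Nat.cast_nonneg m) hqm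
  have hp0 : 0 < p := by linarith
  set κ : ℝ≥0∞ := volume (ball (0 : Euc m) 1) with hκ
  have hκ0 : κ ≠ 0 := (measure_ball_pos _ _ one_pos).ne'
  have hκt : κ ≠ ⊤ := measure_ball_lt_top.ne
  have hB1 : (ball (0 : Euc m) 1 \ ball 0 (1 / 2)) = ball 0 (2 * (1 / 2)) \ ball 0 (1 / 2) := by
    norm_num
  set V : ℝ≥0∞ := volume (ball (0 : Euc m) 1 \ ball 0 (1 / 2)) with hV
  have hV0 : V ≠ 0 := by
    rw [hV, hB1]
    exact ((measure_ball_pos _ _ (by norm_num)).trans_le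
      (volume_ball_le_annulus hm 0 (by norm_num))).ne'
  have hVt : V ≠ ⊤ := ((measure_mono sdiff_subset).trans_lt measure_ball_lt_top).ne
  have h2p : (2 : ℝ≥0∞) ^ p ≠ ⊤ := rpow_ne_top_of_nonneg hp0.le (by simp)
  have h2p1 : (2 : ℝ≥0∞) ^ (p - 1) ≠ ⊤ := rpow_ne_top_of_nonneg (by linarith) (by simp)
  have h2q : (2 : ℝ≥0∞) ^ q ≠ ⊤ := rpow_ne_top_of_nonneg hq0.le (by simp)
  obtain ⟨C₁, hC₁, h1⟩ := exists_lintegral_comp_le_gker (N := N) hp hqm hq0 κ hκ0 hκt 3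
  obtain ⟨C₃, hC₃, h3⟩ := exists_lintegral_gker_near_le (N := N) hm hp hqm
  -- The opened map costs C₁(8^m + 1) and the bubble 1; gluing multiplies by 2^p; the localized
  -- estimate adds 1 for v and multiplies by C₃. The last summand makes M ≥ 1, so that Mσ bounds the
  -- density of v as well.
  set M : ℝ≥0∞ := C₃ * (2 ^ p * (C₁ * (8 ^ m + 1) + 1) + 1) + 1 with hM
  have hMt : M ≠ ⊤ := by finiteness
  refine ⟨fun K => (2 ^ q * V⁻¹ + 2) * ((K : ℝ≥0∞) ^ p * 2 ^ (p - 1)), fun K => ?_, ?_⟩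
  · refine ENNReal.mul_ne_top (ENNReal.add_ne_top.2 ⟨ENNReal.mul_ne_top h2q
      (ENNReal.inv_ne_top.2 hV0), by simp⟩) (ENNReal.mul_ne_top ?_ h2p1)
    exact rpow_ne_top_of_nonneg hp0.le (by simp)
  intro v hv hvE ε hε τ hτ
  obtain ⟨v', hv'm, hvv'⟩ := hv
  set F := gker p q v' (ball 0 1) with hF
  have hFm : Measurable F := measurable_gker hv'm _
  have hFE : ∫⁻ x in ball 0 1, F x = gagliardoEnergy s p v (ball 0 1) := by
    rw [gagliardoEnergy_congr_ae hvv', gagliardoEnergy_eq]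
  obtain ⟨σ, hσ0, hσ⟩ := exists_ne_zero_mul_le (c := 4 * M) (ε := τ) (by finiteness) hτ
  obtain ⟨r, hr0, hr1, hrF⟩ := tendsto_setLIntegral_ball_zero hm (F := F) (A := ball 0 1)
    (by rw [hFE]; exact hvE.ne) subset_rfl hσ0
  -- The modification lives in the ball of radius 3ρ and the estimates in the ball of radius 6ρ; the
  -- factor 24 leaves room for the comparison balls, which reach radius 18ρ.
  set ρ : ℝ := min r ε / 24 with hρ
  have hρ0 : 0 < ρ := by positivity
  have hρr : 24 * ρ ≤ r := by rw [hρ]; linarith [min_le_left r ε]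
  have hρε : 24 * ρ ≤ ε := by rw [hρ]; linarith [min_le_right r ε]
  obtain ⟨a, ha, -, hI⟩ := exists_open_center hFm (0 : Euc m) hρ0 (P := fun _ => True) (by simp)
  have ha' : ‖a‖ < ρ / 2 := by simpa using ha
  have h0mem : (0 : ℝ) ∈ Icc (0 : ℝ) 1 := by simp
  set Φ := openMap 0 a ρ with hΦ
  have hΦm : Measurable Φ := (continuous_openMap _ _ _).measurable
  have hsub3 : ball a ρ ⊆ ball (0 : Euc m) (3 * ρ) := ball_subset_ball' (by
    rw [dist_zero_right]; linarith)
  have hΦid : ∀ x ∉ ball (0 : Euc m) (3 * ρ), Φ x = x := by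
    intro x hx
    have hx' : 3 * ρ ≤ ‖x‖ := by simpa using hx
    refine openMap_eq_self h0mem hρ0 ?_
    linarith [norm_sub_norm_le x a]
  have hF6 : ∫⁻ x in ball (0 : Euc m) (6 * ρ), F (Φ x) ≤ (8 ^ m + 1) * σ := by
    rw [← lintegral_inter_add_sdiff _ _ (measurableSet_ball (x := (0 : Euc m)) (ε := 3 * ρ)),
      inter_eq_right.2 (ball_subset_ball (by linarith)), add_mul, one_mul]
    refine add_le_add (hI.trans ?_) ?_
    · gcongr
      exact (lintegral_mono_set (ball_subset_ball (by linarith))).trans hrF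
    · refine (setLIntegral_mono' (g := F) (measurableSet_ball.diff measurableSet_ball)
        fun y hy => ?_).trans ((lintegral_mono_set
          (sdiff_subset.trans (ball_subset_ball (by linarith)))).trans hrF)
      rw [hΦid y hy.2]
  set v₁ : Euc m → N := fun x => v' (Φ x) with hv₁
  have hv₁m : Measurable v₁ := hv'm.comp hΦm
  have hΦ18 : ∀ x ∈ ball (0 : Euc m) (6 * ρ), Φ x ∈ ball (0 : Euc m) (6 * ρ) := fun x hx => by
    refine openMap_mem_ball h0mem hρ0 (ball_subset_ball' ?_) hx
    rw [dist_zero_right]; linarith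
  have hE1 : gagliardoEnergy s p v₁ (ball 0 (6 * ρ)) ≤ C₁ * ((8 ^ m + 1) * σ) := by
    refine (h1 v' hv'm (ball 0 1) (ball 0 (6 * ρ)) measurableSet_ball measurableSet_ball Φ hΦm
      (openMap_lipschitz h0mem a hρ0).lipschitzOnWith fun x hx y hy => ?_).trans ?_
    -- For z in this ball |z| < |Φ(x)| + |x - y| < 6ρ + 12ρ ≤ 1. Its intersection with the unit ball
    -- is therefore the full ball, and κ is the volume of the unit ball.
    · have hsub : eball (Φ x) (edist x y) ⊆ ball 0 1 := by
        intro z hz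
        have h2 : edist z (Φ x) < edist x y := hz
        rw [edist_dist, edist_dist, ENNReal.ofReal_lt_ofReal_iff_of_nonneg dist_nonneg] at h2
        have h3 := dist_triangle z (Φ x) 0
        have h4 := mem_ball.1 (hΦ18 x hx)
        have h5 := dist_triangle_right x y 0
        have h6 := mem_ball.1 hx
        have h7 := mem_ball.1 hy
        rw [mem_ball]
        linarith
      rw [inter_eq_right.2 hsub]
      rcases eq_or_ne x y with rfl | hxy
      · simp [(show m ≠ 0 by omega)]
      · rw [edist_dist, Metric.eball_ofReal, Measure.addHaar_ball_of_pos _ _ (dist_pos.2 hxy),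
          finrank_euclideanSpace, Fintype.card_fin, ENNReal.ofReal_pow dist_nonneg, mul_comm]
    · gcongr
  -- The opened map takes the value v'(a) on the whole ball around a, so this is the constant that a
  -- bubble must have outside the ball.
  refine ⟨a, ρ, v' a, σ, hρ0, hσ0, hsub3.trans (ball_subset_ball (by linarith)),
    hsub3.trans (ball_subset_ball (by linarith)), ?_⟩
  intro W hW hWb hWE
  obtain ⟨W₀, hW₀m, hWW₀⟩ := hW
  set W' : Euc m → N := (ball a ρ).piecewise W₀ (fun _ => v' a) with hW'
  have hW'm : Measurable W' := Measurable.piecewise measurableSet_ball hW₀m measurable_const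
  have hWW' : W =ᵐ[volume] W' := by
    filter_upwards [hWW₀] with x hx
    by_cases hxb : x ∈ ball a ρ
    · rw [hW', piecewise_eq_of_mem _ _ _ hxb, hx]
    · rw [hW', piecewise_eq_of_notMem _ _ _ hxb, hWb x hxb]
  have hW'E : gagliardoEnergy s p W' (ball 0 (6 * ρ)) ≤ σ := by
    refine le_trans ?_ hWE
    rw [gagliardoEnergy_congr_ae (ae_restrict_of_ae hWW')]
    exact lintegral_gker_mono (subset_univ _) (subset_univ _)
  set w' : Euc m → N := (ball a ρ).piecewise W' v₁ with hw'
  have hw'm : Measurable w' := Measurable.piecewise measurableSet_ball hW'm hv₁m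
  have hw'E : gagliardoEnergy s p w' (ball 0 (6 * ρ)) ≤ 2 ^ p * (C₁ * (8 ^ m + 1) + 1) * σ := by
    have h5 := gagliardoEnergy_glue_le (s := s) hp0 (A := ball (0 : Euc m) (6 * ρ))
      (S := fun _ : Unit => ball a ρ) (W := fun _ => W') (Γ := v₁) (w := w') (c := v' a)
      (fun i j hij => (hij rfl).elim)
      (fun _ x hx => piecewise_eq_of_notMem _ _ _ hx)
      (fun _ x hx => by
        rw [hv₁, hΦ]
        simp only
        rw [openMap_zero_eq hρ0 (by simpa [dist_eq_norm] using (mem_ball.1 hx).le)])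
      (fun _ x hx => piecewise_eq_of_mem _ _ _ hx)
      (fun x hx => piecewise_eq_of_notMem _ _ _ (hx ()))
      (fun _ => hW'm.aemeasurable) hv₁m.aemeasurable
    refine h5.trans ?_
    rw [tsum_fintype]
    simp only [Finset.univ_unique, Finset.sum_const, Finset.card_singleton, one_smul]
    rw [mul_assoc (2 ^ p), add_mul, one_mul, mul_assoc C₁]
    gcongr
  have hw'v' : ∀ x ∈ ball (0 : Euc m) 1 \ ball 0 (3 * ρ), w' x = v' x := by
    intro x hx
    rw [hw', piecewise_eq_of_notMem _ _ _ (fun h => hx.2 (hsub3 h)), hv₁]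
    simp only
    rw [hΦid x hx.2]
  set B : Set (Euc m) := ball 0 (3 * ρ) with hB
  have hBB : B ⊆ ball 0 1 := ball_subset_ball (by linarith)
  have hLw : ∫⁻ x in B, gker p q w' (ball 0 1) x ≤ M * σ := by
    refine (h3 w' v' hw'm hv'm (ball 0 1) measurableSet_ball 0 (3 * ρ) (by positivity)
      (ball_subset_ball (by linarith)) hw'v').trans ?_
    rw [show 2 * (3 * ρ) = 6 * ρ by ring, hM, add_mul _ 1, mul_assoc C₃, add_mul _ 1, one_mul]
    refine le_add_of_le_of_nonneg ?_ zero_le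
    gcongr
    · exact hw'E
    · exact (lintegral_mono_set (ball_subset_ball (by linarith))).trans hrF
  have hLv : ∫⁻ x in B, gker p q v' (ball 0 1) x ≤ M * σ := by
    refine ((lintegral_mono_set (ball_subset_ball (by linarith))).trans hrF).trans ?_
    exact le_mul_of_one_le_left zero_le (by rw [hM]; exact le_add_self)
  have h2M : 2 * (M * σ) ≤ τ := by
    refine le_trans ?_ hσ
    rw [← mul_assoc]
    gcongr
    norm_num
  have hMM : M * σ + M * σ ≤ τ := by rw [← two_mul]; exact h2M
  have hBm : MeasurableSet B := measurableSet_ball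
  have hdm : MeasurableSet (ball (0 : Euc m) 1 \ B) := measurableSet_ball.diff hBm
  -- The representatives W', w' and v' are only almost everywhere equal to the given maps. The final
  -- map uses W and v themselves where pointwise equality is required.
  set w : Euc m → N := fun x => if x ∈ ball a ρ then W x else if x ∈ B then w' x else v x with hw
  have hww' : w =ᵐ[volume.restrict (ball 0 1)] w' := by
    filter_upwards [ae_restrict_mem measurableSet_ball, hvv', ae_restrict_of_ae hWW'] with x hx1 hxv hxW
    simp only [hw]
    split_ifs with h4 h5
    · rw [hw', piecewise_eq_of_mem _ _ _ h4, hxW]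
    · rfl
    · rw [hw'v' x ⟨hx1, h5⟩, hxv]
  refine ⟨w, ⟨w', hw'm, hww'⟩, ?_, ?_, ?_, ?_, ?_⟩
  · intro x hx
    have hxB : x ∉ B := fun h => hx.2 (ball_subset_ball (by linarith) h)
    simp only [hw]
    rw [if_neg (fun h => hxB (hsub3 h)), if_neg hxB]
  · intro x hx
    simp only [hw]
    rw [if_pos hx]
  · rw [gagliardoEnergy_congr_ae hww', gagliardoEnergy_congr_ae hvv', gagliardoEnergy_eq,
      gagliardoEnergy_eq]
    refine (lintegral_gker_split_le hw'm hBm hBB).trans ?_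
    rw [lintegral_gker_congr hdm hdm hw'v' hw'v']
    refine add_le_add (lintegral_gker_mono sdiff_subset sdiff_subset) ?_
    exact (mul_le_mul_right hLw _).trans h2M
  · rw [gagliardoEnergy_congr_ae hww', gagliardoEnergy_congr_ae hvv', gagliardoEnergy_eq,
      gagliardoEnergy_eq]
    refine (lintegral_gker_split_le hv'm hBm hBB).trans ?_
    rw [← lintegral_gker_congr hdm hdm hw'v' hw'v']
    refine add_le_add (lintegral_gker_mono sdiff_subset sdiff_subset) ?_
    exact (mul_le_mul_right hLv _).trans h2M
  · intro ν f K hf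
    set h : Euc m → Euc ν := fun x => f (w' x) - f (v' x) with hh
    have hhm : Measurable h := (hf.continuous.measurable.comp hw'm).sub
      (hf.continuous.measurable.comp hv'm)
    have hae : (fun x => f (w x) - f (v x)) =ᵐ[volume.restrict (ball 0 1)] h := by
      filter_upwards [hww', hvv'] with x h4 h5
      rw [h4, h5]
    have hh0 : ∀ x ∈ ball (0 : Euc m) 1 \ B, h x = 0 := fun x hx => by
      rw [hh]
      simp only
      rw [hw'v' x hx, sub_self]
    have hKt : (K : ℝ≥0∞) ^ p * 2 ^ (p - 1) ≠ ⊤ :=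
      ENNReal.mul_ne_top (rpow_ne_top_of_nonneg hp0.le (by simp)) h2p1
    have hpt : ∀ x y, edist (h x) (h y) ^ p ≤ K ^ p * 2 ^ (p - 1) *
        (edist (w' x) (w' y) ^ p + edist (v' x) (v' y) ^ p) := by
      intro x y
      have e1 : edist (h x) (h y) ≤ K * (edist (w' x) (w' y) + edist (v' x) (v' y)) := by
        have e2 : h x - h y = (f (w' x) - f (w' y)) - (f (v' x) - f (v' y)) := by
          simp only [hh]; abel
        rw [edist_eq_enorm_sub, e2, mul_add]
        refine enorm_sub_le.trans (add_le_add ?_ ?_)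
        · rw [← edist_eq_enorm_sub]; exact hf _ _
        · rw [← edist_eq_enorm_sub]; exact hf _ _
      refine (ENNReal.rpow_le_rpow e1 hp0.le).trans ?_
      rw [mul_rpow_of_nonneg _ _ hp0.le, mul_assoc]
      gcongr
      exact ENNReal.rpow_add_le_mul_rpow_add_rpow _ _ hp
    have hLh : ∫⁻ x in B, gker p q h (ball 0 1) x ≤ K ^ p * 2 ^ (p - 1) * τ := by
      calc ∫⁻ x in B, gker p q h (ball 0 1) x
          ≤ ∫⁻ x in B, K ^ p * 2 ^ (p - 1) *
            (gker p q w' (ball 0 1) x + gker p q v' (ball 0 1) x) := by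
            refine lintegral_mono fun x => ?_
            unfold gker
            have hmm : Measurable fun y => edist (w' x) (w' y) ^ p / edist x y ^ q :=
              ((measurable_const.edist hw'm).pow_const p).div
                ((measurable_const.edist measurable_id).pow_const q)
            rw [← lintegral_add_left hmm,
              ← lintegral_const_mul' _ _ hKt]
            refine lintegral_mono fun y => ?_
            simp only [div_eq_mul_inv]
            rw [← add_mul, ← mul_assoc]
            gcongr
            exact hpt x y
        _ = K ^ p * 2 ^ (p - 1) * ((∫⁻ x in B, gker p q w' (ball 0 1) x) +
              ∫⁻ x in B, gker p q v' (ball 0 1) x) := by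
            rw [lintegral_const_mul' _ _ hKt, lintegral_add_left (measurable_gker hw'm _)]
        _ ≤ K ^ p * 2 ^ (p - 1) * τ := by
            gcongr
            exact (add_le_add hLw hLv).trans hMM
    constructor
    · have e1 : ∫⁻ x in ball 0 1, ‖f (w x) - f (v x)‖ₑ ^ p = ∫⁻ x in B, ‖h x‖ₑ ^ p := by
        have e2 : ∫⁻ x in ball 0 1, ‖f (w x) - f (v x)‖ₑ ^ p = ∫⁻ x in ball 0 1, ‖h x‖ₑ ^ p :=
          lintegral_congr_ae (by filter_upwards [hae] with x hx; rw [hx])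
        rw [e2, ← lintegral_inter_add_sdiff _ _ hBm, inter_eq_right.2 hBB]
        have e3 : ∫⁻ x in ball 0 1 \ B, ‖h x‖ₑ ^ p = 0 := by
          rw [setLIntegral_congr_fun (g := fun _ => 0) hdm (fun x hx => by
            simp only [hh0 x hx, enorm_zero, ENNReal.zero_rpow_of_pos hp0])]
          simp
        rw [e3, add_zero]
      rw [e1]
      -- A Poincaré type bound: h vanishes on the annulus between the radii 1/2 and 1, of measure V,
      -- which is at distance at most 2 from x. Integrating the kernel over that annulus recovers
      -- |h(x)|^p.
      have e4 : ∀ x ∈ B, ‖h x‖ₑ ^ p ≤ 2 ^ q * V⁻¹ * gker p q h (ball 0 1) x := by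
        intro x hx
        have e5 : V * ‖h x‖ₑ ^ p ≤ 2 ^ q * gker p q h (ball 0 1) x := by
          rw [mul_comm, ← setLIntegral_const, gker, ← lintegral_const_mul' _ _ h2q]
          refine (setLIntegral_mono' (measurableSet_ball.diff measurableSet_ball)
            fun y hy => ?_).trans (lintegral_mono_set sdiff_subset)
          have hyB : y ∉ B := fun h => hy.2 (ball_subset_ball (by linarith) h)
          have hxy : x ≠ y := fun h => hyB (h ▸ hx)
          rw [hh0 y ⟨hy.1, hyB⟩, edist_zero_right]
          have e6 : edist x y ≤ 2 := by
            refine (edist_triangle_right x y 0).trans ?_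
            refine (add_le_add (b := 1) (d := 1) ?_ ?_).trans one_add_one_eq_two.le
            · rw [edist_dist, ← ofReal_one]
              exact ofReal_le_ofReal (mem_ball.1 (hBB hx)).le
            · rw [edist_dist, ← ofReal_one]
              exact ofReal_le_ofReal (mem_ball.1 hy.1).le
          have e7 : edist x y ^ q ≠ 0 := by simp [hxy, edist_ne_top]
          have e8 : edist x y ^ q ≠ ⊤ := rpow_ne_top_of_nonneg hq0.le (edist_ne_top _ _)
          calc ‖h x‖ₑ ^ p = edist x y ^ q * (‖h x‖ₑ ^ p / edist x y ^ q) :=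
                (ENNReal.mul_div_cancel e7 e8).symm
            _ ≤ _ := by gcongr
        calc ‖h x‖ₑ ^ p = V⁻¹ * (V * ‖h x‖ₑ ^ p) := by
              rw [← mul_assoc, ENNReal.inv_mul_cancel hV0 hVt, one_mul]
          _ ≤ V⁻¹ * (2 ^ q * gker p q h (ball 0 1) x) := by gcongr
          _ = _ := by ring
      refine (setLIntegral_mono' hBm e4).trans ?_
      rw [lintegral_const_mul' _ _ (ENNReal.mul_ne_top h2q (ENNReal.inv_ne_top.2 hV0)), mul_assoc _ _ τ]
      gcongr
      exact le_self_add
    · rw [gagliardoEnergy_congr_ae hae, gagliardoEnergy_eq]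
      refine (lintegral_gker_split_le hhm hBm hBB).trans ?_
      rw [lintegral_gker_congr (w := fun _ => 0) hdm hdm hh0 hh0]
      simp only [gker_const _ _ hp0, lintegral_zero, zero_add]
      rw [mul_assoc _ _ τ]
      refine (mul_le_mul_right hLh 2).trans ?_
      gcongr
      exact le_add_self

/-! ### Zero capacity of points for the Gagliardo energy. -/

/-- Lipschitz cut-off functions that are admissible for the capacity of the origin. -/
structure IsCutoff (η : Euc m → ℝ) : Prop where
  lip : ∃ K, LipschitzWith K η
  mem : ∀ x, η x ∈ Icc (0 : ℝ) 1
  one : ∃ r, 0 < r ∧ r ≤ 1 ∧ ∀ x ∈ ball 0 r, η x = 1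
  zero : ∀ x ∉ ball 0 1, η x = 0

theorem exists_isCutoff : ∃ η : Euc m → ℝ, IsCutoff η := by
  refine ⟨fun x => max 0 (min 1 (2 - 2 * ‖x‖)), ⟨2, ?_⟩, fun x => ⟨le_max_left _ _, ?_⟩,
    ⟨1 / 2, by norm_num, by norm_num, fun x hx => ?_⟩, fun x hx => ?_⟩
  · refine LipschitzWith.const_max (LipschitzWith.const_min ?_ _) _
    refine LipschitzWith.of_dist_le_mul fun x y => ?_
    rw [Real.dist_eq, dist_eq_norm, show (2 - 2 * ‖x‖ - (2 - 2 * ‖y‖)) = 2 * (‖y‖ - ‖x‖) by ring,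
      abs_mul, norm_sub_rev]
    have := abs_norm_sub_norm_le y x
    norm_num
    linarith
  · exact max_le zero_le_one (min_le_left _ _)
  · have : ‖x‖ < 1 / 2 := by simpa using hx
    rw [min_eq_left (by linarith), max_eq_right zero_le_one]
  · have : 1 ≤ ‖x‖ := by simpa using hx
    rw [min_eq_right (by linarith), max_eq_left (by linarith)]

theorem IsCutoff.comp_homothety {η : Euc m → ℝ} (hη : IsCutoff η) {l : ℝ} (hl : 0 < l)
    (hl1 : l ≤ 1) : IsCutoff fun x => η (l⁻¹ • (x - 0)) := by
  obtain ⟨K, hK⟩ := hη.lip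
  obtain ⟨r, hr, hr1, h1⟩ := hη.one
  refine ⟨⟨K * (‖l⁻¹‖₊ * 1), hK.comp ((lipschitzWith_smul l⁻¹).comp ?_)⟩, fun x => hη.mem _,
    ⟨l * r, by positivity, by nlinarith, fun x hx => h1 _ ?_⟩, fun x hx => hη.zero _ ?_⟩
  · exact LipschitzWith.of_dist_le_mul fun x y => by simp
  · have : ‖x‖ < l * r := by simpa using hx
    rw [mem_ball, dist_zero_right, sub_zero, norm_smul, Real.norm_eq_abs, abs_of_pos (by positivity),
      inv_mul_lt_iff₀ hl]
    exact this
  · have : 1 ≤ ‖x‖ := by simpa using hx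
    rw [mem_ball, dist_zero_right, sub_zero, norm_smul, Real.norm_eq_abs, abs_of_pos (by positivity),
      inv_mul_lt_iff₀ hl, mul_one]
    linarith

theorem IsCutoff.average {η η' : Euc m → ℝ} (hη : IsCutoff η) (hη' : IsCutoff η') :
    IsCutoff fun x => (η x + η' x) * (1 / 2) := by
  obtain ⟨K, hK⟩ := hη.lip
  obtain ⟨K', hK'⟩ := hη'.lip
  obtain ⟨r, hr, hr1, h1⟩ := hη.one
  obtain ⟨r', hr', -, h1'⟩ := hη'.one
  refine ⟨⟨‖(1 / 2 : ℝ)‖₊ * (K + K'), ?_⟩, fun x => ?_,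
    ⟨min r r', lt_min hr hr', (min_le_left _ _).trans hr1, fun x hx => ?_⟩, fun x hx => ?_⟩
  · have := (lipschitzWith_smul (α := ℝ) (β := ℝ) (1 / 2 : ℝ)).comp (hK.add hK')
    have e : (fun x => (η x + η' x) * (1 / 2)) = fun x => (1 / 2 : ℝ) • (η x + η' x) := by
      ext x; simp [mul_comm]
    rw [e]
    exact this
  · have h2 := hη.mem x
    have h3 := hη'.mem x
    exact ⟨by linarith [h2.1, h3.1], by linarith [h2.2, h3.2]⟩
  · rw [h1 x (ball_subset_ball (min_le_left _ _) hx), h1' x (ball_subset_ball (min_le_right _ _) hx)]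
    norm_num
  · rw [hη.zero x hx, hη'.zero x hx]
    norm_num

/-- The infimum I of E over cut-offs is finite and satisfies I ≤ cI with c < 1, hence I = 0. No
explicit, logarithmic, minimizing sequence is needed. -/
theorem exists_isCutoff_le {E : (Euc m → ℝ) → ℝ≥0∞} {c : ℝ≥0∞} (hc : c < 1)
    (hfin : ∀ η, IsCutoff η → E η ≠ ⊤)
    (hstep : ∀ η, IsCutoff η → ∀ θ : ℝ≥0∞, θ ≠ 0 → ∃ η', IsCutoff η' ∧ E η' ≤ c * E η + θ)
    {δ : ℝ≥0∞} (hδ : δ ≠ 0) : ∃ η, IsCutoff η ∧ E η ≤ δ := by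
  set I : ℝ≥0∞ := ⨅ (η : {η : Euc m → ℝ // IsCutoff η}), E η with hI
  obtain ⟨η₀, hη₀⟩ := exists_isCutoff (m := m)
  have hIt : I ≠ ⊤ := ((iInf_le _ (⟨η₀, hη₀⟩ : {η : Euc m → ℝ // IsCutoff η})).trans_lt
    (hfin η₀ hη₀).lt_top).ne
  have hne : Nonempty {η : Euc m → ℝ // IsCutoff η} := ⟨⟨η₀, hη₀⟩⟩
  have h1 : I ≤ c * I := by
    rw [hI, ENNReal.mul_iInf' (fun h => absurd h hc.ne_top) (fun _ => hne)]
    refine le_iInf fun η => ?_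
    refine ENNReal.le_of_forall_pos_le_add fun θ hθ _ => ?_
    obtain ⟨η', h2, h3⟩ := hstep η η.2 θ (by exact_mod_cast hθ.ne')
    exact (iInf_le _ (⟨η', h2⟩ : {η : Euc m → ℝ // IsCutoff η})).trans h3
  have hI0 : I = 0 := by
    by_contra h0
    have : c * I < 1 * I := ENNReal.mul_lt_mul_left h0 hIt hc
    rw [one_mul] at this
    exact absurd h1 this.not_ge
  have h2 : I < δ := by rw [hI0]; exact pos_iff_ne_zero.2 hδ
  obtain ⟨η, hη⟩ := iInf_lt_iff.1 h2
  exact ⟨η, η.2, hη.le⟩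

theorem lintegral_far_le {q : ℝ} (hq : (m : ℝ) < q) {r : ℝ} (hr : 0 < r) :
    ∃ T : ℝ≥0∞, T ≠ ⊤ ∧ ∀ B : Set (Euc m), MeasurableSet B →
      ∫⁻ x, ∫⁻ y, {z : Euc m × Euc m | z.1 ∈ B ∧ ofReal r ≤ edist z.1 z.2}.indicator
        (fun z => edist z.1 z.2 ^ (-q)) (x, y) ≤ T * volume B := by
  obtain ⟨C, hC, -, hT⟩ := exists_tail_kernel hq
  refine ⟨C * ofReal r ^ ((m : ℝ) - q), ENNReal.mul_ne_top hC ?_, fun B hB => ?_⟩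
  · rw [ENNReal.ofReal_rpow_of_pos hr]
    exact ofReal_ne_top
  · calc _ ≤ ∫⁻ x, B.indicator (fun _ => C * ofReal r ^ ((m : ℝ) - q)) x := by
          refine lintegral_mono fun x => ?_
          by_cases hx : x ∈ B
          · rw [indicator_of_mem hx]
            refine le_trans (le_of_eq ?_) (hT x _)
            have hms : MeasurableSet {y : Euc m | ofReal r ≤ edist x y} :=
              measurableSet_le measurable_const (measurable_const.edist measurable_id)
            rw [← lintegral_indicator hms]
            refine lintegral_congr fun y => ?_
            by_cases hy : ofReal r ≤ edist x y
            · rw [indicator_of_mem (by exact ⟨hx, hy⟩), indicator_of_mem (by exact hy)]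
            · rw [indicator_of_notMem (fun h => hy h.2), indicator_of_notMem (by exact hy)]
          · have : ∀ y, {z : Euc m × Euc m | z.1 ∈ B ∧ ofReal r ≤ edist z.1 z.2}.indicator
                (fun z => edist z.1 z.2 ^ (-q)) (x, y) = 0 := fun y =>
              indicator_of_notMem (fun h => hx h.1) _
            simp [this]
      _ = _ := by rw [lintegral_indicator hB, setLIntegral_const]

theorem lintegral_const_mul_add_add {X : Type*} [MeasurableSpace X] {μ : Measure X}
    {f g h : X → ℝ≥0∞} (hf : Measurable f) (hg : Measurable g) (hh : Measurable h) (k : X → ℝ≥0∞)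
    {c : ℝ≥0∞} (hc : c ≠ ⊤) :
    ∫⁻ x, (c * (f x + g x) + (h x + k x)) ∂μ =
      c * ((∫⁻ x, f x ∂μ) + ∫⁻ x, g x ∂μ) + ((∫⁻ x, h x ∂μ) + ∫⁻ x, k x ∂μ) := by
  have hm : Measurable fun x => c * (f x + g x) := (hf.add hg).const_mul c
  rw [lintegral_add_left hm, lintegral_const_mul' _ _ hc, lintegral_add_left hf,
    lintegral_add_left hh]

/-- The function η' varies only where η is already 1. For most pairs of points only one of the two
varies, and the factor 1/2 becomes 2^(-p). The remaining pairs have one point in the ball of radius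
l and are at a distance bounded below, so their total contribution is proportional to the volume of
that small ball. -/
theorem gagliardoEnergy_average_le {s p : ℝ} (hp : 1 ≤ p) (hsp : 0 < s * p) {η : Euc m → ℝ}
    (hη : IsCutoff η) : ∃ T : ℝ≥0∞, T ≠ ⊤ ∧ ∃ r, 0 < r ∧ ∀ η' : Euc m → ℝ, IsCutoff η' → ∀ l < r,
      (∀ x ∉ ball 0 l, η' x = 0) →
      gagliardoEnergy s p (fun x => (η x + η' x) * (1 / 2)) univ ≤
        2 ^ (-p) * (gagliardoEnergy s p η univ + gagliardoEnergy s p η' univ) +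
          T * volume (ball (0 : Euc m) l) := by
  obtain ⟨r, hr, -, h1⟩ := hη.one
  set q := (m : ℝ) + s * p with hq
  have hp0 : 0 < p := by linarith
  have hqm : (m : ℝ) < q := by linarith
  have hq0 : 0 < q := lt_of_le_of_lt (Nat.cast_nonneg m) hqm
  obtain ⟨T, hT, hTB⟩ := lintegral_far_le (m := m) hqm (half_pos hr)
  refine ⟨T + T, by finiteness, r / 2, half_pos hr, fun η' hη' l hl h0 => ?_⟩
  obtain ⟨K, hK⟩ := hη.lip
  obtain ⟨K', hK'⟩ := hη'.lip
  have hm1 : Measurable η := hK.continuous.measurable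
  have hm2 : Measurable η' := hK'.continuous.measurable
  obtain ⟨g, hg⟩ : ∃ g : Euc m × Euc m → ℝ≥0∞, g = {z : Euc m × Euc m | z.1 ∈ ball 0 l ∧
      ofReal (r / 2) ≤ edist z.1 z.2}.indicator (fun z => edist z.1 z.2 ^ (-q)) := ⟨_, rfl⟩
  have hgm : Measurable g := by
    rw [hg]
    refine Measurable.indicator ((measurable_fst.edist measurable_snd).pow_const _) ?_
    exact (measurableSet_ball.preimage measurable_fst).inter
      (measurableSet_le measurable_const (measurable_fst.edist measurable_snd))
  have hgT : ∫⁻ x, ∫⁻ y, g (x, y) ≤ T * volume (ball (0 : Euc m) l) := by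
    rw [hg]; exact hTB _ measurableSet_ball
  have hgT' : ∫⁻ x, ∫⁻ y, g (y, x) ≤ T * volume (ball (0 : Euc m) l) := by
    rw [lintegral_lintegral_swap (f := fun x y => g (y, x)) (hgm.comp measurable_swap).aemeasurable]
    exact hgT
  have hfar : ∀ x ∈ ball (0 : Euc m) l, ∀ y ∉ ball (0 : Euc m) r,
      edist x y ^ (-q) ≤ g (x, y) := by
    intro x hx y hy
    rw [hg, indicator_of_mem]
    refine ⟨hx, ?_⟩
    simp only
    rw [edist_dist]
    refine ofReal_le_ofReal ?_
    have h3 : r ≤ dist y 0 := by simpa using hy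
    have h4 := mem_ball.1 hx
    have h5 := dist_triangle_left y 0 x
    linarith
  have hedist : ∀ a ∈ Icc (0 : ℝ) 1, ∀ b ∈ Icc (0 : ℝ) 1, edist a b ≤ 1 := by
    intro a ha b hb
    rw [edist_dist, ← ofReal_one]
    refine ofReal_le_ofReal ?_
    rw [Real.dist_eq, abs_le]
    constructor <;> linarith [ha.1, ha.2, hb.1, hb.2]
  have hav := hη.average hη'
  have h2p : (2 : ℝ≥0∞) ^ (-p) ≠ ⊤ := by simp
  have hpt : ∀ x y, edist ((η x + η' x) * (1 / 2)) ((η y + η' y) * (1 / 2)) ^ p / edist x y ^ q ≤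
      2 ^ (-p) * (edist (η x) (η y) ^ p / edist x y ^ q + edist (η' x) (η' y) ^ p / edist x y ^ q) +
        (g (x, y) + g (y, x)) := by
    intro x y
    have hhalf : ∀ a b : ℝ, edist (a * (1 / 2)) (b * (1 / 2)) = edist a b / 2 := by
      intro a b
      rw [edist_dist, edist_dist, Real.dist_eq, Real.dist_eq, ← sub_mul, abs_mul,
        abs_of_pos (show (0 : ℝ) < 1 / 2 by norm_num), mul_one_div,
        ENNReal.ofReal_div_of_pos two_pos]
      norm_num
    have hp2 : ∀ a : ℝ≥0∞, (a / 2) ^ p = 2 ^ (-p) * a ^ p := by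
      intro a
      rw [ENNReal.div_rpow_of_nonneg _ _ hp0.le, ENNReal.rpow_neg, mul_comm, div_eq_mul_inv]
    -- On the exceptional pairs the difference of the averaged cut-offs is merely bounded by 1, and
    -- the kernel is estimated by g.
    by_cases hbad : (x ∈ ball (0 : Euc m) l ∧ y ∉ ball (0 : Euc m) r) ∨
        (y ∈ ball (0 : Euc m) l ∧ x ∉ ball (0 : Euc m) r)
    · refine le_trans ?_ (le_add_self)
      have h6 : edist x y ^ (-q) ≤ g (x, y) + g (y, x) := by
        rcases hbad with h | h
        · exact (hfar x h.1 y h.2).trans le_self_add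
        · rw [edist_comm]; exact (hfar y h.1 x h.2).trans le_add_self
      refine le_trans ?_ h6
      rw [ENNReal.rpow_neg, div_eq_mul_inv]
      refine mul_le_of_le_one_left zero_le ?_
      exact ENNReal.rpow_le_one (hedist _ (hav.mem x) _ (hav.mem y)) hp0.le
    · refine le_trans ?_ le_self_add
      rw [← ENNReal.add_div, hhalf, hp2, mul_div_assoc]
      gcongr
      push Not at hbad
      by_cases hx : x ∈ ball (0 : Euc m) l
      · have hy := hbad.1 hx
        have hx' : x ∈ ball (0 : Euc m) r := ball_subset_ball (by linarith) hx
        rw [h1 x hx', h1 y hy, edist_add_left]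
        exact le_add_self
      · by_cases hy : y ∈ ball (0 : Euc m) l
        · have hx' := hbad.2 hy
          have hy' : y ∈ ball (0 : Euc m) r := ball_subset_ball (by linarith) hy
          rw [h1 x hx', h1 y hy', edist_add_left]
          exact le_add_self
        · rw [h0 x hx, h0 y hy, add_zero, add_zero]
          exact le_self_add
  have hk : ∀ f : Euc m → ℝ, Measurable f →
      Measurable fun z : Euc m × Euc m => edist (f z.1) (f z.2) ^ p / edist z.1 z.2 ^ q := fun f hf =>
    (((hf.comp measurable_fst).edist (hf.comp measurable_snd)).pow_const p).div
      ((measurable_fst.edist measurable_snd).pow_const q)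
  have hk1 := hk _ hm1
  have hk2 := hk _ hm2
  have hg2 : Measurable fun z : Euc m × Euc m => g (z.2, z.1) := hgm.comp measurable_swap
  have e : ∀ f : Euc m → ℝ, gagliardoEnergy s p f univ =
      ∫⁻ x, ∫⁻ y, edist (f x) (f y) ^ p / edist x y ^ q := fun f => by
    simp only [gagliardoEnergy, Measure.restrict_univ, hq]
  rw [e, e, e]
  calc _ ≤ ∫⁻ x, ∫⁻ y, (2 ^ (-p) * (edist (η x) (η y) ^ p / edist x y ^ q +
        edist (η' x) (η' y) ^ p / edist x y ^ q) + (g (x, y) + g (y, x))) :=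
      lintegral_mono fun x => lintegral_mono fun y => hpt x y
    _ = ∫⁻ x, (2 ^ (-p) * ((∫⁻ y, edist (η x) (η y) ^ p / edist x y ^ q) +
        ∫⁻ y, edist (η' x) (η' y) ^ p / edist x y ^ q) + ((∫⁻ y, g (x, y)) + ∫⁻ y, g (y, x))) := by
      refine lintegral_congr fun x => ?_
      have a1 : Measurable fun y => edist (η x) (η y) ^ p / edist x y ^ q :=
        hk1.comp measurable_prodMk_left
      have a2 : Measurable fun y => edist (η' x) (η' y) ^ p / edist x y ^ q :=
        hk2.comp measurable_prodMk_left
      have a3 : Measurable fun y => g (x, y) := hgm.comp measurable_prodMk_left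
      exact lintegral_const_mul_add_add a1 a2 a3 _ h2p
    _ = 2 ^ (-p) * ((∫⁻ x, ∫⁻ y, edist (η x) (η y) ^ p / edist x y ^ q) +
        ∫⁻ x, ∫⁻ y, edist (η' x) (η' y) ^ p / edist x y ^ q) +
          ((∫⁻ x, ∫⁻ y, g (x, y)) + ∫⁻ x, ∫⁻ y, g (y, x)) := by
      have b1 : Measurable fun x => ∫⁻ y, edist (η x) (η y) ^ p / edist x y ^ q :=
        hk1.lintegral_prod_right'
      have b2 : Measurable fun x => ∫⁻ y, edist (η' x) (η' y) ^ p / edist x y ^ q :=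
        hk2.lintegral_prod_right'
      have b3 : Measurable fun x => ∫⁻ y, g (x, y) := hgm.lintegral_prod_right'
      exact lintegral_const_mul_add_add b1 b2 b3 _ h2p
    _ ≤ _ := by
      rw [add_mul]
      gcongr

theorem gagliardoEnergy_cutoff_ne_top (hm : 1 ≤ m) {s p : ℝ} (hs : s < 1) (hp : 1 ≤ p)
    (hsp : 0 < s * p) {η : Euc m → ℝ} (hη : IsCutoff η) : gagliardoEnergy s p η univ ≠ ⊤ := by
  set q := (m : ℝ) + s * p with hq
  have hp0 : 0 < p := by linarith
  have hqm : (m : ℝ) < q := by linarith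
  have hq0 : 0 < q := lt_of_le_of_lt (Nat.cast_nonneg m) hqm
  obtain ⟨K, hK⟩ := hη.lip
  obtain ⟨C, hC, hCE⟩ := exists_gagliardoEnergy_far_le (N := ℝ) hm hp hsp
  refine ((hCE η hK.continuous.measurable 0 0 1 one_pos hη.zero).trans_lt ?_).ne
  refine ENNReal.mul_lt_top hC.lt_top ?_
  -- Near the diagonal the Lipschitz bound leaves the exponent q - p = m - (1 - s)p, which is less
  -- than m because s < 1.
  obtain ⟨C₁, hC₁, h1⟩ := exists_near_kernel (q := q - p) hm (by rw [hq]; nlinarith)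
  obtain ⟨C₂, hC₂, -, h2⟩ := exists_tail_kernel hqm
  have hb : ∀ x, ∫⁻ y, edist (η x) (η y) ^ p / edist x y ^ q ≤ K ^ p * C₁ + C₂ := by
    intro x
    rw [← lintegral_add_compl _ (measurableSet_ball (x := x) (ε := 1))]
    refine add_le_add ?_ ?_
    · have : ∀ y, edist (η x) (η y) ^ p / edist x y ^ q ≤ K ^ p * edist x y ^ (-(q - p)) := by
        intro y
        rcases eq_or_ne x y with rfl | hxy
        · simp [hp0]
        · have e1 : edist x y ≠ 0 := by simpa using hxy
          rw [neg_sub, ENNReal.rpow_sub _ _ e1 (edist_ne_top _ _), ← mul_div_assoc,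
            ← mul_rpow_of_nonneg _ _ hp0.le]
          gcongr
          exact hK x y
      refine (lintegral_mono this).trans ?_
      rw [lintegral_const_mul' _ _ (rpow_ne_top_of_nonneg hp0.le (by simp))]
      gcongr
      exact h1 x
    · have e2 : (ball x 1)ᶜ = {y | (1 : ℝ≥0∞) ≤ edist x y} := by
        ext y
        simp only [mem_compl_iff, mem_ball, not_lt, mem_ofPred_eq, edist_dist, dist_comm y x]
        rw [← ofReal_one, ENNReal.ofReal_le_ofReal_iff dist_nonneg]
      rw [e2]
      refine le_trans (lintegral_mono fun y => ?_) ((h2 x 1).trans_eq (by simp))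
      rw [ENNReal.rpow_neg, div_eq_mul_inv]
      refine mul_le_of_le_one_left zero_le (ENNReal.rpow_le_one ?_ hp0.le)
      rw [edist_dist, ← ofReal_one]
      refine ofReal_le_ofReal ?_
      rw [Real.dist_eq, abs_le]
      constructor <;> linarith [(hη.mem x).1, (hη.mem x).2, (hη.mem y).1, (hη.mem y).2]
  calc gagliardoEnergy s p η (ball 0 (2 * 1))
      ≤ ∫⁻ _ in ball (0 : Euc m) (2 * 1), (K ^ p * C₁ + C₂) :=
        lintegral_mono fun x => (setLIntegral_le_lintegral _ _).trans (hb x)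
    _ < ⊤ := by
      rw [setLIntegral_const]
      have : (K : ℝ≥0∞) ^ p ≠ ⊤ := rpow_ne_top_of_nonneg hp0.le (by simp)
      exact ENNReal.mul_lt_top (by finiteness) measure_ball_lt_top

theorem tendsto_volume_ball_zero (hm : 1 ≤ m) :
    Tendsto (fun r : ℝ => volume (ball (0 : Euc m) r)) (𝓝[>] 0) (𝓝 0) := by
  have hnt : Nontrivial (Euc m) := by
    have : Nonempty (Fin m) := ⟨⟨0, hm⟩⟩
    infer_instance
  have h1 : Tendsto (fun r : ℝ => ofReal (r ^ m)) (𝓝[>] 0) (𝓝 0) := by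
    have : Tendsto (fun r : ℝ => ofReal (r ^ m)) (𝓝 0) (𝓝 (ofReal (0 ^ m))) :=
      ((ENNReal.continuous_ofReal.comp (continuous_pow m)).tendsto 0)
    rw [zero_pow (by omega), ENNReal.ofReal_zero] at this
    exact this.mono_left nhdsWithin_le_nhds
  have h2 : Tendsto (fun r : ℝ => ofReal (r ^ m) * volume (ball (0 : Euc m) 1)) (𝓝[>] 0)
      (𝓝 0) := by
    simpa using ENNReal.Tendsto.mul_const h1 (Or.inr measure_ball_lt_top.ne)
  refine h2.congr' ?_
  filter_upwards [self_mem_nhdsWithin] with r hr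
  rw [Measure.addHaar_ball_of_pos _ _ hr]
  simp

/-- The origin has zero capacity for the Gagliardo energy. -/
theorem exists_gagliardo_cutoff (hm : 1 ≤ m) {s p : ℝ} (hs0 : 0 < s) (hs : s < 1) (hp : 1 ≤ p)
    (hspm : s * p ≤ m) {δ : ℝ≥0∞} (hδ : δ ≠ 0) :
    ∃ η : Euc m → ℝ, IsCutoff η ∧ gagliardoEnergy s p η univ ≤ δ := by
  have hsp : 0 < s * p := by positivity
  have hsc : ∀ (η : Euc m → ℝ) (l : ℝ), 0 < l → gagliardoEnergy s p
      (fun x => η (l⁻¹ • (x - 0))) univ = ofReal (l ^ ((m : ℝ) - s * p)) *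
        gagliardoEnergy s p η univ := fun η l hl => gagliardoEnergy_homothety η hl 0
  rcases hspm.lt_or_eq with h | h
  · refine exists_isCutoff_le (c := ofReal ((1 / 2) ^ ((m : ℝ) - s * p))) ?_
      (fun η hη => gagliardoEnergy_cutoff_ne_top hm hs hp hsp hη) (fun η hη θ _ => ?_) hδ
    · rw [← ofReal_one]
      exact (ENNReal.ofReal_lt_ofReal_iff one_pos).2
        (Real.rpow_lt_one (by norm_num) (by norm_num) (by linarith))
    · refine ⟨_, hη.comp_homothety (l := 1 / 2) (by norm_num) (by norm_num), ?_⟩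
      rw [hsc _ _ (by norm_num)]
      exact le_self_add
  -- In the critical case sp = m ≥ 1 with s < 1 forces p > 1, so that 2^(1 - p) < 1.
  · have hp1 : 1 < p := by
      have h1 : (1 : ℝ) ≤ m := by exact_mod_cast hm
      by_contra! h2
      nlinarith
    refine exists_isCutoff_le (c := 2 ^ (1 - p)) ?_
      (fun η hη => gagliardoEnergy_cutoff_ne_top hm hs hp hsp hη) (fun η hη θ hθ => ?_) hδ
    · exact ENNReal.rpow_lt_one_of_one_lt_of_neg (by norm_num) (by linarith)
    -- The rescaled copy of η has the same energy since sp = m. The average then has energy 2^(-p) ·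
    -- 2 times that of η, up to an error that vanishes with l.
    · obtain ⟨T, hT, r, hr, hE⟩ := gagliardoEnergy_average_le hp hsp hη
      have hlim : Tendsto (fun l : ℝ => T * volume (ball (0 : Euc m) l)) (𝓝[>] 0) (𝓝 0) := by
        simpa using ENNReal.Tendsto.const_mul (tendsto_volume_ball_zero hm) (Or.inr hT)
      obtain ⟨l, hl, hl0, hlr⟩ := ((hlim.eventually_lt_const (pos_iff_ne_zero.2 hθ)).and
        (Ioo_mem_nhdsGT (lt_min hr one_pos))).exists
      have hc := hη.comp_homothety hl0 (hlr.trans_le (min_le_right _ _)).le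
      refine ⟨_, hη.average hc, (hE _ hc l (hlr.trans_le (min_le_left _ _)) fun x hx => ?_).trans ?_⟩
      · refine hη.zero _ ?_
        have : l ≤ ‖x‖ := by simpa using hx
        rw [mem_ball, dist_zero_right, sub_zero, norm_smul, Real.norm_eq_abs,
          abs_of_pos (by positivity), inv_mul_lt_iff₀ hl0, mul_one]
        linarith
      · rw [hsc _ _ hl0, h, sub_self, Real.rpow_zero, ofReal_one, one_mul, ← two_mul,
          ← mul_assoc]
        refine add_le_add (le_of_eq ?_) hl.le
        congr 1
        nth_rewrite 2 [← ENNReal.rpow_one 2]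
        rw [← ENNReal.rpow_add _ _ (by norm_num) (by norm_num)]
        congr 1
        ring

end Gagliardo

/-! ### Bubbles: the argument common to both energies. -/

section Gluing

variable {N : Type*} [MeasurableSpace N]

/-- The properties of an energy of maps on the whole space that allow to glue bubbles. -/
structure IsGluingEnergy (q : ℝ) (En : (Euc m → N) → ℝ≥0∞) : Prop where
  const : ∀ c, En (fun _ => c) = 0
  scale : ∀ (W : Euc m → N), AEMeasurable W → ∀ (l : ℝ) (h : Euc m), 0 < l →
    En (fun x => W (l⁻¹ • (x - h))) ≤ ofReal (l ^ q) * En W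
  glue : ∃ C : ℝ≥0∞, C ≠ ⊤ ∧ ∀ (ι : Type) [Countable ι] (x : ι → Euc m) (r : ι → ℝ),
    (Pairwise fun i j => Disjoint (ball (x i) (r i)) (ball (x j) (r j))) →
    ∀ (W : ι → Euc m → N) (Γ w : Euc m → N) (c : N),
    (∀ i, ∀ y ∉ ball (x i) (r i), W i y = c) → (∀ i, ∀ y ∈ ball (x i) (r i), Γ y = c) →
    (∀ i, ∀ y ∈ ball (x i) (r i), w y = W i y) → (∀ y, (∀ i, y ∉ ball (x i) (r i)) → w y = Γ y) →
    (∀ i, AEMeasurable (W i)) → AEMeasurable Γ → En w ≤ C * (En Γ + ∑' i, En (W i))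
  conn : ∀ (b c : N) (δ : ℝ≥0∞) (l₀ : ℝ), δ ≠ 0 → 0 < l₀ → ∃ (l : ℝ) (Γ : Euc m → N), 0 < l ∧ l ≤ l₀ ∧
    l ≤ 1 ∧ AEMeasurable Γ ∧ (∀ x ∈ ball 0 l, Γ x = c) ∧ (∀ x ∉ ball 0 1, Γ x = b) ∧ En Γ ≤ δ

theorem Energy.IsSuperadditive.sum_le {G : Energy m N} (hG : G.IsSuperadditive) {w : Euc m → N}
    (hw : AEMeasurable w) {ι : Type*} {A : ι → Set (Euc m)} (hA : ∀ i, IsOpen (A i))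
    (hd : Pairwise fun i j => Disjoint (closure (A i)) (closure (A j))) (F : Finset ι) :
    ∑ i ∈ F, G.toFun w (A i) ≤ G.toFun w (⋃ i ∈ F, A i) := by
  classical
  have hw' : MeasurableMapOn w univ := by rwa [MeasurableMapOn, Measure.restrict_univ]
  induction F using Finset.induction_on with
  | empty => simp
  | insert i F hi ih =>
    rw [Finset.sum_insert hi, Finset.set_biUnion_insert]
    refine (add_le_add le_rfl ih).trans (hG w hw' _ _ (hA i) (isOpen_biUnion fun j _ => hA j) ?_)
    rw [Finset.closure_biUnion, disjoint_iUnion₂_right]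
    exact fun j hj => hd (fun h => hi (h ▸ hj))

/-- Placing scaled copies of maps in disjoint balls. -/
theorem IsGluingEnergy.place {q s p : ℝ} (hq : q = (m : ℝ) - s * p) {En : (Euc m → N) → ℝ≥0∞}
    (hE : IsGluingEnergy q En) {G : Energy m N} (hG : G.IsSuperadditive) (hG' : G.HasScaling s p) :
    ∃ C : ℝ≥0∞, C ≠ ⊤ ∧ ∀ (ι : Type) [Countable ι] (x : ι → Euc m) (r : ι → ℝ), (∀ i, 0 < r i) →
    (Pairwise fun i j => Disjoint (closedBall (x i) (r i)) (closedBall (x j) (r j))) →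
    ∀ (W : ι → Euc m → N) (Γ : Euc m → N) (c : N), (∀ i, AEMeasurable (W i)) → AEMeasurable Γ →
    (∀ i, ∀ y ∉ ball 0 1, W i y = c) → (∀ i, ∀ y ∈ ball (x i) (r i), Γ y = c) →
    ∃ w : Euc m → N, AEMeasurable w ∧ (∀ y, (∀ i, y ∉ ball (x i) (r i)) → w y = Γ y) ∧
      En w ≤ C * (En Γ + ∑' i, ofReal (r i ^ q) * En (W i)) ∧
      ∀ (O : Set (Euc m)), IsOpen O → (∀ i, ball (x i) (r i) ⊆ O) → ∀ F : Finset ι,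
        ∑ i ∈ F, ofReal (r i ^ q) * G.toFun (W i) (ball 0 1) ≤ G.toFun w O := by
  classical
  obtain ⟨C, hC, hglue⟩ := hE.glue
  refine ⟨C, hC, fun ι _ x r hr hd W Γ c hW hΓ hWc hΓc => ?_⟩
  have hd' : Pairwise fun i j => Disjoint (ball (x i) (r i)) (ball (x j) (r j)) := fun i j hij =>
    (hd hij).mono ball_subset_closedBall ball_subset_closedBall
  have hmem : ∀ i y, y ∈ ball (x i) (r i) ↔ (r i)⁻¹ • (y - x i) ∈ ball (0 : Euc m) 1 := fun i y => by
    rw [mem_ball, mem_ball, dist_zero_right, norm_smul, Real.norm_eq_abs,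
      abs_of_pos (inv_pos.2 (hr i)), inv_mul_lt_iff₀ (hr i), mul_one, dist_eq_norm]
  set V : ι → Euc m → N := fun i y => W i ((r i)⁻¹ • (y - x i)) with hV
  have hVm : ∀ i, AEMeasurable (V i) := fun i => by
    have hqm : Measure.QuasiMeasurePreserving (fun y : Euc m => (r i)⁻¹ • (y - x i)) :=
      (Measure.quasiMeasurePreserving_smul volume (inv_pos.2 (hr i)).ne').comp
        (measurePreserving_sub_right volume (x i)).quasiMeasurePreserving
    exact (hW i).comp_quasiMeasurePreserving hqm
  have hVc : ∀ i, ∀ y ∉ ball (x i) (r i), V i y = c := fun i y hy =>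
    hWc i _ (fun h => hy ((hmem i y).2 h))
  obtain ⟨w, hw⟩ : ∃ w : Euc m → N, ∀ y, w y = if h : ∃ i, y ∈ ball (x i) (r i) then
    V h.choose y else Γ y := ⟨_, fun _ => rfl⟩
  have hwV : ∀ i, ∀ y ∈ ball (x i) (r i), w y = V i y := by
    intro i y hy
    have h : ∃ i, y ∈ ball (x i) (r i) := ⟨i, hy⟩
    rw [hw, dif_pos h]
    by_contra hne
    have hij : h.choose ≠ i := fun e => hne (by rw [e])
    exact (Set.disjoint_left.1 (hd' hij) h.choose_spec) hy
  have hwΓ : ∀ y, (∀ i, y ∉ ball (x i) (r i)) → w y = Γ y := by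
    intro y hy
    rw [hw, dif_neg (by push Not; exact hy)]
  -- The space is split into countably many pieces: the balls, and the complement of their union,
  -- indexed by `none`.
  have hwm : AEMeasurable w := by
    obtain ⟨S, hS⟩ : ∃ S : Option ι → Set (Euc m), ∀ o, S o =
      o.elim (⋃ i, ball (x i) (r i))ᶜ fun i => ball (x i) (r i) := ⟨_, fun _ => rfl⟩
    have hU : (⋃ o, S o) = univ := by
      rw [iUnion_option, hS]
      simp only [hS, Option.elim]
      exact compl_union_self _
    rw [← Measure.restrict_univ (μ := (volume : Measure (Euc m))), ← hU, aemeasurable_iUnion_iff]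
    rintro (_ | i)
    · rw [hS]
      refine hΓ.restrict.congr ?_
      filter_upwards [ae_restrict_mem (MeasurableSet.iUnion fun i => measurableSet_ball).compl]
        with y hy
      exact (hwΓ y (by simpa using hy)).symm
    · rw [hS]
      refine (hVm i).restrict.congr ?_
      filter_upwards [ae_restrict_mem measurableSet_ball] with y hy
      exact (hwV i y hy).symm
  refine ⟨w, hwm, hwΓ, ?_, ?_⟩
  · refine (hglue ι x r hd' V Γ w c hVc hΓc hwV hwΓ hVm hΓ).trans ?_
    gcongr with i
    exact hE.scale _ (hW i) _ _ (hr i)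
  · intro O hO hOB F
    -- Superadditivity requires disjoint closures, hence the assumption on closed balls.
    -- Monotonicity then passes from the finite union to O.
    have hcl : Pairwise fun i j => Disjoint (closure (ball (x i) (r i))) (closure (ball (x j) (r j))) :=
      fun i j hij => (hd hij).mono closure_ball_subset_closedBall closure_ball_subset_closedBall
    have h1 := hG.sum_le hwm (fun i => isOpen_ball (x := x i) (ε := r i)) hcl F
    refine le_trans (Finset.sum_le_sum fun i _ => ?_) (h1.trans (G.restrict_le _ _ w w
      (isOpen_biUnion fun j _ => isOpen_ball) hO (iUnion₂_subset fun i _ => hOB i)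
      (by rw [MeasurableMapOn]; exact hwm.restrict) (fun _ _ => rfl)))
    have h2 := hG' (V i) (by rw [MeasurableMapOn]; exact (hVm i).restrict) (r i) (x i) (ball 0 1) (hr i)
      isOpen_ball
    have h3 : (fun y => x i + r i • y) '' ball (0 : Euc m) 1 = ball (x i) (r i) := by
      ext y
      rw [hmem]
      constructor
      · rintro ⟨z, hz, rfl⟩
        simp only [add_sub_cancel_left]
        rwa [inv_smul_smul₀ (hr i).ne']
      · intro hy
        refine ⟨_, hy, ?_⟩
        simp only
        rw [smul_inv_smul₀ (hr i).ne', add_sub_cancel]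
    have h4 : (fun y => V i (x i + r i • y)) = W i := by
      ext y
      simp only [hV, add_sub_cancel_left]
      rw [inv_smul_smul₀ (hr i).ne']
    rw [h3, h4, ← hq] at h2
    rw [← h2]
    exact G.restrict_le _ _ w (V i) isOpen_ball isOpen_ball subset_rfl
      (by rw [MeasurableMapOn]; exact hwm.restrict) (fun y hy => (hwV i y hy).symm)

/-- Distinct grid points are at distance at least 1/(2mK), more than twice the radius. Their
coordinates are at most 1/(2m), so their norm is at most 1/2 and the balls stay in the unit ball. -/
theorem exists_grid (hm : 1 ≤ m) {K : ℕ} (hK : 1 ≤ K) : ∃ x : (Fin m → Fin K) → Euc m,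
    (Pairwise fun i j => Disjoint (closedBall (x i) (1 / (8 * m * K)))
      (closedBall (x j) (1 / (8 * m * K)))) ∧ ∀ i, ball (x i) (1 / (8 * m * K)) ⊆ ball 0 1 := by
  have hm' : (1 : ℝ) ≤ m := by exact_mod_cast hm
  have hK' : (1 : ℝ) ≤ K := by exact_mod_cast hK
  refine ⟨fun i => WithLp.toLp 2 fun j => (i j : ℝ) / (2 * m * K), fun i j hij => ?_, fun i => ?_⟩
  · obtain ⟨k, hk⟩ := Function.ne_iff.1 hij
    refine closedBall_disjoint_closedBall ?_
    have h1 : (1 : ℝ) ≤ |(i k : ℝ) - j k| := by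
      have h2 : ((i k : ℕ) : ℤ) - (j k : ℕ) ≠ 0 := by
        intro h
        apply hk
        ext
        omega
      exact_mod_cast Int.one_le_abs h2
    have h3 := PiLp.norm_apply_le (WithLp.toLp 2 (fun k => (i k : ℝ) / (2 * m * K)) -
      WithLp.toLp 2 (fun k => (j k : ℝ) / (2 * m * K)) : Euc m) k
    rw [← dist_eq_norm] at h3
    refine lt_of_lt_of_le ?_ h3
    simp only [PiLp.sub_apply, Real.norm_eq_abs]
    rw [← sub_div, abs_div, abs_of_pos (show (0 : ℝ) < 2 * m * K by positivity), ← add_div,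
      div_lt_div_iff₀ (by positivity) (by positivity)]
    have h4 : (1 : ℝ) ≤ m * K := by nlinarith
    nlinarith
  · refine ball_subset_ball' ?_
    rw [dist_zero_right]
    have h1 : ‖(WithLp.toLp 2 (fun k => (i k : ℝ) / (2 * m * K)) : Euc m)‖ ≤ 1 / 2 := by
      rw [EuclideanSpace.norm_eq, Real.sqrt_le_left (by norm_num)]
      calc ∑ k : Fin m, ‖(i k : ℝ) / (2 * m * K)‖ ^ 2 ≤ ∑ k : Fin m, (1 / (2 * m) : ℝ) ^ 2 := by
            refine Finset.sum_le_sum fun k _ => ?_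
            rw [Real.norm_eq_abs, abs_of_nonneg (by positivity)]
            refine pow_le_pow_left₀ (by positivity) ?_ 2
            rw [div_le_div_iff₀ (by positivity) (by positivity)]
            have : (i k : ℝ) ≤ K := by exact_mod_cast (i k).2.le
            nlinarith
        _ ≤ (1 / 2) ^ 2 := by
            rw [Finset.sum_const, Finset.card_univ, Fintype.card_fin, nsmul_eq_mul, div_pow, div_pow,
              mul_pow, ← mul_div_assoc, div_le_div_iff₀ (by positivity) (by norm_num)]
            nlinarith
    have h2 : (1 : ℝ) / (8 * m * K) ≤ 1 / 8 := by
      rw [div_le_div_iff₀ (by positivity) (by norm_num)]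
      nlinarith [mul_le_mul hm' hK' zero_le_one (by linarith)]
    linarith

/-- The grid carries K^m copies at scale 1/(8mK), each with energy multiplied by a constant times
K^(-(m - sp)). Both energies are thus raised by the same factor K^(sp): the level can be tuned
without spoiling the ratio. -/
theorem IsGluingEnergy.cluster (hm : 1 ≤ m) {q s p : ℝ} (hq : q = (m : ℝ) - s * p)
    {En : (Euc m → N) → ℝ≥0∞} (hE : IsGluingEnergy q En) {G : Energy m N} (hG : G.IsSuperadditive)
    (hG' : G.HasScaling s p) : ∃ C κ : ℝ≥0∞, C ≠ ⊤ ∧ κ ≠ 0 ∧ κ ≠ ⊤ ∧ ∀ (U : Euc m → N) (c : N) (K : ℕ),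
      1 ≤ K → AEMeasurable U → (∀ x ∉ ball 0 1, U x = c) → ∃ Z : Euc m → N, AEMeasurable Z ∧
        (∀ x ∉ ball 0 1, Z x = c) ∧ En Z ≤ C * (ofReal (K ^ (s * p)) * En U) ∧
        κ * (ofReal (K ^ (s * p)) * G.toFun U (ball 0 1)) ≤ G.toFun Z (ball 0 1) := by
  obtain ⟨C, hC, hpl⟩ := hE.place hq hG hG'
  have hm' : (1 : ℝ) ≤ m := by exact_mod_cast hm
  set κ : ℝ≥0∞ := ofReal ((1 / (8 * m)) ^ q) with hκ
  refine ⟨C * κ, κ, ENNReal.mul_ne_top hC ofReal_ne_top, ?_, ofReal_ne_top,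
    fun U c K hK hU hUc => ?_⟩
  · rw [hκ, Ne, ENNReal.ofReal_eq_zero, not_le]
    positivity
  have hK' : (1 : ℝ) ≤ K := by exact_mod_cast hK
  obtain ⟨x, hd, hx⟩ := exists_grid hm hK
  obtain ⟨Z, hZ, hZc, hZE, hZG⟩ := hpl (Fin m → Fin K) x (fun _ => 1 / (8 * m * K))
    (fun _ => by positivity) hd (fun _ => U) (fun _ => c) c (fun _ => hU) aemeasurable_const
    (fun _ => hUc) (fun _ _ _ => rfl)
  have hcount : ((Fintype.card (Fin m → Fin K) : ℕ) : ℝ≥0∞) * ofReal ((1 / (8 * m * K)) ^ q) =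
      κ * ofReal (K ^ (s * p)) := by
    rw [Fintype.card_fun, Fintype.card_fin, Fintype.card_fin, ← ENNReal.ofReal_natCast,
      ← ofReal_mul (by positivity), hκ, ← ofReal_mul (by positivity)]
    congr 1
    have hK0 : (0 : ℝ) < K := by linarith
    rw [show (1 : ℝ) / (8 * m * K) = (1 / (8 * m)) * (K : ℝ)⁻¹ by field_simp,
      Real.mul_rpow (by positivity) (by positivity), Real.inv_rpow hK0.le, ← Real.rpow_neg hK0.le,
      mul_left_comm, Nat.cast_pow, ← Real.rpow_natCast, ← Real.rpow_add hK0, hq]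
    congr 2
    ring
  refine ⟨Z, hZ, fun y hy => hZc y fun i hi => hy (hx i hi), ?_, ?_⟩
  · refine hZE.trans ?_
    rw [hE.const, zero_add, tsum_fintype, Finset.sum_const, nsmul_eq_mul, Finset.card_univ,
      ← mul_assoc (Nat.cast _), hcount, mul_assoc, mul_assoc]
  · refine le_trans (le_of_eq ?_) (hZG (ball 0 1) isOpen_ball hx Finset.univ)
    rw [Finset.sum_const, nsmul_eq_mul, Finset.card_univ, ← mul_assoc (Nat.cast _), hcount, mul_assoc]

/-- K is the integer part of r = (θ/a)^(1/t). Since r ≥ 1, rounding down loses at most a factor 2 in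
r, hence 2^t in the power. -/
theorem ENNReal.exists_nat_rpow_mul {a θ : ℝ≥0∞} {t : ℝ} (ht : 0 < t) (ha0 : a ≠ 0) (haθ : a ≤ θ)
    (hθ : θ ≠ ⊤) : ∃ K : ℕ, 1 ≤ K ∧ ofReal (K ^ t) * a ≤ θ ∧
      θ ≤ ofReal (2 ^ t) * (ofReal (K ^ t) * a) := by
  have hat : a ≠ ⊤ := (haθ.trans_lt hθ.lt_top).ne
  lift a to NNReal using hat
  lift θ to NNReal using hθ
  have ha0' : (0 : ℝ) < a := by
    have : a ≠ 0 := by exact_mod_cast ha0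
    positivity
  have haθ' : (a : ℝ) ≤ θ := by exact_mod_cast haθ
  have h1 : (1 : ℝ) ≤ θ / a := (one_le_div ha0').2 haθ'
  set r : ℝ := (θ / a) ^ (1 / t) with hr
  have hr1 : 1 ≤ r := Real.one_le_rpow h1 (by positivity)
  have hrt : r ^ t = θ / a := by
    rw [hr, ← Real.rpow_mul (by linarith), one_div_mul_cancel ht.ne', Real.rpow_one]
  have e : ∀ b : ℝ, 0 ≤ b → ofReal b * (a : ℝ≥0∞) = ofReal (b * a) := fun b hb => by
    rw [ofReal_mul hb, ENNReal.ofReal_coe_nnreal]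
  refine ⟨⌊r⌋₊, (Nat.one_le_floor_iff r).2 hr1, ?_, ?_⟩
  · rw [e _ (by positivity), ← ENNReal.ofReal_coe_nnreal]
    refine ofReal_le_ofReal ?_
    rw [← le_div_iff₀ ha0', ← hrt]
    exact Real.rpow_le_rpow (by positivity) (Nat.floor_le (by linarith)) ht.le
  · rw [e _ (by positivity), ← ofReal_mul (by positivity), ← ENNReal.ofReal_coe_nnreal]
    refine ofReal_le_ofReal ?_
    rw [← mul_assoc, ← div_le_iff₀ ha0', ← hrt, ← Real.mul_rpow (by norm_num) (by positivity)]
    refine Real.rpow_le_rpow (by linarith) ?_ ht.le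
    have h2 := Nat.lt_floor_add_one r
    have h3 : (1 : ℝ) ≤ ⌊r⌋₊ := by exact_mod_cast (Nat.one_le_floor_iff r).2 hr1
    linarith

/-- Bubbles: sequences of maps of finite energy that are constant outside the unit ball. -/
theorem IsGluingEnergy.exists_cell (hm : 1 ≤ m) {q s p : ℝ} (hq : q = (m : ℝ) - s * p) (hq0 : 0 ≤ q)
    (hsp : 0 < s * p) {En : (Euc m → N) → ℝ≥0∞} (hE : IsGluingEnergy q En) {G : Energy m N}
    (hG : G.IsSuperadditive) (hG' : G.HasScaling s p) {e g : ℕ → ℝ≥0∞} {C₀ κ₀ : ℝ≥0∞} (hC₀ : C₀ ≠ ⊤)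
    (hκ₀ : κ₀ ≠ 0) (hκ₀t : κ₀ ≠ ⊤) (he0 : ∀ k, 0 < e k)
    (hlim : Tendsto (fun k => g k / e k) atTop (𝓝 ⊤)) (hcrit : q = 0 → Tendsto e atTop (𝓝 0))
    (hU : ∀ k, e k < ⊤ → ∃ (U : Euc m → N) (c : N), AEMeasurable U ∧ (∀ x ∉ ball 0 1, U x = c) ∧
      En U ≤ C₀ * e k ∧ κ₀ * g k ≤ G.toFun U (ball 0 1))
    (b : N) {δ M : ℝ≥0∞} (hδ : δ ≠ 0) (hM : M ≠ ⊤) :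
    ∃ W : Euc m → N, AEMeasurable W ∧ (∀ x ∉ ball 0 1, W x = b) ∧ En W ≤ δ ∧
      M ≤ G.toFun W (ball 0 1) := by
  obtain ⟨C₁, κ₁, hC₁, hκ₁, hκ₁t, hcl⟩ := hE.cluster hm hq hG hG'
  obtain ⟨C₂, hC₂, hpl⟩ := hE.place hq hG hG'
  -- The energy δ is shared equally between the connection Γ and the cluster placed inside it.
  obtain ⟨δ', hδ'0, hδ'⟩ := exists_ne_zero_mul_le (c := C₂) (ε := δ / 2) hC₂
    (by simpa using hδ)
  obtain ⟨θ₀, hθ₀, hθ₁⟩ := exists_ne_zero_mul_le (c := C₂ * (C₁ * C₀)) (ε := δ / 2)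
    (by finiteness) (by simpa using hδ)
  obtain ⟨θ, hθ, hθt, hθθ⟩ : ∃ θ : ℝ≥0∞, θ ≠ 0 ∧ θ ≠ ⊤ ∧ θ ≤ θ₀ :=
    ⟨min θ₀ 1, (lt_min (pos_iff_ne_zero.2 hθ₀) one_pos).ne', (min_lt_of_right_lt (by simp)).ne,
      min_le_left _ _⟩
  -- The ratio that makes `G` reach M once the energy level is at least θ/2^(sp), with all constants
  -- of extension and clustering taken into account.
  set R : ℝ≥0∞ := M * (κ₁ * κ₀)⁻¹ * (ofReal (2 ^ (s * p)) * θ⁻¹) with hR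
  have hRt : R ≠ ⊤ := by
    refine ENNReal.mul_ne_top (ENNReal.mul_ne_top hM (ENNReal.inv_ne_top.2 (mul_ne_zero hκ₁ hκ₀)))
      (ENNReal.mul_ne_top ofReal_ne_top (ENNReal.inv_ne_top.2 hθ))
  have hev1 : ∀ᶠ k in atTop, R < g k / e k := hlim.eventually_const_lt hRt.lt_top
  -- The starting level l^q e_k must be at most θ, since clustering can only increase it. For q = 0
  -- this comes from e_k → 0; for q > 0 it comes from a small l, with k fixed beforehand.
  obtain ⟨k, l₀, hl₀, hek, hRk, hl₀θ⟩ : ∃ (k : ℕ) (l₀ : ℝ), 0 < l₀ ∧ e k < ⊤ ∧ R < g k / e k ∧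
      ∀ l, 0 < l → l ≤ l₀ → ofReal (l ^ q) * e k ≤ θ := by
    rcases hq0.eq_or_lt with h | h
    · obtain ⟨k, h1, h2⟩ := (hev1.and ((hcrit h.symm).eventually_lt_const
        (pos_iff_ne_zero.2 hθ))).exists
      refine ⟨k, 1, one_pos, h2.trans hθt.lt_top, h1, fun l hl _ => ?_⟩
      rw [← h, Real.rpow_zero, ofReal_one, one_mul]
      exact h2.le
    · obtain ⟨k, h1⟩ := hev1.exists
      -- An infinite denominator would make the quotient 0, which is not greater than R.
      have hekt : e k ≠ ⊤ := fun h => by simp [h] at h1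
      have h2 : Tendsto (fun l : ℝ => ofReal (l ^ q) * e k) (𝓝 0) (𝓝 0) := by
        have h3 : Tendsto (fun l : ℝ => ofReal (l ^ q)) (𝓝 0) (𝓝 0) := by
          have := (ENNReal.continuous_ofReal.comp (Real.continuous_rpow_const h.le)).tendsto 0
          simpa [Real.zero_rpow h.ne', Function.comp_def] using this
        simpa using ENNReal.Tendsto.mul_const h3 (Or.inr hekt)
      obtain ⟨η, hη, h4⟩ := Metric.eventually_nhds_iff.1
        (h2.eventually_lt_const (pos_iff_ne_zero.2 hθ))
      refine ⟨k, η / 2, half_pos hη, hekt.lt_top, h1, fun l hl hl' => (h4 ?_).le⟩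
      rw [Real.dist_eq, sub_zero, abs_of_pos hl]
      linarith
  obtain ⟨U, c, hUm, hUc, hUE, hUG⟩ := hU k hek
  obtain ⟨l, Γ, hl0, hll, hl1, hΓm, hΓc, hΓb, hΓE⟩ := hE.conn b c δ' l₀ hδ'0 hl₀
  have hlq : ofReal (l ^ q) ≠ 0 := by
    rw [Ne, ENNReal.ofReal_eq_zero, not_le]; positivity
  -- K is tuned after l, so that K^(sp) l^q e_k lies between θ/2^(sp) and θ.
  obtain ⟨K, hK1, hKle, hKge⟩ := ENNReal.exists_nat_rpow_mul hsp
    (mul_ne_zero hlq (he0 k).ne') (hl₀θ l hl0 hll) hθt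
  obtain ⟨Z, hZm, hZc, hZE, hZG⟩ := hcl U c K hK1 hUm hUc
  -- The cluster has boundary value c. It is placed in the small ball where Γ equals c, and Γ brings
  -- the value to b outside the unit ball.
  obtain ⟨W, hWm, hWΓ, hWE, hWG⟩ := hpl Unit (fun _ => 0) (fun _ => l) (fun _ => hl0)
    (fun i j hij => (hij rfl).elim) (fun _ => Z) Γ c (fun _ => hZm) hΓm (fun _ => hZc)
    (fun _ => hΓc)
  refine ⟨W, hWm, fun x hx => ?_, ?_, ?_⟩
  · rw [hWΓ x fun _ h => hx (ball_subset_ball hl1 h), hΓb x hx]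
  · refine hWE.trans ?_
    rw [tsum_fintype, Finset.univ_unique, Finset.sum_singleton, mul_add, ← ENNReal.add_halves δ]
    refine add_le_add ((mul_le_mul_right hΓE _).trans hδ') ?_
    calc C₂ * (ofReal (l ^ q) * En Z)
        ≤ C₂ * (ofReal (l ^ q) * (C₁ * (ofReal (K ^ (s * p)) * (C₀ * e k)))) := by
          gcongr
          exact hZE.trans (by gcongr)
      _ = C₂ * (C₁ * C₀) * (ofReal (K ^ (s * p)) * (ofReal (l ^ q) * e k)) := by ring
      _ ≤ C₂ * (C₁ * C₀) * θ₀ := by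
          gcongr
          exact hKle.trans hθθ
      _ ≤ δ / 2 := hθ₁
  · have h5 := hWG (ball 0 1) isOpen_ball (fun _ => ball_subset_ball hl1) Finset.univ
    rw [Finset.univ_unique, Finset.sum_singleton] at h5
    refine le_trans ?_ h5
    have hκt : κ₁ * κ₀ ≠ 0 := mul_ne_zero hκ₁ hκ₀
    have hgk : R * e k ≤ g k := ENNReal.mul_le_of_le_div hRk.le
    calc M ≤ M * ((κ₁ * κ₀)⁻¹ * (κ₁ * κ₀)) * (θ⁻¹ * θ) := ?_
      _ ≤ M * ((κ₁ * κ₀)⁻¹ * (κ₁ * κ₀)) * (θ⁻¹ * (ofReal (2 ^ (s * p)) *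
            (ofReal (K ^ (s * p)) * (ofReal (l ^ q) * e k)))) := by gcongr
      _ = ofReal (l ^ q) * (κ₁ * (ofReal (K ^ (s * p)) * (κ₀ * (R * e k)))) := by
            rw [hR]; ring
      _ ≤ ofReal (l ^ q) * (κ₁ * (ofReal (K ^ (s * p)) * (κ₀ * g k))) := by gcongr
      _ ≤ ofReal (l ^ q) * (κ₁ * (ofReal (K ^ (s * p)) *
            G.toFun U (ball 0 1))) := by gcongr
      _ ≤ _ := by gcongr
    rw [ENNReal.inv_mul_cancel hθ hθt, mul_one, ENNReal.inv_mul_cancel hκt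
      (ENNReal.mul_ne_top hκ₁t hκ₀t), mul_one]

/-- Infinitely many bubbles in disjoint balls. -/
theorem IsGluingEnergy.exists_infinite (hm : 1 ≤ m) {q s p : ℝ} (hq : q = (m : ℝ) - s * p)
    (hq0 : 0 ≤ q) {En : (Euc m → N) → ℝ≥0∞} (hE : IsGluingEnergy q En) {G : Energy m N}
    (hG : G.IsSuperadditive) (hG' : G.HasScaling s p)
    (hcell : ∀ (b : N) (δ M : ℝ≥0∞), δ ≠ 0 → M ≠ ⊤ → ∃ W : Euc m → N, AEMeasurable W ∧
      (∀ x ∉ ball 0 1, W x = b) ∧ En W ≤ δ ∧ M ≤ G.toFun W (ball 0 1))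
    (b : N) {δ : ℝ≥0∞} (hδ : δ ≠ 0) {a : Euc m} {ρ : ℝ} (hρ : 0 < ρ) :
    ∃ W : Euc m → N, AEMeasurable W ∧ (∀ x ∉ ball a ρ, W x = b) ∧ En W ≤ δ ∧
      G.toFun W (ball a ρ) = ⊤ := by
  obtain ⟨C, hC, hpl⟩ := hE.place hq hG hG'
  -- The factor C occurs twice: once for the sequence of cells in the unit ball, once for moving the
  -- result to the ball of centre a and radius ρ.
  obtain ⟨δ₁, hδ₁0, hδ₁⟩ := exists_ne_zero_mul_le (c := C * (ofReal (ρ ^ q) * C)) (ε := δ)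
    (by finiteness) hδ
  obtain ⟨d, hd0, hd⟩ := ENNReal.exists_pos_sum_of_countable' hδ₁0 ℕ
  -- The cells sit on a ray at distances 2^(-(j+1)) from the origin. The gap between consecutive
  -- centres is half the larger distance, more than the sum of the two radii.
  set t : ℕ → ℝ := fun j => (1 / 2) ^ (j + 1) with ht
  have ht0 : ∀ j, 0 < t j := fun j => by positivity
  have ht1 : ∀ j, t j ≤ 1 / 2 := fun j => by
    simp only [ht, pow_succ]
    have : (1 / 2 : ℝ) ^ j ≤ 1 := pow_le_one₀ (by norm_num) (by norm_num)
    linarith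
  set v : Euc m := EuclideanSpace.single ⟨0, hm⟩ 1 with hv
  have hv1 : ‖v‖ = 1 := by simp [hv]
  have hlt : ∀ i j, i < j → Disjoint (closedBall (t i • v) (t i / 8)) (closedBall (t j • v) (t j / 8)) := by
    intro i j hij
    refine closedBall_disjoint_closedBall ?_
    rw [dist_eq_norm, ← sub_smul, norm_smul, hv1, mul_one]
    have h1 : t j ≤ t i / 2 := by
      have : t j ≤ t (i + 1) := pow_le_pow_of_le_one (by norm_num) (by norm_num) (by omega)
      simp only [ht, pow_succ] at this ⊢
      linarith
    refine lt_of_lt_of_le ?_ (le_abs_self _)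
    have := ht0 i
    linarith
  have hdis : Pairwise fun i j => Disjoint (closedBall (t i • v) (t i / 8))
      (closedBall (t j • v) (t j / 8)) := fun i j hij => by
    rcases hij.lt_or_gt with h | h
    · exact hlt i j h
    · exact (hlt j i h).symm
  have hrq : ∀ j, ofReal ((t j / 8) ^ q) ≠ 0 := fun j => by
    have := ht0 j
    rw [Ne, ENNReal.ofReal_eq_zero, not_le]
    positivity
  -- Shrinking multiplies `G` by the j-th radius to the power q. Asking for at least the inverse of
  -- this factor makes every cell contribute at least 1, while the Sobolev energies stay summable.
  choose W hW hWb hWE hWG using fun j => hcell b (d j) (ofReal ((t j / 8) ^ q))⁻¹ (hd0 j).ne'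
    (ENNReal.inv_ne_top.2 (hrq j))
  obtain ⟨V, hV, hVb, hVE, hVG⟩ := hpl ℕ (fun j => t j • v) (fun j => t j / 8)
    (fun j => by have := ht0 j; positivity) hdis W (fun _ => b) b hW aemeasurable_const hWb
    (fun _ _ _ => rfl)
  have hsub : ∀ j, ball (t j • v) (t j / 8) ⊆ ball 0 1 := fun j => ball_subset_ball' (by
    rw [dist_zero_right, norm_smul, hv1, mul_one, Real.norm_eq_abs, abs_of_pos (ht0 j)]
    linarith [ht1 j])
  have hVG' : G.toFun V (ball 0 1) = ⊤ := by
    refine ENNReal.eq_top_of_forall_nnreal_le fun r => ?_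
    obtain ⟨k, hk⟩ := exists_nat_ge r
    refine le_trans ?_ (hVG (ball 0 1) isOpen_ball hsub (Finset.range k))
    calc (r : ℝ≥0∞) ≤ ∑ j ∈ Finset.range k, 1 := by
          rw [Finset.sum_const, Finset.card_range, nsmul_one]
          exact_mod_cast hk
      _ ≤ _ := Finset.sum_le_sum fun j _ => by
          rw [← ENNReal.mul_inv_cancel (hrq j) ofReal_ne_top]
          gcongr
          exact hWG j
  have hVE' : En V ≤ C * δ₁ := by
    refine hVE.trans ?_
    rw [hE.const, zero_add]
    gcongr
    refine le_trans (ENNReal.tsum_le_tsum fun j => ?_) hd.le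
    refine (mul_le_of_le_one_left zero_le ?_).trans (hWE j)
    rw [← ofReal_one]
    have := ht0 j
    exact ofReal_le_ofReal (Real.rpow_le_one (by positivity) (by linarith [ht1 j]) hq0)
  obtain ⟨X, hX, hXb, hXE, hXG⟩ := hpl Unit (fun _ => a) (fun _ => ρ) (fun _ => hρ)
    (fun i j hij => (hij rfl).elim) (fun _ => V) (fun _ => b) b (fun _ => hV) aemeasurable_const
    (fun _ x hx => hVb x fun j hj => hx (hsub j hj)) (fun _ _ _ => rfl)
  refine ⟨X, hX, fun x hx => hXb x fun _ => hx, ?_, ?_⟩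
  · refine hXE.trans (le_trans ?_ hδ₁)
    rw [hE.const, zero_add, tsum_fintype, Finset.univ_unique, Finset.sum_singleton]
    calc C * (ofReal (ρ ^ q) * En V) ≤ C * (ofReal (ρ ^ q) * (C * δ₁)) := by gcongr
      _ = _ := by ring
  · have h := hXG (ball a ρ) isOpen_ball (fun _ => subset_rfl) Finset.univ
    rw [Finset.univ_unique, Finset.sum_singleton, hVG', ENNReal.mul_top] at h
    · exact top_le_iff.1 h
    · rw [Ne, ENNReal.ofReal_eq_zero, not_le]
      positivity

variable [EMetricSpace N]

/-- Extension of maps of the unit ball to the whole space. -/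
def HasExtension (n : ℕ) [ChartedSpace (EuclideanSpace ℝ (Fin n)) N]
    [RiemannianBundle (fun x : N => TangentSpace (𝓡 n) x)] (s p : ℝ) (En : (Euc m → N) → ℝ≥0∞) : Prop :=
  ∃ C : ℝ≥0∞, C ≠ ⊤ ∧ ∀ u : Euc m → N, AEMeasurable u (volume.restrict (ball 0 1)) →
    0 < sobolevEnergy n s p u (ball 0 1) → sobolevEnergy n s p u (ball 0 1) < ⊤ →
    ∃ (U : Euc m → N) (c : N), AEMeasurable U ∧ EqOn U u (ball 0 1) ∧ (∀ x ∉ ball 0 12, U x = c) ∧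
      En U ≤ C * sobolevEnergy n s p u (ball 0 1)

/-- Insertion of maps of small energy in a map of finite energy. -/
def HasInsertion (n : ℕ) [ChartedSpace (EuclideanSpace ℝ (Fin n)) N]
    [RiemannianBundle (fun x : N => TangentSpace (𝓡 n) x)] (s p : ℝ) (En : (Euc m → N) → ℝ≥0∞) : Prop :=
  ∃ C : NNReal → ℕ → ℝ≥0∞, (∀ K ν, C K ν ≠ ⊤) ∧ ∀ v : Euc m → N,
    AEMeasurable v (volume.restrict (ball 0 1)) → sobolevEnergy n s p v (ball 0 1) < ⊤ →
    ∀ ε : ℝ, 0 < ε → ∀ τ : ℝ≥0∞, τ ≠ 0 → ∃ (a : Euc m) (ρ : ℝ) (b : N) (δ : ℝ≥0∞), 0 < ρ ∧ δ ≠ 0 ∧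
      ball a ρ ⊆ ball 0 ε ∧ ball a ρ ⊆ ball 0 1 ∧
      ∀ W : Euc m → N, AEMeasurable W → (∀ x ∉ ball a ρ, W x = b) → En W ≤ δ → ∃ w : Euc m → N,
        AEMeasurable w (volume.restrict (ball 0 1)) ∧ EqOn w v (ball 0 1 \ ball 0 ε) ∧
        EqOn w W (ball a ρ) ∧
        sobolevEnergy n s p w (ball 0 1) ≤ sobolevEnergy n s p v (ball 0 1) + τ ∧
        sobolevEnergy n s p v (ball 0 1) ≤ sobolevEnergy n s p w (ball 0 1) + τ ∧
        ∀ (ν : ℕ) (f : N → Euc ν) (K : NNReal), ContMDiff (𝓡 n) (𝓡 ν) 1 f → LipschitzWith K f →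
          ∫⁻ x in ball 0 1, ‖f (w x) - f (v x)‖ₑ ^ p ≤ C K ν * τ ∧
          sobolevEnergy ν s p (fun x => f (w x) - f (v x)) (ball 0 1) ≤ C K ν * τ

/-- The cases s < 1 and s = 1 enter only through gluing, extension and insertion, so the conclusion
is derived once from these three properties. -/
theorem IsGluingEnergy.density {n : ℕ} [ChartedSpace (EuclideanSpace ℝ (Fin n)) N]
    [RiemannianBundle (fun x : N => TangentSpace (𝓡 n) x)] (hm : 1 ≤ m) {s p : ℝ} (hsp0 : 0 < s * p)
    {En : (Euc m → N) → ℝ≥0∞} (hE : IsGluingEnergy ((m : ℝ) - s * p) En)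
    (hext : HasExtension n s p En) (hins : HasInsertion n s p En)
    (G : Energy m N) (hG : G.IsSuperadditive) (hG' : G.HasScaling s p)
    (hsp : s * p ≤ m) (u : ℕ → Euc m → N) (hu_meas : ∀ k, MeasurableMapOn (u k) (ball 0 1))
    (hu_pos : ∀ k, 0 < sobolevEnergy n s p (u k) (ball 0 1))
    (hu_lim : Tendsto (fun k => G.toFun (u k) (ball 0 1) /
      sobolevEnergy n s p (u k) (ball 0 1)) atTop (𝓝 ⊤))
    (hu_crit : s * p = m →
      Tendsto (fun k => sobolevEnergy n s p (u k) (ball 0 1)) atTop (𝓝 0))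
    (v : Euc m → N) (hv_meas : MeasurableMapOn v (ball 0 1))
    (hv_fin : sobolevEnergy n s p v (ball 0 1) < ⊤) :
    (∀ ε : ℝ, 0 < ε → ∃ w : Euc m → N, MeasurableMapOn w (ball 0 1) ∧
      EqOn w v (ball 0 1 \ ball 0 ε) ∧
      sobolevEnergy n s p w (ball 0 1) ≤ sobolevEnergy n s p v (ball 0 1) + ofReal ε ∧
      G.toFun w (ball 0 1) = ⊤) ∧
    (∃ w : ℕ → Euc m → N,
      (∀ k, MeasurableMapOn (w k) (ball 0 1) ∧
        EqOn (w k) v (ball 0 1 \ ball 0 (1 / ((k : ℝ) + 1))) ∧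
        sobolevEnergy n s p (w k) (ball 0 1) < ⊤ ∧ G.toFun (w k) (ball 0 1) = ⊤) ∧
      Tendsto (fun k => sobolevEnergy n s p (w k) (ball 0 1)) atTop
        (𝓝 (sobolevEnergy n s p v (ball 0 1))) ∧
      SobolevTendsto n s p w v (ball 0 1)) := by
  obtain ⟨C₀, hC₀, hU⟩ := hext
  -- The extended maps are constant only outside the ball of radius 12; shrinking them by 12 costs
  -- the same factor κ₀ on both energies.
  set κ₀ : ℝ≥0∞ := ofReal ((1 / 12) ^ ((m : ℝ) - s * p)) with hκ₀
  have hκ₀0 : κ₀ ≠ 0 := by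
    rw [hκ₀, Ne, ENNReal.ofReal_eq_zero, not_le]
    positivity
  have hbub : ∀ k, sobolevEnergy n s p (u k) (ball 0 1) < ⊤ → ∃ (U : Euc m → N) (c : N),
      AEMeasurable U ∧ (∀ x ∉ ball 0 1, U x = c) ∧
      En U ≤ κ₀ * C₀ * sobolevEnergy n s p (u k) (ball 0 1) ∧
      κ₀ * G.toFun (u k) (ball 0 1) ≤ G.toFun U (ball 0 1) := by
    intro k hk
    obtain ⟨U, c, hUm, hUu, hUc, hUE⟩ := hU (u k) (hu_meas k) (hu_pos k) hk
    have hVm : AEMeasurable fun x : Euc m => U ((1 / 12 : ℝ)⁻¹ • (x - 0)) := by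
      refine hUm.comp_quasiMeasurePreserving
        ((Measure.quasiMeasurePreserving_smul volume (r := (1 / 12 : ℝ)⁻¹) (by norm_num)).comp
        (measurePreserving_sub_right volume 0).quasiMeasurePreserving)
    refine ⟨_, c, hVm, fun x hx => hUc _ ?_, (hE.scale U hUm (1 / 12) 0 (by norm_num)).trans ?_, ?_⟩
    · have : 1 ≤ ‖x‖ := by simpa using hx
      rw [mem_ball, dist_zero_right, sub_zero, norm_smul]
      norm_num
      linarith
    · rw [mul_assoc]
      gcongr
    · have h2 := hG' _ (by rw [MeasurableMapOn]; exact hVm.restrict) (1 / 12) 0 (ball 0 1)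
        (by norm_num) isOpen_ball
      have h4 : (fun x : Euc m => U ((1 / 12 : ℝ)⁻¹ • (0 + (1 / 12 : ℝ) • x - 0))) = U := by
        ext x
        rw [zero_add, sub_zero, inv_smul_smul₀ (by norm_num)]
      rw [h4, ← hκ₀] at h2
      have h5 : G.toFun (u k) (ball 0 1) ≤ G.toFun U (ball 0 1) :=
        G.restrict_le _ _ U (u k) isOpen_ball isOpen_ball subset_rfl hUm.restrict
          fun x hx => (hUu hx).symm
      refine (mul_le_mul_right h5 κ₀).trans (h2.symm.le.trans ?_)
      refine G.restrict_le _ _ _ _ ?_ isOpen_ball ?_ hVm.restrict fun _ _ => rfl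
      · simp only [zero_add]
        exact (isOpenMap_smul₀ (by norm_num)) _ isOpen_ball
      · rintro _ ⟨x, hx, rfl⟩
        have : ‖x‖ < 1 := by simpa using hx
        simp only [mem_ball, dist_zero_right, zero_add, norm_smul]
        norm_num
        linarith
  have hcell := fun b δ M (hδ : δ ≠ 0) (hM : M ≠ ⊤) => hE.exists_cell hm rfl (by linarith) hsp0 hG hG'
    (ENNReal.mul_ne_top ofReal_ne_top hC₀) hκ₀0 ofReal_ne_top hu_pos
    hu_lim (fun h => hu_crit (by linarith)) hbub b (δ := δ) (M := M) hδ hM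
  obtain ⟨C, hC, hv⟩ := hins
  -- The radius ε of the modification and the tolerance τ on the energies are independent. The first
  -- conclusion uses them with equal values, the second along the sequence 1/(k+1).
  have key : ∀ ε : ℝ, 0 < ε → ∀ τ : ℝ≥0∞, τ ≠ 0 → ∃ w : Euc m → N, MeasurableMapOn w (ball 0 1) ∧
      EqOn w v (ball 0 1 \ ball 0 ε) ∧ G.toFun w (ball 0 1) = ⊤ ∧
      sobolevEnergy n s p w (ball 0 1) ≤ sobolevEnergy n s p v (ball 0 1) + τ ∧
      sobolevEnergy n s p v (ball 0 1) ≤ sobolevEnergy n s p w (ball 0 1) + τ ∧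
      ∀ (ν : ℕ) (f : N → Euc ν) (K : NNReal), ContMDiff (𝓡 n) (𝓡 ν) 1 f → LipschitzWith K f →
        ∫⁻ x in ball 0 1, ‖f (w x) - f (v x)‖ₑ ^ p ≤ C K ν * τ ∧
        sobolevEnergy ν s p (fun x => f (w x) - f (v x)) (ball 0 1) ≤ C K ν * τ := by
    intro ε hε τ hτ
    obtain ⟨a, ρ, b, δ, hρ, hδ, haε, ha1, hw⟩ := hv v hv_meas hv_fin ε hε τ hτ
    obtain ⟨W, hWm, hWb, hWE, hWG⟩ := hE.exists_infinite hm rfl (by linarith) hG hG' hcell b hδ hρ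
      (a := a)
    obtain ⟨w, hwm, hwv, hwW, h1, h2, h3⟩ := hw W hWm hWb hWE
    refine ⟨w, hwm, hwv, ?_, h1, h2, h3⟩
    rw [← top_le_iff, ← hWG]
    exact G.restrict_le _ _ w W isOpen_ball isOpen_ball ha1 hwm fun x hx => (hwW hx).symm
  constructor
  · intro ε hε
    obtain ⟨w, h1, h2, h3, h4, -⟩ := key ε hε (ofReal ε) (by simpa using hε)
    exact ⟨w, h1, h2, h4, h3⟩
  · choose w h1 h2 h3 h4 h5 h6 using fun k : ℕ => key (1 / ((k : ℝ) + 1)) (by positivity)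
      (ofReal (1 / ((k : ℝ) + 1))) (by rw [Ne, ENNReal.ofReal_eq_zero, not_le]; positivity)
    have hlim : Tendsto (fun k : ℕ => ofReal (1 / ((k : ℝ) + 1))) atTop (𝓝 0) := by
      have := ENNReal.tendsto_ofReal (tendsto_one_div_add_atTop_nhds_zero_nat (𝕜 := ℝ))
      simpa using this
    refine ⟨w, fun k => ⟨h1 k, h2 k, (h4 k).trans_lt (by finiteness), h3 k⟩, ?_, ?_⟩
    · refine tendsto_of_tendsto_of_tendsto_of_le_of_le
        (g := fun k : ℕ => sobolevEnergy n s p v (ball 0 1) - ofReal (1 / ((k : ℝ) + 1)))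
        (h := fun k : ℕ => sobolevEnergy n s p v (ball 0 1) + ofReal (1 / ((k : ℝ) + 1)))
        ?_ ?_ (fun k => tsub_le_iff_right.2 (h5 k)) h4
      · simpa using ENNReal.Tendsto.sub tendsto_const_nhds hlim (Or.inl hv_fin.ne)
      · simpa using Tendsto.add (tendsto_const_nhds (x := sobolevEnergy n s p v (ball 0 1))) hlim
    · rintro ν f hf ⟨K, hK⟩
      have hlim' : Tendsto (fun k : ℕ => C K ν * ofReal (1 / ((k : ℝ) + 1))) atTop (𝓝 0) := by
        simpa using ENNReal.Tendsto.const_mul hlim (Or.inr (hC K ν))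
      exact ⟨tendsto_zero_of_le hlim' fun k => (h6 k ν f K hf hK).1,
        tendsto_zero_of_le hlim' fun k => (h6 k ν f K hf hK).2⟩

end Gluing

/-! ### The three properties for 0 < s < 1. -/

section Fractional

variable {N : Type*} [EMetricSpace N] [SecondCountableTopology N] [MeasurableSpace N] [BorelSpace N]

theorem sobolevEnergy_of_lt_one {n : ℕ} [ChartedSpace (EuclideanSpace ℝ (Fin n)) N]
    [RiemannianBundle (fun x : N => TangentSpace (𝓡 n) x)] {s : ℝ} (hs : s < 1) (p : ℝ)
    (u : Euc m → N) (A : Set (Euc m)) :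
    sobolevEnergy n s p u A = gagliardoEnergy s p u A := if_neg hs.ne

/-- Connections between points of `N` of small Gagliardo energy. -/
theorem exists_gagliardo_connection (hm : 1 ≤ m) {s p : ℝ} (hs0 : 0 < s)
    (hs : s < 1) (hp : 1 ≤ p) (hspm : s * p ≤ m) {γ : ℝ → N} {L : NNReal} {b c : N} (h0 : γ 0 = b)
    (h1 : γ 1 = c) (hγ : Continuous γ) (hL : LipschitzOnWith L γ (Icc 0 1)) {δ : ℝ≥0∞} {l₀ : ℝ} (hδ : δ ≠ 0)
    (hl₀ : 0 < l₀) : ∃ (l : ℝ) (Γ : Euc m → N), 0 < l ∧ l ≤ l₀ ∧ l ≤ 1 ∧ AEMeasurable Γ ∧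
      (∀ x ∈ ball 0 l, Γ x = c) ∧ (∀ x ∉ ball 0 1, Γ x = b) ∧ gagliardoEnergy s p Γ univ ≤ δ := by
  have hp0 : 0 < p := by linarith
  have hLp : (L : ℝ≥0∞) ^ p ≠ ⊤ := rpow_ne_top_of_nonneg hp0.le (by simp)
  obtain ⟨δ', hδ', hδδ⟩ := exists_ne_zero_mul_le hLp hδ
  -- The connection is γ ∘ η: since η takes values in [0, 1], where γ is Lipschitz, its energy is at
  -- most L^p times that of η.
  obtain ⟨η, hη, hηE⟩ := exists_gagliardo_cutoff hm hs0 hs hp hspm hδ'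
  obtain ⟨K, hK⟩ := hη.lip
  obtain ⟨r, hr, hr1, hr2⟩ := hη.one
  refine ⟨min r l₀, fun x => γ (η x), lt_min hr hl₀, min_le_right _ _, (min_le_left _ _).trans hr1,
    (hγ.comp hK.continuous).measurable.aemeasurable, fun x hx => ?_, fun x hx => ?_, ?_⟩
  · simp only
    rw [hr2 x (ball_subset_ball (min_le_left _ _) hx), h1]
  · simp only
    rw [hη.zero x hx, h0]
  · refine le_trans ?_ ((mul_le_mul_right hηE _).trans hδδ)
    unfold gagliardoEnergy
    rw [← lintegral_const_mul' _ _ hLp]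
    refine lintegral_mono fun x => ?_
    rw [← lintegral_const_mul' _ _ hLp]
    refine lintegral_mono fun y => ?_
    simp only
    rw [← mul_div_assoc, ← mul_rpow_of_nonneg _ _ hp0.le]
    gcongr
    exact hL (hη.mem x) (hη.mem y)

theorem isGluingEnergy_gagliardo (hm : 1 ≤ m) (hpath : ∀ b c : N, ∃ (γ : ℝ → N) (L : NNReal),
      γ 0 = b ∧ γ 1 = c ∧ Continuous γ ∧ LipschitzOnWith L γ (Icc 0 1)) {s p : ℝ} (hs0 : 0 < s)
    (hs : s < 1) (hp : 1 ≤ p) (hspm : s * p ≤ m) :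
    IsGluingEnergy ((m : ℝ) - s * p) fun w : Euc m → N => gagliardoEnergy s p w univ where
  const c := by
    rw [gagliardoEnergy_eq]
    simp [gker_const p _ (show 0 < p by linarith)]
  scale W _ l h hl := (gagliardoEnergy_homothety W hl h).le
  glue := by
    refine ⟨2 ^ p, rpow_ne_top_of_nonneg (by linarith) (by simp), ?_⟩
    intro ι _ x r hd W Γ w c hW hΓ hwW hwΓ hWm hΓm
    exact gagliardoEnergy_glue_le (by linarith) hd hW hΓ hwW hwΓ (fun i => (hWm i).restrict)
      hΓm.restrict
  conn b c δ l₀ hδ hl₀ := by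
    obtain ⟨γ, L, h0, h1, hγ, hL⟩ := hpath b c
    exact exists_gagliardo_connection hm hs0 hs hp hspm h0 h1 hγ hL hδ hl₀

variable [ChartedSpace (Euc n) N] [RiemannianBundle (fun x : N => TangentSpace (𝓡 n) x)]

theorem hasExtension_gagliardo (hm : 1 ≤ m) {s p : ℝ} (hs0 : 0 < s) (hs : s < 1) (hp : 1 ≤ p) :
    HasExtension n s p fun w : Euc m → N => gagliardoEnergy s p w univ := by
  obtain ⟨C, hC, h⟩ := exists_gagliardoEnergy_extension (N := N) hm hp (s := s) (by positivity)
  refine ⟨C, hC, fun u hu _ _ => ?_⟩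
  obtain ⟨w, b, h1, h2, h3, h4⟩ := h u hu
  exact ⟨w, b, h1, h2, h3, by rwa [sobolevEnergy_of_lt_one hs]⟩

theorem hasInsertion_gagliardo (hm : 1 ≤ m) {s p : ℝ} (hs0 : 0 < s) (hs : s < 1) (hp : 1 ≤ p) :
    HasInsertion n s p fun w : Euc m → N => gagliardoEnergy s p w univ := by
  obtain ⟨C, hC, h⟩ := exists_gagliardo_insertion (N := N) hm hp (s := s) (by positivity)
  refine ⟨fun K _ => C K, fun K _ => hC K, fun v hv hvE ε hε τ hτ => ?_⟩
  rw [sobolevEnergy_of_lt_one hs] at hvE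
  obtain ⟨a, ρ, b, δ, hρ, hδ, h1, h2, h3⟩ := h v hv hvE ε hε τ hτ
  refine ⟨a, ρ, b, δ, hρ, hδ, h1, h2, fun W hW hWb hWE => ?_⟩
  obtain ⟨w, h4, h5, h6, h7, h8, h9⟩ := h3 W hW hWb hWE
  refine ⟨w, h4, h5, h6, by simpa only [sobolevEnergy_of_lt_one hs],
    by simpa only [sobolevEnergy_of_lt_one hs], fun ν f K _ hf => ?_⟩
  simp only [sobolevEnergy_of_lt_one hs]
  exact h9 ν f K hf

end Fractional

/-! ### Lipschitz functions and differentials on a Riemannian manifold. -/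

section Dirichlet

variable {N : Type*} [EMetricSpace N] [SecondCountableTopology N] [MeasurableSpace N] [BorelSpace N]
  [ChartedSpace (Euc n) N] [IsManifold (𝓡 n) ∞ N]
  [RiemannianBundle (fun x : N => TangentSpace (𝓡 n) x)]
  [IsContMDiffRiemannianBundle (𝓡 n) ∞ (Euc n) (fun x : N => TangentSpace (𝓡 n) x)]
  [IsRiemannianManifold (𝓡 n) N]

local instance isManifold_one : IsManifold (𝓡 n) 1 N := IsManifold.of_le (n := ∞) (by simp)

local instance isContinuousRiemannianBundle_tangent :
    IsContinuousRiemannianBundle (Euc n) (fun x : N => TangentSpace (𝓡 n) x) :=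
  have h := IsContMDiffRiemannianBundle.exists_contMDiff (IB := 𝓡 n) (n := ∞)
      (F := Euc n) (E := fun x : N => TangentSpace (𝓡 n) x)
  ⟨h.choose, h.choose_spec.1.continuous, h.choose_spec.2⟩

/-- The differential of a vector valued function on a manifold, as a map between vector spaces. -/
noncomputable def mder {F : Type*} [NormedAddCommGroup F] [NormedSpace ℝ F] (f : N → F) (y : N) :
    Euc n →L[ℝ] F :=
  mfderiv (𝓡 n) 𝓘(ℝ, F) f y

/-- The Riemannian norm of a tangent vector, given by its coordinates in the preferred chart. -/
noncomputable def tnorm (y : N) (ξ : Euc n) : ℝ≥0∞ :=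
  ‖(show TangentSpace (𝓡 n) y from ξ)‖ₑ

theorem chartCurve_contMDiffAt (y₀ : N) (x v : Euc n) {s : ℝ}
    (hs : x + s • v ∈ (extChartAt (𝓡 n) y₀).target) :
    ContMDiffAt 𝓘(ℝ, ℝ) (𝓡 n) 1 (fun s : ℝ => (extChartAt (𝓡 n) y₀).symm (x + s • v)) s := by
  have h1 : ContMDiffOn 𝓘(ℝ, Euc n) (𝓡 n) 1 (extChartAt (𝓡 n) y₀).symm
      (extChartAt (𝓡 n) y₀).target := contMDiffOn_extChartAt_symm y₀
  have h2 := h1.contMDiffAt ((isOpen_extChartAt_target y₀).mem_nhds hs)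
  have h3 : ContMDiffAt 𝓘(ℝ, ℝ) 𝓘(ℝ, Euc n) 1 (fun s : ℝ => x + s • v) s := by
    apply ContDiffAt.contMDiffAt
    fun_prop
  exact h2.comp s h3

theorem chartCurve_mfderiv (y₀ : N) (x v : Euc n) {s : ℝ}
    (hs : x + s • v ∈ (extChartAt (𝓡 n) y₀).target) :
    mfderiv 𝓘(ℝ, ℝ) (𝓡 n) (fun s : ℝ => (extChartAt (𝓡 n) y₀).symm (x + s • v)) s (1 : ℝ) =
      (trivializationAt (Euc n) (fun x : N => TangentSpace (𝓡 n) x) y₀).symmL ℝ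
        ((extChartAt (𝓡 n) y₀).symm (x + s • v)) v := by
  have hsrc : (extChartAt (𝓡 n) y₀).symm (x + s • v) ∈ (chartAt (Euc n) y₀).source := by
    simpa using (extChartAt (𝓡 n) y₀).map_target hs
  rw [TangentBundle.symmL_trivializationAt hsrc, (extChartAt (𝓡 n) y₀).right_inv hs]
  have h1 : MDifferentiableWithinAt 𝓘(ℝ, Euc n) (𝓡 n) (extChartAt (𝓡 n) y₀).symm
    (range (𝓡 n)) (x + s • v) := mdifferentiableWithinAt_extChartAt_symm hs
  have hr : range (𝓡 n) = univ := ModelWithCorners.range_eq_univ _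
  rw [hr] at h1 ⊢
  rw [mfderivWithin_univ]
  rw [mdifferentiableWithinAt_univ] at h1
  have h3 : HasMFDerivAt 𝓘(ℝ, ℝ) 𝓘(ℝ, Euc n) (fun s : ℝ => x + s • v) s
      (ContinuousLinearMap.toSpanSingleton ℝ v) := by
    apply HasFDerivAt.hasMFDerivAt
    have h := ((ContinuousLinearMap.toSpanSingleton ℝ v).hasFDerivAt (x := s)).const_add x
    exact h
  have h4 := (h1.hasMFDerivAt.comp s h3).mfderiv
  have : (fun s : ℝ => (extChartAt (𝓡 n) y₀).symm (x + s • v)) =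
    (extChartAt (𝓡 n) y₀).symm ∘ (fun s : ℝ => x + s • v) := rfl
  rw [this, h4]
  change (mfderiv 𝓘(ℝ, Euc n) (𝓡 n) (extChartAt (𝓡 n) y₀).symm (x + s • v))
    (ContinuousLinearMap.toSpanSingleton ℝ v (1 : ℝ)) = _
  rw [ContinuousLinearMap.toSpanSingleton_apply, one_smul]
  rfl

/-- The velocity of a coordinate line is the constant vector read in the trivialization. By
continuity of the metric its norm near y exceeds the norm of ξ by a factor arbitrarily close to 1.
-/
theorem eventually_enorm_mfderiv_chartCurve_le (y : N) (ξ : TangentSpace (𝓡 n) y) {r : ℝ≥0∞}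
    (hr : 1 < r) :
    ∀ᶠ s in 𝓝 (0 : ℝ), extChartAt (𝓡 n) y y + s • ((trivializationAt (Euc n)
        (fun x : N => TangentSpace (𝓡 n) x) y).continuousLinearMapAt ℝ y ξ : Euc n)
          ∈ (extChartAt (𝓡 n) y).target ∧
      ‖mfderiv 𝓘(ℝ, ℝ) (𝓡 n) (fun s : ℝ => (extChartAt (𝓡 n) y).symm
        (extChartAt (𝓡 n) y y + s • ((trivializationAt (Euc n)
        (fun x : N => TangentSpace (𝓡 n) x) y).continuousLinearMapAt ℝ y ξ : Euc n))) s (1 : ℝ)‖ₑ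
        ≤ r * ‖ξ‖ₑ := by
  obtain ⟨q, hq1, hqr⟩ := ENNReal.lt_iff_exists_nnreal_btwn.1 hr
  have hq : (1 : ℝ) < q := by exact_mod_cast hq1
  set v : Euc n := (trivializationAt (Euc n)
        (fun x : N => TangentSpace (𝓡 n) x) y).continuousLinearMapAt ℝ y ξ with hv
  have hc : ContinuousAt (fun s : ℝ => extChartAt (𝓡 n) y y + s • v) 0 := by fun_prop
  have h0 : extChartAt (𝓡 n) y y + (0 : ℝ) • v = extChartAt (𝓡 n) y y := by simp
  have h1 : ∀ᶠ s in 𝓝 (0 : ℝ), extChartAt (𝓡 n) y y + s • v ∈ (extChartAt (𝓡 n) y).target := by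
    apply hc.eventually_mem
    rw [h0]
    exact (isOpen_extChartAt_target y).mem_nhds (mem_extChartAt_target y)
  have hcs : ContinuousAt (fun s : ℝ => (extChartAt (𝓡 n) y).symm
      (extChartAt (𝓡 n) y y + s • v)) 0 := by
    apply ContinuousAt.comp _ hc
    rw [h0]
    exact continuousAt_extChartAt_symm y
  have h2 := eventually_norm_symmL_trivializationAt_comp_self_lt (Euc n)
    (fun x : N => TangentSpace (𝓡 n) x) y hq
  have h3 := hcs.eventually (p := fun z => _) (by simp only [h0, extChartAt_to_inv]; exact h2)
  filter_upwards [h1, h3] with s hs1 hs3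
  refine ⟨hs1, ?_⟩
  rw [chartCurve_mfderiv y _ v hs1]
  have h4 := ContinuousLinearMap.le_of_opNorm_le _ hs3.le ξ
  refine le_trans ?_ (mul_le_mul_left hqr.le _)
  rw [enorm_eq_nnnorm, enorm_eq_nnnorm]
  exact_mod_cast h4

theorem eventually_edist_chartCurve_le (y : N) (ξ : TangentSpace (𝓡 n) y) {r : ℝ≥0∞}
    (hr : 1 < r) :
    ∀ᶠ s in 𝓝 (0 : ℝ), edist ((extChartAt (𝓡 n) y).symm
        (extChartAt (𝓡 n) y y + s • ((trivializationAt (Euc n)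
        (fun x : N => TangentSpace (𝓡 n) x) y).continuousLinearMapAt ℝ y ξ : Euc n))) y
        ≤ r * ‖ξ‖ₑ * ‖s‖ₑ := by
  have h := eventually_enorm_mfderiv_chartCurve_le y ξ hr
  set v : Euc n := (trivializationAt (Euc n)
        (fun x : N => TangentSpace (𝓡 n) x) y).continuousLinearMapAt ℝ y ξ with hv
  rw [Metric.eventually_nhds_iff_ball] at h ⊢
  obtain ⟨ε, hε, h⟩ := h
  refine ⟨ε, hε, fun t ht => ?_⟩
  set γ : ℝ → N := fun s : ℝ => (extChartAt (𝓡 n) y).symm (extChartAt (𝓡 n) y y + s • v) with hγ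
  have hγ0 : γ 0 = y := by simp [hγ]
  have hsub : uIcc 0 t ⊆ ball (0 : ℝ) ε := by
    have : (0 : ℝ) ∈ ball (0 : ℝ) ε := mem_ball_self hε
    rw [← segment_eq_uIcc]
    exact (convex_ball (0 : ℝ) ε).segment_subset this ht
  have key : edist (γ (min 0 t)) (γ (max 0 t)) ≤ r * ‖ξ‖ₑ * ‖t‖ₑ := by
    rw [IsRiemannianManifold.out (I := 𝓡 n) (γ (min 0 t)) (γ (max 0 t))]
    refine (Manifold.riemannianEDist_le_pathELength (γ := γ) (a := min 0 t) (b := max 0 t) ?_ rfl rfl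
      min_le_max).trans ?_
    · intro s hs
      exact (chartCurve_contMDiffAt y _ v (h s (hsub hs)).1).contMDiffWithinAt
    · rw [Manifold.pathELength_eq_lintegral_mfderiv_Icc]
      refine (setLIntegral_mono' measurableSet_Icc (g := fun _ => r * ‖ξ‖ₑ)
        (fun s hs => (h s (hsub hs)).2)).trans ?_
      rw [setLIntegral_const, Real.volume_Icc, max_sub_min_eq_abs, Real.enorm_eq_ofReal_abs]
      simp
  rcases le_total 0 t with h0 | h0
  · rw [min_eq_left h0, max_eq_right h0, hγ0, edist_comm] at key
    exact key
  · rw [min_eq_right h0, max_eq_left h0, hγ0] at key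
    exact key

/-- Along the coordinate line with initial velocity ξ the distance to y is at most r|ξ||s| for every
r > 1 and small s. The difference quotients of f are then at most Kr|ξ|, and r tends to 1. -/
theorem LipschitzWith.enorm_mfderiv_le {F : Type*} [NormedAddCommGroup F] [NormedSpace ℝ F]
    {K : NNReal} {f : N → F} (hf : LipschitzWith K f) {y : N}
    (hd : MDifferentiableAt (𝓡 n) 𝓘(ℝ, F) f y) (ξ : TangentSpace (𝓡 n) y) :
    ‖mder f y ξ‖ₑ ≤ K * ‖ξ‖ₑ := by
  set v : Euc n := (trivializationAt (Euc n)
        (fun x : N => TangentSpace (𝓡 n) x) y).continuousLinearMapAt ℝ y ξ with hv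
  set γ : ℝ → N := fun s : ℝ => (extChartAt (𝓡 n) y).symm (extChartAt (𝓡 n) y y + s • v) with hγ
  have hγ0 : γ 0 = y := by simp [hγ]
  have hmem : extChartAt (𝓡 n) y y + (0 : ℝ) • v ∈ (extChartAt (𝓡 n) y).target := by simp
  have hγd : MDifferentiableAt 𝓘(ℝ, ℝ) (𝓡 n) γ 0 :=
    (chartCurve_contMDiffAt y _ v hmem).mdifferentiableAt one_ne_zero
  have hγ' : mfderiv 𝓘(ℝ, ℝ) (𝓡 n) γ 0 (1 : ℝ) = ξ := by
    rw [hγ, chartCurve_mfderiv y _ v hmem]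
    have : (extChartAt (𝓡 n) y).symm (extChartAt (𝓡 n) y y + (0 : ℝ) • v) = y := hγ0
    rw [this]
    exact (trivializationAt (Euc n) (fun x : N => TangentSpace (𝓡 n) x) y).symmL_continuousLinearMapAt
      (FiberBundle.mem_baseSet_trivializationAt' y) ξ
  have hcomp : HasMFDerivAt 𝓘(ℝ, ℝ) 𝓘(ℝ, F) (f ∘ γ) 0
      ((mfderiv (𝓡 n) 𝓘(ℝ, F) f y).comp (mfderiv 𝓘(ℝ, ℝ) (𝓡 n) γ 0)) := by
    have h1 : HasMFDerivAt (𝓡 n) 𝓘(ℝ, F) f (γ 0) (mfderiv (𝓡 n) 𝓘(ℝ, F) f y) := by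
      rw [hγ0]; exact hd.hasMFDerivAt
    exact h1.comp 0 hγd.hasMFDerivAt
  have hfd := hcomp.hasFDerivAt
  refine ENNReal.le_of_forall_pos_le_add fun ε hε _ => ?_
  have : ∀ r : NNReal, 1 < r → ‖mder f y ξ‖ₑ ≤ K * (r * ‖ξ‖ₑ) := by
    intro r hr
    have hlip : ∀ᶠ s in 𝓝 (0 : ℝ), ‖(f ∘ γ) s - (f ∘ γ) 0‖ ≤ (K * (r * ‖ξ‖₊) : NNReal) * ‖s - 0‖ := by
      filter_upwards [eventually_edist_chartCurve_le y ξ (r := r) (by exact_mod_cast hr)] with s hs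
      have hs' : edist (γ s) (γ 0) ≤ r * ‖ξ‖ₑ * ‖s‖ₑ := by rw [hγ0]; exact hs
      have h1 := (hf.edist_le_mul (γ s) (γ 0)).trans (mul_le_mul_right hs' _)
      rw [edist_eq_enorm_sub, enorm_eq_nnnorm, enorm_eq_nnnorm, enorm_eq_nnnorm] at h1
      have h2 : ‖f (γ s) - f (γ 0)‖₊ ≤ K * (r * ‖ξ‖₊ * ‖s‖₊) := by exact_mod_cast h1
      have h3 : ‖f (γ s) - f (γ 0)‖ ≤ K * (r * ‖ξ‖ * ‖s‖) := by exact_mod_cast h2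
      simp only [Function.comp_apply, sub_zero]
      push_cast
      linarith
    have h4 := hfd.le_of_lip' (NNReal.coe_nonneg _) hlip
    have h5 := ContinuousLinearMap.le_of_opNorm_le _ h4 (1 : ℝ)
    have h6 : ((mfderiv (𝓡 n) 𝓘(ℝ, F) f y).comp (mfderiv 𝓘(ℝ, ℝ) (𝓡 n) γ 0)) (1 : ℝ)
      = mder f y ξ := congrArg (mder f y) hγ'
    have h7 : ‖mder f y ξ‖ ≤ (K * (r * ‖ξ‖₊) : NNReal) * ‖(1 : ℝ)‖ := by
      rw [← h6]; exact h5
    rw [norm_one, mul_one] at h7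
    have h8 : ‖mder f y ξ‖₊ ≤ K * (r * ‖ξ‖₊) := h7
    rw [enorm_eq_nnnorm, enorm_eq_nnnorm]
    exact_mod_cast h8
  have hlim : Tendsto (fun r : NNReal => (K : ℝ≥0∞) * (r * ‖ξ‖ₑ)) (𝓝[>] 1) (𝓝 (K * (1 * ‖ξ‖ₑ))) := by
    apply ENNReal.Tendsto.const_mul _ (Or.inr ENNReal.coe_ne_top)
    apply ENNReal.Tendsto.mul_const _ (Or.inr enorm_ne_top)
    exact (ENNReal.tendsto_coe.2 tendsto_id).mono_left nhdsWithin_le_nhds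
  have := ge_of_tendsto hlim (Filter.eventually_of_mem self_mem_nhdsWithin this)
  rw [one_mul] at this
  exact this.trans le_self_add

/-- Since the distance is the infimum of lengths of curves, it suffices to integrate the bound along
nearly minimizing curves. The condition K ≠ 0 allows division by K in `ℝ≥0∞`. -/
theorem lipschitzWith_of_enorm_mder_le {K : NNReal} (hK0 : K ≠ 0) {f : N → ℝ}
    (hf : ContMDiff (𝓡 n) 𝓘(ℝ, ℝ) 1 f)
    (hK : ∀ y (ξ : TangentSpace (𝓡 n) y), ‖mder f y ξ‖ₑ ≤ K * ‖ξ‖ₑ) :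
    LipschitzWith K f := by
  intro x y
  have hmul : ∀ r, edist x y < r → edist (f x) (f y) ≤ K * r := by
    intro r hr
    rw [IsRiemannianManifold.out (I := 𝓡 n) x y] at hr
    obtain ⟨γ, rfl, rfl, hγ, hlen⟩ := Manifold.exists_lt_of_riemannianEDist_lt hr
    rw [IsRiemannianManifold.out (I := 𝓘(ℝ, ℝ)) (f (γ 0)) (f (γ 1))]
    refine (Manifold.riemannianEDist_le_pathELength (γ := f ∘ γ) (a := 0) (b := 1)
      (hf.comp_contMDiffOn hγ) rfl rfl zero_le_one).trans ?_
    refine le_trans ?_ (mul_le_mul_right hlen.le (K : ℝ≥0∞))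
    rw [Manifold.pathELength_eq_lintegral_mfderiv_Ioo, Manifold.pathELength_eq_lintegral_mfderiv_Ioo,
      ← lintegral_const_mul' _ _ ENNReal.coe_ne_top]
    refine setLIntegral_mono' measurableSet_Ioo fun t ht => ?_
    rw [enorm_tangentSpace_vectorSpace]
    have hd : MDifferentiableAt 𝓘(ℝ, ℝ) (𝓡 n) γ t :=
      ((hγ t (Ioo_subset_Icc_self ht)).contMDiffAt (Icc_mem_nhds ht.1 ht.2)).mdifferentiableAt
        one_ne_zero
    have h := mfderiv_comp t ((hf (γ t)).mdifferentiableAt one_ne_zero) hd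
    have h1 : mfderiv 𝓘(ℝ, ℝ) 𝓘(ℝ, ℝ) (f ∘ γ) t (1 : ℝ) =
      mder f (γ t) (mfderiv 𝓘(ℝ, ℝ) (𝓡 n) γ t (1 : ℝ)) := by rw [h]; rfl
    have h2 := hK (γ t) (mfderiv 𝓘(ℝ, ℝ) (𝓡 n) γ t (1 : ℝ))
    rw [← h1] at h2
    exact h2
  have hK0' : (K : ℝ≥0∞) ≠ 0 := by exact_mod_cast hK0
  rw [mul_comm, ← ENNReal.div_le_iff_le_mul (Or.inl hK0') (Or.inl ENNReal.coe_ne_top)]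
  refine le_of_forall_gt_imp_ge_of_dense fun r hr => ?_
  rw [ENNReal.div_le_iff_le_mul (Or.inl hK0') (Or.inl ENNReal.coe_ne_top), mul_comm]
  exact hmul r hr

/-- Around every point there are bounded Lipschitz functions of class `C^1` that restrict to the
coordinates of the chart. -/
theorem exists_lipschitz_coordinates (y₀ : N) :
    ∃ U : Set N, IsOpen U ∧ y₀ ∈ U ∧ U ⊆ (chartAt (Euc n) y₀).source ∧ ∃ f : Fin n → N → ℝ,
      ∀ k, ContMDiff (𝓡 n) 𝓘(ℝ, ℝ) 1 (f k) ∧ (∃ K, LipschitzWith K (f k)) ∧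
        (∃ M : ℝ, ∀ y, |f k y| ≤ M) ∧ ∀ y ∈ U, ∀ ξ : TangentSpace (𝓡 n) y,
          mder (f k) y ξ = ((trivializationAt (Euc n)
            (fun x : N => TangentSpace (𝓡 n) x) y₀).continuousLinearMapAt ℝ y ξ : Euc n) k := by
  -- The bump function is supported where the trivialization is bounded by C. There a bound on the
  -- differential in coordinates gives one for the Riemannian norm, hence a Lipschitz constant.
  obtain ⟨C, hC, hCy⟩ := eventually_norm_trivializationAt_lt (Euc n)
    (fun x : N => TangentSpace (𝓡 n) x) y₀
  obtain ⟨χ, -, hχ⟩ := (SmoothBumpFunction.nhds_basis_tsupport (I := 𝓡 n) y₀).mem_iff.1 hCy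
  set φ := extChartAt (𝓡 n) y₀ with hφ
  let ψ : Fin n → Euc n → ℝ := fun k x => χ.toContDiffBump x * x k
  let f : Fin n → N → ℝ := fun k y => χ y * φ y k
  have hψ : ∀ k, ContDiff ℝ 1 (ψ k) := fun k =>
    χ.toContDiffBump.contDiff.mul (by fun_prop)
  have hψc : ∀ k, HasCompactSupport (ψ k) := fun k => χ.toContDiffBump.hasCompactSupport.mul_right
  have hfψ : ∀ k, ∀ y ∈ (chartAt (Euc n) y₀).source, f k y = ψ k (φ y) := by
    intro k y hy
    simp only [f, ψ]
    rw [χ.eqOn_source hy]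
    rfl
  have hzero : ∀ k, ∀ y, y ∉ tsupport χ → f k =ᶠ[𝓝 y] fun _ => 0 := by
    intro k y hy
    filter_upwards [(isClosed_tsupport χ).isOpen_compl.mem_nhds hy] with z hz
    simp [f, image_eq_zero_of_notMem_tsupport hz]
  have hfd : ∀ k, ∀ y ∈ (chartAt (Euc n) y₀).source, ∀ ξ : TangentSpace (𝓡 n) y,
      mder (f k) y ξ = fderiv ℝ (ψ k) (φ y) ((trivializationAt (Euc n)
            (fun x : N => TangentSpace (𝓡 n) x) y₀).continuousLinearMapAt ℝ y ξ : Euc n) := by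
    intro k y hy ξ
    have h1 : f k =ᶠ[𝓝 y] ψ k ∘ φ := by
      filter_upwards [(chartAt (Euc n) y₀).open_source.mem_nhds hy] with z hz using hfψ k z hz
    have h2 : MDifferentiableAt (𝓡 n) 𝓘(ℝ, Euc n) φ y :=
      mdifferentiableAt_extChartAt hy
    have h3 : HasMFDerivAt 𝓘(ℝ, Euc n) 𝓘(ℝ, ℝ) (ψ k) (φ y) (fderiv ℝ (ψ k) (φ y)) :=
      ((hψ k).differentiable one_ne_zero _).hasFDerivAt.hasMFDerivAt
    have h4 := ((h3.comp y h2.hasMFDerivAt).congr_of_eventuallyEq h1).mfderiv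
    rw [TangentBundle.continuousLinearMapAt_trivializationAt hy]
    unfold mder
    rw [h4]
    rfl
  have hbd : ∀ k, ∃ B : NNReal, ∀ x, ‖fderiv ℝ (ψ k) x‖ ≤ B := by
    intro k
    obtain ⟨B, hB⟩ := ((hψ k).continuous_fderiv one_ne_zero).bounded_above_of_compact_support
      ((hψc k).fderiv ℝ)
    exact ⟨⟨max B 0, le_max_right _ _⟩, fun x => (hB x).trans (le_max_left _ _)⟩
  have hf : ∀ k, ContMDiff (𝓡 n) 𝓘(ℝ, ℝ) 1 (f k) := by
    intro k y
    by_cases hy : y ∈ tsupport χ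
    · have hy' := χ.tsupport_subset_chartAt_source hy
      have h1 : f k =ᶠ[𝓝 y] ψ k ∘ φ := by
        filter_upwards [(chartAt (Euc n) y₀).open_source.mem_nhds hy'] with z hz using hfψ k z hz
      refine ContMDiffAt.congr_of_eventuallyEq ?_ h1
      exact ((hψ k).contMDiff (φ y)).comp y (contMDiffAt_extChartAt' hy')
    · exact contMDiffAt_const.congr_of_eventuallyEq (hzero k y hy)
  refine ⟨(chartAt (Euc n) y₀).source ∩ φ ⁻¹' (ball (φ y₀) χ.rIn), ?_, ⟨mem_chart_source _ _, ?_⟩, inter_subset_left, f,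
    fun k => ⟨hf k, ?_, ?_, ?_⟩⟩
  · have := (continuousOn_extChartAt (I := 𝓡 n) y₀).isOpen_inter_preimage
      (isOpen_extChartAt_source y₀) (isOpen_ball (x := φ y₀) (ε := χ.rIn))
    rwa [extChartAt_source] at this
  · exact mem_ball_self χ.rIn_pos
  · obtain ⟨B, hB⟩ := hbd k
    -- The summand 1 ensures a nonzero constant.
    refine ⟨B * ⟨C, hC.le⟩ + 1, lipschitzWith_of_enorm_mder_le (by positivity) (hf k) fun y ξ => ?_⟩
    refine le_trans ?_ (mul_le_mul_left (ENNReal.coe_le_coe.2 le_self_add) _)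
    by_cases hy : y ∈ tsupport χ
    · rw [hfd k y (χ.tsupport_subset_chartAt_source hy)]
      have h1 := ContinuousLinearMap.le_of_opNorm_le _ (hB (φ y)) ((trivializationAt (Euc n)
            (fun x : N => TangentSpace (𝓡 n) x) y₀).continuousLinearMapAt ℝ y ξ : Euc n)
      have h2 := ContinuousLinearMap.le_of_opNorm_le _ (hχ hy).le ξ
      have h3 := h1.trans (mul_le_mul_of_nonneg_left h2 B.2)
      rw [← mul_assoc] at h3
      rw [enorm_eq_nnnorm, enorm_eq_nnnorm]
      exact_mod_cast h3
    · have : mder (n := n) (f k) y = 0 := by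
        have h1 : HasMFDerivAt (𝓡 n) 𝓘(ℝ, ℝ) (f k) y 0 :=
          (hasMFDerivAt_const (0 : ℝ) y).congr_of_eventuallyEq (hzero k y hy)
        exact h1.mfderiv
      have h0 : mder (f k) y ξ = 0 := by rw [this]; rfl
      rw [h0, enorm_zero]
      exact zero_le
  · obtain ⟨M, hM⟩ := (hψ k).continuous.bounded_above_of_compact_support (hψc k)
    refine ⟨max M 0, fun y => ?_⟩
    by_cases hy : y ∈ tsupport χ
    · rw [hfψ k y (χ.tsupport_subset_chartAt_source hy)]
      exact (hM _).trans (le_max_left _ _)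
    · rw [(hzero k y hy).eq_of_nhds, abs_zero]
      exact le_max_right _ _
  · rintro y ⟨hy, hyb⟩ ξ
    rw [hfd k y hy]
    have h1 : ψ k =ᶠ[𝓝 (φ y)] fun x => EuclideanSpace.proj (𝕜 := ℝ) k x := by
      have h2 : ∀ᶠ x in 𝓝 (φ y), x ∈ ball (φ y₀) χ.rIn := isOpen_ball.mem_nhds hyb
      filter_upwards [h2] with x hx
      simp only [ψ]
      rw [χ.toContDiffBump.one_of_mem_closedBall (ball_subset_closedBall hx), one_mul]
      rfl
    rw [h1.fderiv_eq, ContinuousLinearMap.fderiv]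
    rfl

/-! ### Norms, measurability and paths in the tangent bundle. -/

theorem tnorm_add_le (y : N) (a b : Euc n) : tnorm y (a + b) ≤ tnorm y a + tnorm y b :=
  enorm_add_le (E := TangentSpace (𝓡 n) y) _ _

theorem tnorm_smul (y : N) (c : ℝ) (a : Euc n) : tnorm y (c • a) = ‖c‖ₑ * tnorm y a :=
  enorm_smul (β := TangentSpace (𝓡 n) y) c _

theorem tnorm_zero (y : N) : tnorm y (0 : Euc n) = 0 :=
  enorm_zero (E := TangentSpace (𝓡 n) y)

theorem tnorm_ne_top (y : N) (a : Euc n) : tnorm y a ≠ ⊤ :=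
  enorm_ne_top (E := TangentSpace (𝓡 n) y)

theorem tnorm_sum_le {ι : Type*} (y : N) (s : Finset ι) (a : ι → Euc n) :
    tnorm y (∑ i ∈ s, a i) ≤ ∑ i ∈ s, tnorm y (a i) := by
  classical
  induction s using Finset.induction_on with
  | empty => simp [tnorm_zero]
  | insert i s hi ih =>
    rw [Finset.sum_insert hi, Finset.sum_insert hi]
    exact (tnorm_add_le _ _ _).trans (add_le_add_right ih _)

/-- The Hilbert-Schmidt norm of a linear map into the tangent space at `y`. -/
noncomputable def hs (y : N) (T : Euc m →L[ℝ] Euc n) : ℝ≥0∞ :=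
  (∑ i : Fin m, tnorm y (T (EuclideanSpace.single i 1)) ^ 2) ^ ((1 : ℝ) / 2)

theorem hs_rpow (y : N) (T : Euc m →L[ℝ] Euc n) (p : ℝ) :
    (∑ i : Fin m, tnorm y (T (EuclideanSpace.single i 1)) ^ 2) ^ (p / 2) = hs y T ^ p := by
  rw [hs, ← ENNReal.rpow_mul]
  congr 1
  ring

theorem hs_zero (y : N) : hs y (0 : Euc m →L[ℝ] Euc n) = 0 := by
  simp [hs, tnorm_zero]

theorem tnorm_single_le_hs (y : N) (T : Euc m →L[ℝ] Euc n) (i : Fin m) :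
    tnorm y (T (EuclideanSpace.single i 1)) ≤ hs y T := by
  have h : tnorm y (T (EuclideanSpace.single i 1)) ^ 2 ≤
      ∑ i : Fin m, tnorm y (T (EuclideanSpace.single i 1)) ^ 2 :=
    Finset.single_le_sum (f := fun i => tnorm y (T (EuclideanSpace.single i 1)) ^ 2)
      (fun _ _ => zero_le) (Finset.mem_univ i)
  have h2 := ENNReal.rpow_le_rpow h (z := (1 : ℝ) / 2) (by norm_num)
  rw [← ENNReal.rpow_natCast, ← ENNReal.rpow_mul] at h2
  simpa [hs] using h2

theorem hs_le_sum (y : N) (T : Euc m →L[ℝ] Euc n) :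
    hs y T ≤ ∑ i : Fin m, tnorm y (T (EuclideanSpace.single i 1)) := by
  have h : ∑ i : Fin m, tnorm y (T (EuclideanSpace.single i 1)) ^ 2 ≤
      (∑ i : Fin m, tnorm y (T (EuclideanSpace.single i 1))) ^ 2 := by
    rw [sq, Finset.sum_mul]
    refine Finset.sum_le_sum fun i hi => ?_
    rw [sq]
    exact mul_le_mul_right (Finset.single_le_sum
      (f := fun i => tnorm y (T (EuclideanSpace.single i 1))) (fun _ _ => zero_le) hi) _
  have h2 := ENNReal.rpow_le_rpow h (z := (1 : ℝ) / 2) (by norm_num)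
  rw [← ENNReal.rpow_natCast _ 2, ← ENNReal.rpow_mul] at h2
  simpa [hs] using h2

theorem tnorm_apply_le (y : N) (T : Euc m →L[ℝ] Euc n) (h : Euc m) :
    tnorm y (T h) ≤ m * hs y T * ‖h‖ₑ := by
  have h1 : T h = ∑ i : Fin m, h i • T (EuclideanSpace.single i 1) := by
    conv_lhs => rw [euc_eq_sum h]
    simp
  rw [h1]
  refine (tnorm_sum_le _ _ _).trans ?_
  refine (Finset.sum_le_card_nsmul _ _ (hs y T * ‖h‖ₑ) fun i _ => ?_).trans ?_
  · rw [tnorm_smul, mul_comm]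
    gcongr
    · exact tnorm_single_le_hs y T i
    · rw [enorm_eq_nnnorm, enorm_eq_nnnorm]
      exact_mod_cast PiLp.norm_apply_le h i
  · simp [mul_assoc]

theorem hs_comp_le (y : N) (T : Euc m →L[ℝ] Euc n) (L : Euc m →L[ℝ] Euc m) :
    hs y (T.comp L) ≤ (m * m : ℝ≥0∞) * ‖L‖ₑ * hs y T := by
  refine (hs_le_sum _ _).trans ?_
  refine (Finset.sum_le_card_nsmul _ _ (m * hs y T * ‖L‖ₑ) fun i _ => ?_).trans ?_
  · refine (tnorm_apply_le y T _).trans ?_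
    gcongr
    have h := L.le_opNorm (EuclideanSpace.single i 1)
    simp only [PiLp.norm_single, norm_one, mul_one] at h
    rw [enorm_eq_nnnorm, enorm_eq_nnnorm]
    exact_mod_cast h
  · simp only [Finset.card_univ, Fintype.card_fin, nsmul_eq_mul]
    apply le_of_eq
    ring

theorem enorm_clm_le_of_forall {E F : Type*} [NormedAddCommGroup E] [NormedSpace ℝ E]
    [NormedAddCommGroup F] [NormedSpace ℝ F] (S : E →L[ℝ] F) {C : ℝ≥0∞}
    (h : ∀ x, ‖S x‖ₑ ≤ C * ‖x‖ₑ) : ‖S‖ₑ ≤ C := by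
  induction C with
  | top => exact le_top
  | coe c =>
    rw [enorm_eq_nnnorm, ENNReal.coe_le_coe]
    refine ContinuousLinearMap.opNNNorm_le_bound _ _ fun x => ?_
    have := h x
    rw [enorm_eq_nnnorm, enorm_eq_nnnorm] at this
    exact_mod_cast this

theorem LipschitzWith.enorm_mder_comp_le {F : Type*} [NormedAddCommGroup F] [NormedSpace ℝ F]
    {K : NNReal} {f : N → F} (hf : LipschitzWith K f) {y : N}
    (hd : MDifferentiableAt (𝓡 n) 𝓘(ℝ, F) f y) (T : Euc m →L[ℝ] Euc n) :
    ‖(mder f y).comp T‖ₑ ≤ K * m * hs y T := by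
  refine enorm_clm_le_of_forall _ fun x => ?_
  refine (LipschitzWith.enorm_mfderiv_le hf hd (T x)).trans ?_
  have := mul_le_mul_right (tnorm_apply_le y T x) (K : ℝ≥0∞)
  refine this.trans_eq ?_
  ring

/-- This makes the norm of a tangent vector a measurable function of its base point and of its
coordinates in a fixed chart. -/
theorem continuousOn_tnorm_symmL (y₀ : N) :
    ContinuousOn (fun z : N × Euc n => tnorm z.1 ((trivializationAt (Euc n)
      (fun x : N => TangentSpace (𝓡 n) x) y₀).symmL ℝ z.1 z.2))
      ((chartAt (Euc n) y₀).source ×ˢ univ) := by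
  set e := trivializationAt (Euc n) (fun x : N => TangentSpace (𝓡 n) x) y₀ with he
  have h1 : ContinuousOn (fun z : N × Euc n => TotalSpace.mk' (Euc n)
      (E := fun x : N => TangentSpace (𝓡 n) x) z.1 (e.symm z.1 z.2)) (e.baseSet ×ˢ univ) :=
    e.continuousOn_symm
  have h2 := ContinuousOn.inner_bundle (b := fun z : N × Euc n => z.1)
    (v := fun z => e.symm z.1 z.2) (w := fun z => e.symm z.1 z.2) h1 h1
  have h3 : ∀ z : N × Euc n, z.1 ∈ e.baseSet → tnorm z.1 (e.symmL ℝ z.1 z.2) =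
      ofReal (Real.sqrt (inner ℝ (e.symm z.1 z.2) (e.symm z.1 z.2))) := by
    intro z hz
    rw [← norm_eq_sqrt_real_inner, ofReal_norm, ← Trivialization.symmL_apply (R := ℝ) _ hz]
    rfl
  have hb : e.baseSet = (chartAt (Euc n) y₀).source := by simp [he]
  rw [← hb]
  exact (ENNReal.continuous_ofReal.comp_continuousOn
    (Real.continuous_sqrt.comp_continuousOn h2)).congr fun z hz => h3 z hz.1

/-- `D` is a weak derivative of `u`, tested against bounded functions only. -/
def IsBddWeakDeriv (u : Euc m → N) (D : Euc m → Euc m →L[ℝ] Euc n) (A : Set (Euc m)) : Prop :=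
  ∀ f : N → ℝ, ContMDiff (𝓡 n) 𝓘(ℝ, ℝ) 1 f → (∃ K, LipschitzWith K f) →
    (∃ M : ℝ, ∀ y, |f y| ≤ M) →
      HasWeakFDerivOn (fun x => f (u x)) (fun x => (mder f (u x)).comp (D x)) A

/-- No measurability of D is assumed, and its values are read in charts that change with the point
u(x). The weak derivatives of the test functions of `exists_lipschitz_coordinates` are measurable,
and over each of countably many coordinate neighbourhoods they are the components of D x h in one
chart. -/
theorem IsBddWeakDeriv.aemeasurable_tnorm {u : Euc m → N} {D : Euc m → Euc m →L[ℝ] Euc n}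
    {A : Set (Euc m)} (hA : IsOpen A) (hu : AEMeasurable u (volume.restrict A))
    (hD : IsBddWeakDeriv u D A) (h : Euc m) :
    AEMeasurable (fun x => tnorm (u x) (D x h)) (volume.restrict A) := by
  classical
  choose U hU hmem hUs f hf hL hM hfy using fun y : N => exists_lipschitz_coordinates (n := n) y
  obtain ⟨T, hTc, hT⟩ := TopologicalSpace.countable_cover_nhds
    (fun y : N => (hU y).mem_nhds (hmem y))
  obtain ⟨u', hu', huu'⟩ := hu
  have hcov : A = ⋃ y ∈ T, A ∩ u' ⁻¹' U y := by
    rw [← inter_iUnion₂, ← preimage_iUnion₂, hT, preimage_univ, inter_univ]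
  have hmA : ∀ y, MeasurableSet (A ∩ u' ⁻¹' U y) := fun y =>
    hA.measurableSet.inter (hu' (hU y).measurableSet)
  have := hTc.to_subtype
  rw [hcov, biUnion_eq_iUnion, aemeasurable_iUnion_iff]
  rintro ⟨y, _⟩
  let e := trivializationAt (Euc n) (fun x : N => TangentSpace (𝓡 n) x) y
  let c : Euc m → Euc n := fun x => WithLp.toLp 2 fun k => mder (f y k) (u x) (D x h)
  have hc : AEMeasurable c (volume.restrict A) := by
    have : AEMeasurable (fun x k => mder (f y k) (u x) (D x h)) (volume.restrict A) := by
      refine aemeasurable_pi_lambda _ fun k => ?_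
      have := (hD (f y k) (hf y k) (hL y k) (hM y k)).2.1.aestronglyMeasurable
      exact (this.apply_continuousLinearMap h).aemeasurable
    exact (WithLp.measurable_toLp 2 _).comp_aemeasurable this
  have hQ : Measurable ((U y ×ˢ univ).piecewise
      (fun z : N × Euc n => tnorm z.1 (e.symmL ℝ z.1 z.2)) 0) := by
    refine ContinuousOn.measurable_piecewise ?_ continuousOn_const
      ((hU y).measurableSet.prod MeasurableSet.univ)
    exact (continuousOn_tnorm_symmL y).mono (prod_mono (hUs y) subset_rfl)
  have hres : volume.restrict (A ∩ u' ⁻¹' U y) ≤ (volume.restrict A : Measure (Euc m)) :=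
    Measure.restrict_mono inter_subset_left le_rfl
  refine (hQ.comp_aemeasurable (hu'.aemeasurable.prodMk (hc.mono_measure hres))).congr ?_
  filter_upwards [ae_restrict_mem (hmA y), ae_mono hres huu'] with x hx hxu
  have hxU : u' x ∈ U y := hx.2
  simp only [Function.comp_apply]
  rw [piecewise_eq_of_mem _ _ _ (by exact ⟨hxU, mem_univ _⟩)]
  simp only
  rw [← hxu]
  rw [← hxu] at hxU
  congr 1
  have hcx : c x = e.continuousLinearMapAt ℝ (u x) (D x h) := by
    ext k
    exact hfy y k (u x) hxU (D x h)
  rw [hcx]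
  refine e.symmL_continuousLinearMapAt ?_ (D x h)
  simpa [e] using hUs y hxU

theorem IsBddWeakDeriv.aemeasurable_hs {u : Euc m → N} {D : Euc m → Euc m →L[ℝ] Euc n}
    {A : Set (Euc m)} (hA : IsOpen A) (hu : AEMeasurable u (volume.restrict A))
    (hD : IsBddWeakDeriv u D A) :
    AEMeasurable (fun x => hs (u x) (D x)) (volume.restrict A) := by
  unfold hs
  refine AEMeasurable.pow_const ?_ _
  exact Finset.aemeasurable_fun_sum _ fun i _ => (hD.aemeasurable_tnorm hA hu _).pow_const _

theorem continuous_enorm_mfderiv {γ : ℝ → N} (hγ : ContMDiff 𝓘(ℝ, ℝ) (𝓡 n) 1 γ) :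
    Continuous fun t => tnorm (γ t) (mfderiv 𝓘(ℝ, ℝ) (𝓡 n) γ t (1 : ℝ)) := by
  have h1 : Continuous (fun t : ℝ => (TotalSpace.mk' (Euc n) (E := fun x : N => TangentSpace (𝓡 n) x)
      (γ t) (mfderiv 𝓘(ℝ, ℝ) (𝓡 n) γ t (1 : ℝ)))) := by
    have h2 := hγ.continuous_tangentMap le_rfl
    have h3 : Continuous fun t : ℝ => (TotalSpace.mk' ℝ (E := fun x : ℝ => TangentSpace 𝓘(ℝ, ℝ) x) t
      (1 : ℝ)) := by
      have := (tangentBundleModelSpaceHomeomorph 𝓘(ℝ, ℝ)).symm.continuous.comp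
        (Continuous.prodMk_left (1 : ℝ))
      exact this
    exact h2.comp h3
  have h2 := Continuous.inner_bundle (b := γ) h1 h1
  have h3 : ∀ t, tnorm (γ t) (mfderiv 𝓘(ℝ, ℝ) (𝓡 n) γ t (1 : ℝ)) =
      ofReal (Real.sqrt (inner ℝ (mfderiv 𝓘(ℝ, ℝ) (𝓡 n) γ t (1 : ℝ))
        (mfderiv 𝓘(ℝ, ℝ) (𝓡 n) γ t (1 : ℝ)))) := by
    intro z
    rw [← norm_eq_sqrt_real_inner, ofReal_norm]
    rfl
  simp only [h3]
  exact ENNReal.continuous_ofReal.comp (Real.continuous_sqrt.comp h2)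

/-- The set of points at finite distance from b is open and closed. -/
theorem edist_lt_top_of_connected [ConnectedSpace N] (b c : N) : edist b c < ⊤ := by
  have h : IsClopen (eball b (⊤ : ℝ≥0∞)) := ⟨isClosed_eball_top, isOpen_eball⟩
  have := h.eq_univ ⟨b, mem_eball_self (by simp)⟩
  have h2 : c ∈ eball b (⊤ : ℝ≥0∞) := this ▸ mem_univ c
  rw [edist_comm]
  exact h2

theorem exists_lipschitz_path [ConnectedSpace N] (b c : N) :
    ∃ (γ : ℝ → N) (L : NNReal), γ 0 = b ∧ γ 1 = c ∧ ContMDiff 𝓘(ℝ, ℝ) (𝓡 n) 1 γ ∧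
      (∀ t ∈ Icc (0 : ℝ) 1, tnorm (γ t) (mfderiv 𝓘(ℝ, ℝ) (𝓡 n) γ t (1 : ℝ)) ≤ L) ∧
      LipschitzOnWith L γ (Icc 0 1) := by
  have h := edist_lt_top_of_connected b c
  rw [IsRiemannianManifold.out (I := 𝓡 n) b c] at h
  obtain ⟨γ, h0, h1, hγ, -⟩ :=
    Manifold.exists_lt_locally_constant_of_riemannianEDist_lt h zero_lt_one
  obtain ⟨t, ht, hmax⟩ := isCompact_Icc.exists_isMaxOn (nonempty_Icc.2 (zero_le_one (α := ℝ)))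
    (continuous_enorm_mfderiv hγ).continuousOn
  have hfin := tnorm_ne_top (γ t) (mfderiv 𝓘(ℝ, ℝ) (𝓡 n) γ t (1 : ℝ))
  set L : NNReal := (tnorm (γ t) (mfderiv 𝓘(ℝ, ℝ) (𝓡 n) γ t (1 : ℝ))).toNNReal with hLdef
  have hL : ∀ t ∈ Icc (0 : ℝ) 1, tnorm (γ t) (mfderiv 𝓘(ℝ, ℝ) (𝓡 n) γ t (1 : ℝ)) ≤ L := by
    intro s hs
    rw [hLdef, ENNReal.coe_toNNReal hfin]
    exact hmax hs
  refine ⟨γ, L, h0, h1, hγ, hL, ?_⟩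
  have key : ∀ s ∈ Icc (0 : ℝ) 1, ∀ t ∈ Icc (0 : ℝ) 1, s ≤ t → edist (γ s) (γ t) ≤ L * edist s t := by
    intro s hs t ht hst
    rw [IsRiemannianManifold.out (I := 𝓡 n) (γ s) (γ t)]
    refine (Manifold.riemannianEDist_le_pathELength hγ.contMDiffOn rfl rfl hst).trans ?_
    rw [Manifold.pathELength_eq_lintegral_mfderiv_Icc]
    refine (setLIntegral_mono' measurableSet_Icc (g := fun _ => (L : ℝ≥0∞))
      (fun r hr => hL r ⟨hs.1.trans hr.1, hr.2.trans ht.2⟩)).trans ?_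
    rw [setLIntegral_const, Real.volume_Icc, edist_comm, edist_dist, Real.dist_eq,
      abs_of_nonneg (by linarith)]
  intro s hs t ht
  rcases le_total s t with h | h
  · exact key s hs t ht h
  · rw [edist_comm, edist_comm s t]
    exact key t ht s hs h

/-! ### Weak derivatives of maps into the manifold. -/

/-- `D` is a weak derivative of `u`, as a map between vector spaces. -/
def IsLipWeakDeriv (u : Euc m → N) (D : Euc m → Euc m →L[ℝ] Euc n) (A : Set (Euc m)) : Prop :=
  ∀ f : N → ℝ, ContMDiff (𝓡 n) 𝓘(ℝ, ℝ) 1 f → (∃ K, LipschitzWith K f) →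
    HasWeakFDerivOn (fun x => f (u x)) (fun x => (mder f (u x)).comp (D x)) A

theorem dirichletEnergy_eq (p : ℝ) (u : Euc m → N) (A : Set (Euc m)) :
    dirichletEnergy n p u A = ⨅ (D : Euc m → Euc m →L[ℝ] Euc n) (_ : IsLipWeakDeriv u D A),
      ∫⁻ x in A, hs (u x) (D x) ^ p := by
  simp only [← hs_rpow]
  rfl

/-- The energy of maps with a weak derivative tested against bounded functions. -/
noncomputable def bddEnergy (n : ℕ) [ChartedSpace (EuclideanSpace ℝ (Fin n)) N]
    [RiemannianBundle (fun x : N => TangentSpace (𝓡 n) x)] (p : ℝ) (u : Euc m → N) : ℝ≥0∞ :=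
  ⨅ (D : Euc m → Euc m →L[ℝ] Euc n) (_ : IsBddWeakDeriv u D univ), ∫⁻ x, hs (u x) (D x) ^ p

theorem IsLipWeakDeriv.isBddWeakDeriv {u : Euc m → N} {D : Euc m → Euc m →L[ℝ] Euc n}
    {A : Set (Euc m)} (h : IsLipWeakDeriv u D A) : IsBddWeakDeriv u D A :=
  fun f hf hK _ => h f hf hK

theorem IsBddWeakDeriv.congr_ae {u w : Euc m → N} {D D' : Euc m → Euc m →L[ℝ] Euc n}
    {A : Set (Euc m)} (h : IsBddWeakDeriv u D A) (huw : u =ᵐ[volume.restrict A] w)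
    (hD : D =ᵐ[volume.restrict A] D') : IsBddWeakDeriv w D' A := fun f hf hK hM =>
  (h f hf hK hM).congr_ae (by filter_upwards [huw] with x hx; rw [hx])
    (by filter_upwards [huw, hD] with x hx hx'; rw [hx, hx'])

theorem IsBddWeakDeriv.union {u : Euc m → N} {D : Euc m → Euc m →L[ℝ] Euc n}
    {A B : Set (Euc m)} (hA : IsOpen A) (hB : IsOpen B) (h : IsBddWeakDeriv u D A)
    (h' : IsBddWeakDeriv u D B) : IsBddWeakDeriv u D (A ∪ B) := fun f hf hK hM =>
  (h f hf hK hM).union hA hB (h' f hf hK hM)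

theorem IsBddWeakDeriv.mono {u : Euc m → N} {D : Euc m → Euc m →L[ℝ] Euc n}
    {A B : Set (Euc m)} (h : IsBddWeakDeriv u D A) (hBA : B ⊆ A) : IsBddWeakDeriv u D B :=
  fun f hf hK hM => (h f hf hK hM).mono hBA

theorem isBddWeakDeriv_const (c : N) (A : Set (Euc m)) :
    IsBddWeakDeriv (fun _ => c) (fun _ => (0 : Euc m →L[ℝ] Euc n)) A := fun f _ _ _ => by
  have := HasWeakFDerivOn.const (f c) A
  simpa using this

theorem IsBddWeakDeriv.comp_lipschitz {u : Euc m → N} {D : Euc m → Euc m →L[ℝ] Euc n}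
    {A U : Set (Euc m)} (h : IsBddWeakDeriv u D A) (hA : IsOpen A) (hU : IsOpen U)
    {Φ : Euc m → Euc m} {L : NNReal} (hL : LipschitzWith L Φ) (hUA : MapsTo Φ U A) {C : ℝ≥0∞}
    (hC : C ≠ ⊤) (hm : (volume.restrict U).map Φ ≤ C • volume) :
    IsBddWeakDeriv (fun x => u (Φ x)) (fun x => (D (Φ x)).comp (fderiv ℝ Φ x)) U :=
  fun f hf hK hM => (h f hf hK hM).comp_lipschitz hA hU hL hUA hC hm

theorem hs_smul (y : N) (c : ℝ) (T : Euc m →L[ℝ] Euc n) : hs y (c • T) = ‖c‖ₑ * hs y T := by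
  have e : ‖c‖ₑ = (‖c‖ₑ ^ 2) ^ ((1 : ℝ) / 2) := by
    rw [← ENNReal.rpow_natCast, ← ENNReal.rpow_mul]
    norm_num
  unfold hs
  rw [e, ← mul_rpow_of_nonneg _ _ (by norm_num), Finset.mul_sum]
  congr 1
  refine Finset.sum_congr rfl fun i _ => ?_
  rw [smul_apply, tnorm_smul, mul_pow]

theorem bddEnergy_le {p : ℝ} {u : Euc m → N} {D : Euc m → Euc m →L[ℝ] Euc n}
    (h : IsBddWeakDeriv u D univ) : bddEnergy n p u ≤ ∫⁻ x, hs (u x) (D x) ^ p :=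
  iInf₂_le (f := fun (D : Euc m → Euc m →L[ℝ] Euc n) (_ : IsBddWeakDeriv u D univ) =>
    ∫⁻ x, hs (u x) (D x) ^ p) D h

theorem dirichletEnergy_le {p : ℝ} {u : Euc m → N} {D : Euc m → Euc m →L[ℝ] Euc n}
    {A : Set (Euc m)} (h : IsLipWeakDeriv u D A) :
    dirichletEnergy n p u A ≤ ∫⁻ x in A, hs (u x) (D x) ^ p := by
  rw [dirichletEnergy_eq]
  exact iInf₂_le (f := fun (D : Euc m → Euc m →L[ℝ] Euc n) (_ : IsLipWeakDeriv u D A) =>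
    ∫⁻ x in A, hs (u x) (D x) ^ p) D h

theorem exists_bddWeakDeriv_of_lt {p : ℝ} {u : Euc m → N} {c : ℝ≥0∞} (h : bddEnergy n p u < c) :
    ∃ D : Euc m → Euc m →L[ℝ] Euc n, IsBddWeakDeriv u D univ ∧ ∫⁻ x, hs (u x) (D x) ^ p < c := by
  simpa only [bddEnergy, iInf_lt_iff, exists_prop] using h

theorem exists_lipWeakDeriv_of_lt {p : ℝ} {u : Euc m → N} {A : Set (Euc m)} {c : ℝ≥0∞}
    (h : dirichletEnergy n p u A < c) :
    ∃ D : Euc m → Euc m →L[ℝ] Euc n, IsLipWeakDeriv u D A ∧ ∫⁻ x in A, hs (u x) (D x) ^ p < c := by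
  simpa only [dirichletEnergy_eq, iInf_lt_iff, exists_prop] using h

theorem bddEnergy_const {p : ℝ} (hp : 1 ≤ p) (c : N) : bddEnergy n p (fun _ : Euc m => c) = 0 := by
  refine le_antisymm ((bddEnergy_le (isBddWeakDeriv_const c univ)).trans ?_) zero_le
  simp [hs_zero, show 0 < p by linarith]

theorem bddEnergy_homothety {p : ℝ} (hp : 1 ≤ p) (W : Euc m → N) {l : ℝ} (hl : 0 < l) (h : Euc m) :
    bddEnergy n p (fun x => W (l⁻¹ • (x - h))) ≤
      ofReal (l ^ ((m : ℝ) - p)) * bddEnergy n p W := by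
  have hp0 : 0 < p := by linarith
  have hc : ofReal (l ^ ((m : ℝ) - p)) ≠ 0 := by
    rw [Ne, ENNReal.ofReal_eq_zero, not_le]; positivity
  nth_rewrite 2 [bddEnergy]
  rw [ENNReal.mul_iInf_of_ne hc ofReal_ne_top]
  refine le_iInf fun D => ?_
  rw [ENNReal.mul_iInf_of_ne hc ofReal_ne_top]
  refine le_iInf fun hD => ?_
  obtain ⟨Φ, hΦ⟩ : ∃ Φ : Euc m → Euc m, ∀ x, Φ x = l⁻¹ • (x - h) := ⟨_, fun _ => rfl⟩
  have hdist : ∀ x y, edist (Φ x) (Φ y) = ofReal l⁻¹ * edist x y := fun x y => by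
    rw [hΦ, hΦ, edist_eq_enorm_sub, edist_eq_enorm_sub, ← smul_sub, enorm_smul, sub_sub_sub_cancel_right,
      Real.enorm_eq_ofReal (by positivity)]
  have hΦL : LipschitzWith (l⁻¹).toNNReal Φ := fun x y => (hdist x y).le
  have hfd : ∀ x, fderiv ℝ Φ x = l⁻¹ • ContinuousLinearMap.id ℝ (Euc m) := fun x => by
    have : Φ = fun x => l⁻¹ • (x - h) := funext hΦ
    rw [this]
    exact ((hasFDerivAt_id x).sub_const h |>.const_smul l⁻¹).fderiv
  have h1 := hD.comp_lipschitz isOpen_univ isOpen_univ hΦL (mapsTo_univ _ _)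
    (C := (l.toNNReal : ℝ≥0∞) ^ m) (by finiteness)
    (map_restrict_le_of_antilipschitz hΦL.continuous.measurable fun x _ y _ => by
      rw [hdist, ← mul_assoc, ← ofReal, ← ofReal_mul hl.le, mul_inv_cancel₀ hl.ne',
        ofReal_one, one_mul])
  simp only [hΦ] at h1
  refine (bddEnergy_le h1).trans (le_of_eq ?_)
  rw [lintegral_homothety _ hl h, Real.rpow_sub hl, Real.rpow_natCast, div_eq_mul_inv,
    ofReal_mul (by positivity), mul_assoc, ← Real.rpow_neg hl.le]
  congr 1
  rw [← lintegral_const_mul' _ _ ofReal_ne_top]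
  refine lintegral_congr fun x => ?_
  rw [add_sub_cancel_left, inv_smul_smul₀ hl.ne', hfd, ContinuousLinearMap.comp_smul,
    ContinuousLinearMap.comp_id, hs_smul, mul_rpow_of_nonneg _ _ hp0.le,
    Real.enorm_eq_ofReal (by positivity), ENNReal.ofReal_rpow_of_pos (by positivity),
    Real.rpow_neg hl.le, Real.inv_rpow hl.le]

theorem hs_le_one_add_rpow {p : ℝ} (hp : 1 ≤ p) (a : ℝ≥0∞) : a ≤ 1 + a ^ p := by
  rcases le_total a 1 with h | h
  · exact h.trans le_self_add
  · refine le_trans ?_ le_add_self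
    calc a = a ^ (1 : ℝ) := (ENNReal.rpow_one a).symm
      _ ≤ a ^ p := ENNReal.rpow_le_rpow_of_exponent_le h hp

/-! ### Gluing for the Dirichlet energy. -/

theorem HasWeakFDerivOn.finset_sum {ι : Type*} {A : Set (Euc m)} {g₀ : Euc m → ℝ}
    {G₀ : Euc m → Euc m →L[ℝ] ℝ} {g : ι → Euc m → ℝ} {G : ι → Euc m → Euc m →L[ℝ] ℝ}
    (h₀ : HasWeakFDerivOn g₀ G₀ A) (h : ∀ i, HasWeakFDerivOn (g i) (G i) A) (F : Finset ι) :
    HasWeakFDerivOn (fun x => g₀ x + ∑ i ∈ F, g i x) (fun x => G₀ x + ∑ i ∈ F, G i x) A := by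
  classical
  induction F using Finset.induction_on with
  | empty => simpa using h₀
  | insert i F hi ih =>
    have := (h i).add ih
    simp only [Finset.sum_insert hi]
    convert this using 2 with x x <;> abel

theorem ae_notMem_sphere (hm : 1 ≤ m) {ι : Type*} [Countable ι] (x : ι → Euc m) (r : ι → ℝ) :
    ∀ᵐ y : Euc m, ∀ i, y ∉ sphere (x i) (r i) := by
  have hnt : Nontrivial (Euc m) := by
    have : Nonempty (Fin m) := ⟨⟨0, hm⟩⟩
    infer_instance
  rw [ae_all_iff]
  intro i
  exact measure_eq_zero_iff_ae_notMem.1 (Measure.addHaar_sphere volume (x i) (r i))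

/-- A countable gluing of scalar functions. -/
theorem HasWeakFDerivOn.of_pieces {ι : Type*} [Countable ι] {A : Set (Euc m)} (hA : IsOpen A)
    {S : ι → Set (Euc m)} (hS : ∀ i, MeasurableSet (S i))
    (hd : Pairwise fun i j => Disjoint (S i) (S j))
    {g : Euc m → ℝ} {G : Euc m → Euc m →L[ℝ] ℝ} (hg : ∀ K ⊆ A, IsCompact K → ∫⁻ x in K, ‖g x‖ₑ ≠ ⊤)
    (hG : ∀ K ⊆ A, IsCompact K → ∫⁻ x in K, ‖G x‖ₑ ≠ ⊤)
    (h₀ : HasWeakFDerivOn ((⋃ i, S i)ᶜ.indicator g) ((⋃ i, S i)ᶜ.indicator G) A)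
    (h : ∀ i, HasWeakFDerivOn ((S i).indicator g) ((S i).indicator G) A) :
    HasWeakFDerivOn g G A := by
  classical
  -- Adding finitely many pieces to the background gives k with the remaining pieces replaced by 0.
  -- These functions are dominated by k and stabilize at every point, so weak differentiability
  -- passes to the limit along finite sets.
  have hpt : ∀ {E : Type} [NormedAddCommGroup E] (k : Euc m → E) (F : Finset ι) (x : Euc m),
      (⋃ i, S i)ᶜ.indicator k x + ∑ i ∈ F, (S i).indicator k x =
        (⋃ i ∈ {i | i ∉ F}, S i)ᶜ.indicator k x := by
    intro E _ k F x
    by_cases hx : ∃ i, x ∈ S i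
    · obtain ⟨i, hi⟩ := hx
      have hne : ∀ j, j ≠ i → x ∉ S j := fun j hj hxj => Set.disjoint_left.1 (hd hj) hxj hi
      rw [indicator_of_notMem (by simpa using ⟨i, hi⟩), zero_add]
      by_cases hiF : i ∈ F
      · rw [Finset.sum_eq_single_of_mem i hiF fun j _ hj => indicator_of_notMem (hne j hj) _,
          indicator_of_mem hi, indicator_of_mem]
        simp only [mem_compl_iff, mem_iUnion, not_exists]
        intro j hj hxj
        exact hj (by rwa [show j = i from by_contra fun h => hne j h hxj])
      · rw [Finset.sum_eq_zero fun j hj => indicator_of_notMem (hne j fun h => hiF (h ▸ hj)) _,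
          indicator_of_notMem]
        simp only [mem_compl_iff, not_not, mem_iUnion]
        exact ⟨i, hiF, hi⟩
    · push Not at hx
      rw [indicator_of_mem (by simpa using hx), Finset.sum_eq_zero fun j _ => indicator_of_notMem (hx j) _,
        add_zero, indicator_of_mem]
      simp only [mem_compl_iff, mem_iUnion, not_exists]
      exact fun j _ => hx j
  have hF : ∀ F : Finset ι, HasWeakFDerivOn ((⋃ i ∈ {i | i ∉ F}, S i)ᶜ.indicator g)
      ((⋃ i ∈ {i | i ∉ F}, S i)ᶜ.indicator G) A := fun F => by
    have := h₀.finset_sum h F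
    simp only [hpt] at this
    exact this
  have hlim : ∀ {E : Type} [NormedAddCommGroup E] (k : Euc m → E) (x : Euc m),
      Tendsto (fun F : Finset ι => (⋃ i ∈ {i | i ∉ F}, S i)ᶜ.indicator k x) atTop (𝓝 (k x)) := by
    intro E _ k x
    refine tendsto_const_nhds.congr' ?_
    by_cases hx : ∃ i, x ∈ S i
    · obtain ⟨i, hi⟩ := hx
      filter_upwards [eventually_ge_atTop {i}] with F hF
      rw [indicator_of_mem]
      simp only [mem_compl_iff, mem_iUnion, not_exists]
      intro j hj hxj
      have : j = i := by_contra fun h => Set.disjoint_left.1 (hd h) hxj hi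
      exact hj (this ▸ hF (Finset.mem_singleton_self i))
    · push Not at hx
      refine Eventually.of_forall fun F => ?_
      simp only
      rw [indicator_of_mem]
      simp only [mem_compl_iff, mem_iUnion, not_exists]
      exact fun j _ => hx j
  have hgm : AEStronglyMeasurable g (volume.restrict A) :=
    aestronglyMeasurable_of_tendsto_ae atTop (fun F => (hF F).1.aestronglyMeasurable)
      (.of_forall fun x => hlim g x)
  have hGm : AEStronglyMeasurable G (volume.restrict A) :=
    aestronglyMeasurable_of_tendsto_ae atTop (fun F => (hF F).2.1.aestronglyMeasurable)
      (.of_forall fun x => hlim G x)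
  have hsub : ∀ {E : Type} [NormedAddCommGroup E] (k : Euc m → E) (K : Set (Euc m)), K ⊆ A → IsCompact K →
      AEStronglyMeasurable k (volume.restrict A) → ∫⁻ x in K, ‖k x‖ₑ ≠ ⊤ →
      Tendsto (fun F : Finset ι => ∫⁻ x in K, ‖(⋃ i ∈ {i | i ∉ F}, S i)ᶜ.indicator k x - k x‖ₑ) atTop
        (𝓝 0) := by
    intro E _ k K hK hKc hk hkt
    have hkK : AEStronglyMeasurable k (volume.restrict K) := hk.mono_measure (Measure.restrict_mono hK le_rfl)
    have hms : ∀ F : Finset ι, MeasurableSet (⋃ i ∈ {i | i ∉ F}, S i)ᶜ := fun F =>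
      (MeasurableSet.biUnion (to_countable _) fun i _ => hS i).compl
    have h5 := tendsto_lintegral_filter_of_dominated_convergence' (μ := volume.restrict K)
      (F := fun (F : Finset ι) x => ‖(⋃ i ∈ {i | i ∉ F}, S i)ᶜ.indicator k x - k x‖ₑ)
      (f := fun _ => 0) (l := atTop) (fun x => 2 * ‖k x‖ₑ)
      (.of_forall fun F => ((hkK.indicator (hms F)).sub hkK).enorm)
      (.of_forall fun F => Eventually.of_forall fun x => by
        rw [two_mul]
        refine (enorm_fun_sub_le _ _).trans (add_le_add ?_ le_rfl)
        exact enorm_indicator_le_enorm_self _ _)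
      (by rw [lintegral_const_mul' _ _ (by simp)]; exact ENNReal.mul_ne_top (by simp) hkt)
      (.of_forall fun x => tendsto_enorm_sub_zero (hlim k x))
    simpa using h5
  refine HasWeakFDerivOn.of_tendsto (l := (atTop : Filter (Finset ι))) ?_ ?_ fun φ _ hc hφ =>
    ⟨_, _, A, hφ, Eventually.of_forall hF, hsub g _ hφ hc hgm (hg _ hφ hc), hsub G _ hφ hc hGm (hG _ hφ hc)⟩
  · rw [locallyIntegrableOn_iff hA.isLocallyClosed]
    exact fun K hK hKc => ⟨hgm.mono_measure (Measure.restrict_mono hK le_rfl),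
      (hg K hK hKc).lt_top⟩
  · rw [locallyIntegrableOn_iff hA.isLocallyClosed]
    exact fun K hK hKc => ⟨hGm.mono_measure (Measure.restrict_mono hK le_rfl),
      (hG K hK hKc).lt_top⟩

/-- The chain rule bound for test functions. -/
theorem lintegral_mder_comp_ne_top {p : ℝ} (hp : 1 ≤ p) {f : N → ℝ} {Kf : NNReal}
    (hf : ContMDiff (𝓡 n) 𝓘(ℝ, ℝ) 1 f) (hK : LipschitzWith Kf f) {u : Euc m → N}
    {D : Euc m → Euc m →L[ℝ] Euc n} {A K : Set (Euc m)} (hKA : K ⊆ A) (hKc : IsCompact K)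
    (hE : ∫⁻ x in A, hs (u x) (D x) ^ p ≠ ⊤) :
    ∫⁻ x in K, ‖(mder f (u x)).comp (D x)‖ₑ ≠ ⊤ := by
  refine ((lintegral_mono (g := fun x => (Kf * m : ℝ≥0∞) * (1 + hs (u x) (D x) ^ p)) fun x => ?_).trans_lt
    ?_).ne
  · refine (LipschitzWith.enorm_mder_comp_le hK (hf.mdifferentiable (by simp) _) (D x)).trans ?_
    exact mul_le_mul_right (hs_le_one_add_rpow hp _) _
  · rw [lintegral_const_mul' _ _ (by finiteness), lintegral_add_left measurable_const,
      setLIntegral_const, one_mul]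
    exact ENNReal.mul_lt_top (by finiteness) (ENNReal.add_lt_top.2 ⟨hKc.measure_lt_top,
      (lintegral_mono_set hKA).trans_lt hE.lt_top⟩)

/-- Gluing of maps that coincide with a constant on the boundaries of disjoint balls. -/
theorem IsBddWeakDeriv.glue (hm : 1 ≤ m) {ι : Type*} [Countable ι] {p : ℝ} (hp : 1 ≤ p)
    {A : Set (Euc m)} (hA : IsOpen A) {x : ι → Euc m} {r : ι → ℝ}
    (hd : Pairwise fun i j => Disjoint (ball (x i) (r i)) (ball (x j) (r j)))
    {W : ι → Euc m → N} {Γ w : Euc m → N} {c : N} (hW : ∀ i, ∀ y ∉ ball (x i) (r i), W i y = c)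
    (hΓ : ∀ i, ∀ y ∈ ball (x i) (r i), Γ y = c) (hwW : ∀ i, ∀ y ∈ ball (x i) (r i), w y = W i y)
    (hwΓ : ∀ y, (∀ i, y ∉ ball (x i) (r i)) → w y = Γ y)
    {Di : ι → Euc m → Euc m →L[ℝ] Euc n} {DΓ D : Euc m → Euc m →L[ℝ] Euc n}
    (hDi : ∀ i, ∀ y ∈ ball (x i) (r i), D y = Di i y)
    (hDΓ : ∀ y, (∀ i, y ∉ ball (x i) (r i)) → D y = DΓ y)
    (hi : ∀ i, IsBddWeakDeriv (W i) (Di i) A) (hΓ' : IsBddWeakDeriv Γ DΓ A)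
    (hE : ∫⁻ y in A, hs (w y) (D y) ^ p ≠ ⊤) : IsBddWeakDeriv w D A := by
  intro f hf hK hM
  obtain ⟨Kf, hKf⟩ := hK
  obtain ⟨M, hM⟩ := hM
  have hsph := ae_notMem_sphere hm x r
  -- After subtraction of f(c) every piece vanishes off its ball and the background vanishes on the
  -- balls, so restricting to a ball or to the complement creates no jump.
  have hker : HasWeakFDerivOn (fun y => f (w y) - f c) (fun y => (mder f (w y)).comp (D y)) A := by
    refine HasWeakFDerivOn.of_pieces hA (fun i => measurableSet_ball) hd (fun K hKA hKc => ?_)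
      (fun K hKA hKc => lintegral_mder_comp_ne_top hp hf hKf hKA hKc hE) ?_ fun i => ?_
    · refine ((lintegral_mono (g := fun _ => ofReal (2 * M)) fun y => ?_).trans_lt ?_).ne
      · rw [Real.enorm_eq_ofReal_abs]
        refine ofReal_le_ofReal ((norm_sub_le (f (w y)) (f c)).trans ?_)
        rw [Real.norm_eq_abs, Real.norm_eq_abs]
        linarith [hM (w y), hM c]
      · rw [setLIntegral_const]
        exact ENNReal.mul_lt_top ENNReal.ofReal_lt_top hKc.measure_lt_top
    · have h1 := (hΓ' f hf ⟨Kf, hKf⟩ ⟨M, hM⟩).sub (HasWeakFDerivOn.const (f c) A)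
      refine h1.congr_ae (.of_forall fun y => ?_) ?_
      · by_cases hy : ∃ i, y ∈ ball (x i) (r i)
        · rw [indicator_of_notMem (by simpa using hy)]
          simp only
          rw [hΓ hy.choose y hy.choose_spec, sub_self]
        · rw [indicator_of_mem (by simpa using hy), hwΓ y (by simpa using hy)]
      -- Γ is constant on each ball, and uniqueness of the weak derivative of f ∘ Γ makes the given
      -- one vanish there almost everywhere.
      · have h2 : ∀ᵐ y, ∀ i, y ∈ A ∩ ball (x i) (r i) → (mder f (Γ y)).comp (DΓ y) = 0 := by
          rw [ae_all_iff]
          intro i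
          have h3 := ((hΓ' f hf ⟨Kf, hKf⟩ ⟨M, hM⟩).mono (A' := A ∩ ball (x i) (r i)) inter_subset_left).congr
            (g' := fun _ => f c) (hA.inter isOpen_ball).measurableSet (fun y hy => by
              simp only; rw [hΓ i y hy.2]) (fun y _ => rfl)
          exact h3.ae_eq (hA.inter isOpen_ball) (HasWeakFDerivOn.const (f c) _)
        filter_upwards [ae_restrict_of_ae h2, ae_restrict_mem hA.measurableSet] with y hy hyA
        by_cases hyi : ∃ i, y ∈ ball (x i) (r i)
        · obtain ⟨i, hyi⟩ := hyi
          rw [indicator_of_notMem (by simpa using ⟨i, hyi⟩), hy i ⟨hyA, hyi⟩, sub_zero]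
        · have hyi' : ∀ i, y ∉ ball (x i) (r i) := by simpa using hyi
          rw [indicator_of_mem (by simpa using hyi), hwΓ y hyi', hDΓ y hyi', sub_zero]
    · have h1 := (hi i f hf ⟨Kf, hKf⟩ ⟨M, hM⟩).sub (HasWeakFDerivOn.const (f c) A)
      refine h1.congr_ae (.of_forall fun y => ?_) ?_
      · by_cases hy : y ∈ ball (x i) (r i)
        · rw [indicator_of_mem hy, hwW i y hy]
        · rw [indicator_of_notMem hy]
          simp only
          rw [hW i y hy, sub_self]
      -- Uniqueness is applied on the exterior of the closed ball; the sphere in between is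
      -- negligible.
      · have hO : IsOpen (A ∩ (closedBall (x i) (r i))ᶜ) := hA.inter isClosed_closedBall.isOpen_compl
        have h3 := ((hi i f hf ⟨Kf, hKf⟩ ⟨M, hM⟩).mono (A' := A ∩ (closedBall (x i) (r i))ᶜ)
          inter_subset_left).congr (g' := fun _ => f c) hO.measurableSet (fun y hy => by
            simp only; rw [hW i y fun h => hy.2 (ball_subset_closedBall h)]) (fun y _ => rfl)
        have h4 := h3.ae_eq hO (HasWeakFDerivOn.const (f c) _)
        filter_upwards [ae_restrict_of_ae h4, ae_restrict_mem hA.measurableSet,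
          ae_restrict_of_ae hsph] with y hy hyA hys
        by_cases hyi : y ∈ ball (x i) (r i)
        · rw [indicator_of_mem hyi, hwW i y hyi, hDi i y hyi, sub_zero]
        · rw [indicator_of_notMem hyi, hy ⟨hyA, fun h => ?_⟩, sub_zero]
          rw [← ball_union_sphere] at h
          exact h.elim hyi (hys i)
  have := hker.add (HasWeakFDerivOn.const (f c) A)
  simpa using this

/-- The energy is local, so the constant is 1. Almost optimal derivatives of the pieces are chosen
with errors whose sum is at most ε. -/
theorem bddEnergy_glue_le (hm : 1 ≤ m) {ι : Type*} [Countable ι] {p : ℝ} (hp : 1 ≤ p)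
    {x : ι → Euc m} {r : ι → ℝ}
    (hd : Pairwise fun i j => Disjoint (ball (x i) (r i)) (ball (x j) (r j)))
    {W : ι → Euc m → N} {Γ w : Euc m → N} {c : N} (hW : ∀ i, ∀ y ∉ ball (x i) (r i), W i y = c)
    (hΓ : ∀ i, ∀ y ∈ ball (x i) (r i), Γ y = c) (hwW : ∀ i, ∀ y ∈ ball (x i) (r i), w y = W i y)
    (hwΓ : ∀ y, (∀ i, y ∉ ball (x i) (r i)) → w y = Γ y) :
    bddEnergy n p w ≤ bddEnergy n p Γ + ∑' i, bddEnergy n p (W i) := by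
  classical
  rcases eq_or_ne (bddEnergy n p Γ + ∑' i, bddEnergy n p (W i)) ⊤ with htop | htop
  · rw [htop]; exact le_top
  have hΓt : bddEnergy n p Γ ≠ ⊤ := fun h => htop (by rw [h, top_add])
  have hWt : ∑' i, bddEnergy n p (W i) ≠ ⊤ := fun h => htop (by rw [h, add_top])
  refine ENNReal.le_of_forall_pos_le_add fun ε hε _ => ?_
  have hε2 : (ε / 2 : ℝ≥0∞) ≠ 0 := by simpa using hε.ne'
  obtain ⟨d, hd0, hdsum⟩ := ENNReal.exists_pos_sum_of_countable' hε2 ι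
  obtain ⟨DΓ, hDΓ, hDΓE⟩ := exists_bddWeakDeriv_of_lt (ENNReal.lt_add_right hΓt hε2)
  choose Di hDi hDiE using fun i => exists_bddWeakDeriv_of_lt (ENNReal.lt_add_right
    (ENNReal.ne_top_of_tsum_ne_top hWt i) (hd0 i).ne')
  obtain ⟨D, hD⟩ : ∃ D : Euc m → Euc m →L[ℝ] Euc n, ∀ y, D y =
      if h : ∃ i, y ∈ ball (x i) (r i) then Di h.choose y else DΓ y := ⟨_, fun _ => rfl⟩
  have hD1 : ∀ i, ∀ y ∈ ball (x i) (r i), D y = Di i y := by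
    intro i y hy
    have h : ∃ i, y ∈ ball (x i) (r i) := ⟨i, hy⟩
    rw [hD, dif_pos h]
    by_contra hne
    have hij : h.choose ≠ i := fun e => hne (by rw [e])
    exact (Set.disjoint_left.1 (hd hij) h.choose_spec) hy
  have hD2 : ∀ y, (∀ i, y ∉ ball (x i) (r i)) → D y = DΓ y := by
    intro y hy
    rw [hD, dif_neg (by push Not; exact hy)]
  have hUm : MeasurableSet (⋃ i, ball (x i) (r i)) := MeasurableSet.iUnion fun i => measurableSet_ball
  have hE : ∫⁻ y, hs (w y) (D y) ^ p ≤
      bddEnergy n p Γ + ∑' i, bddEnergy n p (W i) + ε := by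
    rw [← lintegral_add_compl _ hUm, lintegral_iUnion (fun i => measurableSet_ball) hd, add_comm]
    calc _ ≤ (bddEnergy n p Γ + ε / 2) + ∑' i, (bddEnergy n p (W i) + d i) := by
          refine add_le_add ?_ (ENNReal.tsum_le_tsum fun i => ?_)
          · rw [setLIntegral_congr_fun (g := fun y => hs (Γ y) (DΓ y) ^ p) hUm.compl fun y hy => by
              have hy' : ∀ i, y ∉ ball (x i) (r i) := by simpa using hy
              simp only [hwΓ y hy', hD2 y hy']]
            exact (setLIntegral_le_lintegral _ _).trans hDΓE.le
          · rw [setLIntegral_congr_fun (g := fun y => hs (W i y) (Di i y) ^ p) measurableSet_ball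
              fun y hy => by simp only [hwW i y hy, hD1 i y hy]]
            exact (setLIntegral_le_lintegral _ _).trans (hDiE i).le
      _ = bddEnergy n p Γ + ∑' i, bddEnergy n p (W i) + (ε / 2 + ∑' i, d i) := by
          rw [ENNReal.tsum_add]; ring
      _ ≤ _ := by
          gcongr
          refine (add_le_add le_rfl hdsum.le).trans ?_
          rw [ENNReal.add_halves]
  refine (bddEnergy_le (IsBddWeakDeriv.glue hm hp isOpen_univ hd hW hΓ hwW hwΓ hD1 hD2 hDi hDΓ ?_)).trans hE
  rw [Measure.restrict_univ]
  exact (hE.trans_lt (ENNReal.add_lt_top.2 ⟨htop.lt_top, by simp⟩)).ne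

/-! ### Zero p-capacity of points and connections. -/

theorem lintegral_fderiv_homothety {p : ℝ} (hp : 0 ≤ p) (η : Euc m → ℝ) {l : ℝ} (hl : 0 < l) :
    ∫⁻ x, ‖fderiv ℝ (fun x => η (l⁻¹ • (x - 0))) x‖ₑ ^ p =
      ofReal (l ^ ((m : ℝ) - p)) * ∫⁻ x, ‖fderiv ℝ η x‖ₑ ^ p := by
  rw [lintegral_homothety _ hl 0, Real.rpow_sub hl, Real.rpow_natCast, div_eq_mul_inv,
    ofReal_mul (by positivity), mul_assoc, ← Real.rpow_neg hl.le]
  congr 1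
  rw [← lintegral_const_mul' _ _ ofReal_ne_top]
  refine lintegral_congr fun x => ?_
  simp only [sub_zero, zero_add]
  rw [fderiv_comp_smul, smul_smul, inv_mul_cancel₀ hl.ne', one_smul, enorm_smul,
    mul_rpow_of_nonneg _ _ hp, Real.enorm_eq_ofReal (by positivity),
    ENNReal.ofReal_rpow_of_pos (by positivity), Real.rpow_neg hl.le, Real.inv_rpow hl.le]

theorem fderiv_eq_of_eqOn {F : Type*} [NormedAddCommGroup F] [NormedSpace ℝ F] {f g : Euc m → F}
    {U : Set (Euc m)} (hU : IsOpen U) (h : EqOn f g U) {x : Euc m} (hx : x ∈ U) :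
    fderiv ℝ f x = fderiv ℝ g x :=
  Filter.EventuallyEq.fderiv_eq (h.eventuallyEq_of_mem (hU.mem_nhds hx))

theorem IsCutoff.lintegral_fderiv_ne_top {p : ℝ} (hp : 0 < p) {η : Euc m → ℝ} (hη : IsCutoff η) :
    ∫⁻ x, ‖fderiv ℝ η x‖ₑ ^ p ≠ ⊤ := by
  obtain ⟨K, hK⟩ := hη.lip
  have h : ∀ x, ‖fderiv ℝ η x‖ₑ ^ p ≤ (closedBall (0 : Euc m) 1).indicator (fun _ => (K : ℝ≥0∞) ^ p) x := by
    intro x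
    by_cases hx : x ∈ closedBall (0 : Euc m) 1
    · rw [indicator_of_mem hx]
      exact ENNReal.rpow_le_rpow (enorm_fderiv_le_of_lipschitz hK x) hp.le
    · have h0 : fderiv ℝ η x = 0 := by
        have h1 := fderiv_eq_of_eqOn (f := η) (g := fun _ => 0) isClosed_closedBall.isOpen_compl
          (fun y hy => hη.zero y fun h => hy (ball_subset_closedBall h)) hx
        simpa using h1
      have h2 : ‖fderiv ℝ η x‖ₑ = 0 := by
        rw [h0, ← ofReal_norm, norm_zero, ENNReal.ofReal_zero]
      rw [h2, ENNReal.zero_rpow_of_pos hp]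
      exact zero_le
  refine ((lintegral_mono h).trans_lt ?_).ne
  rw [lintegral_indicator measurableSet_closedBall, setLIntegral_const]
  exact ENNReal.mul_lt_top (ENNReal.rpow_lt_top_of_nonneg hp.le (by simp)) measure_closedBall_lt_top

/-- The origin has zero `p`-capacity. -/
theorem exists_dirichlet_cutoff {p : ℝ} (hm : 1 < m) (hp : 1 ≤ p) (hpm : p ≤ m)
    {δ : ℝ≥0∞} (hδ : δ ≠ 0) :
    ∃ η : Euc m → ℝ, IsCutoff η ∧ ∫⁻ x, ‖fderiv ℝ η x‖ₑ ^ p ≤ δ := by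
  have hp0 : 0 < p := by linarith
  rcases hpm.lt_or_eq with h | h
  · refine exists_isCutoff_le (E := fun η => ∫⁻ x, ‖fderiv ℝ η x‖ₑ ^ p)
      (c := ofReal ((1 / 2) ^ ((m : ℝ) - p))) ?_
      (fun η hη => hη.lintegral_fderiv_ne_top hp0) (fun η hη θ _ => ?_) hδ
    · rw [← ofReal_one]
      exact (ENNReal.ofReal_lt_ofReal_iff one_pos).2
        (Real.rpow_lt_one (by norm_num) (by norm_num) (by linarith))
    · refine ⟨_, hη.comp_homothety (l := 1 / 2) (by norm_num) (by norm_num), ?_⟩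
      rw [lintegral_fderiv_homothety hp0.le _ (by norm_num)]
      exact le_self_add
  -- In the critical case p = m, and m > 1.
  · have hp1 : 1 < p := by rw [h]; exact_mod_cast hm
    refine exists_isCutoff_le (E := fun η => ∫⁻ x, ‖fderiv ℝ η x‖ₑ ^ p) (c := 2 ^ (1 - p)) ?_
      (fun η hη => hη.lintegral_fderiv_ne_top hp0) (fun η hη θ _ => ?_) hδ
    · exact ENNReal.rpow_lt_one_of_one_lt_of_neg (by norm_num) (by linarith)
    · obtain ⟨r, hr, hr1, h1⟩ := hη.one
      have hl0 : 0 < r / 2 := half_pos hr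
      have hc := hη.comp_homothety hl0 (by linarith)
      -- The copy is supported where η = 1, so at each point one of the two derivatives vanishes.
      -- The average then has energy exactly 2^(-p) times the sum of two equal energies.
      obtain ⟨η', hη'⟩ : ∃ η' : Euc m → ℝ, η' = fun x => η ((r / 2)⁻¹ • (x - 0)) := ⟨_, rfl⟩
      have hE := lintegral_fderiv_homothety (p := p) hp0.le η hl0
      rw [← hη', h, sub_self, Real.rpow_zero, ofReal_one, one_mul, ← h] at hE
      rw [← hη'] at hc
      refine ⟨_, hη.average hc, le_trans ?_ le_self_add⟩
      have h0 : ∀ x ∉ ball (0 : Euc m) (r / 2), η' x = 0 := fun x hx => by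
        rw [hη']
        refine hη.zero _ ?_
        have : r / 2 ≤ ‖x‖ := by simpa using hx
        rw [mem_ball, dist_zero_right, sub_zero, norm_smul, Real.norm_eq_abs,
          abs_of_pos (by positivity), inv_mul_lt_iff₀ hl0, mul_one]
        linarith
      have hhalf : ∀ (g : Euc m → ℝ) (a : ℝ) (x : Euc m),
          ‖fderiv ℝ (fun x => (a + g x) * (1 / 2)) x‖ₑ ^ p = 2 ^ (-p) * ‖fderiv ℝ g x‖ₑ ^ p := by
        intro g a x
        have e : (fun x => (a + g x) * (1 / 2)) = (1 / 2 : ℝ) • fun x => a + g x := by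
          ext y; simp [mul_comm]
        rw [e, fderiv_const_smul_field, Pi.smul_apply, fderiv_const_add, enorm_smul,
          mul_rpow_of_nonneg _ _ hp0.le, ENNReal.rpow_neg, ← ENNReal.inv_rpow]
        congr 2
        rw [Real.enorm_eq_ofReal (by norm_num), one_div, ENNReal.ofReal_inv_of_pos two_pos]
        simp
      have hpt : ∀ x, ‖fderiv ℝ (fun x => (η x + η' x) * (1 / 2)) x‖ₑ ^ p ≤
          2 ^ (-p) * ‖fderiv ℝ η x‖ₑ ^ p + 2 ^ (-p) * ‖fderiv ℝ η' x‖ₑ ^ p := by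
        intro x
        by_cases hx : x ∈ ball (0 : Euc m) r
        · refine le_trans (le_of_eq ?_) le_add_self
          rw [← hhalf η' 1 x, fderiv_eq_of_eqOn (g := fun x => (1 + η' x) * (1 / 2)) isOpen_ball
            (fun y hy => by simp only [h1 y hy]) hx]
        · refine le_trans (le_of_eq ?_) le_self_add
          rw [← hhalf η 0 x, fderiv_eq_of_eqOn (g := fun x => (0 + η x) * (1 / 2))
            (isClosed_closedBall (x := (0 : Euc m)) (ε := r / 2)).isOpen_compl (fun y hy => by
              simp only [h0 y (fun h => hy (ball_subset_closedBall h)), add_zero, zero_add])]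
          exact fun h => hx (closedBall_subset_ball (by linarith) h)
      have h2p : (2 : ℝ≥0∞) ^ (-p) ≠ ⊤ := by simp
      have hmeas : Measurable fun x => 2 ^ (-p) * ‖fderiv ℝ η x‖ₑ ^ p :=
        ((measurable_fderiv ℝ η).enorm.pow_const p).const_mul _
      calc _ ≤ ∫⁻ x, (2 ^ (-p) * ‖fderiv ℝ η x‖ₑ ^ p + 2 ^ (-p) * ‖fderiv ℝ η' x‖ₑ ^ p) :=
            lintegral_mono hpt
        _ = 2 ^ (1 - p) * ∫⁻ x, ‖fderiv ℝ η x‖ₑ ^ p := by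
            rw [lintegral_add_left hmeas, lintegral_const_mul' _ _ h2p, lintegral_const_mul' _ _ h2p, hE,
              ← two_mul, ← mul_assoc]
            congr 1
            nth_rewrite 1 [← ENNReal.rpow_one 2]
            rw [← ENNReal.rpow_add _ _ (by norm_num) (by norm_num), sub_eq_add_neg]

theorem fderiv_comp_curve {γ : ℝ → N} (hγ : ContMDiff 𝓘(ℝ, ℝ) (𝓡 n) 1 γ) {f : N → ℝ}
    (hf : ContMDiff (𝓡 n) 𝓘(ℝ, ℝ) 1 f) {η : Euc m → ℝ} {x : Euc m} (hη : DifferentiableAt ℝ η x) :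
    fderiv ℝ (fun x => f (γ (η x))) x = (mder f (γ (η x))).comp
      ((ContinuousLinearMap.toSpanSingleton ℝ (show Euc n from
        mfderiv 𝓘(ℝ, ℝ) (𝓡 n) γ (η x) (1 : ℝ))).comp (fderiv ℝ η x)) := by
  have h1 : DifferentiableAt ℝ (fun t => f (γ t)) (η x) :=
    ((hf.comp hγ).contDiff.differentiable (by simp)) _
  have h2 : fderiv ℝ (fun t => f (γ t)) (η x) (1 : ℝ) =
      mder f (γ (η x)) (mfderiv 𝓘(ℝ, ℝ) (𝓡 n) γ (η x) (1 : ℝ)) := by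
    rw [← mfderiv_eq_fderiv]
    have h3 := mfderiv_comp (η x) (hf.mdifferentiable (by simp) (γ (η x)))
      (hγ.mdifferentiable (by simp) (η x))
    have h4 : (fun t => f (γ t)) = f ∘ γ := rfl
    rw [h4, h3]
    rfl
  have h5 : (fun x => f (γ (η x))) = (fun t => f (γ t)) ∘ η := rfl
  rw [h5, fderiv_comp x h1 hη]
  have e : ∀ (B : Euc n →L[ℝ] ℝ) (ξ : Euc n) (a : ℝ →L[ℝ] ℝ) (t : ℝ), a 1 = B ξ →
      a t = B (t • ξ) := fun B ξ a t hB => by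
    rw [map_smul, ← hB, ← map_smul, smul_eq_mul, mul_one]
  ext v
  exact e _ _ _ _ h2

theorem hs_toSpanSingleton_le (y : N) (ξ : Euc n) (L : Euc m →L[ℝ] ℝ) :
    hs y ((ContinuousLinearMap.toSpanSingleton ℝ ξ).comp L) ≤ m * ‖L‖ₑ * tnorm y ξ := by
  refine (hs_le_sum y _).trans ?_
  calc _ ≤ ∑ _i : Fin m, ‖L‖ₑ * tnorm y ξ := by
        refine Finset.sum_le_sum fun i _ => ?_
        simp only [ContinuousLinearMap.comp_apply, ContinuousLinearMap.toSpanSingleton_apply]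
        rw [tnorm_smul]
        gcongr
        refine (L.le_opENorm _).trans ?_
        rw [← ofReal_norm, ← ofReal_norm]
        simp
    _ = _ := by simp [mul_assoc]

theorem exists_dirichlet_connection {p : ℝ} (hm : 1 < m) (hp : 1 ≤ p) (hpm : p ≤ m)
    [ConnectedSpace N] (b c : N) {δ : ℝ≥0∞} {l₀ : ℝ} (hδ : δ ≠ 0) (hl₀ : 0 < l₀) :
    ∃ (l : ℝ) (Γ : Euc m → N), 0 < l ∧ l ≤ l₀ ∧ l ≤ 1 ∧ AEMeasurable Γ ∧
      (∀ x ∈ ball 0 l, Γ x = c) ∧ (∀ x ∉ ball 0 1, Γ x = b) ∧ bddEnergy n p Γ ≤ δ := by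
  have hp0 : 0 < p := by linarith
  obtain ⟨γ, L, h0, h1, hγ, hγL, hL⟩ := exists_lipschitz_path (n := n) b c
  have hLp : ((m * L : ℝ≥0∞)) ^ p ≠ ⊤ := rpow_ne_top_of_nonneg hp0.le (by finiteness)
  obtain ⟨δ', hδ', hδδ⟩ := exists_ne_zero_mul_le hLp hδ
  -- The connection is γ ∘ η, whose derivative at x is the velocity of γ at η(x) times the
  -- derivative of η; its norm is at most mL|Dη|.
  obtain ⟨η, hη, hηE⟩ := exists_dirichlet_cutoff hm hp hpm hδ'
  obtain ⟨K, hK⟩ := hη.lip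
  obtain ⟨r, hr, hr1, hr2⟩ := hη.one
  refine ⟨min r l₀, fun x => γ (η x), lt_min hr hl₀, min_le_right _ _, (min_le_left _ _).trans hr1,
    (hγ.continuous.comp hK.continuous).measurable.aemeasurable, fun x hx => ?_, fun x hx => ?_, ?_⟩
  · simp only
    rw [hr2 x (ball_subset_ball (min_le_left _ _) hx), h1]
  · simp only
    rw [hη.zero x hx, h0]
  · have hD : IsBddWeakDeriv (fun x => γ (η x)) (fun x =>
        (ContinuousLinearMap.toSpanSingleton ℝ (show Euc n from
          mfderiv 𝓘(ℝ, ℝ) (𝓡 n) γ (η x) (1 : ℝ))).comp (fderiv ℝ η x)) univ := by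
      rintro f hf ⟨Kf, hKf⟩ -
      have hlip : LipschitzWith (Kf * (L * K)) fun x => f (γ (η x)) := by
        intro x y
        refine (hKf _ _).trans ?_
        rw [ENNReal.coe_mul, mul_assoc]
        gcongr
        refine (hL (hη.mem x) (hη.mem y)).trans ?_
        rw [ENNReal.coe_mul, mul_assoc]
        gcongr
        exact hK x y
      refine (LipschitzWith.hasWeakFDerivOn hlip univ).congr_ae (.of_forall fun _ => rfl) ?_
      filter_upwards [ae_restrict_of_ae (hK.ae_differentiableAt)] with x hx
      exact fderiv_comp_curve hγ hf hx
    refine (bddEnergy_le hD).trans (le_trans ?_ ((mul_le_mul_right hηE _).trans hδδ))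
    rw [← lintegral_const_mul' _ _ hLp]
    refine lintegral_mono fun x => ?_
    simp only
    rw [← mul_rpow_of_nonneg _ _ hp0.le]
    refine ENNReal.rpow_le_rpow ((hs_toSpanSingleton_le _ _ _).trans ?_) hp0.le
    rw [mul_right_comm]
    gcongr
    exact hγL _ (hη.mem x)

theorem isGluingEnergy_dirichlet {p : ℝ} (hm : 1 < m) (hp : 1 ≤ p) (hpm : p ≤ m)
    [ConnectedSpace N] : IsGluingEnergy ((m : ℝ) - 1 * p) fun w : Euc m → N => bddEnergy n p w where
  const c := bddEnergy_const hp c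
  scale W _ l h hl := by
    rw [one_mul]
    exact bddEnergy_homothety hp W hl h
  glue := by
    refine ⟨1, by simp, ?_⟩
    intro ι _ x r hd W Γ w c hW hΓ hwW hwΓ _ _
    rw [one_mul]
    exact bddEnergy_glue_le hm.le hp hd hW hΓ hwW hwΓ
  conn b c δ l₀ hδ hl₀ := exists_dirichlet_connection hm hp hpm b c hδ hl₀

/-! ### Opening of Sobolev maps at Lebesgue points. -/

theorem quasiMeasurePreserving_homothety (a : Euc m) {t : ℝ} (ht : t ≠ 0) :
    Measure.QuasiMeasurePreserving (fun x : Euc m => a + t • x) :=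
  (measurePreserving_add_left volume a).quasiMeasurePreserving.comp
    (Measure.quasiMeasurePreserving_smul volume ht)

/-- Lebesgue's differentiation theorem, rewritten on a fixed ball by the homothety of ratio t. -/
theorem ae_tendsto_lintegral_homothety {F : Euc m → ℝ} (hF : LocallyIntegrable F) {R : ℝ}
    (hR : 0 < R) : ∀ᵐ a : Euc m, Tendsto
      (fun t : ℝ => ∫⁻ x in closedBall 0 R, ‖F (a + t • x) - F a‖ₑ) (𝓝[>] 0) (𝓝 0) := by
  filter_upwards [IsUnifLocDoublingMeasure.ae_tendsto_average_norm_sub volume hF 1] with a ha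
  have hδ : Tendsto (fun t : ℝ => t * R) (𝓝[>] 0) (𝓝[>] 0) := by
    refine tendsto_nhdsWithin_iff.2 ⟨?_, ?_⟩
    · have : Tendsto (fun t : ℝ => t * R) (𝓝 0) (𝓝 (0 * R)) := tendsto_id.mul_const R
      rw [zero_mul] at this
      exact this.mono_left nhdsWithin_le_nhds
    · filter_upwards [self_mem_nhdsWithin] with t ht
      exact mul_pos ht hR
  have h1 := ha (fun _ => a) (fun t : ℝ => t * R) hδ (by
    filter_upwards [self_mem_nhdsWithin] with t ht
    exact mem_closedBall_self (by have : 0 < t := ht; positivity))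
  have h2 : Tendsto (fun t : ℝ => volume (closedBall (0 : Euc m) R) *
      ofReal (⨍ y in closedBall a (t * R), ‖F y - F a‖)) (𝓝[>] 0) (𝓝 0) := by
    have := ENNReal.Tendsto.const_mul (ENNReal.tendsto_ofReal h1)
      (Or.inr (measure_closedBall_lt_top (μ := volume) (x := (0 : Euc m)) (r := R)).ne)
    simpa using this
  refine h2.congr' ?_
  filter_upwards [self_mem_nhdsWithin] with t ht
  have ht0 : 0 < t := ht
  have hint : IntegrableOn (fun y => F y - F a) (closedBall a (t * R)) :=
    (hF.integrableOn_isCompact (isCompact_closedBall _ _)).sub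
      (integrableOn_const measure_closedBall_lt_top.ne)
  have h3 : ∫⁻ y in closedBall a (t * R), ‖F y - F a‖ₑ =
      volume (closedBall a (t * R)) * ofReal (⨍ y in closedBall a (t * R), ‖F y - F a‖) := by
    rw [← ofReal_integral_norm_eq_lintegral_enorm hint,
      ← measure_smul_setAverage _ measure_closedBall_lt_top.ne, smul_eq_mul,
      ofReal_mul measureReal_nonneg, ofReal_measureReal measure_closedBall_lt_top.ne]
  have h4 : ∫⁻ y in closedBall a (t * R), ‖F y - F a‖ₑ =
      ofReal (t ^ m) * ∫⁻ x in closedBall 0 R, ‖F (a + t • x) - F a‖ₑ := by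
    rw [← lintegral_indicator measurableSet_closedBall, lintegral_homothety _ ht0 a,
      ← lintegral_indicator measurableSet_closedBall]
    congr 1
    refine lintegral_congr fun x => ?_
    have : a + t • x ∈ closedBall a (t * R) ↔ x ∈ closedBall (0 : Euc m) R := by
      rw [mem_closedBall, mem_closedBall, dist_zero_right, dist_eq_norm, add_sub_cancel_left, norm_smul,
        Real.norm_eq_abs, abs_of_pos ht0, mul_le_mul_iff_right₀ ht0]
    by_cases hx : x ∈ closedBall (0 : Euc m) R
    · rw [indicator_of_mem hx, indicator_of_mem (this.2 hx)]
    · rw [indicator_of_notMem hx, indicator_of_notMem (fun h => hx (this.1 h))]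
  rw [h4, Measure.addHaar_closedBall_mul _ _ ht0.le hR.le, finrank_euclideanSpace, Fintype.card_fin,
    mul_assoc] at h3
  exact ((ENNReal.mul_right_inj (by rw [Ne, ENNReal.ofReal_eq_zero, not_le]; positivity)
    ofReal_ne_top).1 h3).symm

/-- At a Lebesgue point the rescaled integrals stay bounded, so the factor t sends them to 0. -/
theorem ae_tendsto_mul_lintegral_homothety {H : Euc m → ℝ≥0∞} (hH : AEMeasurable H)
    (hHt : ∫⁻ x, H x ≠ ⊤) {R : ℝ} (hR : 0 < R) : ∀ᵐ a : Euc m, Tendsto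
      (fun t : ℝ => ofReal t * ∫⁻ x in closedBall 0 R, H (a + t • x)) (𝓝[>] 0) (𝓝 0) := by
  have hF : Integrable fun x => (H x).toReal := integrable_toReal_of_lintegral_ne_top hH hHt
  have hHF : H =ᵐ[volume] fun x => ‖(H x).toReal‖ₑ := by
    filter_upwards [ae_lt_top' hH hHt] with x hx
    rw [Real.enorm_eq_ofReal ENNReal.toReal_nonneg, ENNReal.ofReal_toReal hx.ne]
  filter_upwards [ae_tendsto_lintegral_homothety hF.locallyIntegrable hR] with a ha
  have ht : Tendsto (fun t : ℝ => ofReal t) (𝓝[>] 0) (𝓝 0) := by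
    have := (ENNReal.continuous_ofReal.tendsto 0).mono_left (nhdsWithin_le_nhds (s := Ioi 0))
    simpa using this
  have h1 : Tendsto (fun t : ℝ => ofReal t *
      ((∫⁻ x in closedBall 0 R, ‖(H (a + t • x)).toReal - (H a).toReal‖ₑ) +
        ‖(H a).toReal‖ₑ * volume (closedBall (0 : Euc m) R))) (𝓝[>] 0) (𝓝 0) := by
    have hne : (0 : ℝ≥0∞) + ‖(H a).toReal‖ₑ * volume (closedBall (0 : Euc m) R) ≠ ⊤ := by
      rw [zero_add]
      exact ENNReal.mul_ne_top enorm_ne_top measure_closedBall_lt_top.ne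
    have h2 := ENNReal.Tendsto.mul ht (Or.inr hne) (ha.add tendsto_const_nhds)
      (Or.inr ENNReal.zero_ne_top)
    rwa [zero_mul] at h2
  refine tendsto_of_tendsto_of_tendsto_of_le_of_le' tendsto_const_nhds h1
    (.of_forall fun _ => zero_le) ?_
  filter_upwards [self_mem_nhdsWithin] with t ht
  have ht0 : t ≠ 0 := (show 0 < t from ht).ne'
  gcongr
  have h3 : ∫⁻ x in closedBall 0 R, H (a + t • x) =
      ∫⁻ x in closedBall 0 R, ‖(H (a + t • x)).toReal‖ₑ :=
    lintegral_congr_ae (ae_restrict_of_ae ((quasiMeasurePreserving_homothety a ht0).ae_eq hHF))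
  rw [h3, ← setLIntegral_const, ← lintegral_add_right _ measurable_const]
  refine lintegral_mono fun x => ?_
  calc ‖(H (a + t • x)).toReal‖ₑ = ‖((H (a + t • x)).toReal - (H a).toReal) + (H a).toReal‖ₑ := by
        rw [sub_add_cancel]
    _ ≤ _ := enorm_add_le _ _

/-- Lebesgue points for a map into a metric space are obtained from the countably many scalar
functions min(1, d(v, c_j)), with c_j dense. The truncation makes them locally integrable for any
measurable v. -/
theorem ae_tendsto_lintegral_edist_homothety {N : Type*} [EMetricSpace N] [SecondCountableTopology N]
    [MeasurableSpace N] [BorelSpace N] {v : Euc m → N} (hv : Measurable v) {R : ℝ} (hR : 0 < R) :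
    ∀ᵐ a : Euc m, Tendsto
      (fun t : ℝ => ∫⁻ x in closedBall 0 R, min 1 (edist (v (a + t • x)) (v a))) (𝓝[>] 0) (𝓝 0) := by
  have hne : Nonempty N := ⟨v 0⟩
  obtain ⟨c, hc⟩ := TopologicalSpace.exists_dense_seq N
  have hfin : ∀ j x, min 1 (edist (v x) (c j)) ≠ ⊤ := fun j x => (min_lt_of_left_lt (by simp)).ne
  have hloc : ∀ j, LocallyIntegrable fun x => (min 1 (edist (v x) (c j))).toReal := fun j => by
    refine (locallyIntegrable_const (1 : ℝ)).mono
      (measurable_const.min (hv.edist measurable_const)).ennreal_toReal.aestronglyMeasurable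
      (.of_forall fun x => ?_)
    rw [Real.norm_eq_abs, abs_of_nonneg ENNReal.toReal_nonneg, norm_one]
    exact ENNReal.toReal_le_of_le_ofReal zero_le_one (by simp)
  have hall := ae_all_iff.2 fun j => ae_tendsto_lintegral_homothety (hloc j) hR
  filter_upwards [hall] with a ha
  have hV : volume (closedBall (0 : Euc m) R) ≠ ⊤ := measure_closedBall_lt_top.ne
  rw [ENNReal.tendsto_nhds_zero]
  intro ε hε
  obtain ⟨δ, hδ, hδε⟩ := exists_ne_zero_mul_le (c := 2 * volume (closedBall (0 : Euc m) R))
    (ε := ε / 2) (by finiteness) (by simpa using hε.ne')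
  obtain ⟨j, hj⟩ : ∃ j, edist (v a) (c j) < δ := by
    obtain ⟨y, ⟨j, hj⟩, hy⟩ := EMetric.mem_closure_iff.1 (hc (v a)) δ (pos_iff_ne_zero.2 hδ)
    exact ⟨j, hj ▸ hy⟩
  filter_upwards [(ha j).eventually_lt_const (ENNReal.half_pos hε.ne')] with t ht
  have hpt : ∀ x, min 1 (edist (v (a + t • x)) (v a)) ≤
      ‖(min 1 (edist (v (a + t • x)) (c j))).toReal - (min 1 (edist (v a) (c j))).toReal‖ₑ + 2 * δ := by
    intro x
    have e1 : ∀ y, min 1 (edist (v y) (c j)) = ‖(min 1 (edist (v y) (c j))).toReal‖ₑ := fun y => by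
      rw [Real.enorm_eq_ofReal ENNReal.toReal_nonneg, ENNReal.ofReal_toReal (hfin j y)]
    calc min 1 (edist (v (a + t • x)) (v a))
        ≤ min 1 (edist (v (a + t • x)) (c j)) + δ := by
          rcases le_total 1 (edist (v (a + t • x)) (c j)) with h | h
          · rw [min_eq_left h]
            exact (min_le_left _ _).trans le_self_add
          · rw [min_eq_right h]
            refine (min_le_right _ _).trans ((edist_triangle _ (c j) _).trans ?_)
            rw [edist_comm (c j)]
            gcongr
      _ ≤ (‖(min 1 (edist (v (a + t • x)) (c j))).toReal - (min 1 (edist (v a) (c j))).toReal‖ₑ +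
            min 1 (edist (v a) (c j))) + δ := by
          gcongr
          have h := enorm_add_le ((min 1 (edist (v (a + t • x)) (c j))).toReal -
            (min 1 (edist (v a) (c j))).toReal) (min 1 (edist (v a) (c j))).toReal
          rwa [sub_add_cancel, ← e1, ← e1] at h
      _ ≤ _ := by
          rw [add_assoc, two_mul]
          gcongr
          exact (min_le_right _ _).trans hj.le
  refine (lintegral_mono hpt).trans ?_
  rw [lintegral_add_right _ measurable_const, setLIntegral_const, ← ENNReal.add_halves ε]
  refine add_le_add ht.le ?_
  rw [mul_right_comm]
  exact hδε

theorem setLIntegral_closedBall_translate (F : Euc m → ℝ≥0∞) (a : Euc m) (R : ℝ) :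
    ∫⁻ x in closedBall a R, F (x - a) = ∫⁻ x in closedBall 0 R, F x := by
  rw [← lintegral_indicator measurableSet_closedBall, ← lintegral_indicator measurableSet_closedBall,
    ← lintegral_sub_right_eq_self ((closedBall 0 R).indicator F) a]
  refine lintegral_congr fun x => ?_
  simp only [indicator, mem_closedBall, dist_eq_norm, sub_zero]

/-- The annuli decrease to the empty set, so their measures tend to 0, and the integral is
absolutely continuous. -/
theorem tendsto_setLIntegral_annulus {F : Euc m → ℝ≥0∞} {a : Euc m} {ρ : ℝ} (hρ : 0 < ρ)
    {S : Set (Euc m)} (hF : ∫⁻ x in S, F x ≠ ⊤) :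
    Tendsto (fun t : ℝ => ∫⁻ x in S ∩ (closedBall a (ρ * (1 + t)) \ closedBall a ρ), F x)
      (𝓝[>] 0) (𝓝 0) := by
  have hvol : Tendsto (fun t : ℝ => volume (closedBall a (ρ * (1 + t)) \ closedBall a ρ))
      (𝓝[>] 0) (𝓝 0) := by
    have h := tendsto_measure_biInter_gt (μ := volume) (a := (0 : ℝ))
      (s := fun t : ℝ => closedBall a (ρ * (1 + t)) \ closedBall a ρ)
      (fun _ _ => (measurableSet_closedBall.diff measurableSet_closedBall).nullMeasurableSet)
      (fun i j _ hij => sdiff_subset_sdiff_left (closedBall_subset_closedBall (by gcongr)))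
      ⟨1, one_pos, ((measure_mono sdiff_subset).trans_lt measure_closedBall_lt_top).ne⟩
    have h0 : (⋂ t : ℝ, ⋂ (_ : t > 0), closedBall a (ρ * (1 + t)) \ closedBall a ρ) = ∅ := by
      refine eq_empty_of_forall_notMem fun x hx => ?_
      simp only [mem_iInter] at hx
      have h1 := (hx 1 one_pos).2
      rw [mem_closedBall, not_le] at h1
      have h2 := (hx ((dist x a / ρ - 1) / 2) (by
        have : 1 < dist x a / ρ := by rwa [one_lt_div hρ]
        simp only [gt_iff_lt]; linarith)).1
      rw [mem_closedBall] at h2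
      have : ρ * (1 + (dist x a / ρ - 1) / 2) = (ρ + dist x a) / 2 := by field_simp; ring
      linarith
    rwa [h0, measure_empty] at h
  have h := tendsto_setLIntegral_zero (μ := volume.restrict S) hF (l := 𝓝[>] (0 : ℝ))
    (s := fun t : ℝ => closedBall a (ρ * (1 + t)) \ closedBall a ρ)
    (tendsto_zero_of_le hvol fun _ => Measure.restrict_apply_le _ _)
  refine h.congr fun t => ?_
  rw [Measure.restrict_restrict (measurableSet_closedBall.diff measurableSet_closedBall), inter_comm]

theorem openMap_mapsTo {t : ℝ} (ht : t ∈ Icc (0 : ℝ) 1) {a : Euc m} {ρ : ℝ} (hρ : 0 < ρ)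
    {A : Set (Euc m)} (hA : closedBall a (2 * ρ) ⊆ A) : MapsTo (openMap t a ρ) A A := by
  intro x hx
  rcases le_total (2 * ρ) ‖x - a‖ with h | h
  · rwa [openMap_eq_self ht hρ h]
  · exact hA (mem_closedBall_iff_norm.2 ((norm_openMap_sub_le ht a x ρ).trans h))

theorem map_openMap_le {t : ℝ} (ht : t ∈ Ioc (0 : ℝ) 1) (a : Euc m) {ρ : ℝ} (hρ : 0 < ρ)
    (U : Set (Euc m)) : (volume.restrict U).map (openMap t a ρ) ≤
      ((((Real.toNNReal t)⁻¹ : NNReal) : ℝ≥0∞) ^ m) • volume := by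
  refine map_restrict_le_of_antilipschitz (continuous_openMap t a ρ).measurable fun x _ y _ => ?_
  have h := openMap_antilipschitz ⟨ht.1.le, ht.2⟩ a hρ x y
  rw [edist_dist, edist_dist, ← ENNReal.ofReal_coe_nnreal, ← ofReal_mul NNReal.zero_le_coe]
  refine ofReal_le_ofReal ?_
  rw [dist_eq_norm, dist_eq_norm, NNReal.coe_inv, Real.coe_toNNReal _ ht.1.le, inv_mul_eq_div, le_div_iff₀ ht.1,
    mul_comm]
  exact h

theorem fderiv_openMap_of_lt {t : ℝ} {a x : Euc m} {ρ : ℝ} (hρ : 0 < ρ)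
    (h : ‖x - a‖ < ρ * (1 + t)) : fderiv ℝ (openMap t a ρ) x = t • ContinuousLinearMap.id ℝ (Euc m) := by
  rw [fderiv_eq_of_eqOn (g := fun x => a + t • (x - a)) (isOpen_ball (x := a) (ε := ρ * (1 + t)))
    (fun y hy => openMap_eq_of_le hρ (mem_ball_iff_norm.1 hy).le) (mem_ball_iff_norm.2 h)]
  exact (((hasFDerivAt_id x).sub_const a).const_smul t).const_add a |>.fderiv

theorem fderiv_openMap_of_gt {t : ℝ} (ht : t ∈ Icc (0 : ℝ) 1) {a x : Euc m} {ρ : ℝ} (hρ : 0 < ρ)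
    (h : ρ * (1 + t) < ‖x - a‖) : fderiv ℝ (openMap t a ρ) x = fderiv ℝ (openMap 0 a ρ) x :=
  fderiv_eq_of_eqOn (U := (closedBall a (ρ * (1 + t)))ᶜ) isClosed_closedBall.isOpen_compl
    (fun y hy => openMap_eq_of_ge ht hρ (by
      rw [mem_compl_iff, mem_closedBall, dist_eq_norm, not_le] at hy; exact hy.le))
    (by rwa [mem_compl_iff, mem_closedBall, dist_eq_norm, not_le])

theorem setLIntegral_le_add_of_indicator {K S T : Set (Euc m)} (hS : MeasurableSet S)
    (hT : MeasurableSet T) {f F₁ F₂ : Euc m → ℝ≥0∞} (hF : AEMeasurable F₂ (volume.restrict K))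
    (h : ∀ᵐ x, f x ≤ S.indicator F₁ x + T.indicator F₂ x) :
    ∫⁻ x in K, f x ≤ (∫⁻ x in S, F₁ x) + ∫⁻ x in K ∩ T, F₂ x := by
  calc ∫⁻ x in K, f x ≤ ∫⁻ x in K, (S.indicator F₁ x + T.indicator F₂ x) :=
        lintegral_mono_ae (ae_restrict_of_ae h)
    _ = (∫⁻ x in K, S.indicator F₁ x) + ∫⁻ x in K, T.indicator F₂ x :=
        lintegral_add_right' _ (hF.indicator hT)
    _ ≤ _ := by
        rw [inter_comm, ← Measure.restrict_restrict hT, ← lintegral_indicator hT,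
          ← lintegral_indicator hS]
        gcongr
        exact Measure.restrict_le_self

/-- Opening of a weakly differentiable function at a generic point. -/
theorem HasWeakFDerivOn.comp_openMap_zero (hm : 1 ≤ m) {g : Euc m → ℝ} {G : Euc m → Euc m →L[ℝ] ℝ}
    {A : Set (Euc m)} (hA : IsOpen A) (h : HasWeakFDerivOn g G A) {a : Euc m} {ρ : ℝ} (hρ : 0 < ρ)
    (haA : closedBall a (2 * ρ) ⊆ A)
    (hg0 : LocallyIntegrableOn (fun x => g (openMap 0 a ρ x)) A)
    (hG0 : ∀ K ⊆ A, IsCompact K →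
      ∫⁻ x in K, ‖(G (openMap 0 a ρ x)).comp (fderiv ℝ (openMap 0 a ρ) x)‖ₑ ≠ ⊤)
    (hl1 : Tendsto (fun t : ℝ => ∫⁻ x in closedBall 0 (2 * ρ), ‖g (a + t • x) - g a‖ₑ)
      (𝓝[>] 0) (𝓝 0))
    (hl2 : Tendsto (fun t : ℝ => ofReal t * ∫⁻ x in closedBall 0 (2 * ρ), ‖G (a + t • x)‖ₑ)
      (𝓝[>] 0) (𝓝 0)) :
    HasWeakFDerivOn (fun x => g (openMap 0 a ρ x))
      (fun x => (G (openMap 0 a ρ x)).comp (fderiv ℝ (openMap 0 a ρ) x)) A := by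
  obtain ⟨gt, hgt⟩ : ∃ gt : ℝ → Euc m → ℝ, ∀ t x, gt t x = g (openMap t a ρ x) :=
    ⟨_, fun _ _ => rfl⟩
  obtain ⟨Gt, hGt⟩ : ∃ Gt : ℝ → Euc m → Euc m →L[ℝ] ℝ, ∀ t x, Gt t x =
      (G (openMap t a ρ x)).comp (fderiv ℝ (openMap t a ρ) x) := ⟨_, fun _ _ => rfl⟩
  simp only [← hgt, ← hGt] at hg0 hG0 ⊢
  -- For t > 0 the opening map is injective and expands volumes of preimages by a finite factor, so
  -- the Lipschitz chain rule applies. That factor blows up as t → 0, which is why t = 0 is reached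
  -- by a limit.
  have hw : ∀ t ∈ Ioc (0 : ℝ) 1, HasWeakFDerivOn (gt t) (Gt t) A := fun t ht => by
    have := h.comp_lipschitz hA hA (openMap_lipschitz ⟨ht.1.le, ht.2⟩ a hρ)
      (openMap_mapsTo ⟨ht.1.le, ht.2⟩ hρ haA) (by finiteness) (map_openMap_le ht a hρ A)
    simpa only [← hgt, ← hGt] using this
  have hge : ∀ t ∈ Icc (0 : ℝ) 1, ∀ x, ρ * (1 + t) < ‖x - a‖ → gt t x = gt 0 x ∧ Gt t x = Gt 0 x :=
    fun t ht x hx => by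
      rw [hgt, hgt, hGt, hGt, openMap_eq_of_ge ht hρ hx.le, fderiv_openMap_of_gt ht hρ hx]
      exact ⟨rfl, rfl⟩
  have hGin : ∀ t, ∀ x, ‖x - a‖ < ρ * (1 + t) → Gt t x = t • G (a + t • (x - a)) := fun t x hx => by
    rw [hGt, openMap_eq_of_le hρ hx.le, fderiv_openMap_of_lt hρ hx]
    ext y
    simp
  have hgin : ∀ t, ∀ x, ‖x - a‖ ≤ ρ * (1 + t) → gt t x = g (a + t • (x - a)) := fun t x hx => by
    rw [hgt, openMap_eq_of_le hρ hx]
  -- Off the closed ball of radius ρ the candidate coincides locally with the derivative for some t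
  -- > 0; it vanishes in the open ball, and the sphere is null.
  have hG0m : AEStronglyMeasurable (Gt 0) (volume.restrict A) := by
    have h1 : AEStronglyMeasurable (Gt 0)
        (volume.restrict (⋃ k : ℕ, A \ closedBall a (ρ * (1 + 1 / ((k : ℝ) + 1))))) := by
      refine aestronglyMeasurable_iUnion_iff.2 fun k => ?_
      have hk : (1 / ((k : ℝ) + 1)) ∈ Ioc (0 : ℝ) 1 :=
        ⟨by positivity, by rw [div_le_one (by positivity)]; linarith [k.cast_nonneg (α := ℝ)]⟩
      have h2 := ((hw _ hk).2.1.aestronglyMeasurable).mono_measure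
        (Measure.restrict_mono (sdiff_subset (t := closedBall a (ρ * (1 + 1 / ((k : ℝ) + 1)))))
          le_rfl)
      refine h2.congr (ae_restrict_of_forall_mem
        (hA.measurableSet.diff measurableSet_closedBall) (fun x hx => ?_))
      have := hx.2
      rw [mem_closedBall, dist_eq_norm, not_le] at this
      exact (hge _ ⟨hk.1.le, hk.2⟩ x this).2
    have h2 : AEStronglyMeasurable (Gt 0) (volume.restrict (ball a ρ)) := by
      refine (aestronglyMeasurable_const (b := (0 : Euc m →L[ℝ] ℝ))).congr
        (ae_restrict_of_forall_mem measurableSet_ball (fun x hx => ?_))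
      rw [hGin 0 x (by rw [add_zero, mul_one]; exact mem_ball_iff_norm.1 hx), zero_smul]
    have h3 : AEStronglyMeasurable (Gt 0) (volume.restrict (sphere a ρ)) := by
      have : volume (sphere a ρ) = 0 := by
        have h4 := ae_notMem_sphere hm (fun _ : Unit => a) (fun _ => ρ)
        rw [ae_iff] at h4
        simpa only [not_forall, not_not, exists_prop, exists_const, ofPred_mem_eq] using h4
      rw [Measure.restrict_zero_set this]
      exact aestronglyMeasurable_zero_measure _
    have h4 := aestronglyMeasurable_union_iff.2 ⟨aestronglyMeasurable_union_iff.2 ⟨h1, h2⟩, h3⟩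
    refine h4.mono_measure (Measure.restrict_mono (fun x hx => ?_) le_rfl)
    rcases lt_trichotomy ‖x - a‖ ρ with hlt | heq | hgt'
    · exact Or.inl (Or.inr (mem_ball_iff_norm.2 hlt))
    · exact Or.inr (mem_sphere_iff_norm.2 heq)
    · refine Or.inl (Or.inl ?_)
      obtain ⟨k, hk⟩ := exists_nat_one_div_lt (show 0 < ‖x - a‖ / ρ - 1 by
        rw [sub_pos, one_lt_div hρ]; exact hgt')
      refine mem_iUnion.2 ⟨k, hx, ?_⟩
      rw [mem_closedBall, dist_eq_norm, not_le]
      calc ρ * (1 + 1 / ((k : ℝ) + 1)) < ρ * (1 + (‖x - a‖ / ρ - 1)) := by gcongr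
        _ = ‖x - a‖ := by field_simp; ring
  have hG0l : LocallyIntegrableOn (Gt 0) A := by
    rw [locallyIntegrableOn_iff hA.isLocallyClosed]
    exact fun K hK hKc => ⟨hG0m.mono_measure (Measure.restrict_mono hK le_rfl),
      lt_top_iff_ne_top.2 (hG0 K hK hKc)⟩
  have hev : ∀ᶠ t : ℝ in 𝓝[>] 0, t ∈ Ioc (0 : ℝ) 1 := Ioc_mem_nhdsGT one_pos
  refine HasWeakFDerivOn.of_tendsto (l := 𝓝[>] (0 : ℝ)) hg0 hG0l fun φ _ hφ hφA =>
    ⟨gt, Gt, A, hφA, hev.mono hw, ?_, ?_⟩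
  -- The two functions agree for |x - a| > ρ(1 + t). On the smaller ball g(a + t(x - a)) is compared
  -- with g(a), which is the Lebesgue point condition; the annulus in between is handled by absolute
  -- continuity.
  · have hfin : ∫⁻ x in tsupport φ, ‖gt 0 x - g a‖ₑ ≠ ⊤ :=
      ((hg0.integrableOn_compact_subset hφA hφ).sub
        (integrableOn_const hφ.isCompact.measure_lt_top.ne)).2.ne
    have hlim := hl1.add (tendsto_setLIntegral_annulus (a := a) hρ hfin)
    rw [add_zero] at hlim
    refine tendsto_of_tendsto_of_tendsto_of_le_of_le' tendsto_const_nhds hlim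
      (.of_forall fun _ => zero_le) ?_
    filter_upwards [hev] with t ht
    rw [← setLIntegral_closedBall_translate (fun x => ‖g (a + t • x) - g a‖ₑ) a]
    refine setLIntegral_le_add_of_indicator measurableSet_closedBall
      (measurableSet_closedBall.diff measurableSet_closedBall)
      ((hg0.integrableOn_compact_subset hφA hφ).1.sub aestronglyMeasurable_const).enorm
      (.of_forall fun x => ?_)
    rcases lt_or_ge (ρ * (1 + t)) ‖x - a‖ with hx | hx
    · rw [(hge t ⟨ht.1.le, ht.2⟩ x hx).1, sub_self, enorm_zero]
      exact zero_le
    · rw [indicator_of_mem (s := closedBall a (2 * ρ)) (mem_closedBall_iff_norm.2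
        (hx.trans (by rw [mul_comm 2]; gcongr; linarith [ht.2]))), hgin t x hx]
      by_cases hx' : x ∈ closedBall a ρ
      · rw [indicator_of_notMem (fun h => h.2 hx'), hgin 0 x (by
          rw [add_zero, mul_one]; exact mem_closedBall_iff_norm.1 hx'), zero_smul, add_zero, add_zero]
      · rw [indicator_of_mem (show x ∈ closedBall a (ρ * (1 + t)) \ closedBall a ρ from
          ⟨mem_closedBall_iff_norm.2 hx, hx'⟩)]
        calc _ = ‖(g (a + t • (x - a)) - g a) - (gt 0 x - g a)‖ₑ := by rw [sub_sub_sub_cancel_right]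
          _ ≤ _ := enorm_fun_sub_le _ _
  · have hlim := hl2.add (tendsto_setLIntegral_annulus (a := a) hρ (hG0 _ hφA hφ))
    rw [add_zero] at hlim
    refine tendsto_of_tendsto_of_tendsto_of_le_of_le' tendsto_const_nhds hlim
      (.of_forall fun _ => zero_le) ?_
    filter_upwards [hev] with t ht
    rw [← setLIntegral_closedBall_translate (fun x => ‖G (a + t • x)‖ₑ) a,
      ← lintegral_const_mul' _ _ ofReal_ne_top]
    refine setLIntegral_le_add_of_indicator measurableSet_closedBall
      (measurableSet_closedBall.diff measurableSet_closedBall)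
      (hG0l.integrableOn_compact_subset hφA hφ).1.enorm ?_
    filter_upwards [ae_notMem_sphere hm (fun _ : Unit => a) (fun _ => ρ * (1 + t)),
      ae_notMem_sphere hm (fun _ : Unit => a) (fun _ => ρ)] with x hx1 hx2
    rcases lt_or_ge (ρ * (1 + t)) ‖x - a‖ with hx | hx
    · rw [(hge t ⟨ht.1.le, ht.2⟩ x hx).2, sub_self, ← ofReal_norm, norm_zero, ENNReal.ofReal_zero]
      exact zero_le
    · have hx3 : ‖x - a‖ < ρ * (1 + t) := lt_of_le_of_ne hx fun he => hx1 () (mem_sphere_iff_norm.2 he)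
      have he : ‖Gt t x‖ₑ = ofReal t * ‖G (a + t • (x - a))‖ₑ := by
        rw [hGin t x hx3, enorm_smul, Real.enorm_eq_ofReal ht.1.le]
      rw [indicator_of_mem (s := closedBall a (2 * ρ)) (mem_closedBall_iff_norm.2
        (hx.trans (by rw [mul_comm 2]; gcongr; linarith [ht.2]))), ← he]
      by_cases hx' : x ∈ closedBall a ρ
      · have h0 : Gt 0 x = 0 := by
          rw [hGin 0 x (by
            rw [add_zero, mul_one]
            exact lt_of_le_of_ne (mem_closedBall_iff_norm.1 hx')
              fun he => hx2 () (mem_sphere_iff_norm.2 he)), zero_smul]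
        rw [indicator_of_notMem (fun h => h.2 hx'), h0, sub_zero, add_zero]
      · rw [indicator_of_mem (show x ∈ closedBall a (ρ * (1 + t)) \ closedBall a ρ from
          ⟨mem_closedBall_iff_norm.2 hx, hx'⟩)]
        exact enorm_fun_sub_le _ _

theorem IsBddWeakDeriv.comp_openMap_zero (hm : 1 ≤ m) {p : ℝ} (hp : 1 ≤ p) {u : Euc m → N}
    {D : Euc m → Euc m →L[ℝ] Euc n} {A : Set (Euc m)} (hA : IsOpen A) (hu : Measurable u)
    (h : IsBddWeakDeriv u D A) {a : Euc m} {ρ : ℝ} (hρ : 0 < ρ) (haA : closedBall a (2 * ρ) ⊆ A)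
    (hE : ∫⁻ x in A, hs (u (openMap 0 a ρ x))
      ((D (openMap 0 a ρ x)).comp (fderiv ℝ (openMap 0 a ρ) x)) ^ p ≠ ⊤)
    (hl1 : Tendsto (fun t : ℝ => ∫⁻ x in closedBall 0 (2 * ρ), min 1 (edist (u (a + t • x)) (u a)))
      (𝓝[>] 0) (𝓝 0))
    (hl2 : Tendsto (fun t : ℝ => ofReal t *
      ∫⁻ x in closedBall 0 (2 * ρ), hs (u (a + t • x)) (D (a + t • x))) (𝓝[>] 0) (𝓝 0)) :
    IsBddWeakDeriv (fun x => u (openMap 0 a ρ x))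
      (fun x => (D (openMap 0 a ρ x)).comp (fderiv ℝ (openMap 0 a ρ) x)) A := by
  rintro f hf ⟨K, hK⟩ ⟨M, hM⟩
  have hfm : Measurable fun x => f (u (openMap 0 a ρ x)) :=
    hf.continuous.measurable.comp (hu.comp (continuous_openMap 0 a ρ).measurable)
  have hM0 : 0 ≤ M := (abs_nonneg _).trans (hM (u 0))
  have e : ∀ (B : Euc n →L[ℝ] ℝ) (T : Euc m →L[ℝ] Euc n) (S : Euc m →L[ℝ] Euc m),
      B.comp (T.comp S) = (B.comp T).comp S := fun _ _ _ => rfl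
  simp only [e]
  refine HasWeakFDerivOn.comp_openMap_zero (g := fun x => f (u x))
    (G := fun x => (mder f (u x)).comp (D x)) hm hA (h f hf ⟨K, hK⟩ ⟨M, hM⟩) hρ haA ?_ ?_ ?_ ?_
  · exact ((locallyIntegrable_const M).mono hfm.aestronglyMeasurable (.of_forall fun x => by
      rw [Real.norm_eq_abs, Real.norm_eq_abs, abs_of_nonneg hM0]; exact hM _)).locallyIntegrableOn A
  · intro L hL hLc
    simp only [← e]
    exact lintegral_mder_comp_ne_top (u := fun x => u (openMap 0 a ρ x)) (D := fun x =>
      (D (openMap 0 a ρ x)).comp (fderiv ℝ (openMap 0 a ρ) x)) hp hf hK hL hLc hE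
  · have hlim := ENNReal.Tendsto.const_mul hl1
      (Or.inr (show (K : ℝ≥0∞) + ofReal (2 * M) ≠ ⊤ by finiteness))
    rw [mul_zero] at hlim
    refine tendsto_zero_of_le hlim fun t => ?_
    rw [← lintegral_const_mul' _ _ (by finiteness)]
    refine lintegral_mono fun x => ?_
    rcases le_total 1 (edist (u (a + t • x)) (u a)) with h1 | h1
    · rw [min_eq_left h1, mul_one]
      refine le_trans ?_ le_add_self
      rw [Real.enorm_eq_ofReal_abs]
      refine ofReal_le_ofReal ((abs_sub _ _).trans ?_)
      linarith [hM (u (a + t • x)), hM (u a)]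
    · rw [min_eq_right h1, ← edist_eq_enorm_sub]
      exact (hK _ _).trans (by gcongr; exact le_self_add)
  · have hlim := ENNReal.Tendsto.const_mul hl2 (Or.inr (show (K : ℝ≥0∞) * m ≠ ⊤ by finiteness))
    rw [mul_zero] at hlim
    refine tendsto_zero_of_le hlim fun t => ?_
    rw [mul_left_comm]
    refine mul_le_mul_right ?_ _
    rw [← lintegral_const_mul' _ _ (by finiteness)]
    refine lintegral_mono fun x => ?_
    exact LipschitzWith.enorm_mder_comp_le hK (hf.mdifferentiable one_ne_zero _) _

/-- The majorant holds at every point. This matters because the opening map sends a ball to one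
point, so bounds valid almost everywhere cannot be composed with it. -/
theorem exists_measurable_ge_ae_eq {X : Type*} [MeasurableSpace X] {μ : Measure X} {f : X → ℝ≥0∞}
    (hf : AEMeasurable f μ) : ∃ g : X → ℝ≥0∞, Measurable g ∧ f ≤ g ∧ f =ᵐ[μ] g := by
  obtain ⟨Z, hZ, hZm, hZ0⟩ := exists_measurable_superset_of_null (ae_iff.1 hf.ae_eq_mk)
  classical
  refine ⟨Z.piecewise (fun _ => ⊤) (hf.mk f), measurable_const.piecewise hZm hf.measurable_mk |>.mono
    le_rfl le_rfl, fun x => ?_, ?_⟩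
  · by_cases hx : x ∈ Z
    · rw [piecewise_eq_of_mem _ _ _ hx]; exact le_top
    · rw [piecewise_eq_of_notMem _ _ _ hx]
      exact (not_not.1 fun h => hx (hZ h)).le
  · have : ∀ᵐ x ∂μ, x ∉ Z := measure_eq_zero_iff_ae_notMem.1 hZ0
    filter_upwards [this] with x hx
    rw [piecewise_eq_of_notMem _ _ _ hx]
    exact not_not.1 fun h => hx (hZ h)

/-- Opening of a Sobolev map at a generic point. -/
theorem exists_opening (hm : 1 ≤ m) {p : ℝ} (hp : 1 ≤ p) : ∃ C : ℝ≥0∞, C ≠ ⊤ ∧ ∀ (u : Euc m → N)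
    (D : Euc m → Euc m →L[ℝ] Euc n), Measurable u → IsBddWeakDeriv u D (ball 0 1) →
    ∫⁻ x in ball 0 1, hs (u x) (D x) ^ p ≠ ⊤ → ∀ ρ : ℝ, 0 < ρ → 3 * ρ ≤ 1 →
    ∃ a ∈ ball (0 : Euc m) (ρ / 2), ∃ D₀ : Euc m → Euc m →L[ℝ] Euc n,
      IsBddWeakDeriv (fun x => u (openMap 0 a ρ x)) D₀ (ball 0 1) ∧
      (∀ x ∉ ball (0 : Euc m) (3 * ρ), openMap 0 a ρ x = x ∧ D₀ x = D x) ∧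
      (∀ x ∈ ball a ρ, D₀ x = 0) ∧
      ∫⁻ x in ball 0 (3 * ρ), hs (u (openMap 0 a ρ x)) (D₀ x) ^ p ≤
        C * ∫⁻ x in ball 0 (3 * ρ), hs (u x) (D x) ^ p := by
  refine ⟨(m * m * 3 : ℝ≥0∞) ^ p * 8 ^ m, by finiteness, fun u D hu hD hE ρ hρ hρ1 => ?_⟩
  have hp0 : 0 ≤ p := by linarith
  have hmeas : AEMeasurable (fun x => hs (u x) (D x)) (volume.restrict (ball 0 1)) :=
    hD.aemeasurable_hs isOpen_ball hu.aemeasurable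
  have hE1 : ∫⁻ x in ball 0 1, hs (u x) (D x) ≠ ⊤ := by
    refine ne_top_of_le_ne_top ?_ (lintegral_mono fun x => hs_le_one_add_rpow hp (hs (u x) (D x)))
    rw [lintegral_add_left measurable_const, setLIntegral_const, one_mul]
    exact ENNReal.add_ne_top.2 ⟨measure_ball_lt_top.ne, hE⟩
  obtain ⟨F, hFm, hF, hFe⟩ := exists_measurable_ge_ae_eq (f := (ball (0 : Euc m) 1).indicator
    fun x => hs (u x) (D x) ^ p) (μ := volume)
    ((aemeasurable_indicator_iff measurableSet_ball).2 (hmeas.pow_const p))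
  have hl1 := ae_tendsto_lintegral_edist_homothety hu (show 0 < 2 * ρ by positivity)
  have hl2 := ae_tendsto_mul_lintegral_homothety (H := (ball (0 : Euc m) 1).indicator
    fun x => hs (u x) (D x)) ((aemeasurable_indicator_iff measurableSet_ball).2 hmeas)
    (by rwa [lintegral_indicator measurableSet_ball]) (show 0 < 2 * ρ by positivity)
  -- The centre is generic for both Lebesgue point conditions and satisfies the averaged energy
  -- bound.
  obtain ⟨a, ha, ⟨ha1, ha2⟩, ha3⟩ := exists_open_center hFm 0 hρ
    ((hl1.and hl2).mono fun a h _ => h)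
  have ha' : ‖a‖ < ρ / 2 := mem_ball_zero_iff.1 ha
  have hbb : ball (0 : Euc m) (3 * ρ) ⊆ ball 0 1 := ball_subset_ball hρ1
  have hab : closedBall a (2 * ρ) ⊆ ball 0 (3 * ρ) := fun x hx => by
    rw [mem_ball_zero_iff]
    have := norm_le_norm_add_norm_sub' x a
    have := mem_closedBall_iff_norm.1 hx
    linarith
  have hoff : ∀ x ∉ ball (0 : Euc m) (3 * ρ), 2 * ρ < ‖x - a‖ := fun x hx => by
    by_contra! h
    exact hx (hab (mem_closedBall_iff_norm.2 h))
  have h01 : (0 : ℝ) ∈ Icc (0 : ℝ) 1 := ⟨le_rfl, zero_le_one⟩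
  have hDoff : ∀ x ∉ ball (0 : Euc m) (3 * ρ), openMap 0 a ρ x = x ∧
      (D (openMap 0 a ρ x)).comp (fderiv ℝ (openMap 0 a ρ) x) = D x := fun x hx => by
    have h := hoff x hx
    have h1 : openMap 0 a ρ x = x := openMap_eq_self h01 hρ h.le
    refine ⟨h1, ?_⟩
    rw [h1, fderiv_eq_of_eqOn (g := fun x => x) (U := (closedBall a (2 * ρ))ᶜ)
      isClosed_closedBall.isOpen_compl (fun y hy => openMap_eq_self h01 hρ (by
        rw [mem_compl_iff, mem_closedBall, dist_eq_norm, not_le] at hy; exact hy.le))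
      (by rwa [mem_compl_iff, mem_closedBall, dist_eq_norm, not_le]), fderiv_fun_id]
    exact ContinuousLinearMap.comp_id _
  have hbound : ∫⁻ x in ball 0 (3 * ρ), hs (u (openMap 0 a ρ x))
      ((D (openMap 0 a ρ x)).comp (fderiv ℝ (openMap 0 a ρ) x)) ^ p ≤
        (m * m * 3 : ℝ≥0∞) ^ p * 8 ^ m * ∫⁻ x in ball 0 (3 * ρ), hs (u x) (D x) ^ p := by
    have hFi : ∫⁻ x in ball 0 (3 * ρ), F x = ∫⁻ x in ball 0 (3 * ρ), hs (u x) (D x) ^ p := by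
      rw [← lintegral_congr_ae (ae_restrict_of_ae hFe)]
      exact setLIntegral_congr_fun measurableSet_ball fun x hx => indicator_of_mem (hbb hx) _
    rw [← hFi, mul_assoc]
    refine le_trans ?_ (mul_le_mul_right ha3 _)
    rw [← lintegral_const_mul' _ _ (by finiteness)]
    refine setLIntegral_mono' measurableSet_ball fun x hx => ?_
    have hx1 : openMap 0 a ρ x ∈ ball (0 : Euc m) 1 :=
      openMap_mapsTo h01 hρ (hab.trans hbb) (hbb hx)
    refine le_trans ?_ (mul_le_mul_right (hF _) _)
    rw [indicator_of_mem hx1, ← mul_rpow_of_nonneg _ _ hp0]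
    refine ENNReal.rpow_le_rpow ((hs_comp_le _ _ _).trans ?_) hp0
    gcongr
    exact enorm_fderiv_le_of_lipschitz (openMap_lipschitz h01 a hρ) x
  have hb3 : ∫⁻ x in ball 0 (3 * ρ), hs (u x) (D x) ^ p ≠ ⊤ :=
    ne_top_of_le_ne_top hE (lintegral_mono_set hbb)
  refine ⟨a, ha, _, hD.comp_openMap_zero hm hp isOpen_ball hu hρ (hab.trans hbb) ?_ ha1 ?_, hDoff,
    fun x hx => ?_, hbound⟩
  · refine ne_top_of_le_ne_top (ENNReal.add_ne_top.2 ⟨ne_top_of_le_ne_top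
      (ENNReal.mul_ne_top (by finiteness) hb3) hbound, hE⟩)
      ((lintegral_mono_set (t := ball 0 (3 * ρ) ∪ (ball 0 1 \ ball 0 (3 * ρ))) (by simp)).trans
        ((lintegral_union_le _ _ _).trans (add_le_add le_rfl ?_)))
    calc _ = ∫⁻ x in ball 0 1 \ ball 0 (3 * ρ), hs (u x) (D x) ^ p :=
          setLIntegral_congr_fun (measurableSet_ball.diff measurableSet_ball) fun x hx => by
            obtain ⟨h1, h2⟩ := hDoff x hx.2
            beta_reduce
            rw [h2, h1]
      _ ≤ _ := lintegral_mono_set sdiff_subset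
  · refine ha2.congr' ?_
    filter_upwards [Ioc_mem_nhdsGT one_pos] with t ht
    congr 1
    refine setLIntegral_congr_fun measurableSet_closedBall fun x hx => indicator_of_mem
      (hbb (hab (mem_closedBall_iff_norm.2 ?_))) _
    rw [add_sub_cancel_left, norm_smul, Real.norm_eq_abs, abs_of_pos ht.1]
    exact (mul_le_of_le_one_left (norm_nonneg _) ht.2).trans (mem_closedBall_zero_iff.1 hx)
  · rw [fderiv_openMap_of_lt hρ (by rw [add_zero, mul_one]; exact mem_ball_iff_norm.1 hx)]
    ext
    simp

/-! ### Reflection and extension for the Dirichlet energy. -/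

/-- The reflection of the exterior of the unit ball. -/
noncomputable def reflMap (x : Euc m) : Euc m :=
  open scoped Classical in
  if ‖x‖ ≤ 1 then x else sphereInv x

theorem reflMap_of_le {x : Euc m} (h : ‖x‖ ≤ 1) : reflMap x = x := if_pos h

theorem reflMap_of_ge {x : Euc m} (h : 1 ≤ ‖x‖) : reflMap x = sphereInv x := by
  rcases h.eq_or_lt with h | h
  · rw [reflMap_of_le h.ge, sphereInv, ← h, one_pow, inv_one, one_smul]
  · exact if_neg h.not_ge

theorem reflMap_lipschitz : LipschitzWith 1 (reflMap : Euc m → Euc m) := by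
  refine lipschitzWith_of_closedBall (fun x hx y hy => ?_) fun x hx y hy => ?_
  · rw [reflMap_of_le (by simpa using hx), reflMap_of_le (by simpa using hy), ENNReal.coe_one, one_mul]
  · rw [reflMap_of_ge hx, reflMap_of_ge hy]
    exact sphereInv_lipschitzOnWith hx hy

theorem norm_reflMap_le (x : Euc m) : ‖reflMap x‖ ≤ 1 := by
  rcases le_total ‖x‖ 1 with h | h
  · rwa [reflMap_of_le h]
  · rw [reflMap_of_ge h, norm_sphereInv]
    exact inv_le_one_of_one_le₀ h

/-- The constant is uniform in τ, so that τ can be sent to 1. The factor 2^m bounds the effect of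
the dilation since τ ≥ 1/2. -/
theorem map_reflMap_le : ∃ C : ℝ≥0∞, C ≠ ⊤ ∧ ∀ τ ∈ Icc (1 / 2 : ℝ) 1,
    (volume.restrict (ball (0 : Euc m) 24)).map (fun x => τ • reflMap x) ≤ C • volume := by
  refine ⟨(1 + ((24 * 24 : NNReal) : ℝ≥0∞) ^ m) * 2 ^ m, by finiteness, fun τ hτ => ?_⟩
  have hR : Measurable (reflMap : Euc m → Euc m) := reflMap_lipschitz.continuous.measurable
  have h1 : (volume.restrict (ball (0 : Euc m) 24)).map reflMap ≤
      (1 + ((24 * 24 : NNReal) : ℝ≥0∞) ^ m) • volume := by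
    refine Measure.le_iff.2 fun s hs => ?_
    have h2 := Measure.le_iff.1 (map_sphereInv_le (m := m) (R := 24)) s hs
    rw [Measure.map_apply measurable_sphereInv hs,
      Measure.restrict_apply (measurable_sphereInv hs), Measure.smul_apply, smul_eq_mul] at h2
    rw [Measure.map_apply hR hs, Measure.restrict_apply (hR hs), Measure.smul_apply, smul_eq_mul,
      add_mul, one_mul]
    refine (measure_mono ?_).trans ((measure_union_le _ _).trans (add_le_add le_rfl h2))
    intro x hx
    have h3 := hx.1
    rw [mem_preimage] at h3
    rcases le_or_gt ‖x‖ 1 with h | h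
    · rw [reflMap_of_le h] at h3
      exact Or.inl h3
    · rw [reflMap_of_ge h.le] at h3
      exact Or.inr ⟨h3, h, by simpa using hx.2⟩
  have hτ0 : 0 < τ := by linarith [hτ.1]
  have h2 : volume.map (fun x : Euc m => τ • x) ≤ (2 : ℝ≥0∞) ^ m • volume := by
    rw [Measure.map_addHaar_smul _ hτ0.ne', finrank_euclideanSpace, Fintype.card_fin]
    refine Measure.le_iff.2 fun s _ => ?_
    rw [Measure.smul_apply, Measure.smul_apply, smul_eq_mul, smul_eq_mul]
    gcongr
    rw [← ENNReal.ofReal_ofNat, ← ENNReal.ofReal_pow zero_le_two]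
    refine ofReal_le_ofReal ?_
    rw [abs_of_pos (by positivity), ← inv_pow]
    gcongr
    rw [inv_le_comm₀ hτ0 two_pos]
    linarith [hτ.1]
  have h3 : (volume.restrict (ball (0 : Euc m) 24)).map (fun x => τ • reflMap x) =
      ((volume.restrict (ball (0 : Euc m) 24)).map reflMap).map (fun x : Euc m => τ • x) :=
    (Measure.map_map (measurable_const_smul τ) hR).symm
  rw [h3, mul_smul]
  refine (Measure.map_mono h1 (measurable_const_smul τ)).trans ?_
  rw [Measure.map_smul]
  exact Measure.le_iff.2 fun s hs => by
    have := Measure.le_iff.1 h2 s hs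
    simp only [Measure.smul_apply, smul_eq_mul] at this ⊢
    gcongr

theorem ae_reflMap_mem (hm : 1 ≤ m) : ∀ᵐ x : Euc m, reflMap x ∈ ball (0 : Euc m) 1 := by
  filter_upwards [ae_notMem_sphere hm (fun _ : Unit => (0 : Euc m)) (fun _ => 1)] with x hx
  have hx1 : ‖x‖ ≠ 1 := fun h => hx () (mem_sphere_zero_iff_norm.2 h)
  rw [mem_ball_zero_iff]
  rcases le_or_gt ‖x‖ 1 with h | h
  · rw [reflMap_of_le h]
    exact lt_of_le_of_ne h hx1
  · rw [reflMap_of_ge h.le, norm_sphereInv]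
    exact inv_lt_one_of_one_lt₀ h

/-- The reflection maps the unit sphere to itself, outside the open ball where g has a weak
derivative, so the chain rule does not apply directly. The maps x ↦ τ `reflMap` x with τ < 1 take
values in the open ball, and the compositions converge as τ → 1. -/
theorem HasWeakFDerivOn.comp_reflMap (hm : 1 ≤ m) {g : Euc m → ℝ} {G : Euc m → Euc m →L[ℝ] ℝ}
    (h : HasWeakFDerivOn g G (ball 0 1)) (hg : IntegrableOn g (ball 0 1))
    (hG : IntegrableOn G (ball 0 1)) :
    HasWeakFDerivOn (fun x => g (reflMap x))
      (fun x => (G (reflMap x)).comp (fderiv ℝ reflMap x)) (ball 0 24) := by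
  obtain ⟨C, hC, hmap⟩ := map_reflMap_le (m := m)
  have hR : Measurable (reflMap : Euc m → Euc m) := reflMap_lipschitz.continuous.measurable
  -- Truncation to the unit ball gives integrability on the whole space and is invisible after
  -- composition, as the reflection lands in the open ball almost everywhere.
  obtain ⟨g', hg'⟩ : ∃ g' : Euc m → ℝ, g' = (ball 0 1).indicator g := ⟨_, rfl⟩
  obtain ⟨G', hG'⟩ : ∃ G' : Euc m → Euc m →L[ℝ] ℝ, G' = (ball 0 1).indicator G := ⟨_, rfl⟩
  have h' : HasWeakFDerivOn g' G' (ball 0 1) := h.congr measurableSet_ball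
    (fun x hx => by rw [hg', indicator_of_mem hx]) (fun x hx => by rw [hG', indicator_of_mem hx])
  have hgi : Integrable g' := hg' ▸ hg.integrable_indicator measurableSet_ball
  have hGi : Integrable G' := IntegrableOn.integrable_of_zero (hG.congr_fun (fun x hx => by
    rw [hG', indicator_of_mem hx]) measurableSet_ball) measurableSet_ball fun x hx => by
    rw [hG', indicator_of_notMem hx]
  suffices hs : HasWeakFDerivOn (fun x => g' (reflMap x))
      (fun x => (G' (reflMap x)).comp (fderiv ℝ reflMap x)) (ball 0 24) by
    refine hs.congr_ae ?_ ?_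
    · filter_upwards [ae_restrict_of_ae (ae_reflMap_mem hm)] with x hx
      rw [hg', indicator_of_mem hx]
    · filter_upwards [ae_restrict_of_ae (ae_reflMap_mem hm)] with x hx
      rw [hG', indicator_of_mem hx]
  have hmap1 : (volume.restrict (ball (0 : Euc m) 24)).map reflMap ≤ C • volume := by
    have := hmap 1 ⟨by norm_num, le_rfl⟩
    simpa only [one_smul] using this
  have hgR : IntegrableOn (fun x => g' (reflMap x)) (ball 0 24) :=
    integrableOn_comp hR hC hmap1 subset_rfl (mapsTo_univ _ _) MeasurableSet.univ
      (integrableOn_univ.2 hgi)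
  have hGR : IntegrableOn (fun x => G' (reflMap x)) (ball 0 24) :=
    integrableOn_comp hR hC hmap1 subset_rfl (mapsTo_univ _ _) MeasurableSet.univ
      (integrableOn_univ.2 hGi)
  have hev : ∀ᶠ τ : ℝ in 𝓝[<] 1, τ ∈ Ico (1 / 2 : ℝ) 1 := Ico_mem_nhdsLT (by norm_num)
  have hτ1 : Tendsto (fun τ : ℝ => τ) (𝓝[<] 1) (𝓝 1) := tendsto_id.mono_left nhdsWithin_le_nhds
  have hfin : IsFiniteMeasure (volume.restrict (ball (0 : Euc m) 24)) :=
    ⟨by rw [Measure.restrict_apply_univ]; exact measure_ball_lt_top⟩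
  have hlim : ∀ {E : Type} [NormedAddCommGroup E] [NormedSpace ℝ E] {F : Euc m → E}, Integrable F →
      Tendsto (fun τ : ℝ => ∫⁻ x in ball 0 24, ‖F (τ • reflMap x) - F (reflMap x)‖ₑ)
        (𝓝[<] 1) (𝓝 0) := fun hF =>
    tendsto_lintegral_comp_sub hC (.of_forall fun τ => hR.const_smul τ) hR
      (hev.mono fun τ hτ => hmap τ ⟨hτ.1, hτ.2.le⟩) hmap1 (.of_forall fun x => by
        have := hτ1.smul_const (reflMap x)
        rwa [one_smul] at this) hF
  refine HasWeakFDerivOn.of_tendsto (l := 𝓝[<] (1 : ℝ)) hgR.locallyIntegrableOn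
    (integrableOn_comp_fderiv hGR reflMap_lipschitz).locallyIntegrableOn fun φ _ hφ hφA =>
    ⟨fun τ x => g' (τ • reflMap x), fun τ x => (G' (τ • reflMap x)).comp
      (fderiv ℝ (fun x => τ • reflMap x) x), ball 0 24, hφA, ?_, ?_, ?_⟩
  · filter_upwards [hev] with τ hτ
    have hτ0 : 0 ≤ τ := by linarith [hτ.1]
    have hL : LipschitzWith (‖τ‖₊ * 1) fun x : Euc m => τ • reflMap x :=
      (lipschitzWith_smul τ).comp reflMap_lipschitz
    refine h'.comp_lipschitz isOpen_ball isOpen_ball hL (fun x _ => ?_) hC (hmap τ ⟨hτ.1, hτ.2.le⟩)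
    rw [mem_ball_zero_iff, norm_smul, Real.norm_eq_abs, abs_of_nonneg hτ0]
    exact (mul_le_of_le_one_right hτ0 (norm_reflMap_le x)).trans_lt hτ.2
  · exact tendsto_zero_of_le (hlim hgi) fun τ => lintegral_mono_set hφA
  · have ht0 : Tendsto (fun τ : ℝ => ofReal (1 - τ)) (𝓝[<] 1) (𝓝 0) := by
      have := ENNReal.tendsto_ofReal (hτ1.const_sub 1)
      rwa [sub_self, ENNReal.ofReal_zero] at this
    have h0 := (hlim hGi).add (ENNReal.Tendsto.mul_const
      (b := ∫⁻ x in ball (0 : Euc m) 24, ‖G' (reflMap x)‖ₑ) ht0 (Or.inr hGR.2.ne))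
    rw [zero_mul, add_zero] at h0
    refine tendsto_of_tendsto_of_tendsto_of_le_of_le' tendsto_const_nhds h0
      (.of_forall fun _ => zero_le) ?_
    filter_upwards [hev] with τ hτ
    have hτ0 : 0 ≤ τ := by linarith [hτ.1]
    refine (lintegral_mono_set hφA).trans ?_
    rw [← lintegral_const_mul' _ _ ofReal_ne_top, ← lintegral_add_right' _
      (hGR.1.enorm.const_mul _)]
    refine lintegral_mono fun x => ?_
    have e1 : (G' (τ • reflMap x)).comp (fderiv ℝ (fun x => τ • reflMap x) x) -
        (G' (reflMap x)).comp (fderiv ℝ reflMap x) =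
        (τ • (G' (τ • reflMap x) - G' (reflMap x)) - (1 - τ) • G' (reflMap x)).comp
          (fderiv ℝ reflMap x) := by
      have : fderiv ℝ (fun x : Euc m => τ • reflMap x) x = τ • fderiv ℝ reflMap x :=
        congrFun (fderiv_const_smul_field (f := (reflMap : Euc m → Euc m)) τ) x
      rw [this]
      ext y
      simp
      ring
    beta_reduce
    rw [e1]
    refine (enorm_comp_le _ _).trans ?_
    refine (mul_le_of_le_one_right zero_le
      (enorm_fderiv_le_of_lipschitz reflMap_lipschitz x)).trans ((enorm_fun_sub_le _ _).trans ?_)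
    rw [enorm_smul, enorm_smul, Real.enorm_eq_ofReal (sub_nonneg.2 hτ.2.le)]
    refine add_le_add (mul_le_of_le_one_left zero_le ?_) le_rfl
    rw [Real.enorm_eq_ofReal hτ0]
    exact ENNReal.ofReal_le_one.2 hτ.2.le

theorem IsBddWeakDeriv.comp_reflMap (hm : 1 ≤ m) {p : ℝ} (hp : 1 ≤ p) {u : Euc m → N}
    {D : Euc m → Euc m →L[ℝ] Euc n} (h : IsBddWeakDeriv u D (ball 0 1))
    (hE : ∫⁻ x in ball 0 1, hs (u x) (D x) ^ p ≠ ⊤) :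
    IsBddWeakDeriv (fun x => u (reflMap x))
      (fun x => (D (reflMap x)).comp (fderiv ℝ reflMap x)) (ball 0 24) := by
  rintro f hf ⟨K, hK⟩ ⟨M, hM⟩
  have e : ∀ (B : Euc n →L[ℝ] ℝ) (T : Euc m →L[ℝ] Euc n) (S : Euc m →L[ℝ] Euc m),
      B.comp (T.comp S) = (B.comp T).comp S := fun _ _ _ => rfl
  have hw := h f hf ⟨K, hK⟩ ⟨M, hM⟩
  have hE1 : ∫⁻ x in ball 0 1, hs (u x) (D x) ≠ ⊤ := by
    refine ne_top_of_le_ne_top ?_ (lintegral_mono fun x => hs_le_one_add_rpow hp (hs (u x) (D x)))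
    rw [lintegral_add_left measurable_const, setLIntegral_const, one_mul]
    exact ENNReal.add_ne_top.2 ⟨measure_ball_lt_top.ne, hE⟩
  simp only [e]
  refine HasWeakFDerivOn.comp_reflMap (g := fun x => f (u x))
    (G := fun x => (mder f (u x)).comp (D x)) hm hw ?_ ⟨hw.2.1.aestronglyMeasurable, ?_⟩
  · have hc : IntegrableOn (fun _ : Euc m => M) (ball 0 1) :=
      integrableOn_const measure_ball_lt_top.ne
    exact hc.mono' hw.1.aestronglyMeasurable (.of_forall fun x => hM _)
  · refine lt_of_le_of_lt (lintegral_mono (g := fun x => (K * m : ℝ≥0∞) * hs (u x) (D x)) fun x =>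
      LipschitzWith.enorm_mder_comp_le hK (hf.mdifferentiable one_ne_zero _) _) ?_
    rw [lintegral_const_mul' _ _ (by finiteness)]
    exact ENNReal.mul_lt_top (by finiteness) hE1.lt_top

theorem hasExtension_dirichlet (hm : 1 ≤ m) {p : ℝ} (hp : 1 ≤ p) :
    HasExtension n 1 p fun w : Euc m → N => bddEnergy n p w := by
  classical
  obtain ⟨C₁, hC₁, hopen⟩ := exists_opening (m := m) (n := n) (N := N) hm hp
  obtain ⟨C₂, hC₂, hmap⟩ := map_reflMap_le (m := m)
  have hp0 : 0 ≤ p := by linarith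
  refine ⟨(1 + (m * m : ℝ≥0∞) ^ p * (C₂ * (C₁ + 1))) * 2, by finiteness, fun u hu hE0 hE => ?_⟩
  simp only [sobolevEnergy, if_true] at hE0 hE ⊢
  -- The energy is an infimum over weak derivatives. Since it is positive and finite, some
  -- derivative realizes it within a factor 2.
  obtain ⟨D, hD, hDE⟩ := exists_lipWeakDeriv_of_lt (c := 2 * dirichletEnergy n p u (ball 0 1)) (by
    conv_lhs => rw [← one_mul (dirichletEnergy n p u (ball 0 1))]
    exact ENNReal.mul_lt_mul_left hE0.ne' hE.ne (by norm_num))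
  have hDt : ∫⁻ x in ball 0 1, hs (u x) (D x) ^ p ≠ ⊤ := ne_top_of_lt hDE
  obtain ⟨u', hu'm, huu'⟩ := hu
  have hD' : IsBddWeakDeriv u' D (ball 0 1) := hD.isBddWeakDeriv.congr_ae huu' (ae_eq_refl _)
  have hEq : ∫⁻ x in ball 0 1, hs (u' x) (D x) ^ p = ∫⁻ x in ball 0 1, hs (u x) (D x) ^ p :=
    lintegral_congr_ae (huu'.mono fun x hx => by simp only [hx])
  -- With radius 1/6 and |a| < 1/12, the collapsed ball contains the ball of radius 1/12, where the
  -- reflection sends all points with |x| ≥ 12. The reflected map is therefore constant there.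
  obtain ⟨a, ha, D₀, hD₀, hoff, hin, hE₀⟩ := hopen u' D hu'm hD' (hEq ▸ hDt) (1 / 6) (by norm_num)
    (by norm_num)
  norm_num only at ha hoff hE₀
  obtain ⟨u₀, hu₀⟩ : ∃ u₀ : Euc m → N, ∀ x, u₀ x = u' (openMap 0 a (1 / 6) x) := ⟨_, fun _ => rfl⟩
  simp only [← hu₀] at hD₀ hE₀
  have hu₀m : Measurable u₀ := by
    rw [show u₀ = fun x => u' (openMap 0 a (1 / 6) x) from funext hu₀]
    exact hu'm.comp (continuous_openMap _ _ _).measurable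
  have hsub : ball (0 : Euc m) (1 / 2) ⊆ ball 0 1 := ball_subset_ball (by norm_num)
  have hE₁ : ∫⁻ x in ball 0 1, hs (u₀ x) (D₀ x) ^ p ≤
      (C₁ + 1) * ∫⁻ x in ball 0 1, hs (u x) (D x) ^ p := by
    rw [← lintegral_inter_add_sdiff _ _ (measurableSet_ball (x := (0 : Euc m)) (ε := 1 / 2)),
      inter_eq_right.2 hsub, add_mul, one_mul, ← hEq]
    refine add_le_add (hE₀.trans ?_) ?_
    · gcongr
    · refine le_trans (le_of_eq (setLIntegral_congr_fun (g := fun x => hs (u' x) (D x) ^ p)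
        (measurableSet_ball.diff measurableSet_ball) fun y hy => ?_))
        (lintegral_mono_set sdiff_subset)
      beta_reduce
      rw [(hoff y hy.2).2, hu₀, (hoff y hy.2).1]
  have hE₁t : ∫⁻ x in ball 0 1, hs (u₀ x) (D₀ x) ^ p ≠ ⊤ :=
    ne_top_of_le_ne_top (ENNReal.mul_ne_top (by finiteness) hDt) hE₁
  have hR := hD₀.comp_reflMap hm hp hE₁t
  have hRm : Measurable (reflMap : Euc m → Euc m) := reflMap_lipschitz.continuous.measurable
  have hER : ∫⁻ x in ball 0 24, hs (u₀ (reflMap x)) ((D₀ (reflMap x)).comp (fderiv ℝ reflMap x)) ^ p ≤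
      (m * m : ℝ≥0∞) ^ p * (C₂ * ((C₁ + 1) * ∫⁻ x in ball 0 1, hs (u x) (D x) ^ p)) := by
    have h1 := lintegral_comp_le_of_map_le hRm.aemeasurable (by
      have := hmap 1 ⟨by norm_num, le_rfl⟩
      simpa only [one_smul] using this)
      ((aemeasurable_indicator_iff measurableSet_ball).2
        ((hD₀.aemeasurable_hs isOpen_ball hu₀m.aemeasurable).pow_const p))
    rw [lintegral_indicator measurableSet_ball] at h1
    refine le_trans ?_ (mul_le_mul_right (h1.trans (mul_le_mul_right hE₁ _)) _)
    rw [← lintegral_const_mul' _ _ (by finiteness)]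
    refine lintegral_mono_ae ?_
    filter_upwards [ae_restrict_of_ae (ae_reflMap_mem hm)] with x hx
    rw [indicator_of_mem hx, ← mul_rpow_of_nonneg _ _ hp0]
    refine ENNReal.rpow_le_rpow ((hs_comp_le _ _ _).trans ?_) hp0
    refine mul_le_mul_left (mul_le_of_le_one_right zero_le ?_) _
    exact enorm_fderiv_le_of_lipschitz reflMap_lipschitz x
  have hfar : ∀ x : Euc m, 12 ≤ ‖x‖ → reflMap x ∈ closedBall (0 : Euc m) (1 / 12) := fun x hx => by
    rw [mem_closedBall_zero_iff, reflMap_of_ge (by linarith), norm_sphereInv, one_div]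
    gcongr
  have ha' : ‖a‖ < 1 / 12 := mem_ball_zero_iff.1 ha
  have hfar' : ∀ x : Euc m, 12 ≤ ‖x‖ → ‖reflMap x - a‖ < 1 / 6 := fun x hx => by
    have := norm_sub_le (reflMap x) a
    have := mem_closedBall_zero_iff.1 (hfar x hx)
    linarith
  obtain ⟨U, hU⟩ : ∃ U : Euc m → N, U = (ball 0 1).piecewise u fun x => u₀ (reflMap x) := ⟨_, rfl⟩
  obtain ⟨D', hD'⟩ : ∃ D' : Euc m → Euc m →L[ℝ] Euc n, D' = (ball 0 1).piecewise D
      ((ball 0 24).piecewise (fun x => (D₀ (reflMap x)).comp (fderiv ℝ reflMap x)) fun _ => 0) :=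
    ⟨_, rfl⟩
  have hUin : ∀ x ∈ ball (0 : Euc m) 1, U x = u x := fun x hx => by
    rw [hU, piecewise_eq_of_mem _ _ _ hx]
  have hUout : ∀ x ∉ ball (0 : Euc m) 1, U x = u₀ (reflMap x) := fun x hx => by
    rw [hU, piecewise_eq_of_notMem _ _ _ hx]
  have hDin : ∀ x ∈ ball (0 : Euc m) 1, D' x = D x := fun x hx => by
    rw [hD', piecewise_eq_of_mem _ _ _ hx]
  have hDmid : ∀ x ∉ ball (0 : Euc m) 1, x ∈ ball (0 : Euc m) 24 →
      D' x = (D₀ (reflMap x)).comp (fderiv ℝ reflMap x) := fun x hx hx' => by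
    rw [hD', piecewise_eq_of_notMem _ _ _ hx, piecewise_eq_of_mem _ _ _ hx']
  have hDout : ∀ x ∉ ball (0 : Euc m) 24, D' x = 0 := fun x hx => by
    rw [hD', piecewise_eq_of_notMem _ _ _ fun h => hx (ball_subset_ball (by norm_num) h),
      piecewise_eq_of_notMem _ _ _ hx]
  have hUfar : ∀ x : Euc m, 12 ≤ ‖x‖ → U x = u' a := fun x hx => by
    rw [hUout x (by rw [mem_ball_zero_iff]; linarith), hu₀,
      openMap_zero_eq (by norm_num) (hfar' x hx).le]
  have hDfar : ∀ x : Euc m, 12 ≤ ‖x‖ → D' x = 0 := fun x hx => by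
    by_cases h : x ∈ ball (0 : Euc m) 24
    · rw [hDmid x (by rw [mem_ball_zero_iff]; linarith) h,
        hin _ (mem_ball_iff_norm.2 (hfar' x hx))]
      exact ContinuousLinearMap.zero_comp _
    · exact hDout x h
  -- The three open sets overlap where the definitions agree: in W the opening is invisible inside
  -- the unit ball because it acts only for |x| < 1/2, and beyond radius 12 everything is constant.
  obtain ⟨W, hW⟩ : ∃ W : Set (Euc m), W = ball 0 24 \ closedBall 0 (1 / 2) := ⟨_, rfl⟩
  have hWo : IsOpen W := hW ▸ isOpen_ball.sdiff isClosed_closedBall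
  have hweak : IsBddWeakDeriv U D' univ := by
    have h1 : IsBddWeakDeriv U D' (ball 0 1) := hD.isBddWeakDeriv.congr_ae
      (ae_restrict_of_forall_mem measurableSet_ball (fun x hx => (hUin x hx).symm))
      (ae_restrict_of_forall_mem measurableSet_ball (fun x hx => (hDin x hx).symm))
    have h2 : IsBddWeakDeriv U D' W := by
      have hmem : ∀ x ∈ W, x ∈ ball (0 : Euc m) 1 → reflMap x = x ∧ fderiv ℝ reflMap x =
          ContinuousLinearMap.id ℝ (Euc m) ∧ openMap 0 a (1 / 6) x = x ∧ D₀ x = D x := fun x hxW hx => by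
        have h3 : x ∉ ball (0 : Euc m) (1 / 2) := fun h => (hW ▸ hxW).2 (ball_subset_closedBall h)
        refine ⟨reflMap_of_le (mem_ball_zero_iff.1 hx).le, ?_, (hoff x h3).1, (hoff x h3).2⟩
        rw [fderiv_eq_of_eqOn (g := fun x => x) isOpen_ball (fun y hy =>
          reflMap_of_le (mem_ball_zero_iff.1 hy).le) hx, fderiv_fun_id]
      refine (hR.mono (hW ▸ sdiff_subset)).congr_ae ?_ ?_
      · have h4 := ae_imp_of_ae_restrict huu'
        refine (ae_restrict_iff' hWo.measurableSet).2 ?_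
        filter_upwards [h4] with x hx hxW
        by_cases hx1 : x ∈ ball (0 : Euc m) 1
        · obtain ⟨e1, -, e3, -⟩ := hmem x hxW hx1
          rw [e1, hu₀, e3, hUin x hx1, hx hx1]
        · rw [hUout x hx1]
      · refine ae_restrict_of_forall_mem hWo.measurableSet (fun x hxW => ?_)
        beta_reduce
        by_cases hx1 : x ∈ ball (0 : Euc m) 1
        · obtain ⟨e1, e2, -, e4⟩ := hmem x hxW hx1
          rw [e2, e1, e4, hDin x hx1]
          exact ContinuousLinearMap.comp_id _
        · rw [hDmid x hx1 (hW ▸ hxW).1]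
    have h3 : IsBddWeakDeriv U D' (closedBall 0 12)ᶜ := by
      have hm3 : MeasurableSet (closedBall (0 : Euc m) 12)ᶜ := measurableSet_closedBall.compl
      have hle : ∀ x ∈ (closedBall (0 : Euc m) 12)ᶜ, 12 ≤ ‖x‖ := fun x hx => by
        rw [mem_compl_iff, mem_closedBall_zero_iff, not_le] at hx
        exact hx.le
      exact (isBddWeakDeriv_const (u' a) _).congr_ae
        (ae_restrict_of_forall_mem hm3 (fun x hx => (hUfar x (hle x hx)).symm))
        (ae_restrict_of_forall_mem hm3 (fun x hx => (hDfar x (hle x hx)).symm))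
    refine ((h1.union isOpen_ball hWo h2).union (isOpen_ball.union hWo)
      isClosed_closedBall.isOpen_compl h3).mono fun x _ => ?_
    rw [hW, mem_union, mem_union, Set.mem_sdiff, mem_compl_iff, mem_ball_zero_iff, mem_ball_zero_iff,
      mem_closedBall_zero_iff, mem_closedBall_zero_iff]
    rcases lt_or_ge ‖x‖ 1 with h | h
    · exact Or.inl (Or.inl h)
    · rcases le_or_gt ‖x‖ 12 with h' | h'
      · exact Or.inl (Or.inr ⟨by linarith, by linarith⟩)
      · exact Or.inr (by linarith)
  refine ⟨U, u' a, ?_, hUin, fun x hx => hUfar x (by simpa using hx), ?_⟩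
  · have h1 : AEMeasurable U (volume.restrict (ball 0 1)) := AEMeasurable.congr ⟨u', hu'm, huu'⟩
      (ae_restrict_of_forall_mem measurableSet_ball (fun x hx => (hUin x hx).symm))
    have h2 : AEMeasurable U (volume.restrict (ball 0 1)ᶜ) :=
      (hu₀m.comp hRm).aemeasurable.congr (ae_restrict_of_forall_mem measurableSet_ball.compl
        (fun x hx => (hUout x hx).symm))
    have h3 := aemeasurable_union_iff.2 ⟨h1, h2⟩
    rwa [union_compl_self, Measure.restrict_univ] at h3
  · refine (bddEnergy_le hweak).trans ?_
    rw [mul_assoc]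
    refine le_trans ?_ (mul_le_mul_right hDE.le _)
    rw [← lintegral_add_compl _ (measurableSet_ball (x := (0 : Euc m)) (ε := 1)), add_mul, one_mul]
    refine add_le_add (le_of_eq (setLIntegral_congr_fun measurableSet_ball fun x hx => by
      simp only [hUin x hx, hDin x hx])) ?_
    rw [mul_assoc, mul_assoc]
    refine le_trans ?_ hER
    rw [← lintegral_indicator measurableSet_ball.compl, ← lintegral_indicator measurableSet_ball]
    refine lintegral_mono fun x => indicator_apply_le fun hx => ?_
    by_cases hx' : x ∈ ball (0 : Euc m) 24
    · rw [indicator_of_mem hx', hUout x hx, hDmid x hx hx']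
    · rw [hDout x hx', hs_zero, ENNReal.zero_rpow_of_pos (by linarith)]
      exact zero_le

/-! ### Truncation, recovery of Lipschitz tests, and insertion for the Dirichlet energy. -/

theorem HasWeakFDerivOn.of_dominated {A : Set (Euc m)} (hA : IsOpen A) {gi : ℕ → Euc m → ℝ}
    {Gi : ℕ → Euc m → Euc m →L[ℝ] ℝ} {g : Euc m → ℝ} {G : Euc m → Euc m →L[ℝ] ℝ}
    (hw : ∀ k, HasWeakFDerivOn (gi k) (Gi k) A) {b : Euc m → ℝ≥0∞}
    (hb : ∀ K ⊆ A, IsCompact K → ∫⁻ x in K, b x ≠ ⊤)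
    (hg : ∀ k, ∀ x ∈ A, ‖gi k x‖ₑ ≤ b x) (hG : ∀ k, ∀ x ∈ A, ‖Gi k x‖ₑ ≤ b x)
    (hgl : ∀ x ∈ A, Tendsto (fun k => gi k x) atTop (𝓝 (g x)))
    (hGl : ∀ x ∈ A, Tendsto (fun k => Gi k x) atTop (𝓝 (G x))) : HasWeakFDerivOn g G A := by
  have key : ∀ {E : Type} [NormedAddCommGroup E] [NormedSpace ℝ E] {Fi : ℕ → Euc m → E}
      {F : Euc m → E}, (∀ k, LocallyIntegrableOn (Fi k) A) → (∀ k, ∀ x ∈ A, ‖Fi k x‖ₑ ≤ b x) →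
      (∀ x ∈ A, Tendsto (fun k => Fi k x) atTop (𝓝 (F x))) → LocallyIntegrableOn F A ∧
      ∀ K ⊆ A, IsCompact K → Tendsto (fun k => ∫⁻ x in K, ‖Fi k x - F x‖ₑ) atTop (𝓝 0) := by
    intro E _ _ Fi F hi hbd hl
    have hF : ∀ x ∈ A, ‖F x‖ₑ ≤ b x := fun x hx =>
      le_of_tendsto' (hl x hx).enorm fun k => hbd k x hx
    have hFm : AEStronglyMeasurable F (volume.restrict A) :=
      aestronglyMeasurable_of_tendsto_ae atTop (fun k => (hi k).aestronglyMeasurable)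
        (ae_restrict_of_forall_mem hA.measurableSet hl)
    refine ⟨(locallyIntegrableOn_iff hA.isLocallyClosed).2 fun K hK hKc =>
      ⟨hFm.mono_measure (Measure.restrict_mono hK le_rfl), lt_of_le_of_lt
        (setLIntegral_mono' hKc.measurableSet fun x hx => hF x (hK hx)) (hb K hK hKc).lt_top⟩,
      fun K hK hKc => ?_⟩
    have h := tendsto_lintegral_of_dominated_convergence' (μ := volume.restrict K)
      (F := fun k x => ‖Fi k x - F x‖ₑ) (f := fun _ => 0) (fun x => 2 * b x)
      (fun k => (((hi k).aestronglyMeasurable.sub hFm).mono_measure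
        (Measure.restrict_mono hK le_rfl)).enorm)
      (fun k => ae_restrict_of_forall_mem hKc.measurableSet (fun x hx => by
        beta_reduce
        rw [two_mul]
        exact (enorm_fun_sub_le _ _).trans (add_le_add (hbd k x (hK hx)) (hF x (hK hx)))))
      (by
        rw [lintegral_const_mul' _ _ (by finiteness)]
        exact ENNReal.mul_ne_top (by finiteness) (hb K hK hKc))
      (ae_restrict_of_forall_mem hKc.measurableSet (fun x hx =>
        tendsto_enorm_sub_zero (hl x (hK hx))))
    rwa [lintegral_zero] at h
  obtain ⟨h1, h2⟩ := key (fun k => (hw k).1) hg hgl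
  obtain ⟨h3, h4⟩ := key (fun k => (hw k).2.1) hG hGl
  exact HasWeakFDerivOn.of_tendsto h1 h3 fun φ _ hφ hφA =>
    ⟨gi, Gi, A, hφA, Eventually.of_forall hw, h2 _ hφA hφ, h4 _ hφA hφ⟩

/-- A Poincaré inequality for functions with compact support in the unit ball. -/
theorem HasWeakFDerivOn.poincare_ball (hm : 1 ≤ m) {g : Euc m → ℝ} {G : Euc m → Euc m →L[ℝ] ℝ}
    (h : HasWeakFDerivOn g G (ball 0 1)) {r : ℝ} (hr : r < 1)
    (h0 : ∀ x ∉ ball (0 : Euc m) r, g x = 0 ∧ G x = 0) {p : ℝ} (hp : 1 ≤ p) :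
    ∫⁻ x, ‖g x‖ₑ ^ p ≤ 2 ^ p * ∫⁻ x, ‖G x‖ₑ ^ p := by
  have hn : ∀ x ∉ closedBall (0 : Euc m) r, x ∉ ball (0 : Euc m) r :=
    fun x hx h => hx (ball_subset_closedBall h)
  obtain ⟨h1, h2, h3⟩ := h.extend_zero isOpen_ball (isCompact_closedBall 0 r)
    (closedBall_subset_ball hr) (fun x hx => (h0 x (hn x hx)).1) fun x hx => (h0 x (hn x hx)).2
  have := h1.poincare hm h2 h3 one_pos
    (fun x hx => (h0 x fun h => hx (ball_subset_ball hr.le h)).1) hp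
  rwa [mul_one, ENNReal.ofReal_ofNat] at this

/-- Bounded truncations of the identity. -/
noncomputable def trunc (k : ℕ) (t : ℝ) : ℝ := ((k : ℝ) + 1) * Real.arctan (((k : ℝ) + 1)⁻¹ * t)

theorem hasDerivAt_trunc (k : ℕ) (t : ℝ) :
    HasDerivAt (trunc k) (1 / (1 + (((k : ℝ) + 1)⁻¹ * t) ^ 2)) t := by
  have h := (((hasDerivAt_id t).const_mul ((k : ℝ) + 1)⁻¹).arctan).const_mul ((k : ℝ) + 1)
  refine h.congr_deriv ?_
  have : (k : ℝ) + 1 ≠ 0 := by positivity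
  simp only [id]
  field_simp

theorem contDiff_trunc (k : ℕ) : ContDiff ℝ 1 (trunc k) :=
  contDiff_const.mul (Real.contDiff_arctan.comp (contDiff_const.mul contDiff_id))

theorem trunc_deriv_mem (k : ℕ) (t : ℝ) :
    1 / (1 + (((k : ℝ) + 1)⁻¹ * t) ^ 2) ∈ Icc (0 : ℝ) 1 :=
  ⟨by positivity, by rw [div_le_one (by positivity)]; nlinarith [sq_nonneg (((k : ℝ) + 1)⁻¹ * t)]⟩

theorem lipschitzWith_trunc (k : ℕ) : LipschitzWith 1 (trunc k) :=
  lipschitzWith_of_nnnorm_deriv_le (fun t => (hasDerivAt_trunc k t).differentiableAt) fun t => by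
    rw [(hasDerivAt_trunc k t).deriv, ← NNReal.coe_le_coe, coe_nnnorm, Real.norm_eq_abs,
      abs_of_nonneg (trunc_deriv_mem k t).1]
    exact (trunc_deriv_mem k t).2

theorem abs_trunc_le (k : ℕ) (t : ℝ) : |trunc k t| ≤ ((k : ℝ) + 1) * (Real.pi / 2) := by
  rw [trunc, abs_mul, abs_of_nonneg (by positivity)]
  gcongr
  exact abs_le.2 ⟨(Real.neg_pi_div_two_lt_arctan _).le, (Real.arctan_lt_pi_div_two _).le⟩

/-- The values are difference quotients at 0 of ε ↦ arctan(εt), whose derivative there is t. -/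
theorem tendsto_trunc (t : ℝ) : Tendsto (fun k => trunc k t) atTop (𝓝 t) := by
  have h : HasDerivAt (fun ε : ℝ => Real.arctan (ε * t)) t 0 := by
    have := ((hasDerivAt_id (0 : ℝ)).mul_const t).arctan
    simpa using this
  have h1 := h.tendsto_slope_zero_right.comp (tendsto_nhdsWithin_iff.2
    ⟨tendsto_one_div_add_atTop_nhds_zero_nat (𝕜 := ℝ), .of_forall fun k => by
      rw [mem_Ioi]; positivity⟩)
  refine h1.congr fun k => ?_
  simp [trunc]

theorem tendsto_trunc_deriv (t : ℝ) :
    Tendsto (fun k : ℕ => 1 / (1 + (((k : ℝ) + 1)⁻¹ * t) ^ 2)) atTop (𝓝 1) := by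
  have h : Tendsto (fun k : ℕ => ((k : ℝ) + 1)⁻¹) atTop (𝓝 0) := by
    simpa using tendsto_one_div_add_atTop_nhds_zero_nat (𝕜 := ℝ)
  have h1 : Tendsto (fun k : ℕ => 1 + (((k : ℝ) + 1)⁻¹ * t) ^ 2) atTop (𝓝 (1 + (0 * t) ^ 2)) :=
    ((h.mul_const t).pow 2).const_add 1
  have h2 := h1.inv₀ (by simp)
  simpa using h2

theorem mder_comp_left {F F' : Type*} [NormedAddCommGroup F] [NormedSpace ℝ F]
    [NormedAddCommGroup F'] [NormedSpace ℝ F'] {f : N → F} (hf : ContMDiff (𝓡 n) 𝓘(ℝ, F) 1 f)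
    {θ : F → F'} {y : N} {L : F →L[ℝ] F'} (hθ : HasFDerivAt θ L (f y)) :
    mder (n := n) (fun y => θ (f y)) y = L.comp (mder f y) :=
  (hθ.hasMFDerivAt.comp y (hf.mdifferentiable one_ne_zero y).hasMFDerivAt).mfderiv

theorem mder_comp_left_real {f : N → ℝ} (hf : ContMDiff (𝓡 n) 𝓘(ℝ, ℝ) 1 f) {θ : ℝ → ℝ} {y : N}
    {c : ℝ} (hθ : HasDerivAt θ c (f y)) :
    mder (n := n) (fun y => θ (f y)) y = c • mder f y := by
  rw [mder_comp_left hf hθ.hasFDerivAt]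
  ext ξ
  simp [mul_comm]

/-- A local perturbation of finite energy of a Sobolev map is a Sobolev map. -/
theorem IsBddWeakDeriv.isLipWeakDeriv_of_eq (hm : 1 ≤ m) {p : ℝ} (hp : 1 ≤ p) {v w : Euc m → N}
    {D D' : Euc m → Euc m →L[ℝ] Euc n} (hv : IsLipWeakDeriv v D (ball 0 1))
    (hw : IsBddWeakDeriv w D' (ball 0 1)) {r : ℝ} (hr : r < 1)
    (h : ∀ x ∉ ball (0 : Euc m) r, w x = v x ∧ D' x = D x)
    (hE : ∫⁻ x in ball 0 1, hs (v x) (D x) ^ p ≠ ⊤)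
    (hE' : ∫⁻ x in ball 0 1, hs (w x) (D' x) ^ p ≠ ⊤) : IsLipWeakDeriv w D' (ball 0 1) := by
  rintro f hf ⟨K, hK⟩
  obtain ⟨P, hP⟩ : ∃ P : Euc m → Euc m →L[ℝ] ℝ, ∀ x, P x = (mder f (w x)).comp (D' x) :=
    ⟨_, fun _ => rfl⟩
  obtain ⟨Q, hQ⟩ : ∃ Q : Euc m → Euc m →L[ℝ] ℝ, ∀ x, Q x = (mder f (v x)).comp (D x) :=
    ⟨_, fun _ => rfl⟩
  have hvf := hv f hf ⟨K, hK⟩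
  obtain ⟨c, hc⟩ : ∃ c : ℕ → N → ℝ, ∀ k y, c k y = 1 / (1 + (((k : ℝ) + 1)⁻¹ * f y) ^ 2) :=
    ⟨_, fun _ _ => rfl⟩
  have hc1 : ∀ k y, ‖c k y‖ₑ ≤ 1 := fun k y => by
    rw [hc, Real.enorm_eq_ofReal (trunc_deriv_mem k _).1]
    exact ENNReal.ofReal_le_one.2 (trunc_deriv_mem k _).2
  -- The truncation of f is a bounded test function, so the weak derivative is known for w. The
  -- difference with v is considered because it vanishes off a smaller ball.
  have hweak : ∀ k, HasWeakFDerivOn (fun x => trunc k (f (w x)) - trunc k (f (v x)))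
      (fun x => c k (w x) • P x - c k (v x) • Q x) (ball 0 1) := fun k => by
    have hfk : ContMDiff (𝓡 n) 𝓘(ℝ, ℝ) 1 fun y => trunc k (f y) :=
      (contDiff_trunc k).contMDiff.comp hf
    have hKk : ∃ K, LipschitzWith K fun y => trunc k (f y) := ⟨_, (lipschitzWith_trunc k).comp hK⟩
    have e : ∀ (c : ℝ) (B : Euc n →L[ℝ] ℝ) (T : Euc m →L[ℝ] Euc n),
        (c • B).comp T = c • B.comp T := fun _ _ _ => rfl
    have := (hw _ hfk hKk ⟨_, fun y => abs_trunc_le k (f y)⟩).sub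
      (hv.isBddWeakDeriv _ hfk hKk ⟨_, fun y => abs_trunc_le k (f y)⟩)
    simpa only [mder_comp_left_real hf (hasDerivAt_trunc k _), e, ← hc, ← hP, ← hQ] using this
  have hoff : ∀ x ∉ ball (0 : Euc m) r, w x = v x ∧ P x = Q x := fun x hx => by
    rw [hP, hQ, (h x hx).1, (h x hx).2]
    exact ⟨rfl, rfl⟩
  have hsub : ball (0 : Euc m) r ⊆ ball 0 1 := ball_subset_ball hr.le
  have hfin : ∀ (u : Euc m → N) (T : Euc m → Euc m →L[ℝ] Euc n),
      ∫⁻ x in ball 0 1, hs (u x) (T x) ^ p ≠ ⊤ →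
      ∫⁻ x in ball 0 r, ‖(mder f (u x)).comp (T x)‖ₑ ≠ ⊤ := fun u T hu =>
    ne_top_of_le_ne_top (lintegral_mder_comp_ne_top hp hf hK (closedBall_subset_ball hr)
      (isCompact_closedBall 0 r) hu) (lintegral_mono_set ball_subset_closedBall)
  obtain ⟨b, hb⟩ : ∃ b : Euc m → ℝ≥0∞, b = (ball 0 r).indicator fun x => ‖P x‖ₑ + ‖Q x‖ₑ :=
    ⟨_, rfl⟩
  have hbfin : ∫⁻ x, b x ≠ ⊤ := by
    rw [hb, lintegral_indicator measurableSet_ball, lintegral_add_right'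
      _ (hvf.2.1.aestronglyMeasurable.mono_measure (Measure.restrict_mono hsub le_rfl) |>.enorm.congr
        (.of_forall fun x => by simp only [hQ]))]
    simp only [hP, hQ]
    exact ENNReal.add_ne_top.2 ⟨hfin w D' hE', hfin v D hE⟩
  have hGb : ∀ k x, ‖c k (w x) • P x - c k (v x) • Q x‖ₑ ≤ b x := fun k x => by
    by_cases hx : x ∈ ball (0 : Euc m) r
    · rw [hb, indicator_of_mem hx]
      refine (enorm_fun_sub_le _ _).trans (add_le_add ?_ ?_) <;> rw [enorm_smul] <;>
        exact mul_le_of_le_one_left zero_le (hc1 _ _)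
    · rw [(hoff x hx).1, (hoff x hx).2, sub_self, ← ofReal_norm, norm_zero, ENNReal.ofReal_zero]
      exact zero_le
  -- The Poincaré inequality with exponent 1 bounds these differences in L^1 uniformly in the level
  -- of truncation.
  have hpoin : ∀ k, ∫⁻ x, ‖trunc k (f (w x)) - trunc k (f (v x))‖ₑ ≤ 2 * ∫⁻ x, b x := fun k => by
    have := (hweak k).poincare_ball hm hr (fun x hx => by
      rw [(hoff x hx).1, (hoff x hx).2, sub_self, sub_self]; exact ⟨rfl, rfl⟩) le_rfl
    simp only [ENNReal.rpow_one] at this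
    exact this.trans (mul_le_mul_right (lintegral_mono (hGb k)) _)
  have hlim : ∀ x, Tendsto (fun k => trunc k (f (w x)) - trunc k (f (v x))) atTop
      (𝓝 (f (w x) - f (v x))) := fun x => (tendsto_trunc _).sub (tendsto_trunc _)
  -- Fatou's lemma transfers the uniform bound to f ∘ w - f ∘ v, whose integrability is not known
  -- beforehand.
  have hdiff : ∫⁻ x in ball 0 1, ‖f (w x) - f (v x)‖ₑ ≠ ⊤ := by
    refine ne_top_of_le_ne_top (ENNReal.mul_ne_top ENNReal.ofNat_ne_top hbfin) (?_ : _ ≤ 2 * ∫⁻ x, b x)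
    calc _ = ∫⁻ x in ball 0 1, liminf (fun k => ‖trunc k (f (w x)) - trunc k (f (v x))‖ₑ) atTop :=
          lintegral_congr fun x => (hlim x).enorm.liminf_eq.symm
      _ ≤ liminf (fun k => ∫⁻ x in ball 0 1, ‖trunc k (f (w x)) - trunc k (f (v x))‖ₑ) atTop :=
          lintegral_liminf_le' fun k => (hweak k).1.aestronglyMeasurable.enorm
      _ ≤ _ := (liminf_le_liminf (.of_forall fun k =>
          (setLIntegral_le_lintegral _ _).trans (hpoin k))).trans (liminf_const _).le
  have hfinal : HasWeakFDerivOn (fun x => f (w x) - f (v x)) (fun x => P x - Q x) (ball 0 1) := by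
    refine HasWeakFDerivOn.of_dominated isOpen_ball hweak
      (b := fun x => ‖f (w x) - f (v x)‖ₑ + b x) (fun L hL _ => ?_) (fun k x _ => ?_)
      (fun k x _ => (hGb k x).trans le_add_self) (fun x _ => hlim x) fun x _ => ?_
    · have hm : AEStronglyMeasurable (fun x => f (w x) - f (v x)) (volume.restrict (ball 0 1)) :=
        aestronglyMeasurable_of_tendsto_ae atTop (fun k => (hweak k).1.aestronglyMeasurable)
          (Eventually.of_forall hlim)
      rw [lintegral_add_left' (hm.mono_measure (Measure.restrict_mono hL le_rfl)).enorm]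
      exact ENNReal.add_ne_top.2 ⟨ne_top_of_le_ne_top hdiff (lintegral_mono_set hL),
        ne_top_of_le_ne_top hbfin (setLIntegral_le_lintegral _ _)⟩
    · refine le_trans ?_ le_self_add
      rw [← edist_eq_enorm_sub, ← edist_eq_enorm_sub]
      simpa using lipschitzWith_trunc k (f (w x)) (f (v x))
    · have h1 := ((tendsto_trunc_deriv (f (w x))).smul_const (P x)).sub
        ((tendsto_trunc_deriv (f (v x))).smul_const (Q x))
      simpa only [one_smul, ← hc] using h1
  have := hfinal.add hvf
  refine this.congr measurableSet_ball (fun x _ => by ring) fun x _ => ?_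
  beta_reduce
  rw [← hP, ← hQ]
  exact sub_add_cancel _ _

/-- Any weak derivative T of v may replace D' off K: by uniqueness, df ∘ T and df ∘ D agree almost
everywhere for each test function f, so the spliced map is a weak derivative of w. T is then taken
almost optimal for v. -/
theorem dirichletEnergy_le_add {p : ℝ} {v w : Euc m → N} {D D' : Euc m → Euc m →L[ℝ] Euc n}
    {A K : Set (Euc m)} (hA : IsOpen A) (hK : MeasurableSet K) (hv : IsLipWeakDeriv v D A)
    (hw : IsLipWeakDeriv w D' A) (h : ∀ x ∉ K, w x = v x ∧ D' x = D x) :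
    dirichletEnergy n p w A ≤ dirichletEnergy n p v A + ∫⁻ x in K, hs (w x) (D' x) ^ p := by
  classical
  refine le_of_forall_gt_imp_ge_of_dense fun c hc => ?_
  rcases eq_or_ne (∫⁻ x in K, hs (w x) (D' x) ^ p) ⊤ with hI | hI
  · rw [hI, add_top] at hc
    exact (not_top_lt hc).elim
  obtain ⟨T, hT, hTc⟩ := exists_lipWeakDeriv_of_lt (lt_tsub_iff_right.2 hc)
  obtain ⟨T', hT'⟩ : ∃ T' : Euc m → Euc m →L[ℝ] Euc n, T' = K.piecewise D' T := ⟨_, rfl⟩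
  have hlip : IsLipWeakDeriv w T' A := by
    intro f hf hKf
    refine (hw f hf hKf).congr_ae (ae_eq_refl _) ((ae_restrict_iff' hA.measurableSet).2 ?_)
    filter_upwards [(hv f hf hKf).ae_eq hA (hT f hf hKf)] with x hx hxA
    by_cases hxK : x ∈ K
    · rw [hT', piecewise_eq_of_mem _ _ _ hxK]
    · rw [hT', piecewise_eq_of_notMem _ _ _ hxK, (h x hxK).1, (h x hxK).2]
      exact hx hxA
  refine (dirichletEnergy_le hlip).trans (le_trans ?_ (lt_tsub_iff_right.1 hTc).le)
  rw [← lintegral_inter_add_sdiff _ _ hK, add_comm]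
  refine add_le_add (le_trans (le_of_eq (setLIntegral_congr_fun (g := fun x => hs (v x) (T x) ^ p)
    (hA.measurableSet.diff hK) fun x hx => ?_)) (lintegral_mono_set sdiff_subset))
    (le_trans (le_of_eq (setLIntegral_congr_fun (g := fun x => hs (w x) (D' x) ^ p)
    (hA.measurableSet.inter hK) fun x hx => ?_)) (lintegral_mono_set inter_subset_right))
  · beta_reduce
    rw [hT', piecewise_eq_of_notMem _ _ _ hx.2, (h x hx.2).1]
  · beta_reduce
    rw [hT', piecewise_eq_of_mem _ _ _ hx.2]

theorem enorm_euclideanSpace_single (i : Fin m) :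
    ‖(EuclideanSpace.single i (1 : ℝ) : Euc m)‖ₑ = 1 := by
  rw [← ofReal_norm]
  simp

theorem hs_euclidean_le {ν : ℕ} (y : Euc ν) (T : Euc m →L[ℝ] Euc ν) : hs y T ≤ m * ‖T‖ₑ := by
  refine (hs_le_sum y T).trans ?_
  calc _ ≤ ∑ i : Fin m, ‖T‖ₑ := Finset.sum_le_sum fun i _ => by
        have h := T.le_opENorm (EuclideanSpace.single i (1 : ℝ))
        rw [enorm_euclideanSpace_single, mul_one] at h
        exact enorm_tangentSpace_vectorSpace.le.trans h
    _ = m * ‖T‖ₑ := by rw [Finset.sum_const, Finset.card_univ, Fintype.card_fin, nsmul_eq_mul]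

/-- The difference f ∘ w - f ∘ v has derivative H, zero off the ball of radius r and bounded by the
energy densities of w and v. The Poincaré inequality for each component controls the difference
itself. -/
theorem dirichlet_sub_le (hm : 1 ≤ m) {p : ℝ} (hp : 1 ≤ p) {v w : Euc m → N}
    {D D' : Euc m → Euc m →L[ℝ] Euc n} (hvm : AEMeasurable v (volume.restrict (ball 0 1)))
    (hv : IsLipWeakDeriv v D (ball 0 1))
    (hw : IsLipWeakDeriv w D' (ball 0 1)) {r : ℝ} (hr : r < 1)
    (h : ∀ x ∉ ball (0 : Euc m) r, w x = v x ∧ D' x = D x) {ν : ℕ} {f : N → Euc ν} {K : NNReal}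
    (hf : ContMDiff (𝓡 n) (𝓡 ν) 1 f) (hK : LipschitzWith K f) {σ : ℝ≥0∞}
    (hσ : (∫⁻ x in ball 0 r, hs (w x) (D' x) ^ p) + ∫⁻ x in ball 0 r, hs (v x) (D x) ^ p ≤ σ) :
    ∫⁻ x in ball 0 1, ‖f (w x) - f (v x)‖ₑ ^ p ≤
      (ν : ℝ≥0∞) ^ (p - 1) * (ν * (2 ^ p * ((K * m) ^ p * (2 ^ (p - 1) * σ)))) ∧
    dirichletEnergy ν p (fun x => f (w x) - f (v x)) (ball 0 1) ≤
      m ^ p * ((K * m) ^ p * (2 ^ (p - 1) * σ)) := by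
  have hp0 : 0 < p := by linarith
  obtain ⟨H, hH⟩ : ∃ H : Euc m → Euc m →L[ℝ] Euc ν, ∀ x, H x =
    (mder f (w x)).comp (D' x) - (mder f (v x)).comp (D x) := ⟨_, fun _ => rfl⟩
  have hoff : ∀ x ∉ ball (0 : Euc m) r, H x = 0 := fun x hx => by
    rw [hH, (h x hx).1, (h x hx).2]
    exact sub_self _
  have hHb : ∀ x, ‖H x‖ₑ ≤ (K * m) * (hs (w x) (D' x) + hs (v x) (D x)) := fun x => by
    rw [hH, mul_add]
    exact (enorm_fun_sub_le _ _).trans (add_le_add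
      (LipschitzWith.enorm_mder_comp_le hK (hf.mdifferentiable one_ne_zero _) _)
      (LipschitzWith.enorm_mder_comp_le hK (hf.mdifferentiable one_ne_zero _) _))
  have hsub : ball (0 : Euc m) r ⊆ ball 0 1 := ball_subset_ball hr.le
  have hHp : ∫⁻ x, ‖H x‖ₑ ^ p ≤ (K * m) ^ p * (2 ^ (p - 1) * σ) := by
    have hmeas : AEMeasurable (fun x => hs (v x) (D x) ^ p) (volume.restrict (ball 0 r)) :=
      ((hv.isBddWeakDeriv.aemeasurable_hs isOpen_ball hvm).mono_measure
        (Measure.restrict_mono hsub le_rfl)).pow_const p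
    calc ∫⁻ x, ‖H x‖ₑ ^ p ≤ ∫⁻ x in ball 0 r, (K * m : ℝ≥0∞) ^ p *
          (2 ^ (p - 1) * (hs (w x) (D' x) ^ p + hs (v x) (D x) ^ p)) := by
          rw [← lintegral_indicator measurableSet_ball]
          refine lintegral_mono fun x => ?_
          by_cases hx : x ∈ ball (0 : Euc m) r
          · rw [indicator_of_mem hx]
            refine (ENNReal.rpow_le_rpow (hHb x) hp0.le).trans ?_
            rw [mul_rpow_of_nonneg _ _ hp0.le]
            gcongr
            exact ENNReal.rpow_add_le_mul_rpow_add_rpow _ _ hp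
          · rw [hoff x hx, ← ofReal_norm, norm_zero, ENNReal.ofReal_zero, ENNReal.zero_rpow_of_pos hp0]
            exact zero_le
      _ ≤ _ := by
          rw [lintegral_const_mul' _ _ (by finiteness), lintegral_const_mul' _ _
            (rpow_ne_top_of_nonneg (by linarith) (by finiteness)),
            lintegral_add_right' _ hmeas]
          gcongr
  have hi : ∀ i : Fin ν, HasWeakFDerivOn (fun x => (f (w x) - f (v x)) i)
      (fun x => (EuclideanSpace.proj i : Euc ν →L[ℝ] ℝ).comp (H x)) (ball 0 1) := fun i => by
    have hfi : ContMDiff (𝓡 n) 𝓘(ℝ, ℝ) 1 fun y => (EuclideanSpace.proj i : Euc ν →L[ℝ] ℝ) (f y) :=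
      (EuclideanSpace.proj i : Euc ν →L[ℝ] ℝ).contDiff.contMDiff.comp hf
    have hKi : ∃ K, LipschitzWith K fun y => (EuclideanSpace.proj i : Euc ν →L[ℝ] ℝ) (f y) :=
      ⟨_, (EuclideanSpace.proj i : Euc ν →L[ℝ] ℝ).lipschitz.comp hK⟩
    have := (hw _ hfi hKi).sub (hv _ hfi hKi)
    simp only [mder_comp_left hf (EuclideanSpace.proj i : Euc ν →L[ℝ] ℝ).hasFDerivAt] at this
    simp only [hH, ContinuousLinearMap.comp_sub]
    exact this
  constructor
  · have hpo : ∀ i, ∫⁻ x in ball 0 1, ‖(f (w x) - f (v x)) i‖ₑ ^ p ≤ 2 ^ p * ∫⁻ x, ‖H x‖ₑ ^ p :=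
      fun i => (setLIntegral_le_lintegral _ _).trans (((hi i).poincare_ball hm hr (fun x hx => by
        rw [hoff x hx, (h x hx).1, sub_self]
        exact ⟨rfl, ContinuousLinearMap.comp_zero _⟩) hp).trans (by
          gcongr with x
          refine (enorm_comp_le _ _).trans (mul_le_of_le_one_left zero_le ?_)
          rw [← ofReal_norm]
          exact ENNReal.ofReal_le_one.2 (ContinuousLinearMap.opNorm_le_bound _ zero_le_one fun y => by
            rw [one_mul]; exact PiLp.norm_apply_le y i)))
    calc _ ≤ ∫⁻ x in ball 0 1, (ν : ℝ≥0∞) ^ (p - 1) * ∑ i, ‖(f (w x) - f (v x)) i‖ₑ ^ p := by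
          refine lintegral_mono fun x => ?_
          have h1 : ‖f (w x) - f (v x)‖ₑ ≤ ∑ i, ‖(f (w x) - f (v x)) i‖ₑ := by
            conv_lhs => rw [euc_eq_sum (f (w x) - f (v x))]
            refine (enorm_sum_le _ _).trans (Finset.sum_le_sum fun i _ => ?_)
            rw [enorm_smul, enorm_euclideanSpace_single, mul_one]
          have h2 := ENNReal.rpow_sum_le_const_mul_sum_rpow Finset.univ
            (fun i => ‖(f (w x) - f (v x)) i‖ₑ) hp
          rw [Finset.card_univ, Fintype.card_fin] at h2
          exact (ENNReal.rpow_le_rpow h1 hp0.le).trans h2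
      _ = (ν : ℝ≥0∞) ^ (p - 1) * ∑ i, ∫⁻ x in ball 0 1, ‖(f (w x) - f (v x)) i‖ₑ ^ p := by
          rw [lintegral_const_mul' _ _ (rpow_ne_top_of_nonneg (by linarith) (by finiteness)),
            lintegral_finsetSum' _ fun i _ => (hi i).1.aestronglyMeasurable.enorm.pow_const p]
      _ ≤ _ := by
          gcongr
          refine (Finset.sum_le_sum fun i _ => (hpo i).trans (mul_le_mul_right hHp _)).trans ?_
          rw [Finset.sum_const, Finset.card_univ, Fintype.card_fin, nsmul_eq_mul]
  -- Componentwise weak derivatives are turned into the definition by test functions through the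
  -- chain rule for C^1 Lipschitz functions of a vector-valued map.
  · have hlip : IsLipWeakDeriv (n := ν) (fun x => f (w x) - f (v x)) H (ball 0 1) := by
      rintro F hF ⟨L, hL⟩
      have := HasWeakFDerivOn.comp_contDiff isOpen_ball hi (contMDiff_iff_contDiff.1 hF) hL
      simpa only [mder, mfderiv_eq_fderiv] using this
    refine (dirichletEnergy_le hlip).trans (le_trans ?_ (mul_le_mul_right hHp _))
    rw [← lintegral_const_mul' _ _ (by finiteness)]
    refine (setLIntegral_le_lintegral _ _).trans (lintegral_mono fun x => ?_)
    rw [← mul_rpow_of_nonneg _ _ hp0.le]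
    exact ENNReal.rpow_le_rpow (hs_euclidean_le _ _) hp0.le

theorem hasInsertion_dirichlet (hm : 1 ≤ m) {p : ℝ} (hp : 1 ≤ p) :
    HasInsertion n 1 p fun w : Euc m → N => bddEnergy n p w := by
  classical
  obtain ⟨C₁, hC₁, hopen⟩ := exists_opening (m := m) (n := n) (N := N) hm hp
  have hνp : ∀ ν : ℕ, (ν : ℝ≥0∞) ^ (p - 1) ≠ ⊤ := fun ν =>
    rpow_ne_top_of_nonneg (by linarith) (by finiteness)
  have h2p : (2 : ℝ≥0∞) ^ (p - 1) ≠ ⊤ := rpow_ne_top_of_nonneg (by linarith) (by finiteness)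
  refine ⟨fun K ν => (ν : ℝ≥0∞) ^ (p - 1) * (ν * (2 ^ p * ((K * m) ^ p * 2 ^ (p - 1)))) +
    m ^ p * ((K * m) ^ p * 2 ^ (p - 1)), fun K ν => ?_, fun v hv hvE ε hε τ hτ => ?_⟩
  · have h1 := hνp ν
    finiteness
  simp only [sobolevEnergy, if_true] at hvE ⊢
  obtain ⟨σ', hσ', hσ'τ⟩ := exists_ne_zero_mul_le (c := C₁ + 2) (by finiteness) hτ
  obtain ⟨σ, hσ, hσ0, hσt⟩ : ∃ σ : ℝ≥0∞, (C₁ + 2) * σ ≤ τ ∧ σ ≠ 0 ∧ σ ≠ ⊤ :=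
    ⟨min σ' 1, (mul_le_mul_right (min_le_left _ _) _).trans hσ'τ,
      (lt_min (pos_iff_ne_zero.2 hσ') one_pos).ne', ne_top_of_le_ne_top ENNReal.one_ne_top
        (min_le_right _ _)⟩
  obtain ⟨D, hD, hDE⟩ := exists_lipWeakDeriv_of_lt hvE
  obtain ⟨r, hr0, hr1, hrσ⟩ := tendsto_setLIntegral_ball_zero hm hDE.ne subset_rfl hσ0
  -- The inequality 3ρ < 1 has to be strict: the differences must vanish near the unit sphere for
  -- the Poincaré inequality.
  obtain ⟨ρ, hρ, hρr, hρε⟩ : ∃ ρ : ℝ, 0 < ρ ∧ 3 * ρ < r ∧ 3 * ρ < ε :=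
    ⟨min r ε / 4, by positivity, by linarith [min_le_left r ε], by linarith [min_le_right r ε]⟩
  have hρ1 : 3 * ρ < 1 := by linarith
  have hsub : ball (0 : Euc m) (3 * ρ) ⊆ ball 0 1 := ball_subset_ball hρ1.le
  have hσv : ∫⁻ x in ball 0 (3 * ρ), hs (v x) (D x) ^ p ≤ σ :=
    (lintegral_mono_set (ball_subset_ball hρr.le)).trans hrσ
  obtain ⟨v', hv'm, hvv'⟩ := id hv
  have hEq : ∀ s : Set (Euc m), s ⊆ ball 0 1 →
      ∫⁻ x in s, hs (v' x) (D x) ^ p = ∫⁻ x in s, hs (v x) (D x) ^ p := fun s hs' =>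
    lintegral_congr_ae (Eventually.mono (ae_mono (Measure.restrict_mono hs' le_rfl) hvv')
      fun x hx => by simp only [hx])
  obtain ⟨a, ha, D₀, hD₀, hoff, hin, hE₀⟩ := hopen v' D hv'm
    (hD.isBddWeakDeriv.congr_ae hvv' (ae_eq_refl _)) (by rw [hEq _ subset_rfl]; exact hDE.ne) ρ hρ
    hρ1.le
  rw [hEq _ hsub] at hE₀
  obtain ⟨v₀, hv₀⟩ : ∃ v₀ : Euc m → N, ∀ x, v₀ x = v' (openMap 0 a ρ x) := ⟨_, fun _ => rfl⟩
  simp only [← hv₀] at hD₀ hE₀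
  have hv₀m : Measurable v₀ := by
    rw [show v₀ = fun x => v' (openMap 0 a ρ x) from funext hv₀]
    exact hv'm.comp (continuous_openMap _ _ _).measurable
  have ha' : ‖a‖ < ρ / 2 := mem_ball_zero_iff.1 ha
  have hab : ball a ρ ⊆ ball 0 (3 * ρ) := ball_subset_ball' (by rw [dist_zero_right]; linarith)
  -- Half of σ leaves room for a weak derivative of the bubble with energy strictly below σ, the
  -- energy being only an infimum.
  refine ⟨a, ρ, v' a, σ / 2, hρ, (ENNReal.half_pos hσ0).ne', hab.trans (ball_subset_ball hρε.le),
    hab.trans hsub, fun W hW hWb hWE => ?_⟩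
  obtain ⟨T, hT, hTσ⟩ := exists_bddWeakDeriv_of_lt (hWE.trans_lt (ENNReal.half_lt_self hσ0 hσt))
  obtain ⟨w', hw'⟩ : ∃ w' : Euc m → N, w' = (ball a ρ).piecewise W v₀ := ⟨_, rfl⟩
  obtain ⟨D', hD'⟩ : ∃ D' : Euc m → Euc m →L[ℝ] Euc n, D' = (ball a ρ).piecewise T D₀ := ⟨_, rfl⟩
  have hw'in : ∀ x ∈ ball a ρ, w' x = W x := fun x hx => by rw [hw', piecewise_eq_of_mem _ _ _ hx]
  have hw'out : ∀ x ∉ ball a ρ, w' x = v₀ x := fun x hx => by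
    rw [hw', piecewise_eq_of_notMem _ _ _ hx]
  have hD'in : ∀ x ∈ ball a ρ, D' x = T x := fun x hx => by rw [hD', piecewise_eq_of_mem _ _ _ hx]
  have hD'out : ∀ x ∉ ball a ρ, D' x = D₀ x := fun x hx => by
    rw [hD', piecewise_eq_of_notMem _ _ _ hx]
  have hEw' : ∫⁻ x in ball 0 (3 * ρ), hs (w' x) (D' x) ^ p ≤ C₁ * σ + σ := by
    rw [← lintegral_inter_add_sdiff _ _ (measurableSet_ball (x := a) (ε := ρ)), add_comm]
    refine add_le_add ?_ ?_
    · calc _ = ∫⁻ x in ball 0 (3 * ρ) \ ball a ρ, hs (v₀ x) (D₀ x) ^ p :=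
            setLIntegral_congr_fun (measurableSet_ball.diff measurableSet_ball) fun x hx => by
              simp only [hw'out x hx.2, hD'out x hx.2]
        _ ≤ _ := (lintegral_mono_set sdiff_subset).trans (hE₀.trans (by gcongr))
    · calc _ = ∫⁻ x in ball 0 (3 * ρ) ∩ ball a ρ, hs (W x) (T x) ^ p :=
            setLIntegral_congr_fun (measurableSet_ball.inter measurableSet_ball) fun x hx => by
              simp only [hw'in x hx.2, hD'in x hx.2]
        _ ≤ _ := (setLIntegral_le_lintegral _ _).trans hTσ.le
  obtain ⟨w, hw⟩ : ∃ w : Euc m → N, w = (ball 0 (3 * ρ)).piecewise w' v := ⟨_, rfl⟩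
  have hwin : ∀ x ∈ ball (0 : Euc m) (3 * ρ), w x = w' x := fun x hx => by
    rw [hw, piecewise_eq_of_mem _ _ _ hx]
  have hwout : ∀ x ∉ ball (0 : Euc m) (3 * ρ), w x = v x := fun x hx => by
    rw [hw, piecewise_eq_of_notMem _ _ _ hx]
  have hww' : w' =ᵐ[volume.restrict (ball 0 1)] w := by
    filter_upwards [hvv'] with x hx
    by_cases h : x ∈ ball (0 : Euc m) (3 * ρ)
    · exact (hwin x h).symm
    · rw [hwout x h, hw'out x fun h' => h (hab h'), hv₀, (hoff x h).1, hx]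
  have hwm : AEMeasurable w (volume.restrict (ball 0 1)) := by
    refine AEMeasurable.congr ?_ hww'
    have h := aemeasurable_union_iff.2 ⟨hW.restrict.congr (ae_restrict_of_forall_mem measurableSet_ball
      (fun x hx => (hw'in x hx).symm)), hv₀m.aemeasurable.congr
      (ae_restrict_of_forall_mem measurableSet_ball.compl (fun x hx => (hw'out x hx).symm))⟩
    rw [union_compl_self, Measure.restrict_univ] at h
    exact h.restrict
  have hout : ∀ x ∉ ball (0 : Euc m) (3 * ρ), w x = v x ∧ D' x = D x := fun x hx =>
    ⟨hwout x hx, by rw [hD'out x fun h' => hx (hab h'), (hoff x hx).2]⟩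
  have hEw : ∫⁻ x in ball 0 (3 * ρ), hs (w x) (D' x) ^ p ≤ C₁ * σ + σ :=
    (setLIntegral_congr_fun measurableSet_ball fun x hx => by simp only [hwin x hx]).trans_le hEw'
  have hEwt : ∫⁻ x in ball 0 1, hs (w x) (D' x) ^ p ≠ ⊤ := by
    rw [← lintegral_inter_add_sdiff _ _ (measurableSet_ball (x := (0 : Euc m)) (ε := 3 * ρ)),
      inter_eq_right.2 hsub]
    refine ENNReal.add_ne_top.2 ⟨ne_top_of_le_ne_top (by finiteness) hEw, ?_⟩
    rw [setLIntegral_congr_fun (g := fun x => hs (v x) (D x) ^ p)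
      (measurableSet_ball.diff measurableSet_ball) fun x hx => by
        simp only [(hout x hx.2).1, (hout x hx.2).2]]
    exact ne_top_of_le_ne_top hDE.ne (lintegral_mono_set sdiff_subset)
  have hbdd : IsBddWeakDeriv w D' (ball 0 1) := by
    refine (IsBddWeakDeriv.glue hm hp isOpen_ball (ι := Unit) (x := fun _ => a) (r := fun _ => ρ)
      (fun i j h => (h (Subsingleton.elim _ _)).elim) (W := fun _ => W) (Γ := v₀) (c := v' a)
      (fun _ => hWb) (fun _ y hy => ?_) (fun _ => hw'in) (fun y hy => hw'out y (hy ()))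
      (Di := fun _ => T) (DΓ := D₀) (fun _ => hD'in) (fun y hy => hD'out y (hy ()))
      (fun _ => hT.mono (subset_univ _)) hD₀ ?_).congr_ae hww' (ae_eq_refl _)
    · rw [hv₀, openMap_zero_eq hρ (mem_ball_iff_norm.1 hy).le]
    · rwa [lintegral_congr_ae (g := fun x => hs (w x) (D' x) ^ p)
        (hww'.mono fun x hx => by simp only [hx])]
  -- The construction only provides bounded tests; unbounded ones are recovered by comparison with
  -- v, which equals w off the small ball.
  have hlip : IsLipWeakDeriv w D' (ball 0 1) :=
    hbdd.isLipWeakDeriv_of_eq hm hp hD hρ1 hout hDE.ne hEwt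
  have hsum : C₁ * σ + σ + σ ≤ τ := by
    convert hσ using 1
    ring
  refine ⟨w, hwm, fun x hx => hwout x fun h => hx.2 (ball_subset_ball hρε.le h), fun x hx => ?_,
    ?_, ?_, fun ν f K hf hK => ?_⟩
  · rw [hwin x (hab hx), hw'in x hx]
  · refine (dirichletEnergy_le_add isOpen_ball measurableSet_ball hD hlip hout).trans ?_
    gcongr
    exact hEw.trans (le_self_add.trans hsum)
  · refine (dirichletEnergy_le_add isOpen_ball measurableSet_ball hlip hD fun x hx =>
      ⟨(hout x hx).1.symm, (hout x hx).2.symm⟩).trans ?_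
    gcongr
    exact hσv.trans (le_add_self.trans hsum)
  · obtain ⟨h1, h2⟩ := dirichlet_sub_le hm hp hv hD hlip hρ1 hout hf hK
      ((add_le_add hEw hσv).trans hsum)
    rw [add_mul]
    simp only [mul_assoc] at h1 h2 ⊢
    exact ⟨h1.trans le_self_add, h2.trans le_add_self⟩

end Dirichlet

end SobolevMaps

/-! ### Conclusion: the two regimes of s. -/

theorem mainTheorem3 {m n : ℕ} (hm : 1 ≤ m) {s p : ℝ} (hs0 : 0 < s) (hs1 : s ≤ 1) (hp : 1 ≤ p)
    {N : Type*} [EMetricSpace N] [SecondCountableTopology N] [ConnectedSpace N]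
    [ChartedSpace (EuclideanSpace ℝ (Fin n)) N] [IsManifold (𝓡 n) ∞ N]
    [RiemannianBundle (fun x : N => TangentSpace (𝓡 n) x)]
    [IsContMDiffRiemannianBundle (𝓡 n) ∞ (EuclideanSpace ℝ (Fin n))
      (fun x : N => TangentSpace (𝓡 n) x)]
    [IsRiemannianManifold (𝓡 n) N]
    [MeasurableSpace N] [BorelSpace N]
    (G : SobolevMaps.Energy m N) (hG_super : G.IsSuperadditive) (hG_scal : G.HasScaling s p)
    (hsp : s * p ≤ m) (hsm : s < m)
    (u : ℕ → EuclideanSpace ℝ (Fin m) → N)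
    (hu_meas : ∀ k, SobolevMaps.MeasurableMapOn (u k) (ball 0 1))
    (hu_pos : ∀ k, 0 < SobolevMaps.sobolevEnergy n s p (u k) (ball 0 1))
    (hu_fin : ∀ k, G.toFun (u k) (ball 0 1) < ⊤)
    (hu_lim : Tendsto (fun k => G.toFun (u k) (ball 0 1) /
      SobolevMaps.sobolevEnergy n s p (u k) (ball 0 1)) atTop (𝓝 ⊤))
    (hu_crit : s * p = m →
      Tendsto (fun k => SobolevMaps.sobolevEnergy n s p (u k) (ball 0 1)) atTop (𝓝 0))
    (v : EuclideanSpace ℝ (Fin m) → N) (hv_meas : SobolevMaps.MeasurableMapOn v (ball 0 1))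
    (hv_fin : SobolevMaps.sobolevEnergy n s p v (ball 0 1) < ⊤) :
    (∀ ε : ℝ, 0 < ε → ∃ w : EuclideanSpace ℝ (Fin m) → N,
      SobolevMaps.MeasurableMapOn w (ball 0 1) ∧
      EqOn w v (ball 0 1 \ ball 0 ε) ∧
      SobolevMaps.sobolevEnergy n s p w (ball 0 1) ≤
        SobolevMaps.sobolevEnergy n s p v (ball 0 1) + ENNReal.ofReal ε ∧
      G.toFun w (ball 0 1) = ⊤) ∧
    (∃ w : ℕ → EuclideanSpace ℝ (Fin m) → N,
      (∀ k, SobolevMaps.MeasurableMapOn (w k) (ball 0 1) ∧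
        EqOn (w k) v (ball 0 1 \ ball 0 (1 / ((k : ℝ) + 1))) ∧
        SobolevMaps.sobolevEnergy n s p (w k) (ball 0 1) < ⊤ ∧
        G.toFun (w k) (ball 0 1) = ⊤) ∧
      Tendsto (fun k => SobolevMaps.sobolevEnergy n s p (w k) (ball 0 1)) atTop
        (𝓝 (SobolevMaps.sobolevEnergy n s p v (ball 0 1))) ∧
      SobolevMaps.SobolevTendsto n s p w v (ball 0 1)) := by
  have hsp0 : 0 < s * p := by positivity
  rcases hs1.lt_or_eq with hs | rfl
  · exact (SobolevMaps.isGluingEnergy_gagliardo hm (fun b c => by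
      obtain ⟨γ, L, h0, h1, hγ, -, hL⟩ := SobolevMaps.exists_lipschitz_path (n := n) b c
      exact ⟨γ, L, h0, h1, hγ.continuous, hL⟩) hs0 hs hp hsp).density hm hsp0
      (SobolevMaps.hasExtension_gagliardo hm hs0 hs hp)
      (SobolevMaps.hasInsertion_gagliardo hm hs0 hs hp) G hG_super hG_scal hsp u hu_meas hu_pos
      hu_lim hu_crit v hv_meas hv_fin
  -- For s = 1 the assumption s < m reads 1 < m. It excludes the line, where points have positive
  -- capacity for p = 1.
  · exact (SobolevMaps.isGluingEnergy_dirichlet (n := n) (by exact_mod_cast hsm) hp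
      (by rwa [one_mul] at hsp)).density hm hsp0 (SobolevMaps.hasExtension_dirichlet hm hp)
      (SobolevMaps.hasInsertion_dirichlet hm hp) G hG_super hG_scal hsp u hu_meas hu_pos
      hu_lim hu_crit v hv_meas hv_fin
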